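/- Let $\mathcal V$ be a Bénabou cosmos, i.e. a complete and cocomplete symmetric monoidal closed category, let $\mathcal C$ be a small monoidal $\mathcal V$-category with tensor product $\otimes$ and unit object $\mathbb 1$, and let $\mathcal M$ be a small left $\mathcal C$-module $\mathcal V$-category with action $\odot:\mathcal C\otimes\mathcal M\to\mathcal M$. For small $\mathcal V$-categories, a profunctor $F:\mathcal A \nrightarrow \mathcal B$ is a family of objects $F(b,a)\in\mathcal V$, contravariant in $b\in\mathcal B$ and covariant in $a\in\mathcal A$, with commuting unital and associative actions of the hom objects. Profunctors are composed by coends, $(G\bullet F)(c,a)=\int^{b}G(c,b)\otimes F(b,a)$; the identity profunctor is given by the hom objects, and a $\mathcal V$-functor $H:\mathcal A\to\mathcal B$ has a companion $H_*(b,a)=\mathcal B(b,Ha)$ and a conjoint $H^*(a,b)=\mathcal B(Ha,b)$. Let $*$ be the unit $\mathcal V$-category. Consider the following three categories. 1. ${}_{\mathcal C}\mathcal V\mathrm{prof}^{\mathrm{lax}}(\mathcal M,\mathcal M)$: its objects are lax $\mathcal C$-module profunctors, i.e. pairs of a profunctor $F:\mathcal M \nrightarrow \mathcal M$ and a morphism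 $\beta:\odot_*\bullet(\mathrm{Id}_{\mathcal C}\otimes F)\Rightarrow F\bullet\odot_*$ compatible with the associativity and unit isomorphisms of $\mathcal M$; its morphisms are the morphisms of profunctors compatible with $\beta$. 2. $\mathrm{Lmd}_{\mathcal M\Omega_{\mathcal C}\mathcal M}$: the category of modules $(F,\kappa:\Omega(F)\Rightarrow F)$ over the monad $\Omega(F)=\odot_*\bullet(\mathrm{Id}_{\mathcal C}\otimes F)\bullet\odot^*$ on profunctors $\mathcal M \nrightarrow \mathcal M$, so that $$\Omega(F)(n,m)\cong\int^{x\in\mathcal C,\;n_1,m_1\in\mathcal M}\mathcal M(n,x\odot n_1)\otimes F(n_1,m_1)\otimes\mathcal M(x\odot m_1,m).$$ The multiplication and unit of $\Omega$ are induced by the tensor product and unit of $\mathcal C$, the action of $\mathcal C$ on hom objects and the associativity and unit isomorphisms of $\mathcal M$. 3. $\mathrm{Lmd}_{\mathcal M\mathbb H_{\mathcal C}\mathcal M}(*)$: the category of left modules $P:*\nrightarrow \mathcal M^{op}\otimes\mathcal M$, with action $H\bullet P\Rightarrow P$, over the promonad $H=\mathcal M\mathbb H_{\mathcal C}\mathcal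 M$ on $\mathcal M^{op}\otimes\mathcal M$, $$H\big((b_1,b_2),(a_1,a_2)\big)=\int^{x\in\mathcal C}\mathcal M(b_2,x\odot a_2)\otimes\mathcal M(x\odot a_1,b_1),$$ with multiplication and unit induced in the same way as those of $\Omega$. These categories carry the following monoidal structures. 1. On ${}_{\mathcal C}\mathcal V\mathrm{prof}^{\mathrm{lax}}(\mathcal M,\mathcal M)$: the tensor product of $F$ and $G$ is $F\bullet G$, with the lax structure given by the one of $F$ followed by the one of $G$; the unit is the identity profunctor, with the lax structure given by the action of $\mathcal C$ on hom objects. 2. On $\mathrm{Lmd}_{\mathcal M\Omega_{\mathcal C}\mathcal M}$: the tensor product of $F$ and $G$ is carried by $F\bullet G$. On the summand $\mathcal M(n,x\odot n_1)\otimes F(n_1,k)\otimes G(k,m_1)\otimes\mathcal M(x\odot m_1,m)$ the action inserts the identity of $x\odot k$ between $F(n_1,k)$ and $G(k,m_1)$, and then acts on both factors, with values in $F(n,x\odot k)\otimes G(x\odot k,m)$. The unit is the identity profunctor, with the action given by the action of $\mathcal C$ on hom objects and composition. 3. On $\mathrm{Lmd}_{\mathcal M\mathbb H_{\mathcal C}\mathcal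 M}(*)$: the tensor product of $X$ and $Y$ is carried by $\mu\bullet(Y\otimes X)$, where $\mu:(\mathcal M^{op}\otimes\mathcal M)^{\otimes 2}\nrightarrow \mathcal M^{op}\otimes\mathcal M$ is the profunctor $$\mu\big((m_1,m_2);(a_1,a_2),(b_1,b_2)\big)=\mathcal M(a_1,m_1)\otimes\mathcal M(b_1,a_2)\otimes\mathcal M(m_2,b_2),$$ so that its values are $\int^{k}Y(m_1,k)\otimes X(k,m_2)$. The promonad $H$ acts on both factors after insertion of the identity of $x\odot k$. The unit is $(m_1,m_2)\mapsto\mathcal M(m_2,m_1)$, with the action given by the action of $\mathcal C$ on hom objects and composition. In all three cases the associator and the unitors are those of the composition of profunctors. **Theorem.** These monoidal structures exist, and there are canonical monoidal equivalences $${}_{\mathcal C}\mathcal V\mathrm{prof}^{\mathrm{lax}}(\mathcal M,\mathcal M)\;\simeq\;\mathrm{Lmd}_{\mathcal M\Omega_{\mathcal C}\mathcal M}\;\simeq\;\mathrm{Lmd}_{\mathcal M\mathbb H_{\mathcal C}\mathcal M}(*).$$ The first one keeps the underlying profunctor $F$ and sends a lax structure, with components $\beta_x:\mathcal M(n,x\odot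 n_1)\otimes F(n_1,m_1)\to F(n,x\odot m_1)$, to the action that first applies $\beta_x$ and then the action of $\mathcal M(x\odot m_1,m)$ on $F$. The second one identifies a profunctor $F:\mathcal M\nrightarrow \mathcal M$ with its transpose $P:*\nrightarrow \mathcal M^{op}\otimes\mathcal M$, $P(m,n)=F(n,m)$, and identifies the corresponding actions. Their monoidal structures are the canonical ones over the composition of profunctors. -/

import Mathlib

open CategoryTheory MonoidalCategory Limits
open scoped MonoidalLeftAction

universe u v

namespace LaxModuleProf

noncomputable section

/-! ### Products of enriched categories -/

section Enriched

variable (V : Type u) [Category.{v} V] [MonoidalCategory V] [SymmetricCategory V]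

/-- The tensor product of two `V`-categories. -/
instance prodEnriched (C D : Type v) [EnrichedCategory V C] [EnrichedCategory V D] :
    EnrichedCategory V (C × D) where
  Hom p q := (p.1 ⟶[V] q.1) ⊗ (p.2 ⟶[V] q.2)
  id p := (λ_ (𝟙_ V)).inv ≫ (eId V p.1 ⊗ₘ eId V p.2)
  comp p q r := tensorμ _ _ _ _ ≫ (eComp V p.1 q.1 r.1 ⊗ₘ eComp V p.2 q.2 r.2)
  id_comp p q := by
    rw [comp_whiskerRight, Category.assoc, tensorμ_natural_left_assoc, tensorHom_comp_tensorHom]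
    have h := tensor_left_unitality (C := V) (p.1 ⟶[V] q.1) (p.2 ⟶[V] q.2)
    have h1 := e_id_comp V p.1 q.1
    have h2 := e_id_comp V p.2 q.2
    rw [Iso.inv_comp_eq] at h1 h2
    rw [Iso.inv_comp_eq, h1, h2, Category.comp_id, Category.comp_id]
    simpa using h.symm
  comp_id p q := by
    rw [whiskerLeft_comp, Category.assoc, tensorμ_natural_right_assoc, tensorHom_comp_tensorHom]
    have h := tensor_right_unitality (C := V) (p.1 ⟶[V] q.1) (p.2 ⟶[V] q.2)
    have h1 := e_comp_id V p.1 q.1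
    have h2 := e_comp_id V p.2 q.2
    rw [Iso.inv_comp_eq] at h1 h2
    rw [Iso.inv_comp_eq, h1, h2, Category.comp_id, Category.comp_id]
    simpa using h.symm
  assoc p q r s := by
    rw [comp_whiskerRight, whiskerLeft_comp, Category.assoc, Category.assoc,
      tensorμ_natural_left_assoc, tensorμ_natural_right_assoc, tensorHom_comp_tensorHom,
      tensorHom_comp_tensorHom]
    have h := tensor_associativity (C := V) (p.1 ⟶[V] q.1) (p.2 ⟶[V] q.2) (q.1 ⟶[V] r.1)
      (q.2 ⟶[V] r.2) (r.1 ⟶[V] s.1) (r.2 ⟶[V] s.2)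
    rw [Iso.inv_comp_eq, ← reassoc_of% h]
    simp only [tensorHom_comp_tensorHom, e_assoc']

/-- The unit `V`-category, with one object whose endomorphism object is the unit. -/
instance punitEnriched : EnrichedCategory V PUnit.{v + 1} where
  Hom _ _ := 𝟙_ V
  id _ := 𝟙 _
  comp _ _ _ := (λ_ _).hom
  id_comp _ _ := by simp
  comp_id _ _ := by simp [unitors_equal]
  assoc _ _ _ _ := by simp [unitors_equal]

lemma comp_inv_of_comp_hom {W : Type u} [Category.{v} W] [MonoidalCategory W] {A B A' B' Z Z' : W}
    (a : A ≅ A') (b : B ≅ B') (z : Z ≅ Z') (f : A ⊗ B ⟶ Z) (g : A' ⊗ B' ⟶ Z')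
    (h : f ≫ z.hom = (a.hom ⊗ₘ b.hom) ≫ g) : g ≫ z.inv = (a.inv ⊗ₘ b.inv) ≫ f := by
  rw [Iso.comp_inv_eq, Category.assoc, h, tensorHom_comp_tensorHom_assoc]
  simp

/-- The reassociation `V`-functor for products of `V`-categories. -/
def assocFunctor (C D E : Type v) [EnrichedCategory V C] [EnrichedCategory V D]
    [EnrichedCategory V E] : EnrichedFunctor V ((C × D) × E) (C × (D × E)) where
  obj p := (p.1.1, (p.1.2, p.2))
  map _ _ := (α_ _ _ _).hom
  map_id p := by
    change ((λ_ (𝟙_ V)).inv ≫ (((λ_ (𝟙_ V)).inv ≫ (eId V p.1.1 ⊗ₘ eId V p.1.2)) ⊗ₘ eId V p.2)) ≫ _ =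
      (λ_ (𝟙_ V)).inv ≫ (eId V p.1.1 ⊗ₘ ((λ_ (𝟙_ V)).inv ≫ (eId V p.1.2 ⊗ₘ eId V p.2)))
    simp [MonoidalCategory.tensorHom_def]
    rw [← unitors_equal, Iso.inv_hom_id_assoc]
  map_comp p q r := by
    change (tensorμ _ _ _ _ ≫ ((tensorμ _ _ _ _ ≫ (eComp V p.1.1 q.1.1 r.1.1 ⊗ₘ
        eComp V p.1.2 q.1.2 r.1.2)) ⊗ₘ eComp V p.2 q.2 r.2)) ≫ _ =
      _ ≫ tensorμ _ _ _ _ ≫ (eComp V p.1.1 q.1.1 r.1.1 ⊗ₘ (tensorμ _ _ _ _ ≫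
        (eComp V p.1.2 q.1.2 r.1.2 ⊗ₘ eComp V p.2 q.2 r.2)))
    have h := associator_monoidal (C := V) (p.1.1 ⟶[V] q.1.1) (p.1.2 ⟶[V] q.1.2) (p.2 ⟶[V] q.2)
      (q.1.1 ⟶[V] r.1.1) (q.1.2 ⟶[V] r.1.2) (q.2 ⟶[V] r.2)
    have h1 : (eComp V p.1.1 q.1.1 r.1.1 ⊗ₘ
          tensorμ (p.1.2 ⟶[V] q.1.2) (p.2 ⟶[V] q.2) (q.1.2 ⟶[V] r.1.2) (q.2 ⟶[V] r.2) ≫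
            (eComp V p.1.2 q.1.2 r.1.2 ⊗ₘ eComp V p.2 q.2 r.2)) =
        _ ◁ tensorμ (p.1.2 ⟶[V] q.1.2) (p.2 ⟶[V] q.2) (q.1.2 ⟶[V] r.1.2) (q.2 ⟶[V] r.2) ≫
          (eComp V p.1.1 q.1.1 r.1.1 ⊗ₘ (eComp V p.1.2 q.1.2 r.1.2 ⊗ₘ eComp V p.2 q.2 r.2)) := by
      rw [← id_tensorHom, tensorHom_comp_tensorHom, Category.id_comp]
    have h2 : (tensorμ (p.1.1 ⟶[V] q.1.1) (p.1.2 ⟶[V] q.1.2) (q.1.1 ⟶[V] r.1.1)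
          (q.1.2 ⟶[V] r.1.2) ≫
            (eComp V p.1.1 q.1.1 r.1.1 ⊗ₘ eComp V p.1.2 q.1.2 r.1.2) ⊗ₘ eComp V p.2 q.2 r.2) =
        tensorμ (p.1.1 ⟶[V] q.1.1) (p.1.2 ⟶[V] q.1.2) (q.1.1 ⟶[V] r.1.1) (q.1.2 ⟶[V] r.1.2) ▷ _ ≫
          ((eComp V p.1.1 q.1.1 r.1.1 ⊗ₘ eComp V p.1.2 q.1.2 r.1.2) ⊗ₘ eComp V p.2 q.2 r.2) := by
      rw [← tensorHom_id, tensorHom_comp_tensorHom, Category.id_comp]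
    rw [h1, h2, ← reassoc_of% h]
    simp only [Category.assoc, associator_naturality]

/-- The reassociation `V`-functor in the other direction. -/
def assocInvFunctor (C D E : Type v) [EnrichedCategory V C] [EnrichedCategory V D]
    [EnrichedCategory V E] : EnrichedFunctor V (C × (D × E)) ((C × D) × E) where
  obj p := ((p.1, p.2.1), p.2.2)
  map _ _ := (α_ _ _ _).inv
  map_id p := by
    have h := (assocFunctor V C D E).map_id ((p.1, p.2.1), p.2.2)
    exact ((Iso.comp_inv_eq _).2 h.symm)
  map_comp p q r := by
    have h := (assocFunctor V C D E).map_comp ((p.1, p.2.1), p.2.2) ((q.1, q.2.1), q.2.2)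
      ((r.1, r.2.1), r.2.2)
    exact comp_inv_of_comp_hom (α_ _ _ _) (α_ _ _ _) (α_ _ _ _) _ _ h

/-- The `V`-functor `C ⟶ C × *`. -/
def unitInvFunctor (C : Type v) [EnrichedCategory V C] :
    EnrichedFunctor V C (C × PUnit.{v + 1}) where
  obj c := (c, PUnit.unit)
  map _ _ := (ρ_ _).inv
  map_id c := by
    change _ = (λ_ (𝟙_ V)).inv ≫ (eId V c ⊗ₘ 𝟙 _)
    simp [unitors_inv_equal]
  map_comp c d e := by
    change _ = (_ ⊗ₘ _) ≫ tensorμ _ _ _ _ ≫ (eComp V c d e ⊗ₘ (λ_ (𝟙_ V)).hom)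
    have h := rightUnitor_monoidal (C := V) (c ⟶[V] d) (d ⟶[V] e)
    rw [Iso.comp_inv_eq]
    rw [← cancel_epi ((ρ_ (c ⟶[V] d)).hom ⊗ₘ (ρ_ (d ⟶[V] e)).hom)]
    simp only [Category.assoc, tensorHom_comp_tensorHom_assoc, Iso.hom_inv_id, id_tensorHom_id, Category.id_comp]
    rw [h, tensorHom_def' (eComp V c d e)]
    simp

/-- The product of two `V`-functors. -/
def prodFunctor {C D C' D' : Type v} [EnrichedCategory V C] [EnrichedCategory V D]
    [EnrichedCategory V C'] [EnrichedCategory V D'] (F : EnrichedFunctor V C D)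
    (G : EnrichedFunctor V C' D') : EnrichedFunctor V (C × C') (D × D') where
  obj p := (F.obj p.1, G.obj p.2)
  map p q := F.map p.1 q.1 ⊗ₘ G.map p.2 q.2
  map_id p := by
    change ((λ_ (𝟙_ V)).inv ≫ (eId V p.1 ⊗ₘ eId V p.2)) ≫ _ = (λ_ (𝟙_ V)).inv ≫ _
    rw [Category.assoc, tensorHom_comp_tensorHom, F.map_id, G.map_id]
  map_comp p q r := by
    change (tensorμ _ _ _ _ ≫ (eComp V _ _ _ ⊗ₘ eComp V _ _ _)) ≫ _ =
      _ ≫ (tensorμ _ _ _ _ ≫ (eComp V _ _ _ ⊗ₘ eComp V _ _ _))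
    rw [Category.assoc, tensorHom_comp_tensorHom, F.map_comp, G.map_comp, tensorμ_natural_assoc,
      tensorHom_comp_tensorHom]

end Enriched

/-! ### Monoidal enriched categories and their modules -/

section Module

variable (V : Type u) [Category.{v} V] [MonoidalCategory V] [SymmetricCategory V]

/-- A monoidal `V`-category: the tensor product of `C` is a `V`-functor `C ⊗ C ⟶ C`, and the
associator and the unitors are `V`-natural. -/
class MonoidalEnriched (C : Type v) [Category.{v} C] [MonoidalCategory C]
    [EnrichedOrdinaryCategory V C] where
  tensorE (x x' y y' : C) : (x ⟶[V] x') ⊗ (y ⟶[V] y') ⟶ ((x ⊗ y) ⟶[V] (x' ⊗ y'))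
  tensorE_hom {x x' y y' : C} (f : x ⟶ x') (g : y ⟶ y') :
    (λ_ (𝟙_ V)).inv ≫ (eHomEquiv V f ⊗ₘ eHomEquiv V g) ≫ tensorE x x' y y' =
      eHomEquiv V (f ⊗ₘ g)
  tensorE_comp (x x' x'' y y' y'' : C) :
    (tensorE x x' y y' ⊗ₘ tensorE x' x'' y' y'') ≫ eComp V (x ⊗ y) (x' ⊗ y') (x'' ⊗ y'') =
      tensorμ _ _ _ _ ≫ (eComp V x x' x'' ⊗ₘ eComp V y y' y'') ≫ tensorE x x'' y y''
  associator_enriched (x x' y y' z z' : C) :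
    tensorE x x' y y' ▷ (z ⟶[V] z') ≫ tensorE (x ⊗ y) (x' ⊗ y') z z' ≫
        eHomWhiskerLeft V ((x ⊗ y) ⊗ z) (α_ x' y' z').hom =
      (α_ _ _ _).hom ≫ (x ⟶[V] x') ◁ tensorE y y' z z' ≫
        tensorE x x' (y ⊗ z) (y' ⊗ z') ≫ eHomWhiskerRight V (α_ x y z).hom (x' ⊗ (y' ⊗ z'))
  leftUnitor_enriched (y y' : C) :
    (λ_ (y ⟶[V] y')).inv ≫ eId V (𝟙_ C) ▷ (y ⟶[V] y') ≫ tensorE (𝟙_ C) (𝟙_ C) y y' ≫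
        eHomWhiskerLeft V (𝟙_ C ⊗ y) (λ_ y').hom =
      eHomWhiskerRight V (λ_ y).hom y'
  rightUnitor_enriched (x x' : C) :
    (ρ_ (x ⟶[V] x')).inv ≫ (x ⟶[V] x') ◁ eId V (𝟙_ C) ≫ tensorE x x' (𝟙_ C) (𝟙_ C) ≫
        eHomWhiskerLeft V (x ⊗ 𝟙_ C) (ρ_ x').hom =
      eHomWhiskerRight V (ρ_ x).hom x'

/-- A left module `V`-category over the monoidal `V`-category `C`: the action is a `V`-functor
`C ⊗ M ⟶ M`, and its associativity and unit isomorphisms are `V`-natural. -/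
class ModuleEnriched (C : Type v) [Category.{v} C] [MonoidalCategory C]
    [EnrichedOrdinaryCategory V C] [MonoidalEnriched V C] (M : Type v) [Category.{v} M]
    [EnrichedOrdinaryCategory V M] [MonoidalLeftAction C M] where
  actE (x x' : C) (m m' : M) : (x ⟶[V] x') ⊗ (m ⟶[V] m') ⟶ ((x ⊙ₗ m) ⟶[V] (x' ⊙ₗ m'))
  actE_hom {x x' : C} {m m' : M} (f : x ⟶ x') (g : m ⟶ m') :
    (λ_ (𝟙_ V)).inv ≫ (eHomEquiv V f ⊗ₘ eHomEquiv V g) ≫ actE x x' m m' =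
      eHomEquiv V (f ⊙ₗₘ g)
  actE_comp (x x' x'' : C) (m m' m'' : M) :
    (actE x x' m m' ⊗ₘ actE x' x'' m' m'') ≫ eComp V (x ⊙ₗ m) (x' ⊙ₗ m') (x'' ⊙ₗ m'') =
      tensorμ _ _ _ _ ≫ (eComp V x x' x'' ⊗ₘ eComp V m m' m'') ≫ actE x x'' m m''
  actionAssoc_enriched (x x' y y' : C) (m m' : M) :
    MonoidalEnriched.tensorE x x' y y' ▷ (m ⟶[V] m') ≫ actE (x ⊗ y) (x' ⊗ y') m m' ≫
        eHomWhiskerLeft V ((x ⊗ y) ⊙ₗ m) (αₗ x' y' m').hom =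
      (α_ _ _ _).hom ≫ (x ⟶[V] x') ◁ actE y y' m m' ≫
        actE x x' (y ⊙ₗ m) (y' ⊙ₗ m') ≫
          eHomWhiskerRight V (αₗ x y m).hom (x' ⊙ₗ (y' ⊙ₗ m'))
  actionUnit_enriched (m m' : M) :
    (λ_ (m ⟶[V] m')).inv ≫ eId V (𝟙_ C) ▷ (m ⟶[V] m') ≫ actE (𝟙_ C) (𝟙_ C) m m' ≫
        eHomWhiskerLeft V ((𝟙_ C) ⊙ₗ m) (λₗ m').hom =
      eHomWhiskerRight V (λₗ m).hom m'

variable (C : Type v) [Category.{v} C] [MonoidalCategory C] [EnrichedOrdinaryCategory V C]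
  [MonoidalEnriched V C] (M : Type v) [Category.{v} M] [EnrichedOrdinaryCategory V M]
  [MonoidalLeftAction C M] [ModuleEnriched V C M]

/-- The action as a `V`-functor `C ⊗ M ⟶ M`. -/
def actFunctor : EnrichedFunctor V (C × M) M where
  obj p := p.1 ⊙ₗ p.2
  map p q := ModuleEnriched.actE p.1 q.1 p.2 q.2
  map_id p := by
    change ((λ_ (𝟙_ V)).inv ≫ (eId V p.1 ⊗ₘ eId V p.2)) ≫ _ = _
    rw [Category.assoc, ← eHomEquiv_id, ← eHomEquiv_id, ModuleEnriched.actE_hom]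
    simp
  map_comp p q r := by
    change (tensorμ _ _ _ _ ≫ (eComp V _ _ _ ⊗ₘ eComp V _ _ _)) ≫ _ = _
    rw [Category.assoc, ModuleEnriched.actE_comp]

end Module

/-! ### Enriched profunctors -/

section Prof

variable (V : Type u) [Category.{v} V] [MonoidalCategory V] [SymmetricCategory V]

/-- A `V`-profunctor `C ⇸ D`: objects `F(d, c)` of `V`, contravariant in `d` and covariant in `c`,
with commuting unital and associative actions of the hom objects of `D` and of `C`. -/
structure VProf (C : Type v) [EnrichedCategory V C] (D : Type v) [EnrichedCategory V D] where
  obj : D → C → V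
  pre (d d' : D) (c : C) : (d ⟶[V] d') ⊗ obj d' c ⟶ obj d c
  post (d : D) (c c' : C) : obj d c ⊗ (c ⟶[V] c') ⟶ obj d c'
  pre_id (d : D) (c : C) : eId V d ▷ obj d c ≫ pre d d c = (λ_ _).hom
  pre_comp (d d' d'' : D) (c : C) :
    eComp V d d' d'' ▷ obj d'' c ≫ pre d d'' c =
      (α_ _ _ _).hom ≫ (d ⟶[V] d') ◁ pre d' d'' c ≫ pre d d' c
  post_id (d : D) (c : C) : obj d c ◁ eId V c ≫ post d c c = (ρ_ _).hom
  post_comp (d : D) (c c' c'' : C) :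
    (α_ _ _ _).hom ≫ obj d c ◁ eComp V c c' c'' ≫ post d c c'' =
      post d c c' ▷ (c' ⟶[V] c'') ≫ post d c' c''
  pre_post (d d' : D) (c c' : C) :
    pre d d' c ▷ (c ⟶[V] c') ≫ post d c c' =
      (α_ _ _ _).hom ≫ (d ⟶[V] d') ◁ post d' c c' ≫ pre d d' c'

namespace VProf

set_option linter.unusedSectionVars false

variable {V}
variable {C : Type v} [EnrichedCategory V C] {D : Type v} [EnrichedCategory V D]
variable {E : Type v} [EnrichedCategory V E]

/-- A morphism of profunctors: an equivariant family. -/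
@[ext]
structure Hom (F G : VProf V C D) where
  app (d : D) (c : C) : F.obj d c ⟶ G.obj d c
  pre_app (d d' : D) (c : C) : F.pre d d' c ≫ app d c = (d ⟶[V] d') ◁ app d' c ≫ G.pre d d' c
  post_app (d : D) (c c' : C) :
    F.post d c c' ≫ app d c' = app d c ▷ (c ⟶[V] c') ≫ G.post d c c'

instance : Category (VProf V C D) where
  Hom F G := Hom F G
  id F := { app := fun _ _ => 𝟙 _, pre_app := by simp, post_app := by simp }
  comp f g :=
    { app := fun d c => f.app d c ≫ g.app d c
      pre_app := by
        intro d d' c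
        rw [← Category.assoc, f.pre_app, Category.assoc, g.pre_app]; simp
      post_app := by
        intro d c c'
        rw [← Category.assoc, f.post_app, Category.assoc, g.post_app]; simp }
  id_comp f := by apply Hom.ext; funext d c; exact Category.id_comp _
  comp_id f := by apply Hom.ext; funext d c; exact Category.comp_id _
  assoc f g h := by apply Hom.ext; funext d c; exact Category.assoc _ _ _

@[simp] lemma id_app (F : VProf V C D) (d : D) (c : C) : Hom.app (𝟙 F) d c = 𝟙 _ := rfl

@[simp] lemma comp_app {F G H : VProf V C D} (f : F ⟶ G) (g : G ⟶ H) (d : D) (c : C) :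
    Hom.app (f ≫ g) d c = f.app d c ≫ g.app d c := rfl

@[ext] lemma hom_ext {F G : VProf V C D} (f g : F ⟶ G) (h : ∀ d c, f.app d c = g.app d c) :
    f = g := Hom.ext (funext fun d => funext fun c => h d c)

lemma e_assoc_symm (a b c d : C) :
    eComp V a b c ▷ (c ⟶[V] d) ≫ eComp V a c d =
      (α_ _ _ _).hom ≫ (a ⟶[V] b) ◁ eComp V b c d ≫ eComp V a b d :=
  (e_assoc' V a b c d).symm

variable (V C) in
/-- The identity profunctor, given by the hom objects. -/
def idProf : VProf V C C where
  obj d c := d ⟶[V] c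
  pre d d' c := eComp V d d' c
  post d c c' := eComp V d c c'
  pre_id d c := by rw [← Iso.inv_comp_eq_id]; simp [e_id_comp]
  pre_comp d d' d'' c := (e_assoc' V _ _ _ _).symm
  post_id d c := by rw [← Iso.inv_comp_eq_id]; simp [e_comp_id]
  post_comp d c c' c'' := e_assoc' V _ _ _ _
  pre_post d d' c c' := (e_assoc' V _ _ _ _).symm

/-- Restriction of a profunctor along `V`-functors, `(d, c) ↦ F(K d, H c)`. -/
def restrict {C' D' : Type v} [EnrichedCategory V C'] [EnrichedCategory V D'] (F : VProf V C D)
    (K : EnrichedFunctor V D' D) (H : EnrichedFunctor V C' C) : VProf V C' D' where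
  obj d c := F.obj (K.obj d) (H.obj c)
  pre d d' c := K.map d d' ▷ _ ≫ F.pre _ _ _
  post d c c' := _ ◁ H.map c c' ≫ F.post _ _ _
  pre_id d c := by rw [← comp_whiskerRight_assoc, K.map_id, F.pre_id]
  pre_comp d d' d'' c := by
    rw [← comp_whiskerRight_assoc, K.map_comp, comp_whiskerRight_assoc, F.pre_comp]
    simp only [MonoidalCategory.tensorHom_def, comp_whiskerRight, Category.assoc,
      associator_naturality_left_assoc, associator_naturality_middle_assoc,
      MonoidalCategory.whiskerLeft_comp, whisker_exchange_assoc]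
  post_id d c := by rw [← MonoidalCategory.whiskerLeft_comp_assoc, H.map_id, F.post_id]
  post_comp d c c' c'' := by
    rw [← MonoidalCategory.whiskerLeft_comp_assoc, H.map_comp,
      MonoidalCategory.whiskerLeft_comp_assoc,
      comp_whiskerRight, Category.assoc, ← whisker_exchange_assoc, ← F.post_comp]
    simp only [MonoidalCategory.tensorHom_def, Category.assoc, MonoidalCategory.whiskerLeft_comp,
      associator_naturality_middle_assoc, associator_naturality_right_assoc]
  pre_post d d' c c' := by
    rw [comp_whiskerRight, Category.assoc, ← whisker_exchange_assoc, F.pre_post,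
      MonoidalCategory.whiskerLeft_comp, Category.assoc, ← whisker_exchange_assoc,
      whisker_exchange_assoc, associator_naturality_right_assoc,
      associator_naturality_left_assoc, whisker_exchange_assoc, whisker_exchange_assoc]

/-- The companion of a `V`-functor, `(d, c) ↦ D(d, H c)`. -/
def companion (H : EnrichedFunctor V C D) : VProf V C D where
  obj d c := d ⟶[V] H.obj c
  pre d d' c := eComp V d d' (H.obj c)
  post d c c' := _ ◁ H.map c c' ≫ eComp V d (H.obj c) (H.obj c')
  pre_id d c := (idProf V D).pre_id d (H.obj c)
  pre_comp d d' d'' c := (idProf V D).pre_comp d d' d'' (H.obj c)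
  post_id d c := ((idProf V D).restrict (EnrichedFunctor.id V D) H).post_id d c
  post_comp d c c' c'' :=
    ((idProf V D).restrict (EnrichedFunctor.id V D) H).post_comp d c c' c''
  pre_post d d' c c' := by
    rw [← whisker_exchange_assoc, e_assoc_symm]
    simp

/-- The conjoint of a `V`-functor, `(c, d) ↦ D(H c, d)`. -/
def conjoint (H : EnrichedFunctor V C D) : VProf V D C where
  obj c d := H.obj c ⟶[V] d
  pre c c' d := H.map c c' ▷ _ ≫ eComp V (H.obj c) (H.obj c') d
  post c d d' := eComp V (H.obj c) d d'
  pre_id c d := ((idProf V D).restrict H (EnrichedFunctor.id V D)).pre_id c d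
  pre_comp c c' c'' d :=
    ((idProf V D).restrict H (EnrichedFunctor.id V D)).pre_comp c c' c'' d
  post_id c d := (idProf V D).post_id (H.obj c) d
  post_comp c d d' d'' := (idProf V D).post_comp (H.obj c) d d' d''
  pre_post c c' d d' := by
    rw [comp_whiskerRight, Category.assoc, e_assoc_symm, whisker_exchange_assoc]
    simp

/-- The tensor product of profunctors. -/
def tens {C' D' : Type v} [EnrichedCategory V C'] [EnrichedCategory V D'] (F : VProf V C D)
    (G : VProf V C' D') : VProf V (C × C') (D × D') where
  obj d c := F.obj d.1 c.1 ⊗ G.obj d.2 c.2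
  pre d d' c := tensorμ _ _ _ _ ≫ (F.pre d.1 d'.1 c.1 ⊗ₘ G.pre d.2 d'.2 c.2)
  post d c c' := tensorμ _ _ _ _ ≫ (F.post d.1 c.1 c'.1 ⊗ₘ G.post d.2 c.2 c'.2)
  pre_id d c := by
    change ((λ_ (𝟙_ V)).inv ≫ (eId V d.1 ⊗ₘ eId V d.2)) ▷ _ ≫ _ = _
    rw [comp_whiskerRight, Category.assoc, tensorμ_natural_left_assoc, tensorHom_comp_tensorHom,
      F.pre_id, G.pre_id]
    simpa using (tensor_left_unitality (C := V) (F.obj d.1 c.1) (G.obj d.2 c.2)).symm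
  pre_comp d d' d'' c := by
    change (tensorμ _ _ _ _ ≫ (eComp V d.1 d'.1 d''.1 ⊗ₘ eComp V d.2 d'.2 d''.2)) ▷ _ ≫ _ =
      (α_ ((d.1 ⟶[V] d'.1) ⊗ (d.2 ⟶[V] d'.2)) _ _).hom ≫ _ ◁ _ ≫ _
    have h := tensor_associativity (C := V) (d.1 ⟶[V] d'.1) (d.2 ⟶[V] d'.2) (d'.1 ⟶[V] d''.1)
      (d'.2 ⟶[V] d''.2) (F.obj d''.1 c.1) (G.obj d''.2 c.2)
    rw [comp_whiskerRight, MonoidalCategory.whiskerLeft_comp, Category.assoc, Category.assoc,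
      tensorμ_natural_left_assoc, tensorμ_natural_right_assoc, tensorHom_comp_tensorHom,
      tensorHom_comp_tensorHom, F.pre_comp, G.pre_comp, ← reassoc_of% h, tensorHom_comp_tensorHom]
  post_id d c := by
    change _ ◁ ((λ_ (𝟙_ V)).inv ≫ (eId V c.1 ⊗ₘ eId V c.2)) ≫ _ = _
    rw [MonoidalCategory.whiskerLeft_comp, Category.assoc, tensorμ_natural_right_assoc,
      tensorHom_comp_tensorHom, F.post_id, G.post_id]
    simpa using (tensor_right_unitality (C := V) (F.obj d.1 c.1) (G.obj d.2 c.2)).symm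
  post_comp d c c' c'' := by
    change (α_ _ ((c.1 ⟶[V] c'.1) ⊗ (c.2 ⟶[V] c'.2)) ((c'.1 ⟶[V] c''.1) ⊗ (c'.2 ⟶[V] c''.2))).hom ≫
      _ ◁ (tensorμ _ _ _ _ ≫ (eComp V c.1 c'.1 c''.1 ⊗ₘ eComp V c.2 c'.2 c''.2)) ≫ _ = _ ▷ _ ≫ _
    have h := tensor_associativity (C := V) (F.obj d.1 c.1) (G.obj d.2 c.2) (c.1 ⟶[V] c'.1)
      (c.2 ⟶[V] c'.2) (c'.1 ⟶[V] c''.1) (c'.2 ⟶[V] c''.2)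
    rw [comp_whiskerRight, MonoidalCategory.whiskerLeft_comp, Category.assoc, Category.assoc,
      tensorμ_natural_left_assoc, tensorμ_natural_right_assoc, tensorHom_comp_tensorHom,
      tensorHom_comp_tensorHom, ← F.post_comp, ← G.post_comp, ← reassoc_of% h,
      tensorHom_comp_tensorHom]
  pre_post d d' c c' := by
    change _ ▷ ((c.1 ⟶[V] c'.1) ⊗ (c.2 ⟶[V] c'.2)) ≫ _ =
      (α_ ((d.1 ⟶[V] d'.1) ⊗ (d.2 ⟶[V] d'.2)) _ ((c.1 ⟶[V] c'.1) ⊗ (c.2 ⟶[V] c'.2))).hom ≫ _ ◁ _ ≫ _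
    have h := tensor_associativity (C := V) (d.1 ⟶[V] d'.1) (d.2 ⟶[V] d'.2) (F.obj d'.1 c.1)
      (G.obj d'.2 c.2) (c.1 ⟶[V] c'.1) (c.2 ⟶[V] c'.2)
    rw [comp_whiskerRight, MonoidalCategory.whiskerLeft_comp, Category.assoc, Category.assoc,
      tensorμ_natural_left_assoc, tensorμ_natural_right_assoc, tensorHom_comp_tensorHom,
      tensorHom_comp_tensorHom, F.pre_post, G.pre_post, ← reassoc_of% h, tensorHom_comp_tensorHom]

lemma tensorμ_equivariant_left {A A' B B' B₁ B₁' Z Z' W W' : V} (p : A ⊗ B ⟶ Z) (p' : A' ⊗ B' ⟶ Z')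
    (f : Z ⟶ W) (f' : Z' ⟶ W') (g : B ⟶ B₁) (g' : B' ⟶ B₁') (q : A ⊗ B₁ ⟶ W) (q' : A' ⊗ B₁' ⟶ W')
    (h : p ≫ f = A ◁ g ≫ q) (h' : p' ≫ f' = A' ◁ g' ≫ q') :
    (tensorμ A A' B B' ≫ (p ⊗ₘ p')) ≫ (f ⊗ₘ f') =
      (A ⊗ A') ◁ (g ⊗ₘ g') ≫ tensorμ A A' B₁ B₁' ≫ (q ⊗ₘ q') := by
  rw [tensorμ_natural_right_assoc, Category.assoc, tensorHom_comp_tensorHom,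
    tensorHom_comp_tensorHom, h, h']

lemma tensorμ_equivariant_right {A A' B B' B₁ B₁' Z Z' W W' : V} (p : B ⊗ A ⟶ Z)
    (p' : B' ⊗ A' ⟶ Z') (f : Z ⟶ W) (f' : Z' ⟶ W') (g : B ⟶ B₁) (g' : B' ⟶ B₁') (q : B₁ ⊗ A ⟶ W)
    (q' : B₁' ⊗ A' ⟶ W') (h : p ≫ f = g ▷ A ≫ q) (h' : p' ≫ f' = g' ▷ A' ≫ q') :
    (tensorμ B B' A A' ≫ (p ⊗ₘ p')) ≫ (f ⊗ₘ f') =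
      (g ⊗ₘ g') ▷ (A ⊗ A') ≫ tensorμ B₁ B₁' A A' ≫ (q ⊗ₘ q') := by
  rw [tensorμ_natural_left_assoc, Category.assoc, tensorHom_comp_tensorHom,
    tensorHom_comp_tensorHom, h, h']

/-- The tensor product of morphisms of profunctors. -/
def tensMap {C' D' : Type v} [EnrichedCategory V C'] [EnrichedCategory V D'] {F F' : VProf V C D}
    {G G' : VProf V C' D'} (f : F ⟶ F') (g : G ⟶ G') : tens F G ⟶ tens F' G' where
  app d c := f.app d.1 c.1 ⊗ₘ g.app d.2 c.2
  pre_app _ _ _ := tensorμ_equivariant_left _ _ _ _ _ _ _ _ (f.pre_app _ _ _) (g.pre_app _ _ _)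
  post_app _ _ _ :=
    tensorμ_equivariant_right _ _ _ _ _ _ _ _ (f.post_app _ _ _) (g.post_app _ _ _)

end VProf
end Prof

/-! ### Composition of profunctors by coends -/

section Comp

variable {V : Type u} [Category.{v} V] [MonoidalCategory V] [SymmetricCategory V]
  [MonoidalClosed V] [HasColimits V]

namespace VProf

set_option linter.unusedSectionVars false

variable {C : Type v} [EnrichedCategory V C] {D : Type v} [EnrichedCategory V D]
  {E : Type v} [EnrichedCategory V E]

variable (G : VProf V D E) (F : VProf V C D)

/-- One of the two maps whose coequalizer is the coend: the action on `G`. -/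
def coendLeft (e : E) (c : C) :
    (∐ fun p : D × D => (G.obj e p.1 ⊗ (p.1 ⟶[V] p.2)) ⊗ F.obj p.2 c) ⟶
      ∐ fun d : D => G.obj e d ⊗ F.obj d c :=
  Sigma.desc fun p => G.post e p.1 p.2 ▷ F.obj p.2 c ≫
    Sigma.ι (fun d : D => G.obj e d ⊗ F.obj d c) p.2

/-- The other map whose coequalizer is the coend: the action on `F`. -/
def coendRight (e : E) (c : C) :
    (∐ fun p : D × D => (G.obj e p.1 ⊗ (p.1 ⟶[V] p.2)) ⊗ F.obj p.2 c) ⟶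
      ∐ fun d : D => G.obj e d ⊗ F.obj d c :=
  Sigma.desc fun p => (α_ _ _ _).hom ≫ G.obj e p.1 ◁ F.pre p.1 p.2 c ≫
    Sigma.ι (fun d : D => G.obj e d ⊗ F.obj d c) p.1

/-- The coend `∫^d G(e, d) ⊗ F(d, c)`. -/
def compObj (e : E) (c : C) : V := coequalizer (coendLeft G F e c) (coendRight G F e c)

/-- The quotient map of the coend. -/
def compπ (e : E) (c : C) : (∐ fun d : D => G.obj e d ⊗ F.obj d c) ⟶ compObj G F e c :=
  coequalizer.π _ _

/-- The coprojections of the coend. -/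
def ι (e : E) (d : D) (c : C) : G.obj e d ⊗ F.obj d c ⟶ compObj G F e c :=
  Sigma.ι (fun d : D => G.obj e d ⊗ F.obj d c) d ≫ compπ G F e c

lemma ι_dinatural (e : E) (d d' : D) (c : C) :
    G.post e d d' ▷ F.obj d' c ≫ ι G F e d' c =
      (α_ _ _ _).hom ≫ G.obj e d ◁ F.pre d d' c ≫ ι G F e d c := by
  have h0 : coendLeft G F e c ≫ compπ G F e c = coendRight G F e c ≫ compπ G F e c :=
    coequalizer.condition _ _
  have h := Sigma.ι (fun p : D × D => (G.obj e p.1 ⊗ (p.1 ⟶[V] p.2)) ⊗ F.obj p.2 c) (d, d') ≫= h0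
  rw [coendLeft, coendRight, colimit.ι_desc_assoc, colimit.ι_desc_assoc] at h
  simpa [ι] using h

variable {G F}

lemma compObj_ext {e : E} {c : C} {Z : V} {f g : compObj G F e c ⟶ Z}
    (h : ∀ d, ι G F e d c ≫ f = ι G F e d c ≫ g) : f = g := by
  apply coequalizer.hom_ext
  apply Sigma.hom_ext
  intro d
  have h' := h d
  rw [ι, Category.assoc, Category.assoc] at h'
  exact h'

/-- Maps out of the coend. -/
def compDesc {e : E} {c : C} {Z : V} (f : ∀ d, G.obj e d ⊗ F.obj d c ⟶ Z)
    (hf : ∀ d d', G.post e d d' ▷ F.obj d' c ≫ f d' =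
      (α_ _ _ _).hom ≫ G.obj e d ◁ F.pre d d' c ≫ f d) : compObj G F e c ⟶ Z :=
  coequalizer.desc (Sigma.desc f) (by
    apply Sigma.hom_ext
    rintro ⟨d, d'⟩
    simpa [coendLeft, coendRight] using hf d d')

lemma compπ_compDesc {e : E} {c : C} {Z : V} (f : ∀ d, G.obj e d ⊗ F.obj d c ⟶ Z) (hf) :
    compπ G F e c ≫ compDesc f hf = Sigma.desc f :=
  coequalizer.π_desc _ _

@[simp]
lemma ι_compDesc {e : E} {c : C} {Z : V} (f : ∀ d, G.obj e d ⊗ F.obj d c ⟶ Z) (hf) (d : D) :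
    ι G F e d c ≫ compDesc f hf = f d := by
  rw [ι, Category.assoc, compπ_compDesc, colimit.ι_desc]
  rfl

@[simp]
lemma ι_compDesc_assoc {e : E} {c : C} {Z W : V} (f : ∀ d, G.obj e d ⊗ F.obj d c ⟶ Z) (hf) (d : D)
    (h : Z ⟶ W) : ι G F e d c ≫ compDesc f hf ≫ h = f d ≫ h := by
  rw [← Category.assoc, ι_compDesc]

lemma whiskerLeft_compObj_ext {A : V} {e : E} {c : C} {Z : V} {f g : A ⊗ compObj G F e c ⟶ Z}
    (h : ∀ d, A ◁ ι G F e d c ≫ f = A ◁ ι G F e d c ≫ g) : f = g := by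
  apply MonoidalClosed.curry_injective
  apply compObj_ext
  intro d
  rw [← MonoidalClosed.curry_natural_left, ← MonoidalClosed.curry_natural_left, h]

lemma compObj_whiskerRight_ext {A : V} {e : E} {c : C} {Z : V} {f g : compObj G F e c ⊗ A ⟶ Z}
    (h : ∀ d, ι G F e d c ▷ A ≫ f = ι G F e d c ▷ A ≫ g) : f = g := by
  rw [← cancel_epi (β_ A _).hom]
  apply whiskerLeft_compObj_ext
  intro d
  simp only [BraidedCategory.braiding_naturality_right_assoc, h]

lemma whiskerLeft_compObj_whiskerRight_ext {A B : V} {e : E} {c : C} {Z : V}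
    {f g : (A ⊗ compObj G F e c) ⊗ B ⟶ Z}
    (h : ∀ d, (A ◁ ι G F e d c) ▷ B ≫ f = (A ◁ ι G F e d c) ▷ B ≫ g) : f = g := by
  rw [← cancel_epi (β_ B _).hom, ← cancel_epi (α_ B A _).hom]
  apply whiskerLeft_compObj_ext
  intro d
  simp only [associator_naturality_right_assoc, BraidedCategory.braiding_naturality_right_assoc, h]

/-- Maps out of the coend with a parameter on the left. -/
def compDescLeft {A : V} {e : E} {c : C} {Z : V} (f : ∀ d, A ⊗ (G.obj e d ⊗ F.obj d c) ⟶ Z)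
    (hf : ∀ d d', A ◁ (G.post e d d' ▷ F.obj d' c) ≫ f d' =
      A ◁ (α_ _ _ _).hom ≫ A ◁ (G.obj e d ◁ F.pre d d' c) ≫ f d) : A ⊗ compObj G F e c ⟶ Z :=
  MonoidalClosed.uncurry (compDesc (fun d => MonoidalClosed.curry (f d)) (by
    intro d d'
    rw [← MonoidalClosed.curry_natural_left, ← MonoidalClosed.curry_natural_left,
      ← MonoidalClosed.curry_natural_left, hf]))

@[simp]
lemma ι_compDescLeft {A : V} {e : E} {c : C} {Z : V}
    (f : ∀ d, A ⊗ (G.obj e d ⊗ F.obj d c) ⟶ Z) (hf) (d : D) :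
    A ◁ ι G F e d c ≫ compDescLeft f hf = f d := by
  rw [compDescLeft, ← MonoidalClosed.uncurry_natural_left, ι_compDesc,
    MonoidalClosed.uncurry_curry]

@[simp]
lemma ι_compDescLeft_assoc {A : V} {e : E} {c : C} {Z W : V}
    (f : ∀ d, A ⊗ (G.obj e d ⊗ F.obj d c) ⟶ Z) (hf) (d : D) (h : Z ⟶ W) :
    A ◁ ι G F e d c ≫ compDescLeft f hf ≫ h = f d ≫ h := by
  rw [← Category.assoc, ι_compDescLeft]

/-- Maps out of the coend with a parameter on the right. -/
def compDescRight {A : V} {e : E} {c : C} {Z : V} (f : ∀ d, (G.obj e d ⊗ F.obj d c) ⊗ A ⟶ Z)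
    (hf : ∀ d d', (G.post e d d' ▷ F.obj d' c) ▷ A ≫ f d' =
      (α_ _ _ _).hom ▷ A ≫ (G.obj e d ◁ F.pre d d' c) ▷ A ≫ f d) : compObj G F e c ⊗ A ⟶ Z :=
  (β_ _ _).hom ≫ compDescLeft (fun d => (β_ _ _).hom ≫ f d) (by
    intro d d'
    simp only [BraidedCategory.braiding_naturality_right_assoc, hf])

@[simp]
lemma ι_compDescRight {A : V} {e : E} {c : C} {Z : V}
    (f : ∀ d, (G.obj e d ⊗ F.obj d c) ⊗ A ⟶ Z) (hf) (d : D) :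
    ι G F e d c ▷ A ≫ compDescRight f hf = f d := by
  rw [compDescRight, BraidedCategory.braiding_naturality_left_assoc, ι_compDescLeft,
    SymmetricCategory.symmetry_assoc]

@[simp]
lemma ι_compDescRight_assoc {A : V} {e : E} {c : C} {Z W : V}
    (f : ∀ d, (G.obj e d ⊗ F.obj d c) ⊗ A ⟶ Z) (hf) (d : D) (h : Z ⟶ W) :
    ι G F e d c ▷ A ≫ compDescRight f hf ≫ h = f d ≫ h := by
  rw [← Category.assoc, ι_compDescRight]

/-- The action of `E` on a composite. -/
def compPre (G : VProf V D E) (F : VProf V C D) (e e' : E) (c : C) :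
    (e ⟶[V] e') ⊗ compObj G F e' c ⟶ compObj G F e c :=
  compDescLeft (fun d => (α_ _ _ _).inv ≫ G.pre e e' d ▷ F.obj d c ≫ ι G F e d c) (by
    intro d d'
    rw [associator_inv_naturality_middle_assoc, ← comp_whiskerRight_assoc]
    have h := G.pre_post e e' d d'
    rw [← Iso.inv_comp_eq] at h
    rw [← h, comp_whiskerRight_assoc, comp_whiskerRight_assoc, ι_dinatural]
    simp only [associator_naturality_left_assoc, whisker_exchange_assoc,
      associator_inv_naturality_right_assoc]
    monoidal)

@[simp]
lemma ι_compPre (G : VProf V D E) (F : VProf V C D) (e e' : E) (d : D) (c : C) :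
    (e ⟶[V] e') ◁ ι G F e' d c ≫ compPre G F e e' c =
      (α_ _ _ _).inv ≫ G.pre e e' d ▷ F.obj d c ≫ ι G F e d c := by
  simp [compPre]

@[simp]
lemma ι_compPre_assoc (G : VProf V D E) (F : VProf V C D) (e e' : E) (d : D) (c : C) {W : V}
    (h : compObj G F e c ⟶ W) :
    (e ⟶[V] e') ◁ ι G F e' d c ≫ compPre G F e e' c ≫ h =
      (α_ _ _ _).inv ≫ G.pre e e' d ▷ F.obj d c ≫ ι G F e d c ≫ h := by
  rw [← Category.assoc, ι_compPre]
  simp only [Category.assoc]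

/-- The action of `C` on a composite. -/
def compPost (G : VProf V D E) (F : VProf V C D) (e : E) (c c' : C) :
    compObj G F e c ⊗ (c ⟶[V] c') ⟶ compObj G F e c' :=
  compDescRight (fun d => (α_ _ _ _).hom ≫ G.obj e d ◁ F.post d c c' ≫ ι G F e d c') (by
    intro d d'
    rw [associator_naturality_left_assoc, ← whisker_exchange_assoc, ι_dinatural,
      associator_naturality_middle_assoc, ← MonoidalCategory.whiskerLeft_comp_assoc, F.pre_post]
    simp)

@[simp]
lemma ι_compPost (G : VProf V D E) (F : VProf V C D) (e : E) (d : D) (c c' : C) :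
    ι G F e d c ▷ (c ⟶[V] c') ≫ compPost G F e c c' =
      (α_ _ _ _).hom ≫ G.obj e d ◁ F.post d c c' ≫ ι G F e d c' := by
  simp [compPost]

@[simp]
lemma ι_compPost_assoc (G : VProf V D E) (F : VProf V C D) (e : E) (d : D) (c c' : C) {W : V}
    (h : compObj G F e c' ⟶ W) :
    ι G F e d c ▷ (c ⟶[V] c') ≫ compPost G F e c c' ≫ h =
      (α_ _ _ _).hom ≫ G.obj e d ◁ F.post d c c' ≫ ι G F e d c' ≫ h := by
  rw [← Category.assoc, ι_compPost]
  simp only [Category.assoc]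

/-- The composite profunctor `G • F`, `(e, c) ↦ ∫^d G(e, d) ⊗ F(d, c)`. -/
def comp (G : VProf V D E) (F : VProf V C D) : VProf V C E where
  obj e c := compObj G F e c
  pre e e' c := compPre G F e e' c
  post e c c' := compPost G F e c c'
  pre_id e c := by
    apply whiskerLeft_compObj_ext
    intro d
    rw [whisker_exchange_assoc, ι_compPre, associator_inv_naturality_left_assoc,
      ← comp_whiskerRight_assoc, G.pre_id]
    simp
  pre_comp e e' e'' c := by
    apply whiskerLeft_compObj_ext
    intro d
    rw [whisker_exchange_assoc, ι_compPre, associator_inv_naturality_left_assoc,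
      ← comp_whiskerRight_assoc, G.pre_comp, associator_naturality_right_assoc,
      ← MonoidalCategory.whiskerLeft_comp_assoc, ι_compPre]
    simp
  post_id e c := by
    apply compObj_whiskerRight_ext
    intro d
    rw [← whisker_exchange_assoc, ι_compPost, associator_naturality_right_assoc,
      ← MonoidalCategory.whiskerLeft_comp_assoc, F.post_id]
    simp
  post_comp e c c' c'' := by
    rw [← Iso.eq_inv_comp]
    apply compObj_whiskerRight_ext
    intro d
    rw [← whisker_exchange_assoc, ι_compPost, associator_inv_naturality_left_assoc,
      ← comp_whiskerRight_assoc, ι_compPost, comp_whiskerRight_assoc, comp_whiskerRight_assoc,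
      ι_compPost, associator_naturality_middle_assoc, ← MonoidalCategory.whiskerLeft_comp_assoc,
      ← F.post_comp, associator_naturality_right_assoc]
    simp

  pre_post e e' c c' := by
    apply whiskerLeft_compObj_whiskerRight_ext
    intro d
    rw [← comp_whiskerRight_assoc, ι_compPre, associator_naturality_middle_assoc,
      ← MonoidalCategory.whiskerLeft_comp_assoc, ι_compPost]
    simp only [comp_whiskerRight, Category.assoc, ι_compPost, MonoidalCategory.whiskerLeft_comp,
      ι_compPre, associator_inv_naturality_right_assoc, whisker_exchange_assoc,
      associator_naturality_left_assoc]
    monoidal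

end VProf
end Comp

/-! ### Actions of products and opposites -/

section Actions

variable {V : Type u} [Category.{v} V] [MonoidalCategory V] [SymmetricCategory V]

lemma left_action_prod {X₁ X₂ X₃ Y₁ Y₂ Y₃ F F₁ F₂ F₂' F₃ F₄ : V} (mX : X₁ ⊗ X₂ ⟶ X₃)
    (mY : Y₁ ⊗ Y₂ ⟶ Y₃) (b₂ : Y₂ ⊗ F ⟶ F₁) (b₁ : Y₁ ⊗ F₁ ⟶ F₂) (b₃ : Y₃ ⊗ F ⟶ F₂)
    (a₂ : X₂ ⊗ F₂ ⟶ F₃) (a₁ : X₁ ⊗ F₃ ⟶ F₄) (a₃ : X₃ ⊗ F₂ ⟶ F₄)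
    (a₂' : X₂ ⊗ F₁ ⟶ F₂') (b₁' : Y₁ ⊗ F₂' ⟶ F₃)
    (hX : mX ▷ F₂ ≫ a₃ = (α_ _ _ _).hom ≫ X₁ ◁ a₂ ≫ a₁)
    (hY : mY ▷ F ≫ b₃ = (α_ _ _ _).hom ≫ Y₁ ◁ b₂ ≫ b₁)
    (hc : Y₁ ◁ a₂' ≫ b₁' =
      (α_ _ _ _).inv ≫ (β_ Y₁ X₂).hom ▷ F₁ ≫ (α_ _ _ _).hom ≫ X₂ ◁ b₁ ≫ a₂) :
    (tensorμ X₁ Y₁ X₂ Y₂ ≫ (mX ⊗ₘ mY)) ▷ F ≫ (α_ X₃ Y₃ F).hom ≫ X₃ ◁ b₃ ≫ a₃ =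
      (α_ (X₁ ⊗ Y₁) (X₂ ⊗ Y₂) F).hom ≫ (X₁ ⊗ Y₁) ◁ ((α_ X₂ Y₂ F).hom ≫ X₂ ◁ b₂ ≫ a₂') ≫
        (α_ X₁ Y₁ F₂').hom ≫ X₁ ◁ b₁' ≫ a₁ := by
  calc _ = (tensorμ X₁ Y₁ X₂ Y₂) ▷ F ≫ (α_ _ _ _).hom ≫ (X₁ ⊗ X₂) ◁ (mY ▷ F ≫ b₃) ≫
        mX ▷ F₂ ≫ a₃ := by
        rw [MonoidalCategory.whiskerLeft_comp, Category.assoc, whisker_exchange_assoc,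
          MonoidalCategory.tensorHom_def']
        simp only [comp_whiskerRight, Category.assoc, whisker_assoc, Iso.inv_hom_id_assoc,
          associator_naturality_left_assoc]
    _ = (α_ _ _ _).hom ≫ (X₁ ⊗ Y₁) ◁ ((α_ X₂ Y₂ F).hom ≫ X₂ ◁ b₂) ≫ (α_ _ _ _).hom ≫
        X₁ ◁ ((α_ _ _ _).inv ≫ (β_ Y₁ X₂).hom ▷ F₁ ≫ (α_ _ _ _).hom ≫ X₂ ◁ b₁ ≫ a₂) ≫ a₁ := by
        rw [hX, hY]
        simp only [MonoidalCategory.whiskerLeft_comp, Category.assoc, tensor_whiskerLeft,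
          Iso.inv_hom_id_assoc, tensorμ, comp_whiskerRight, whisker_assoc]
        have e : Y₁ ◁ X₂ ◁ b₂ ≫ (α_ _ _ _).inv ≫ (β_ Y₁ X₂).hom ▷ F₁ ≫ (α_ _ _ _).hom =
            (α_ _ _ _).inv ≫ (β_ Y₁ X₂).hom ▷ _ ≫ (α_ _ _ _).hom ≫ X₂ ◁ Y₁ ◁ b₂ := by
          rw [associator_inv_naturality_right_assoc, whisker_exchange_assoc,
            associator_naturality_right]
        have e' := congrArg (fun t => X₁ ◁ t ≫ X₁ ◁ X₂ ◁ b₁ ≫ X₁ ◁ a₂ ≫ a₁) e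
        simp only [MonoidalCategory.whiskerLeft_comp, Category.assoc] at e'
        rw [e']
        monoidal
    _ = _ := by
        rw [← hc]
        simp

lemma right_action_prod {X₁ X₂ X₃ Y₁ Y₂ Y₃ F F₁ F₂ F₂' F₃ F₄ : V} (mX : X₁ ⊗ X₂ ⟶ X₃)
    (mY : Y₁ ⊗ Y₂ ⟶ Y₃) (a₁ : F ⊗ X₁ ⟶ F₁) (a₂ : F₁ ⊗ X₂ ⟶ F₂) (a₃ : F ⊗ X₃ ⟶ F₂)
    (b₁ : F₂ ⊗ Y₁ ⟶ F₃) (b₂ : F₃ ⊗ Y₂ ⟶ F₄) (b₃ : F₂ ⊗ Y₃ ⟶ F₄)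
    (b₁' : F₁ ⊗ Y₁ ⟶ F₂') (a₂' : F₂' ⊗ X₂ ⟶ F₃)
    (hX : (α_ _ _ _).hom ≫ F ◁ mX ≫ a₃ = a₁ ▷ X₂ ≫ a₂)
    (hY : (α_ _ _ _).hom ≫ F₂ ◁ mY ≫ b₃ = b₁ ▷ Y₂ ≫ b₂)
    (hc : b₁' ▷ X₂ ≫ a₂' =
      (α_ _ _ _).hom ≫ F₁ ◁ (β_ Y₁ X₂).hom ≫ (α_ _ _ _).inv ≫ a₂ ▷ Y₁ ≫ b₁) :
    F ◁ (tensorμ X₁ Y₁ X₂ Y₂ ≫ (mX ⊗ₘ mY)) ≫ (α_ F X₃ Y₃).inv ≫ a₃ ▷ Y₃ ≫ b₃ =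
      (α_ F (X₁ ⊗ Y₁) (X₂ ⊗ Y₂)).inv ≫ ((α_ F X₁ Y₁).inv ≫ a₁ ▷ Y₁ ≫ b₁') ▷ (X₂ ⊗ Y₂) ≫
        (α_ F₂' X₂ Y₂).inv ≫ a₂' ▷ Y₂ ≫ b₂ := by
  rw [← Iso.eq_inv_comp] at hX hY
  calc _ = F ◁ (tensorμ X₁ Y₁ X₂ Y₂) ≫ (α_ _ _ _).inv ≫ (F ◁ mX ≫ a₃) ▷ (Y₁ ⊗ Y₂) ≫
        F₂ ◁ mY ≫ b₃ := by
        rw [comp_whiskerRight, Category.assoc, ← whisker_exchange_assoc,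
          MonoidalCategory.tensorHom_def]
        simp only [MonoidalCategory.whiskerLeft_comp, Category.assoc,
          associator_inv_naturality_middle_assoc, associator_inv_naturality_right_assoc]
    _ = (α_ _ _ _).inv ≫ ((α_ F X₁ Y₁).inv ≫ a₁ ▷ Y₁) ▷ (X₂ ⊗ Y₂) ≫ (α_ _ _ _).inv ≫
        ((α_ _ _ _).hom ≫ F₁ ◁ (β_ Y₁ X₂).hom ≫ (α_ _ _ _).inv ≫ a₂ ▷ Y₁ ≫ b₁) ▷ Y₂ ≫ b₂ := by
        rw [hX, hY]
        have e : a₁ ▷ Y₁ ▷ X₂ ≫ (α_ _ _ _).hom ≫ F₁ ◁ (β_ Y₁ X₂).hom ≫ (α_ _ _ _).inv =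
            (α_ _ _ _).hom ≫ _ ◁ (β_ Y₁ X₂).hom ≫ (α_ _ _ _).inv ≫ a₁ ▷ X₂ ▷ Y₁ := by
          rw [associator_naturality_left_assoc, ← whisker_exchange_assoc,
            associator_inv_naturality_left]
        have e' := congrArg (fun t => t ▷ Y₂ ≫ a₂ ▷ Y₁ ▷ Y₂ ≫ b₁ ▷ Y₂ ≫ b₂) e
        simp only [comp_whiskerRight, Category.assoc, tensorμ] at e' ⊢
        have e2 : (α_ F (X₁ ⊗ Y₁) (X₂ ⊗ Y₂)).inv ≫ (α_ F X₁ Y₁).inv ▷ (X₂ ⊗ Y₂) ≫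
            a₁ ▷ Y₁ ▷ (X₂ ⊗ Y₂) ≫ (α_ _ _ _).inv = (α_ F (X₁ ⊗ Y₁) (X₂ ⊗ Y₂)).inv ≫
            (α_ F X₁ Y₁).inv ▷ (X₂ ⊗ Y₂) ≫ (α_ _ _ _).inv ≫ a₁ ▷ Y₁ ▷ X₂ ▷ Y₂ := by
          rw [associator_inv_naturality_left]
        rw [reassoc_of% e2, e']
        monoidal
    _ = _ := by
        rw [← hc]
        simp

end Actions

section Actions

set_option linter.unusedSectionVars false

variable {V : Type u} [Category.{v} V] [MonoidalCategory V] [SymmetricCategory V]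

lemma left_action_op {X₁ X₂ X₃ F F₁ F₂ : V} (m : X₁ ⊗ X₂ ⟶ X₃) (a₁ : F ⊗ X₁ ⟶ F₁)
    (a₂ : F₁ ⊗ X₂ ⟶ F₂) (a₃ : F ⊗ X₃ ⟶ F₂) (h : (α_ _ _ _).hom ≫ F ◁ m ≫ a₃ = a₁ ▷ X₂ ≫ a₂) :
    ((β_ X₂ X₁).hom ≫ m) ▷ F ≫ (β_ X₃ F).hom ≫ a₃ =
      (α_ _ _ _).hom ≫ X₂ ◁ ((β_ X₁ F).hom ≫ a₁) ≫ (β_ X₂ F₁).hom ≫ a₂ := by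
  rw [comp_whiskerRight, Category.assoc, BraidedCategory.braiding_naturality_left_assoc,
    MonoidalCategory.whiskerLeft_comp, Category.assoc,
    BraidedCategory.braiding_naturality_right_assoc, ← h]
  simp only [BraidedCategory.braiding_tensor_left_hom, BraidedCategory.braiding_tensor_right_hom,
    Category.assoc, Iso.inv_hom_id_assoc]
  have e := BraidedCategory.yang_baxter X₂ X₁ F
  simp only [← Category.assoc]
  congr 2
  simp only [Category.assoc]
  rw [← cancel_epi (α_ X₂ X₁ F).inv]
  simp only [Category.assoc, Iso.inv_hom_id_assoc] at e ⊢
  exact e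

lemma right_action_op {X₁ X₂ X₃ F F₁ F₂ : V} (m : X₁ ⊗ X₂ ⟶ X₃) (b₂ : X₂ ⊗ F ⟶ F₁)
    (b₁ : X₁ ⊗ F₁ ⟶ F₂) (b₃ : X₃ ⊗ F ⟶ F₂) (h : m ▷ F ≫ b₃ = (α_ _ _ _).hom ≫ X₁ ◁ b₂ ≫ b₁) :
    (α_ _ _ _).hom ≫ F ◁ ((β_ X₂ X₁).hom ≫ m) ≫ (β_ F X₃).hom ≫ b₃ =
      ((β_ F X₂).hom ≫ b₂) ▷ X₁ ≫ (β_ F₁ X₁).hom ≫ b₁ := by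
  rw [MonoidalCategory.whiskerLeft_comp, Category.assoc,
    BraidedCategory.braiding_naturality_right_assoc, h, comp_whiskerRight, Category.assoc,
    BraidedCategory.braiding_naturality_left_assoc]
  simp only [← Category.assoc]
  congr 2
  simp only [BraidedCategory.braiding_tensor_left_hom, BraidedCategory.braiding_tensor_right_hom,
    Category.assoc, Iso.inv_hom_id, Category.comp_id]
  have e := BraidedCategory.yang_baxter F X₂ X₁
  simp only [← Category.assoc] at e ⊢
  rw [← cancel_epi (α_ F X₂ X₁).inv]
  simp only [Category.assoc, Iso.inv_hom_id_assoc] at e ⊢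
  rw [← cancel_mono (α_ X₁ X₂ F).inv]
  simp only [Category.assoc, Iso.hom_inv_id, Category.comp_id]
  rw [← cancel_mono (α_ X₁ X₂ F).hom]
  simp only [Category.assoc, Iso.inv_hom_id, Category.comp_id]
  exact e.symm

lemma left_op_commute {X Y F F₁ F₂ F₃ : V} (b : Y ⊗ F ⟶ F₁) (a' : F₁ ⊗ X ⟶ F₃) (a : F ⊗ X ⟶ F₂)
    (b' : Y ⊗ F₂ ⟶ F₃) (h : b ▷ X ≫ a' = (α_ _ _ _).hom ≫ Y ◁ a ≫ b') :
    Y ◁ ((β_ X F).hom ≫ a) ≫ b' =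
      (α_ _ _ _).inv ≫ (β_ Y X).hom ▷ F ≫ (α_ _ _ _).hom ≫ X ◁ b ≫ (β_ X F₁).hom ≫ a' := by
  have e : (β_ Y X).hom ▷ F ≫ (β_ X Y).hom ▷ F = 𝟙 _ := by
    rw [← comp_whiskerRight, SymmetricCategory.symmetry, id_whiskerRight]
  rw [BraidedCategory.braiding_naturality_right_assoc, h]
  simp [reassoc_of% e, BraidedCategory.braiding_tensor_right_hom]

lemma right_op_commute {X Y F F₁ F₂ F₃ : V} (b : Y ⊗ F ⟶ F₁) (a' : F₁ ⊗ X ⟶ F₃) (a : F ⊗ X ⟶ F₂)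
    (b' : Y ⊗ F₂ ⟶ F₃) (h : b ▷ X ≫ a' = (α_ _ _ _).hom ≫ Y ◁ a ≫ b') :
    ((β_ F Y).hom ≫ b) ▷ X ≫ a' =
      (α_ _ _ _).hom ≫ F ◁ (β_ Y X).hom ≫ (α_ _ _ _).inv ≫ a ▷ Y ≫ (β_ F₂ Y).hom ≫ b' := by
  rw [BraidedCategory.braiding_naturality_left_assoc, comp_whiskerRight, Category.assoc, h]
  have e : F ◁ (β_ Y X).hom ≫ F ◁ (β_ X Y).hom = 𝟙 _ := by
    rw [← MonoidalCategory.whiskerLeft_comp, SymmetricCategory.symmetry,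
      MonoidalCategory.whiskerLeft_id]
  simp [reassoc_of% e, BraidedCategory.braiding_tensor_left_hom]

lemma op_op_commute {X Y F F₁ F₂ F₃ : V} (b : Y ⊗ F ⟶ F₁) (a' : F₁ ⊗ X ⟶ F₃) (a : F ⊗ X ⟶ F₂)
    (b' : Y ⊗ F₂ ⟶ F₃) (h : b ▷ X ≫ a' = (α_ _ _ _).hom ≫ Y ◁ a ≫ b') :
    ((β_ X F).hom ≫ a) ▷ Y ≫ (β_ F₂ Y).hom ≫ b' =
      (α_ _ _ _).hom ≫ X ◁ ((β_ F Y).hom ≫ b) ≫ (β_ X F₁).hom ≫ a' := by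
  rw [comp_whiskerRight, Category.assoc, BraidedCategory.braiding_naturality_left_assoc,
    MonoidalCategory.whiskerLeft_comp, Category.assoc,
    BraidedCategory.braiding_naturality_right_assoc, h]
  simp only [BraidedCategory.braiding_tensor_left_hom, BraidedCategory.braiding_tensor_right_hom,
    Category.assoc, Iso.inv_hom_id_assoc]
  simp only [← Category.assoc]
  congr 2
  simp only [Category.assoc]
  have e := BraidedCategory.yang_baxter X F Y
  simp only [← Category.assoc] at e ⊢
  rw [← cancel_epi (α_ X F Y).inv]
  simp only [Category.assoc, Iso.inv_hom_id_assoc] at e ⊢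
  exact e

lemma left_left_commute {Y Z F F₁ F₂ F₃ : V} (b : Y ⊗ F ⟶ F₁) (c' : Z ⊗ F₁ ⟶ F₃)
    (c : Z ⊗ F ⟶ F₂) (b' : Y ⊗ F₂ ⟶ F₃)
    (h : Z ◁ b ≫ c' = (α_ _ _ _).inv ≫ (β_ Z Y).hom ▷ F ≫ (α_ _ _ _).hom ≫ Y ◁ c ≫ b') :
    b ▷ Z ≫ (β_ F₁ Z).hom ≫ c' = (α_ _ _ _).hom ≫ Y ◁ ((β_ F Z).hom ≫ c) ≫ b' := by
  rw [BraidedCategory.braiding_naturality_left_assoc, h]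
  simp [BraidedCategory.braiding_tensor_left_hom, ← comp_whiskerRight_assoc]

lemma bimodule_prod {X Y Z F F₁ F₂ G G₁ G₂ : V} (b : Y ⊗ F ⟶ F₁) (a : X ⊗ F₁ ⟶ F₂)
    (c : F ⊗ Z ⟶ G) (c₁ : F₁ ⊗ Z ⟶ G₁) (c₂ : F₂ ⊗ Z ⟶ G₂) (b' : Y ⊗ G ⟶ G₁) (a' : X ⊗ G₁ ⟶ G₂)
    (hb : b ▷ Z ≫ c₁ = (α_ _ _ _).hom ≫ Y ◁ c ≫ b')
    (ha : a ▷ Z ≫ c₂ = (α_ _ _ _).hom ≫ X ◁ c₁ ≫ a') :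
    ((α_ X Y F).hom ≫ X ◁ b ≫ a) ▷ Z ≫ c₂ =
      (α_ _ _ _).hom ≫ (X ⊗ Y) ◁ c ≫ (α_ X Y G).hom ≫ X ◁ b' ≫ a' := by
  simp only [comp_whiskerRight, Category.assoc, ha]
  rw [associator_naturality_middle_assoc, ← MonoidalCategory.whiskerLeft_comp_assoc, hb]
  simp

end Actions

section Units

variable {V : Type u} [Category.{v} V] [MonoidalCategory V] [SymmetricCategory V]

set_option linter.unusedSectionVars false

lemma left_action_prod_id {X Y F : V} (i : 𝟙_ V ⟶ X) (k : 𝟙_ V ⟶ Y) (b : Y ⊗ F ⟶ F)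
    (a : X ⊗ F ⟶ F) (hb : k ▷ F ≫ b = (λ_ F).hom) (ha : i ▷ F ≫ a = (λ_ F).hom) :
    ((λ_ (𝟙_ V)).inv ≫ (i ⊗ₘ k)) ▷ F ≫ (α_ X Y F).hom ≫ X ◁ b ≫ a = (λ_ F).hom := by
  rw [MonoidalCategory.tensorHom_def', comp_whiskerRight, comp_whiskerRight]
  simp only [Category.assoc, associator_naturality_left_assoc, ← whisker_exchange_assoc, ha]
  rw [whisker_assoc]
  simp only [Category.assoc, Iso.inv_hom_id_assoc, ← MonoidalCategory.whiskerLeft_comp_assoc, hb]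
  simp

lemma right_action_prod_id {X Y F : V} (i : 𝟙_ V ⟶ X) (k : 𝟙_ V ⟶ Y) (a : F ⊗ X ⟶ F)
    (b : F ⊗ Y ⟶ F) (ha : F ◁ i ≫ a = (ρ_ F).hom) (hb : F ◁ k ≫ b = (ρ_ F).hom) :
    F ◁ ((λ_ (𝟙_ V)).inv ≫ (i ⊗ₘ k)) ≫ (α_ F X Y).inv ≫ a ▷ Y ≫ b = (ρ_ F).hom := by
  rw [MonoidalCategory.tensorHom_def, MonoidalCategory.whiskerLeft_comp,
    MonoidalCategory.whiskerLeft_comp]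
  simp only [Category.assoc, associator_inv_naturality_right_assoc, whisker_exchange_assoc, hb]
  rw [associator_inv_naturality_middle_assoc, ← comp_whiskerRight_assoc, ha]
  simp

lemma left_op_id {X F : V} (i : 𝟙_ V ⟶ X) (a : F ⊗ X ⟶ F) (ha : F ◁ i ≫ a = (ρ_ F).hom) :
    i ▷ F ≫ (β_ X F).hom ≫ a = (λ_ F).hom := by
  rw [BraidedCategory.braiding_naturality_left_assoc, ha]
  simp

lemma right_op_id {X F : V} (i : 𝟙_ V ⟶ X) (a : X ⊗ F ⟶ F) (ha : i ▷ F ≫ a = (λ_ F).hom) :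
    F ◁ i ≫ (β_ F X).hom ≫ a = (ρ_ F).hom := by
  rw [BraidedCategory.braiding_naturality_right_assoc, ha]
  simp

lemma insert_right_comp {A B Z I : V} (m : A ⊗ B ⟶ Z) (i : 𝟙_ V ⟶ I) (mI : I ⊗ I ⟶ I)
    (h : i ▷ I ≫ mI = (λ_ I).hom) :
    m ≫ (ρ_ Z).inv ≫ Z ◁ i =
      ((ρ_ A).inv ≫ A ◁ i ⊗ₘ (ρ_ B).inv ≫ B ◁ i) ≫ tensorμ A I B I ≫ (m ⊗ₘ mI) := by
  have h1 : (i ⊗ₘ i) ≫ mI = (λ_ (𝟙_ V)).hom ≫ i := by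
    rw [MonoidalCategory.tensorHom_def', Category.assoc, h, leftUnitor_naturality]
  have h2 := tensorμ_natural (𝟙 A) i (𝟙 B) i
  have h3 := rightUnitor_monoidal A B
  rw [← tensorHom_comp_tensorHom, ← id_tensorHom A, ← id_tensorHom B, Category.assoc, reassoc_of% h2,
    tensorHom_comp_tensorHom, h1, ← cancel_epi ((ρ_ A).hom ⊗ₘ (ρ_ B).hom),
    tensorHom_comp_tensorHom_assoc, Iso.hom_inv_id, Iso.hom_inv_id, id_tensorHom_id,
    Category.id_comp, h3, id_tensorHom_id, Category.id_comp,
    MonoidalCategory.tensorHom_def' m]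
  simp only [Category.assoc, MonoidalCategory.whiskerLeft_comp]
  rw [whisker_exchange, ← rightUnitor_naturality_assoc, Iso.hom_inv_id_assoc]

lemma insert_left_comp {A B Z I : V} (m : A ⊗ B ⟶ Z) (i : 𝟙_ V ⟶ I) (mI : I ⊗ I ⟶ I)
    (h : i ▷ I ≫ mI = (λ_ I).hom) :
    m ≫ (λ_ Z).inv ≫ i ▷ Z =
      ((λ_ A).inv ≫ i ▷ A ⊗ₘ (λ_ B).inv ≫ i ▷ B) ≫ tensorμ I A I B ≫ (mI ⊗ₘ m) := by
  have h1 : (i ⊗ₘ i) ≫ mI = (λ_ (𝟙_ V)).hom ≫ i := by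
    rw [MonoidalCategory.tensorHom_def', Category.assoc, h, leftUnitor_naturality]
  have h2 := tensorμ_natural i (𝟙 A) i (𝟙 B)
  have h3 := leftUnitor_monoidal A B
  rw [← tensorHom_comp_tensorHom, ← tensorHom_id _ A, ← tensorHom_id _ B, Category.assoc, reassoc_of% h2,
    tensorHom_comp_tensorHom, h1, ← cancel_epi ((λ_ A).hom ⊗ₘ (λ_ B).hom),
    tensorHom_comp_tensorHom_assoc, Iso.hom_inv_id, Iso.hom_inv_id, id_tensorHom_id,
    Category.id_comp, h3, id_tensorHom_id, Category.id_comp,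
    MonoidalCategory.tensorHom_def _ m]
  simp only [Category.assoc, comp_whiskerRight]
  rw [← whisker_exchange, ← leftUnitor_naturality_assoc, Iso.hom_inv_id_assoc]

lemma insert_exchange {Y Z I J : V} (i : 𝟙_ V ⟶ I) (k : 𝟙_ V ⟶ J) (a : I ⊗ Y ⟶ Y)
    (c : Z ⊗ J ⟶ Z) (ha : i ▷ Y ≫ a = (λ_ Y).hom) (hc : Z ◁ k ≫ c = (ρ_ Z).hom) :
    ((λ_ Z).inv ≫ i ▷ Z ⊗ₘ (ρ_ Y).inv ≫ Y ◁ k) ≫ tensorμ I Z Y J ≫ (a ⊗ₘ c) =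
      (β_ Z Y).hom := by
  have h2 := tensorμ_natural i (𝟙 Z) (𝟙 Y) k
  rw [← tensorHom_comp_tensorHom, ← tensorHom_id, ← id_tensorHom, Category.assoc, reassoc_of% h2,
    tensorHom_comp_tensorHom, tensorHom_id, id_tensorHom, ha, hc]
  simp [tensorμ, MonoidalCategory.tensorHom_def]
  monoidal

lemma insert_exchange' {Y Z I J : V} (i : 𝟙_ V ⟶ I) (k : 𝟙_ V ⟶ J) (a : Y ⊗ J ⟶ Y)
    (c : I ⊗ Z ⟶ Z) (ha : Y ◁ k ≫ a = (ρ_ Y).hom) (hc : i ▷ Z ≫ c = (λ_ Z).hom) :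
    ((ρ_ Y).inv ≫ Y ◁ i ⊗ₘ (λ_ Z).inv ≫ k ▷ Z) ≫ tensorμ Y I J Z ≫ (a ⊗ₘ c) = 𝟙 _ := by
  have h2 := tensorμ_natural (𝟙 Y) i k (𝟙 Z)
  rw [← tensorHom_comp_tensorHom, ← tensorHom_id, ← id_tensorHom, Category.assoc, reassoc_of% h2,
    tensorHom_comp_tensorHom, tensorHom_id, id_tensorHom, ha, hc]
  have e : (β_ (𝟙_ V) (𝟙_ V)).hom = 𝟙 _ := by
    rw [braiding_tensorUnit_left, ← unitors_inv_equal, Iso.hom_inv_id]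
  rw [tensorμ, e]
  monoidal

lemma action_comp_aux {Z Y P Q R F G₀ G₁ : V} (r : Z ⟶ P) (l : Y ⟶ Q) (p₁ : P ⊗ G₁ ⟶ G₀)
    (p₂ : Q ⊗ F ⟶ G₁) (p₃ : R ⊗ F ⟶ G₀) (c : P ⊗ Q ⟶ R)
    (h : c ▷ F ≫ p₃ = (α_ _ _ _).hom ≫ P ◁ p₂ ≫ p₁) :
    Z ◁ (l ▷ F ≫ p₂) ≫ r ▷ G₁ ≫ p₁ = (α_ _ _ _).inv ≫ ((r ⊗ₘ l) ≫ c) ▷ F ≫ p₃ := by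
  rw [comp_whiskerRight, Category.assoc, h, MonoidalCategory.tensorHom_def']
  simp only [MonoidalCategory.whiskerLeft_comp, Category.assoc, comp_whiskerRight,
    associator_naturality_left_assoc, associator_naturality_middle_assoc, Iso.inv_hom_id_assoc,
    whisker_exchange_assoc]

lemma action_restrict_aux {Y P X F F₁ G F₂ : V} (l : Y ⟶ P) (p : P ⊗ F ⟶ F₁) (q : F₁ ⊗ X ⟶ F₂)
    (q' : F ⊗ X ⟶ G) (p' : P ⊗ G ⟶ F₂) (h : p ▷ X ≫ q = (α_ _ _ _).hom ≫ P ◁ q' ≫ p') :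
    (l ▷ F ≫ p) ▷ X ≫ q = (α_ _ _ _).hom ≫ Y ◁ q' ≫ l ▷ G ≫ p' := by
  rw [comp_whiskerRight, Category.assoc, h, associator_naturality_left_assoc,
    whisker_exchange_assoc]

end Units

/-! ### Transposes of profunctors, and further operations -/

section Transpose

set_option linter.unusedVariables false

variable {V : Type u} [Category.{v} V] [MonoidalCategory V] [SymmetricCategory V]

/-- The `V`-functor `C ⟶ C × D`, `c ↦ (c, d)`. -/
def insertLeft (C : Type v) [EnrichedCategory V C] {D : Type v} [EnrichedCategory V D] (d : D) :
    EnrichedFunctor V C (C × D) where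
  obj c := (c, d)
  map _ _ := (ρ_ _).inv ≫ _ ◁ eId V d
  map_id c := by
    change _ = (λ_ (𝟙_ V)).inv ≫ (eId V c ⊗ₘ eId V d)
    rw [rightUnitor_inv_naturality_assoc, unitors_inv_equal, MonoidalCategory.tensorHom_def]
  map_comp c c' c'' := by
    change _ = (_ ⊗ₘ _) ≫ tensorμ _ _ _ _ ≫ (eComp V c c' c'' ⊗ₘ eComp V d d d)
    refine insert_right_comp _ _ _ ?_
    rw [← Iso.inv_comp_eq_id, e_id_comp]

/-- The `V`-functor `D ⟶ C × D`, `d ↦ (c, d)`. -/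
def insertRight {C : Type v} [EnrichedCategory V C] (D : Type v) [EnrichedCategory V D] (c : C) :
    EnrichedFunctor V D (C × D) where
  obj d := (c, d)
  map _ _ := (λ_ _).inv ≫ eId V c ▷ _
  map_id d := by
    change _ = (λ_ (𝟙_ V)).inv ≫ (eId V c ⊗ₘ eId V d)
    rw [leftUnitor_inv_naturality_assoc, MonoidalCategory.tensorHom_def']
  map_comp d d' d'' := by
    change _ = (_ ⊗ₘ _) ≫ tensorμ _ _ _ _ ≫ (eComp V c c c ⊗ₘ eComp V d d' d'')
    refine insert_left_comp _ _ _ ?_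
    rw [← Iso.inv_comp_eq_id, e_id_comp]

namespace VProf

variable {C : Type v} [EnrichedCategory V C] {D : Type v} [EnrichedCategory V D]
variable {E : Type v} [EnrichedCategory V E]

/-- The transpose `* ⇸ Cᵒᵖ ⊗ D` of a profunctor `C ⇸ D`, with the same values. -/
def heart (F : VProf V C D) : VProf V PUnit.{v + 1} (Cᵒᵖ × D) where
  obj p _ := F.obj p.2 p.1.unop
  pre p q _ := (α_ _ _ _).hom ≫ _ ◁ F.pre p.2 q.2 q.1.unop ≫ (β_ _ _).hom ≫
    F.post p.2 q.1.unop p.1.unop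
  post _ _ _ := (ρ_ _).hom
  pre_id p _ := left_action_prod_id _ _ _ _ (F.pre_id _ _) (left_op_id _ _ (F.post_id _ _))
  pre_comp p q r _ := 
    left_action_prod _ _ _ _ _ _ _ _ _ _ (left_action_op _ _ _ _ (F.post_comp _ _ _ _))
      (F.pre_comp _ _ _ _) (left_op_commute _ _ _ _ (F.pre_post _ _ _ _))
  post_id p _ := by
    change _ ◁ 𝟙 _ ≫ _ = _
    simp
  post_comp p _ _ _ := by
    change (α_ _ _ _).hom ≫ _ ◁ (λ_ (𝟙_ V)).hom ≫ _ = (ρ_ _).hom ▷ (𝟙_ V) ≫ _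
    simp
  pre_post p q _ _ := by
    change _ ▷ (𝟙_ V) ≫ (ρ_ _).hom = (α_ _ _ (𝟙_ V)).hom ≫ _ ◁ (ρ_ _).hom ≫ _
    rw [rightUnitor_naturality, rightUnitor_tensor_hom, Category.assoc]

lemma heartMap_aux {X Y F₁ F₂ F₃ G₁ G₂ G₃ : V} (b : Y ⊗ F₁ ⟶ F₂) (a : F₂ ⊗ X ⟶ F₃)
    (b' : Y ⊗ G₁ ⟶ G₂) (a' : G₂ ⊗ X ⟶ G₃) (f₁ : F₁ ⟶ G₁) (f₂ : F₂ ⟶ G₂) (f₃ : F₃ ⟶ G₃)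
    (hb : b ≫ f₂ = Y ◁ f₁ ≫ b') (ha : a ≫ f₃ = f₂ ▷ X ≫ a') :
    ((α_ X Y F₁).hom ≫ X ◁ b ≫ (β_ X F₂).hom ≫ a) ≫ f₃ =
      (X ⊗ Y) ◁ f₁ ≫ (α_ X Y G₁).hom ≫ X ◁ b' ≫ (β_ X G₂).hom ≫ a' := by
  rw [Category.assoc, Category.assoc, Category.assoc, ha,
    ← BraidedCategory.braiding_naturality_right_assoc, ← MonoidalCategory.whiskerLeft_comp_assoc,
    hb, MonoidalCategory.whiskerLeft_comp_assoc, associator_naturality_right_assoc]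

/-- The transpose of a morphism of profunctors. -/
def heartMap {F G : VProf V C D} (f : F ⟶ G) : heart F ⟶ heart G where
  app p _ := f.app p.2 p.1.unop
  pre_app p q _ := heartMap_aux _ _ _ _ _ _ _ (f.pre_app _ _ _) (f.post_app _ _ _)
  post_app p _ _ := (rightUnitor_naturality (f.app p.2 p.1.unop)).symm

variable (V C) in
/-- The coevaluation `C ⊗ Cᵒᵖ ⇸ *`, `(b, a) ↦ C(a, b)`. -/
def coev : VProf V (C × Cᵒᵖ) PUnit.{v + 1} where
  obj _ p := p.2.unop ⟶[V] p.1
  pre _ _ _ := (λ_ _).hom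
  post _ p q := (α_ _ _ _).inv ≫ eComp V p.2.unop p.1 q.1 ▷ _ ≫ (β_ _ _).hom ≫
    eComp V q.2.unop p.2.unop q.1
  pre_id _ p := by
    change 𝟙 _ ▷ _ ≫ _ = _
    simp
  pre_comp _ _ _ p := by
    change (λ_ (𝟙_ V)).hom ▷ _ ≫ _ = (α_ (𝟙_ V) _ _).hom ≫ (𝟙_ V) ◁ (λ_ _).hom ≫ _
    simp
  post_id _ p := by
    refine right_action_prod_id _ _ _ _ ?_ (right_op_id _ _ ?_)
    · exact (Iso.inv_comp_eq_id _).1 (e_comp_id V _ _)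
    · exact (Iso.inv_comp_eq_id _).1 (e_id_comp V _ _)
  post_comp _ p q r :=
    (Iso.eq_inv_comp _).1 (right_action_prod _ _ _ _ _ _ _ _ _ _ (e_assoc' V _ _ _ _)
      (right_action_op _ _ _ _ (e_assoc' V _ _ _ _).symm)
      (right_op_commute _ _ _ _ (e_assoc' V _ _ _ _).symm))
  pre_post _ _ p q := by
    change (λ_ _).hom ▷ _ ≫ _ = (α_ (𝟙_ V) _ _).hom ≫ (𝟙_ V) ◁ _ ≫ (λ_ _).hom
    rw [leftUnitor_naturality, leftUnitor_tensor_hom_assoc, Iso.hom_inv_id_assoc]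

/-- Partial left action of the first factor of a product. -/
def preFst (K : VProf V D (C × E)) (x x' : C) (e : E) (d : D) :
    (x ⟶[V] x') ⊗ K.obj (x', e) d ⟶ K.obj (x, e) d :=
  (insertLeft C e).map x x' ▷ _ ≫ K.pre (x, e) (x', e) d

/-- Partial left action of the second factor of a product. -/
def preSnd (K : VProf V D (C × E)) (x : C) (e e' : E) (d : D) :
    (e ⟶[V] e') ⊗ K.obj (x, e') d ⟶ K.obj (x, e) d :=
  (insertRight E x).map e e' ▷ _ ≫ K.pre (x, e) (x, e') d

lemma preFst_post (K : VProf V D (C × E)) (x x' : C) (e : E) (d d' : D) :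
    K.preFst x x' e d ▷ (d ⟶[V] d') ≫ K.post (x, e) d d' =
      (α_ _ _ _).hom ≫ (x ⟶[V] x') ◁ K.post (x', e) d d' ≫ K.preFst x x' e d' := by
  exact action_restrict_aux _ _ _ _ _ (K.pre_post _ _ _ _)

lemma preSnd_post (K : VProf V D (C × E)) (x : C) (e e' : E) (d d' : D) :
    K.preSnd x e e' d ▷ (d ⟶[V] d') ≫ K.post (x, e) d d' =
      (α_ _ _ _).hom ≫ (e ⟶[V] e') ◁ K.post (x, e') d d' ≫ K.preSnd x e e' d' := by
  exact action_restrict_aux _ _ _ _ _ (K.pre_post _ _ _ _)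

lemma preFst_preSnd (K : VProf V D (C × E)) (x x' : C) (e e' : E) (d : D) :
    (e ⟶[V] e') ◁ K.preFst x x' e' d ≫ K.preSnd x e e' d =
      (α_ _ _ _).inv ≫ (β_ _ _).hom ▷ K.obj (x', e') d ≫ (α_ _ _ _).hom ≫
        (x ⟶[V] x') ◁ K.preSnd x' e e' d ≫ K.preFst x x' e d := by
  have h1 := action_comp_aux ((insertRight (V := V) E x).map e e')
    ((insertLeft (V := V) C e').map x x') _ _ _ _ (K.pre_comp (x, e) (x, e') (x', e') d)
  have h2 := action_comp_aux ((insertLeft (V := V) C e).map x x')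
    ((insertRight (V := V) E x').map e e') _ _ _ _ (K.pre_comp (x, e) (x', e) (x', e') d)
  refine h1.trans ?_
  refine Eq.trans ?_ (congrArg (fun t => (α_ _ _ _).inv ≫ (β_ _ _).hom ▷ K.obj (x', e') d ≫
    (α_ _ _ _).hom ≫ t) h2.symm)
  have k1 : ((insertRight (V := V) E x).map e e' ⊗ₘ (insertLeft (V := V) C e').map x x') ≫
      eComp V (x, e) (x, e') (x', e') = (β_ (e ⟶[V] e') (x ⟶[V] x')).hom :=
    insert_exchange _ _ _ _ (by rw [← Iso.inv_comp_eq_id, e_id_comp])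
      (by rw [← Iso.inv_comp_eq_id, e_comp_id])
  have k2 : ((insertLeft (V := V) C e).map x x' ⊗ₘ (insertRight (V := V) E x').map e e') ≫
      eComp V (x, e) (x', e) (x', e') = 𝟙 _ :=
    insert_exchange' _ _ _ _ (by rw [← Iso.inv_comp_eq_id, e_comp_id])
      (by rw [← Iso.inv_comp_eq_id, e_id_comp])
  rw [k1, k2]
  simp

/-- Bending two legs: from `K : D ⇸ C ⊗ E` to `Eᵒᵖ ⇸ Dᵒᵖ ⊗ C`, with the same values. -/
def bend (K : VProf V D (C × E)) : VProf V Eᵒᵖ (Dᵒᵖ × C) where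
  obj p e := K.obj (p.2, e.unop) p.1.unop
  pre p q e := (α_ _ _ _).hom ≫ _ ◁ K.preFst p.2 q.2 e.unop q.1.unop ≫
      (β_ _ _).hom ≫ K.post (p.2, e.unop) q.1.unop p.1.unop
  post p e e' := (β_ _ _).hom ≫ K.preSnd p.2 e'.unop e.unop p.1.unop
  pre_id p e := left_action_prod_id _ _ _ _
    ((K.restrict (insertLeft C e.unop) (EnrichedFunctor.id V D)).pre_id _ _)
    (left_op_id _ _ (K.post_id _ _))
  pre_comp p q r e :=
    left_action_prod _ _ _ _ _ _ _ _ _ _ (left_action_op _ _ _ _ (K.post_comp _ _ _ _))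
      ((K.restrict (insertLeft C e.unop) (EnrichedFunctor.id V D)).pre_comp _ _ _ _)
      (left_op_commute _ _ _ _ (K.preFst_post _ _ _ _ _))
  post_id p e := right_op_id _ _
    ((K.restrict (insertRight E p.2) (EnrichedFunctor.id V D)).pre_id _ _)
  post_comp p e e' e'' := right_action_op _ _ _ _
    ((K.restrict (insertRight E p.2) (EnrichedFunctor.id V D)).pre_comp _ _ _ _)
  pre_post p q e e' := bimodule_prod _ _ _ _ _ _ _
    (left_left_commute _ _ _ _ (K.preFst_preSnd _ _ _ _ _))
    (op_op_commute _ _ _ _ (K.preSnd_post _ _ _ _ _))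

end VProf
end Transpose

/-! ### Functoriality of composition, and contraction of a companion -/

section CompMap

variable {V : Type u} [Category.{v} V] [MonoidalCategory V] [SymmetricCategory V]

namespace VProf

variable {C : Type v} [EnrichedCategory V C] {D : Type v} [EnrichedCategory V D]
  {E : Type v} [EnrichedCategory V E]

lemma tensMap_id {C' D' : Type v} [EnrichedCategory V C'] [EnrichedCategory V D']
    (F : VProf V C D) (G : VProf V C' D') : tensMap (𝟙 F) (𝟙 G) = 𝟙 (tens F G) := by
  ext d c
  exact id_tensorHom_id _ _

lemma tensMap_comp {C' D' : Type v} [EnrichedCategory V C'] [EnrichedCategory V D']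
    {F F' F'' : VProf V C D} {G G' G'' : VProf V C' D'} (f : F ⟶ F') (f' : F' ⟶ F'')
    (g : G ⟶ G') (g' : G' ⟶ G'') :
    tensMap (f ≫ f') (g ≫ g') = tensMap f g ≫ tensMap f' g' := by
  ext d c
  exact (tensorHom_comp_tensorHom _ _ _ _).symm

variable (V C D) in
/-- Transposition as a functor. -/
def heartFunctor : VProf V C D ⥤ VProf V PUnit.{v + 1} (Cᵒᵖ × D) where
  obj F := heart F
  map f := heartMap f
  map_id _ := rfl
  map_comp _ _ := rfl

/-- Covariant action of a morphism of the underlying category of the domain. -/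
def mapRight {M : Type v} [Category.{v} M] [EnrichedOrdinaryCategory V M] (F : VProf V M D) (d : D)
    {m m' : M} (f : m ⟶ m') : F.obj d m ⟶ F.obj d m' :=
  (ρ_ _).inv ≫ F.obj d m ◁ eHomEquiv V f ≫ F.post d m m'

variable [MonoidalClosed V] [HasColimits V]

/-- The map of coends induced by morphisms of profunctors. -/
def compObjMap {G G' : VProf V D E} {F F' : VProf V C D} (g : G ⟶ G') (f : F ⟶ F') (e : E) (c : C) :
    compObj G F e c ⟶ compObj G' F' e c :=
  compDesc (fun d => (g.app e d ⊗ₘ f.app d c) ≫ ι G' F' e d c) (by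
    intro d d'
    rw [MonoidalCategory.tensorHom_def, Category.assoc, ← comp_whiskerRight_assoc, g.post_app,
      comp_whiskerRight_assoc, ← whisker_exchange_assoc, ι_dinatural,
      MonoidalCategory.tensorHom_def', Category.assoc, ← MonoidalCategory.whiskerLeft_comp_assoc,
      f.pre_app, MonoidalCategory.whiskerLeft_comp_assoc, whisker_exchange_assoc,
      associator_naturality_right_assoc, associator_naturality_left_assoc,
      whisker_exchange_assoc])

@[simp]
lemma ι_compObjMap {G G' : VProf V D E} {F F' : VProf V C D} (g : G ⟶ G') (f : F ⟶ F') (e : E)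
    (d : D) (c : C) :
    ι G F e d c ≫ compObjMap g f e c = (g.app e d ⊗ₘ f.app d c) ≫ ι G' F' e d c :=
  ι_compDesc _ _ _

@[simp]
lemma ι_compObjMap_assoc {G G' : VProf V D E} {F F' : VProf V C D} (g : G ⟶ G') (f : F ⟶ F')
    (e : E) (d : D) (c : C) {W : V} (h : compObj G' F' e c ⟶ W) :
    ι G F e d c ≫ compObjMap g f e c ≫ h =
      (g.app e d ⊗ₘ f.app d c) ≫ ι G' F' e d c ≫ h := by
  rw [← Category.assoc, ι_compObjMap]
  simp only [Category.assoc]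

lemma compObjMap_pre {G G' : VProf V D E} {F F' : VProf V C D} (g : G ⟶ G') (f : F ⟶ F') (e e' : E)
    (c : C) : compPre G F e e' c ≫ compObjMap g f e c =
      (e ⟶[V] e') ◁ compObjMap g f e' c ≫ compPre G' F' e e' c := by
  apply whiskerLeft_compObj_ext
  intro d
  rw [ι_compPre_assoc, ι_compObjMap, ← MonoidalCategory.whiskerLeft_comp_assoc, ι_compObjMap,
    MonoidalCategory.whiskerLeft_comp_assoc, ι_compPre, MonoidalCategory.tensorHom_def,
    Category.assoc, ← comp_whiskerRight_assoc, g.pre_app]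
  rw [comp_whiskerRight_assoc, MonoidalCategory.tensorHom_def,
    MonoidalCategory.whiskerLeft_comp_assoc, associator_inv_naturality_right_assoc,
    associator_inv_naturality_middle_assoc, whisker_exchange_assoc]

lemma compObjMap_post {G G' : VProf V D E} {F F' : VProf V C D} (g : G ⟶ G') (f : F ⟶ F') (e : E)
    (c c' : C) : compPost G F e c c' ≫ compObjMap g f e c' =
      compObjMap g f e c ▷ (c ⟶[V] c') ≫ compPost G' F' e c c' := by
  apply compObj_whiskerRight_ext
  intro d
  rw [ι_compPost_assoc, ι_compObjMap, ← comp_whiskerRight_assoc, ι_compObjMap,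
    comp_whiskerRight_assoc, ι_compPost, MonoidalCategory.tensorHom_def',
    Category.assoc, ← MonoidalCategory.whiskerLeft_comp_assoc, f.post_app]
  rw [MonoidalCategory.whiskerLeft_comp_assoc, MonoidalCategory.tensorHom_def',
    comp_whiskerRight_assoc, associator_naturality_left_assoc,
    associator_naturality_middle_assoc, ← whisker_exchange_assoc]

/-- Horizontal composition of morphisms of profunctors. -/
def compMap {G G' : VProf V D E} {F F' : VProf V C D} (g : G ⟶ G') (f : F ⟶ F') :
    comp G F ⟶ comp G' F' where
  app e c := compObjMap g f e c
  pre_app e e' c := compObjMap_pre g f e e' c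
  post_app e c c' := compObjMap_post g f e c c'

lemma compMap_id (G : VProf V D E) (F : VProf V C D) : compMap (𝟙 G) (𝟙 F) = 𝟙 (comp G F) := by
  ext e c
  have h : compObjMap (𝟙 G) (𝟙 F) e c = 𝟙 (compObj G F e c) := by
    apply compObj_ext
    intro d
    rw [ι_compObjMap, id_app, id_app, id_tensorHom_id, Category.id_comp, Category.comp_id]
  exact h

lemma compMap_comp {G G' G'' : VProf V D E} {F F' F'' : VProf V C D} (g : G ⟶ G') (g' : G' ⟶ G'')
    (f : F ⟶ F') (f' : F' ⟶ F'') :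
    compMap (g ≫ g') (f ≫ f') = compMap g f ≫ compMap g' f' := by
  ext e c
  have h : compObjMap (g ≫ g') (f ≫ f') e c = compObjMap g f e c ≫ compObjMap g' f' e c := by
    apply compObj_ext
    intro d
    rw [ι_compObjMap, comp_app, comp_app, ι_compObjMap_assoc, ι_compObjMap,
      tensorHom_comp_tensorHom_assoc]
  exact h

/-- Contraction of a companion: `∫^d F(e, d) ⊗ D(d, H c) ⟶ F(e, H c)`, given by the action of `D`. -/
def contract (F : VProf V D E) (H : EnrichedFunctor V C D) (e : E) (c : C) :
    compObj F (companion H) e c ⟶ F.obj e (H.obj c) :=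
  compDesc (fun d => F.post e d (H.obj c)) (fun d d' => (F.post_comp e d d' (H.obj c)).symm)

end VProf
end CompMap

/-! ### Composition of hom objects along the action -/

section ActionMaps

variable (V : Type u) [Category.{v} V] [MonoidalCategory V] [SymmetricCategory V]

/-- Insertion of an identity on the left. -/
def idLeft {C : Type v} [EnrichedCategory V C] (c : C) (A : V) : A ⟶ (c ⟶[V] c) ⊗ A :=
  (λ_ A).inv ≫ eId V c ▷ A

/-- Insertion of an identity on the right. -/
def idRight {C : Type v} [EnrichedCategory V C] (A : V) (c : C) : A ⟶ A ⊗ (c ⟶[V] c) :=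
  (ρ_ A).inv ≫ A ◁ eId V c

variable {C : Type v} [Category.{v} C] [MonoidalCategory C] [EnrichedOrdinaryCategory V C]
  [MonoidalEnriched V C] {N : Type v} [Category.{v} N] [EnrichedOrdinaryCategory V N]
  [MonoidalLeftAction C N] [ModuleEnriched V C N]

/-- The action of an object `x` of `C` on hom objects, `N(n, n') ⟶ N(x ⊙ n, x ⊙ n')`. -/
def actL (x : C) (n n' : N) : (n ⟶[V] n') ⟶ ((x ⊙ₗ n) ⟶[V] (x ⊙ₗ n')) :=
  idLeft V x (n ⟶[V] n') ≫ ModuleEnriched.actE x x n n'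

/-- `N(n, x ⊙ n₁) ⊗ N(n₁, y ⊙ n₂) ⟶ N(n, (x ⊗ y) ⊙ n₂)`: act by `x`, compose, and use the inverse
of the associativity isomorphism of the module. -/
def actComp (x y : C) (n n₁ n₂ : N) :
    (n ⟶[V] (x ⊙ₗ n₁)) ⊗ (n₁ ⟶[V] (y ⊙ₗ n₂)) ⟶ (n ⟶[V] ((x ⊗ y) ⊙ₗ n₂)) :=
  _ ◁ actL V x n₁ (y ⊙ₗ n₂) ≫ eComp V n (x ⊙ₗ n₁) (x ⊙ₗ (y ⊙ₗ n₂)) ≫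
    eHomWhiskerLeft V n (αₗ x y n₂).inv

/-- `N(y ⊙ n₂, n₁) ⊗ N(x ⊙ n₁, n) ⟶ N((x ⊗ y) ⊙ n₂, n)`: act by `x`, compose, and use the
associativity isomorphism of the module. -/
def coactComp (x y : C) (n n₁ n₂ : N) :
    ((y ⊙ₗ n₂) ⟶[V] n₁) ⊗ ((x ⊙ₗ n₁) ⟶[V] n) ⟶ (((x ⊗ y) ⊙ₗ n₂) ⟶[V] n) :=
  actL V x (y ⊙ₗ n₂) n₁ ▷ _ ≫ eComp V (x ⊙ₗ (y ⊙ₗ n₂)) (x ⊙ₗ n₁) n ≫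
    eHomWhiskerRight V (αₗ x y n₂).hom n

end ActionMaps

open VProf

/-! ### Lax module profunctors -/

section Lax

set_option linter.unusedSectionVars false

variable (V : Type u) [Category.{v} V] [MonoidalCategory V] [SymmetricCategory V]
  [MonoidalClosed V] [HasColimits V]
  (C : Type v) [Category.{v} C] [MonoidalCategory C] [EnrichedOrdinaryCategory V C]
  [MonoidalEnriched V C]
  (M : Type v) [Category.{v} M] [EnrichedOrdinaryCategory V M] [MonoidalLeftAction C M]
  [ModuleEnriched V C M]
  (N : Type v) [Category.{v} N] [EnrichedOrdinaryCategory V N] [MonoidalLeftAction C N]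
  [ModuleEnriched V C N]

variable {V M N} in
/-- The domain `(⊙_N)_* • (Id_C ⊗ F)` of a lax module structure on `F`. -/
abbrev laxDom (F : VProf V M N) : VProf V (C × M) N :=
  comp (companion (actFunctor V C N)) (tens (idProf V C) F)

variable {V M N} in
/-- The codomain `F • (⊙_M)_*` of a lax module structure on `F`. -/
abbrev laxCod (F : VProf V M N) : VProf V (C × M) N :=
  comp F (companion (actFunctor V C M))

variable {V M N} in
/-- Functoriality of the domain. -/
def laxDomMap {F G : VProf V M N} (f : F ⟶ G) : laxDom C F ⟶ laxDom C G :=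
  compMap (𝟙 _) (tensMap (𝟙 _) f)

variable {V M N} in
/-- Functoriality of the codomain. -/
def laxCodMap {F G : VProf V M N} (f : F ⟶ G) : laxCod C F ⟶ laxCod C G :=
  compMap f (𝟙 _)

lemma laxDomMap_id (F : VProf V M N) : laxDomMap C (𝟙 F) = 𝟙 _ := by
  rw [laxDomMap, tensMap_id, compMap_id]

lemma laxCodMap_id (F : VProf V M N) : laxCodMap C (𝟙 F) = 𝟙 _ := by
  rw [laxCodMap, compMap_id]

lemma laxDomMap_comp {F G H : VProf V M N} (f : F ⟶ G) (g : G ⟶ H) :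
    laxDomMap C (f ≫ g) = laxDomMap C f ≫ laxDomMap C g := by
  rw [laxDomMap, laxDomMap, laxDomMap, ← compMap_comp, ← tensMap_comp, Category.id_comp,
    Category.id_comp]

lemma laxCodMap_comp {F G H : VProf V M N} (f : F ⟶ G) (g : G ⟶ H) :
    laxCodMap C (f ≫ g) = laxCodMap C f ≫ laxCodMap C g := by
  rw [laxCodMap, laxCodMap, laxCodMap, ← compMap_comp, Category.id_comp]

variable {V C M N} in
/-- The components `N(n, x ⊙ n₁) ⊗ F(n₁, m) ⟶ F(n, x ⊙ m)` of a lax module structure: insert the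
identity of `x`, apply the structure, and contract the companion of the action. These determine
the structure, as the domain is the coend of `N(n, x' ⊙ n₁) ⊗ (C(x', x) ⊗ F(n₁, m))`. -/
def laxComponent {F : VProf V M N} (β : laxDom C F ⟶ laxCod C F) (x : C) (n n₁ : N) (m : M) :
    (n ⟶[V] (x ⊙ₗ n₁)) ⊗ F.obj n₁ m ⟶ F.obj n (x ⊙ₗ m) :=
  (_ ◁ idLeft V x (F.obj n₁ m)) ≫
    ι (companion (actFunctor V C N)) (tens (idProf V C) F) n (x, n₁) (x, m) ≫
    β.app n (x, m) ≫ contract F (actFunctor V C M) n (x, m)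

/-- A lax `C`-module profunctor `M ⇸ N`. -/
structure LaxMod where
  prof : VProf V M N
  β : laxDom C prof ⟶ laxCod C prof
  assoc (x y : C) (n n₁ n₂ : N) (m : M) :
    (n ⟶[V] (x ⊙ₗ n₁)) ◁ laxComponent β y n₁ n₂ m ≫ laxComponent β x n n₁ (y ⊙ₗ m) ≫
        prof.mapRight n (αₗ x y m).inv =
      (α_ _ _ _).inv ≫ actComp V x y n n₁ n₂ ▷ prof.obj n₂ m ≫ laxComponent β (x ⊗ y) n n₂ m
  unit (n n₁ : N) (m : M) :
    laxComponent β (𝟙_ C) n n₁ m ≫ prof.mapRight n (λₗ m).hom =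
      eHomWhiskerLeft V n (λₗ n₁).hom ▷ prof.obj n₁ m ≫ prof.pre n n₁ m

namespace LaxMod

variable {V C M N}

/-- The components of the structure. -/
def component (X : LaxMod V C M N) (x : C) (n n₁ : N) (m : M) :
    (n ⟶[V] (x ⊙ₗ n₁)) ⊗ X.prof.obj n₁ m ⟶ X.prof.obj n (x ⊙ₗ m) :=
  laxComponent X.β x n n₁ m

/-- A morphism of lax module profunctors. -/
@[ext]
structure Hom (X Y : LaxMod V C M N) where
  hom : X.prof ⟶ Y.prof
  comm : X.β ≫ laxCodMap C hom = laxDomMap C hom ≫ Y.β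

instance : Category (LaxMod V C M N) where
  Hom := Hom
  id X := ⟨𝟙 _, by rw [laxCodMap_id, laxDomMap_id, Category.comp_id, Category.id_comp]⟩
  comp f g := ⟨f.hom ≫ g.hom, by
    rw [laxCodMap_comp, laxDomMap_comp, ← Category.assoc, f.comm, Category.assoc, g.comm,
      Category.assoc]⟩
  id_comp f := Hom.ext (Category.id_comp _)
  comp_id f := Hom.ext (Category.comp_id _)
  assoc f g h := Hom.ext (Category.assoc _ _ _)

variable (V C M N) in
/-- The underlying profunctor. -/
def forget : LaxMod V C M N ⥤ VProf V M N where
  obj X := X.prof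
  map f := f.hom
  map_id _ := rfl
  map_comp _ _ := rfl

end LaxMod

/-! ### Modules over the monad of pro-tensors -/

variable {V M N} in
/-- The profunctor `Ω(F) = (⊙_N)_* • (Id_C ⊗ F) • (⊙_M)^*`. -/
abbrev omega (F : VProf V M N) : VProf V M N :=
  comp (companion (actFunctor V C N))
    (comp (tens (idProf V C) F) (conjoint (actFunctor V C M)))

variable {V M N} in
/-- Functoriality of `Ω`. -/
def omegaMap {F G : VProf V M N} (f : F ⟶ G) : omega C F ⟶ omega C G :=
  compMap (𝟙 _) (compMap (tensMap (𝟙 _) f) (𝟙 _))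

lemma omegaMap_id (F : VProf V M N) : omegaMap C (𝟙 F) = 𝟙 _ := by
  rw [omegaMap, tensMap_id, compMap_id, compMap_id]

lemma omegaMap_comp {F G H : VProf V M N} (f : F ⟶ G) (g : G ⟶ H) :
    omegaMap C (f ≫ g) = omegaMap C f ≫ omegaMap C g := by
  rw [omegaMap, omegaMap, omegaMap, ← compMap_comp, ← compMap_comp, ← tensMap_comp,
    Category.id_comp, Category.id_comp, Category.id_comp]

variable {V C M N} in
/-- The coprojections `N(n, x ⊙ n₁) ⊗ (F(n₁, m₁) ⊗ M(x ⊙ m₁, m)) ⟶ Ω(F)(n, m)`, with the identity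
of `x` inserted. They are jointly epimorphic. -/
def omegaι (F : VProf V M N) (x : C) (n n₁ : N) (m₁ m : M) :
    (n ⟶[V] (x ⊙ₗ n₁)) ⊗ (F.obj n₁ m₁ ⊗ ((x ⊙ₗ m₁) ⟶[V] m)) ⟶ (omega C F).obj n m :=
  _ ◁ (idLeft V x (F.obj n₁ m₁) ▷ _ ≫
      ι (tens (idProf V C) F) (conjoint (actFunctor V C M)) (x, n₁) (x, m₁) m) ≫
    ι (companion (actFunctor V C N))
      (comp (tens (idProf V C) F) (conjoint (actFunctor V C M))) n (x, n₁) m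

variable {V C M N} in
/-- The components of an action `Ω(F) ⟶ F`. -/
def omegaComponent {F : VProf V M N} (κ : omega C F ⟶ F) (x : C) (n n₁ : N) (m₁ m : M) :
    (n ⟶[V] (x ⊙ₗ n₁)) ⊗ (F.obj n₁ m₁ ⊗ ((x ⊙ₗ m₁) ⟶[V] m)) ⟶ F.obj n m :=
  omegaι F x n n₁ m₁ m ≫ κ.app n m

/-- A module over the monad `Ω` on profunctors `M ⇸ N`. The multiplication of `Ω` uses the
associativity isomorphisms of `N` and of `M` and the tensor product of `C`, and its unit uses the
unit isomorphisms of `N` and of `M`; the axioms are stated on the jointly epimorphic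
coprojections. -/
structure OmegaMod where
  prof : VProf V M N
  κ : omega C prof ⟶ prof
  assoc (x y : C) (n n₁ n₂ : N) (m₂ m₁ m : M) :
    (n ⟶[V] (x ⊙ₗ n₁)) ◁ (omegaComponent κ y n₁ n₂ m₂ m₁ ▷ ((x ⊙ₗ m₁) ⟶[V] m)) ≫
        omegaComponent κ x n n₁ m₁ m =
      _ ◁ (α_ _ _ _).hom ≫ (α_ _ _ _).inv ≫
        (actComp V x y n n₁ n₂ ⊗ₘ
          ((α_ _ _ _).hom ≫ prof.obj n₂ m₂ ◁ coactComp V x y m m₁ m₂)) ≫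
        omegaComponent κ (x ⊗ y) n n₂ m₂ m
  unit (n : N) (m : M) :
    (λ_ _).inv ≫ (eHomEquiv V (λₗ n).inv ⊗ₘ
        ((ρ_ _).inv ≫ prof.obj n m ◁ eHomEquiv V (λₗ m).hom)) ≫
      omegaComponent κ (𝟙_ C) n n m m = 𝟙 _

namespace OmegaMod

variable {V C M N}

/-- The components of the action. -/
def component (X : OmegaMod V C M N) (x : C) (n n₁ : N) (m₁ m : M) :
    (n ⟶[V] (x ⊙ₗ n₁)) ⊗ (X.prof.obj n₁ m₁ ⊗ ((x ⊙ₗ m₁) ⟶[V] m)) ⟶ X.prof.obj n m :=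
  omegaComponent X.κ x n n₁ m₁ m

/-- A morphism of `Ω`-modules. -/
@[ext]
structure Hom (X Y : OmegaMod V C M N) where
  hom : X.prof ⟶ Y.prof
  comm : X.κ ≫ hom = omegaMap C hom ≫ Y.κ

instance : Category (OmegaMod V C M N) where
  Hom := Hom
  id X := ⟨𝟙 _, by rw [omegaMap_id, Category.comp_id, Category.id_comp]⟩
  comp f g := ⟨f.hom ≫ g.hom, by
    rw [omegaMap_comp, ← Category.assoc, f.comm, Category.assoc, g.comm, Category.assoc]⟩
  id_comp f := Hom.ext (Category.id_comp _)
  comp_id f := Hom.ext (Category.comp_id _)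
  assoc f g h := Hom.ext (Category.assoc _ _ _)

variable (V C M N) in
/-- The underlying profunctor. -/
def forget : OmegaMod V C M N ⥤ VProf V M N where
  obj X := X.prof
  map f := f.hom
  map_id _ := rfl
  map_comp _ _ := rfl

end OmegaMod

/-! ### Modules over the probimonad -/

/-- The profunctor `H : Mᵒᵖ ⊗ N ⇸ Mᵒᵖ ⊗ N`,
`H((m₁, n₁), (m₂, n₂)) = ∫^x N(n₁, x ⊙ n₂) ⊗ M(x ⊙ m₂, m₁)`, as a composite along `Mᵒᵖ ⊗ C ⊗ N`. -/
def hProf : VProf V (Mᵒᵖ × N) (Mᵒᵖ × N) :=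
  comp
    ((tens (idProf V Mᵒᵖ) (companion (actFunctor V C N))).restrict
      (EnrichedFunctor.id V (Mᵒᵖ × N)) (assocFunctor V Mᵒᵖ C N))
    (tens (bend (conjoint (actFunctor V C M))) (idProf V N))

variable {C M N} in
/-- The summand `M(x ⊙ a₁, b₁) ⊗ N(b₂, x ⊙ a₂)` of `H(b, a)`. -/
abbrev hSummand (x : C) (b a : Mᵒᵖ × N) : V :=
  ((x ⊙ₗ a.1.unop) ⟶[V] b.1.unop) ⊗ (b.2 ⟶[V] (x ⊙ₗ a.2))

variable {V C M N} in
/-- The coprojections of `H`, with identities inserted. They are jointly epimorphic. -/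
def hι (x : C) (b a : Mᵒᵖ × N) : hSummand V x b a ⟶ (hProf V C M N).obj b a :=
  (β_ _ _).hom ≫ (idLeft V b.1 (b.2 ⟶[V] (x ⊙ₗ a.2)) ⊗ₘ
      idRight V ((x ⊙ₗ a.1.unop) ⟶[V] b.1.unop) a.2) ≫
    ι ((tens (idProf V Mᵒᵖ) (companion (actFunctor V C N))).restrict
        (EnrichedFunctor.id V (Mᵒᵖ × N)) (assocFunctor V Mᵒᵖ C N))
      (tens (bend (conjoint (actFunctor V C M))) (idProf V N)) b ((b.1, x), a.2) a

variable {V C M N} in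
/-- The multiplication of `H` on coprojections. -/
def hMul (x y : C) (c b a : Mᵒᵖ × N) :
    (hSummand V x c b ⊗ hSummand V y b a : V) ⟶ hSummand V (x ⊗ y) c a :=
  tensorμ _ _ _ _ ≫
    (((β_ _ _).hom ≫ coactComp V x y c.1.unop b.1.unop a.1.unop) ⊗ₘ actComp V x y c.2 b.2 a.2)

variable {V M N} in
/-- The unit of `H`. -/
def hUnit (b : Mᵒᵖ × N) : 𝟙_ V ⟶ hSummand V (𝟙_ C) b b :=
  (λ_ _).inv ≫ (eHomEquiv V (λₗ b.1.unop).hom ⊗ₘ eHomEquiv V (λₗ b.2).inv)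

variable {V C M N} in
/-- The components of an action `H • P ⟶ P`. -/
def hComponent {P : VProf V PUnit.{v + 1} (Mᵒᵖ × N)} (κ : comp (hProf V C M N) P ⟶ P) (x : C)
    (b a : Mᵒᵖ × N) :
    hSummand V x b a ⊗ P.obj a PUnit.unit ⟶ P.obj b PUnit.unit :=
  hι x b a ▷ _ ≫ ι (hProf V C M N) P b a PUnit.unit ≫ κ.app b PUnit.unit

/-- A left module `* ⇸ Mᵒᵖ ⊗ N` over the promonad `H`; the axioms are stated on the jointly
epimorphic coprojections. -/
structure HMod where
  prof : VProf V PUnit.{v + 1} (Mᵒᵖ × N)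
  κ : comp (hProf V C M N) prof ⟶ prof
  assoc (x y : C) (c b a : Mᵒᵖ × N) :
    hSummand V x c b ◁ hComponent κ y b a ≫ hComponent κ x c b =
      (α_ _ _ _).inv ≫ hMul x y c b a ▷ prof.obj a PUnit.unit ≫ hComponent κ (x ⊗ y) c a
  unit (b : Mᵒᵖ × N) :
    (λ_ _).inv ≫ hUnit C b ▷ prof.obj b PUnit.unit ≫ hComponent κ (𝟙_ C) b b = 𝟙 _

namespace HMod

variable {V C M N}

/-- The components of the action. -/
def component (X : HMod V C M N) (x : C) (b a : Mᵒᵖ × N) :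
    hSummand V x b a ⊗ X.prof.obj a PUnit.unit ⟶ X.prof.obj b PUnit.unit :=
  hComponent X.κ x b a

/-- A morphism of modules over `H`. -/
@[ext]
structure Hom (X Y : HMod V C M N) where
  hom : X.prof ⟶ Y.prof
  comm : X.κ ≫ hom = compMap (𝟙 _) hom ≫ Y.κ

instance : Category (HMod V C M N) where
  Hom := Hom
  id X := ⟨𝟙 _, by rw [compMap_id, Category.comp_id, Category.id_comp]⟩
  comp f g := ⟨f.hom ≫ g.hom, by
    rw [← Category.id_comp (𝟙 (hProf V C M N)), compMap_comp, ← Category.assoc, f.comm,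
      Category.assoc, g.comm, Category.assoc]⟩
  id_comp f := Hom.ext (Category.id_comp _)
  comp_id f := Hom.ext (Category.comp_id _)
  assoc f g h := Hom.ext (Category.assoc _ _ _)

variable (V C M N) in
/-- The underlying profunctor. -/
def forget : HMod V C M N ⥤ VProf V PUnit.{v + 1} (Mᵒᵖ × N) where
  obj X := X.prof
  map f := f.hom
  map_id _ := rfl
  map_comp _ _ := rfl

end HMod

end Lax

/-! ### The convolution of modules over the probimonad -/

section Convolution

set_option linter.unusedSectionVars false

variable (V : Type u) [Category.{v} V] [MonoidalCategory V] [SymmetricCategory V]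
  (M : Type v) [Category.{v} M] [EnrichedOrdinaryCategory V M]

/-- The profunctor `(Mᵒᵖ ⊗ M) ⊗ (Mᵒᵖ ⊗ M) ⇸ Mᵒᵖ ⊗ M` that joins the two inner legs,
`(m, (a, b)) ↦ (M(a₁, m₁) ⊗ M(b₁, a₂)) ⊗ M(m₂, b₂)`. -/
def mulProf : VProf V ((Mᵒᵖ × M) × (Mᵒᵖ × M)) (Mᵒᵖ × M) :=
  (tens (tens (idProf V Mᵒᵖ) (coev V M)) (idProf V M)).restrict
    (prodFunctor V (unitInvFunctor V Mᵒᵖ) (EnrichedFunctor.id V M))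
    (EnrichedFunctor.comp V (assocInvFunctor V (Mᵒᵖ × M) Mᵒᵖ M)
      (prodFunctor V (assocFunctor V Mᵒᵖ M Mᵒᵖ) (EnrichedFunctor.id V M)))

variable {V M}
variable [MonoidalClosed V] [HasColimits V]

/-- The composite of the multiplication profunctor with `P ⊗ Q`. -/
def conv (P Q : VProf V PUnit.{v + 1} (Mᵒᵖ × M)) : VProf V PUnit.{v + 1} (Mᵒᵖ × M) :=
  comp (mulProf V M)
    ((tens P Q).restrict (EnrichedFunctor.id V ((Mᵒᵖ × M) × (Mᵒᵖ × M)))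
      (unitInvFunctor V PUnit.{v + 1}))

/-- The coprojections `P(m₁, k) ⊗ Q(k, m₂) ⟶ (P ⊛ Q)(m₁, m₂)`, with three identities inserted.
They are jointly epimorphic. -/
def convι (P Q : VProf V PUnit.{v + 1} (Mᵒᵖ × M)) (m : Mᵒᵖ × M) (k : M) :
    P.obj (m.1, k) PUnit.unit ⊗ Q.obj (Opposite.op k, m.2) PUnit.unit ⟶
      (conv P Q).obj m PUnit.unit :=
  (λ_ _).inv ≫
    ((λ_ (𝟙_ V)).inv ≫ (((λ_ (𝟙_ V)).inv ≫ (eId V m.1 ⊗ₘ eId V k)) ⊗ₘ eId V m.2)) ▷ _ ≫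
    ι (mulProf V M)
      ((tens P Q).restrict (EnrichedFunctor.id V ((Mᵒᵖ × M) × (Mᵒᵖ × M)))
        (unitInvFunctor V PUnit.{v + 1})) m ((m.1, k), (Opposite.op k, m.2)) PUnit.unit

end Convolution

/-! ### The three monoidal structures

Each of the following structures says that a given monoidal structure is the one of the theory:
its tensor product and its unit are carried by the prescribed profunctors with the prescribed
actions, and its associator and unitors are the ones of the composition of profunctors. All
conditions are stated on jointly epimorphic coprojections, and they determine the monoidal
structure up to a unique isomorphism over the underlying profunctors. -/

section Specs

set_option linter.unusedSectionVars false

variable {V : Type u} [Category.{v} V] [MonoidalCategory V] [SymmetricCategory V]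
  [MonoidalClosed V] [HasColimits V]

section CompositionTensor

variable {M : Type v} [Category.{v} M] [EnrichedOrdinaryCategory V M]

/-- The maps `U X(n, k) ⊗ U Y(k, m) ⟶ (U X • U Y)(n, m) ≅ U (X ⊗ Y)(n, m)`. -/
def compositionJ {T : Type*} [Category* T] [MonoidalCategory T] (U : T ⥤ VProf V M M) {X Y : T}
    (t : U.obj (X ⊗ Y) ≅ comp (U.obj X) (U.obj Y)) (n k m : M) :
    (U.obj X).obj n k ⊗ (U.obj Y).obj k m ⟶ (U.obj (X ⊗ Y)).obj n m :=
  ι (U.obj X) (U.obj Y) n k m ≫ t.inv.app n m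

/-- The maps `M(n, m) ⟶ U 𝟙 (n, m)`. -/
def compositionU {T : Type*} [Category* T] [MonoidalCategory T] (U : T ⥤ VProf V M M)
    (t : U.obj (𝟙_ T) ≅ idProf V M) (n m : M) : (n ⟶[V] m) ⟶ (U.obj (𝟙_ T)).obj n m :=
  t.inv.app n m

/-- The monoidal structure of `T` lies over the composition of profunctors `M ⇸ M`: the functor `U`
is strong monoidal, with the composition `•` of profunctors as tensor product and the identity
profunctor as unit. -/
structure CompositionTensor {T : Type*} [Category* T] [MonoidalCategory T]
    (U : T ⥤ VProf V M M) where
  tensorIso (X Y : T) : U.obj (X ⊗ Y) ≅ comp (U.obj X) (U.obj Y)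
  unitIso : U.obj (𝟙_ T) ≅ idProf V M
  natural {X X' Y Y' : T} (f : X ⟶ X') (g : Y ⟶ Y') (n k m : M) :
    ((U.map f).app n k ⊗ₘ (U.map g).app k m) ≫ compositionJ U (tensorIso X' Y') n k m =
      compositionJ U (tensorIso X Y) n k m ≫ (U.map (f ⊗ₘ g)).app n m
  associativity (X Y Z : T) (n k l m : M) :
    compositionJ U (tensorIso X Y) n k l ▷ (U.obj Z).obj l m ≫
        compositionJ U (tensorIso (X ⊗ Y) Z) n l m ≫ (U.map (α_ X Y Z).hom).app n m =
      (α_ _ _ _).hom ≫ (U.obj X).obj n k ◁ compositionJ U (tensorIso Y Z) k l m ≫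
        compositionJ U (tensorIso X (Y ⊗ Z)) n k m
  left_unit (X : T) (n k m : M) :
    compositionU U unitIso n k ▷ (U.obj X).obj k m ≫ compositionJ U (tensorIso (𝟙_ T) X) n k m ≫
        (U.map (λ_ X).hom).app n m =
      (U.obj X).pre n k m
  right_unit (X : T) (n k m : M) :
    (U.obj X).obj n k ◁ compositionU U unitIso k m ≫ compositionJ U (tensorIso X (𝟙_ T)) n k m ≫
        (U.map (ρ_ X).hom).app n m =
      (U.obj X).post n k m

variable {T : Type*} [Category* T] [MonoidalCategory T] {U : T ⥤ VProf V M M}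

/-- The coprojections of a tensor product. -/
abbrev CompositionTensor.j (S : CompositionTensor U) (X Y : T) (n k m : M) :
    (U.obj X).obj n k ⊗ (U.obj Y).obj k m ⟶ (U.obj (X ⊗ Y)).obj n m :=
  compositionJ U (S.tensorIso X Y) n k m

/-- The identification of the unit. -/
abbrev CompositionTensor.u (S : CompositionTensor U) (n m : M) :
    (n ⟶[V] m) ⟶ (U.obj (𝟙_ T)).obj n m :=
  compositionU U S.unitIso n m

end CompositionTensor

variable (V)
variable (C : Type v) [Category.{v} C] [MonoidalCategory C] [EnrichedOrdinaryCategory V C]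
  [MonoidalEnriched V C]
  (M : Type v) [Category.{v} M] [EnrichedOrdinaryCategory V M] [MonoidalLeftAction C M]
  [ModuleEnriched V C M]

/-- The monoidal structure on lax module profunctors given by composition: the lax structure of
`X ⊗ Y` is the lax structure of `X` followed by that of `Y`, and the unit is the identity
profunctor with the structure given by the action. -/
structure LaxTensorSpec [MonoidalCategory (LaxMod V C M M)] where
  toComposition : CompositionTensor (LaxMod.forget V C M M)
  tensor_component (X Y : LaxMod V C M M) (x : C) (n n₁ k m : M) :
    (n ⟶[V] (x ⊙ₗ n₁)) ◁ toComposition.j X Y n₁ k m ≫ (X ⊗ Y).component x n n₁ m =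
      (α_ _ _ _).inv ≫ X.component x n n₁ k ▷ Y.prof.obj k m ≫
        X.prof.obj n (x ⊙ₗ k) ◁ (idLeft V (x ⊙ₗ k) (Y.prof.obj k m) ≫
          Y.component x (x ⊙ₗ k) k m) ≫
        toComposition.j X Y n (x ⊙ₗ k) (x ⊙ₗ m)
  unit_component (x : C) (n n₁ m : M) :
    (n ⟶[V] (x ⊙ₗ n₁)) ◁ toComposition.u n₁ m ≫
        (𝟙_ (LaxMod V C M M)).component x n n₁ m =
      (n ⟶[V] (x ⊙ₗ n₁)) ◁ actL V x n₁ m ≫ eComp V n (x ⊙ₗ n₁) (x ⊙ₗ m) ≫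
        toComposition.u n (x ⊙ₗ m)

/-- The monoidal structure on `Ω`-modules given by contracting the underlying profunctors: the
action on `X ⊗ Y` inserts an identity of `x ⊙ k` between the two factors and acts on both of them,
and the unit is the identity profunctor with the action given by that of `C`. -/
structure OmegaTensorSpec [MonoidalCategory (OmegaMod V C M M)] where
  toComposition : CompositionTensor (OmegaMod.forget V C M M)
  tensor_component (X Y : OmegaMod V C M M) (x : C) (n n₁ k m₁ m : M) :
    (n ⟶[V] (x ⊙ₗ n₁)) ◁ (toComposition.j X Y n₁ k m₁ ▷ ((x ⊙ₗ m₁) ⟶[V] m)) ≫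
        (X ⊗ Y).component x n n₁ m₁ m =
      (n ⟶[V] (x ⊙ₗ n₁)) ◁
          (α_ (X.prof.obj n₁ k) (Y.prof.obj k m₁) ((x ⊙ₗ m₁) ⟶[V] m)).hom ≫
        (α_ _ _ _).inv ≫
        (((n ⟶[V] (x ⊙ₗ n₁)) ◁ idRight V (X.prof.obj n₁ k) (x ⊙ₗ k) ≫
            X.component x n n₁ k (x ⊙ₗ k)) ⊗ₘ
          (idLeft V (x ⊙ₗ k) (Y.prof.obj k m₁ ⊗ ((x ⊙ₗ m₁) ⟶[V] m)) ≫
            Y.component x (x ⊙ₗ k) k m₁ m)) ≫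
        toComposition.j X Y n (x ⊙ₗ k) m
  unit_component (x : C) (n n₁ m₁ m : M) :
    (n ⟶[V] (x ⊙ₗ n₁)) ◁ (toComposition.u n₁ m₁ ▷ ((x ⊙ₗ m₁) ⟶[V] m)) ≫
        (𝟙_ (OmegaMod V C M M)).component x n n₁ m₁ m =
      (n ⟶[V] (x ⊙ₗ n₁)) ◁ (actL V x n₁ m₁ ▷ ((x ⊙ₗ m₁) ⟶[V] m) ≫
          eComp V (x ⊙ₗ n₁) (x ⊙ₗ m₁) m) ≫
        eComp V n (x ⊙ₗ n₁) m ≫ toComposition.u n m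

variable {V C M}

/-- The maps `Y(m₁, k) ⊗ X(k, m₂) ⟶ (Y ⊛ X)(m₁, m₂) ≅ (X ⊗ Y)(m₁, m₂)`. -/
def convolutionJ [MonoidalCategory (HMod V C M M)] {X Y : HMod V C M M}
    (t : (X ⊗ Y).prof ≅ conv Y.prof X.prof) (m : Mᵒᵖ × M) (k : M) :
    Y.prof.obj (m.1, k) PUnit.unit ⊗ X.prof.obj (Opposite.op k, m.2) PUnit.unit ⟶
      (X ⊗ Y).prof.obj m PUnit.unit :=
  convι Y.prof X.prof m k ≫ t.inv.app m PUnit.unit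

/-- The maps `M(m₂, m₁) ⟶ 𝟙 (m₁, m₂)`. -/
def convolutionU [MonoidalCategory (HMod V C M M)]
    (t : (𝟙_ (HMod V C M M)).prof ≅ heart (idProf V M)) (m : Mᵒᵖ × M) :
    (m.2 ⟶[V] m.1.unop) ⟶ (𝟙_ (HMod V C M M)).prof.obj m PUnit.unit :=
  t.inv.app m PUnit.unit

variable (V C M)

/-- The monoidal structure on modules over `H` coming from the probimonad structure of `H`: the
tensor product is the composite of the multiplication profunctor with the tensor product of the
two modules (with the second module fed into the first slot), the unit is the transpose of the
identity profunctor, and `H` acts on both factors through its comultiplication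
`hSummand x m' m ⟶ H((m'₁, x ⊙ k), (m₁, k)) ⊗ H((x ⊙ k, m'₂), (k, m₂))`, which inserts identities
of `x ⊙ k`. -/
structure HTensorSpec [MonoidalCategory (HMod V C M M)] where
  tensorIso (X Y : HMod V C M M) : (X ⊗ Y).prof ≅ conv Y.prof X.prof
  unitIso : (𝟙_ (HMod V C M M)).prof ≅ heart (idProf V M)
  natural {X X' Y Y' : HMod V C M M} (f : X ⟶ X') (g : Y ⟶ Y') (m : Mᵒᵖ × M) (k : M) :
    (((HMod.forget V C M M).map g).app (m.1, k) PUnit.unit ⊗ₘ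
        ((HMod.forget V C M M).map f).app (Opposite.op k, m.2) PUnit.unit) ≫
        convolutionJ (tensorIso X' Y') m k =
      convolutionJ (tensorIso X Y) m k ≫
        ((HMod.forget V C M M).map (f ⊗ₘ g)).app m PUnit.unit
  associativity (X Y Z : HMod V C M M) (m : Mᵒᵖ × M) (k l : M) :
    Z.prof.obj (m.1, l) PUnit.unit ◁ convolutionJ (tensorIso X Y) (Opposite.op l, m.2) k ≫
        convolutionJ (tensorIso (X ⊗ Y) Z) m l ≫
        ((HMod.forget V C M M).map (α_ X Y Z).hom).app m PUnit.unit =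
      (α_ _ _ _).inv ≫
        convolutionJ (tensorIso Y Z) (m.1, k) l ▷ X.prof.obj (Opposite.op k, m.2) PUnit.unit ≫
        convolutionJ (tensorIso X (Y ⊗ Z)) m k
  left_unit (X : HMod V C M M) (m : Mᵒᵖ × M) (k : M) :
    X.prof.obj (m.1, k) PUnit.unit ◁ convolutionU unitIso (Opposite.op k, m.2) ≫
        convolutionJ (tensorIso (𝟙_ _) X) m k ≫
        ((HMod.forget V C M M).map (λ_ X).hom).app m PUnit.unit =
      (β_ _ _).hom ≫ X.prof.preSnd m.1 m.2 k PUnit.unit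
  right_unit (X : HMod V C M M) (m : Mᵒᵖ × M) (k : M) :
    convolutionU unitIso (m.1, k) ▷ X.prof.obj (Opposite.op k, m.2) PUnit.unit ≫
        convolutionJ (tensorIso X (𝟙_ _)) m k ≫
        ((HMod.forget V C M M).map (ρ_ X).hom).app m PUnit.unit =
      X.prof.preFst m.1 (Opposite.op k) m.2 PUnit.unit
  tensor_component (X Y : HMod V C M M) (x : C) (m' m : Mᵒᵖ × M) (k : M) :
    hSummand V x m' m ◁ convolutionJ (tensorIso X Y) m k ≫ (X ⊗ Y).component x m' m =
      tensorμ _ _ _ _ ≫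
        ((idRight V ((x ⊙ₗ m.1.unop) ⟶[V] m'.1.unop) (x ⊙ₗ k) ▷ _ ≫
            Y.component x (m'.1, x ⊙ₗ k) (m.1, k)) ⊗ₘ
          (idLeft V (x ⊙ₗ k) (m'.2 ⟶[V] (x ⊙ₗ m.2)) ▷ _ ≫
            X.component x (Opposite.op (x ⊙ₗ k), m'.2) (Opposite.op k, m.2))) ≫
        convolutionJ (tensorIso X Y) m' (x ⊙ₗ k)
  unit_component (x : C) (m' m : Mᵒᵖ × M) :
    hSummand V x m' m ◁ convolutionU unitIso m ≫ (𝟙_ (HMod V C M M)).component x m' m =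
      (α_ _ _ _).hom ≫
        ((x ⊙ₗ m.1.unop) ⟶[V] m'.1.unop) ◁ ((m'.2 ⟶[V] (x ⊙ₗ m.2)) ◁ actL V x m.2 m.1.unop ≫
          eComp V m'.2 (x ⊙ₗ m.2) (x ⊙ₗ m.1.unop)) ≫
        (β_ _ _).hom ≫ eComp V m'.2 (x ⊙ₗ m.1.unop) m'.1.unop ≫ convolutionU unitIso m'

variable {V C M}

/-- The coprojections of a tensor product. -/
abbrev HTensorSpec.j [MonoidalCategory (HMod V C M M)] (S : HTensorSpec V C M)
    (X Y : HMod V C M M) (m : Mᵒᵖ × M) (k : M) :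
    Y.prof.obj (m.1, k) PUnit.unit ⊗ X.prof.obj (Opposite.op k, m.2) PUnit.unit ⟶
      (X ⊗ Y).prof.obj m PUnit.unit :=
  convolutionJ (S.tensorIso X Y) m k

/-- The identification of the unit. -/
abbrev HTensorSpec.u [MonoidalCategory (HMod V C M M)] (S : HTensorSpec V C M) (m : Mᵒᵖ × M) :
    (m.2 ⟶[V] m.1.unop) ⟶ (𝟙_ (HMod V C M M)).prof.obj m PUnit.unit :=
  convolutionU S.unitIso m

/-! ### The canonical monoidal equivalences -/

/-- The canonical monoidal equivalence between lax module profunctors and `Ω`-modules: it keeps the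
underlying profunctor, it turns a lax structure into the action obtained by applying it and then
the action of the hom objects of `M`, and its monoidal structure is the canonical one over the
composition of profunctors. -/
structure LaxOmegaEquiv [MonoidalCategory (LaxMod V C M M)] [MonoidalCategory (OmegaMod V C M M)]
    (S₁ : LaxTensorSpec V C M) (S₂ : OmegaTensorSpec V C M) where
  equiv : LaxMod V C M M ≌ OmegaMod V C M M
  monoidal : equiv.functor.Monoidal
  underlying : equiv.functor ⋙ OmegaMod.forget V C M M ≅ LaxMod.forget V C M M
  action (X : LaxMod V C M M) (x : C) (n n₁ m₁ m : M) :
    (equiv.functor.obj X).component x n n₁ m₁ m ≫ (underlying.hom.app X).app n m =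
      (n ⟶[V] (x ⊙ₗ n₁)) ◁ ((underlying.hom.app X).app n₁ m₁ ▷ ((x ⊙ₗ m₁) ⟶[V] m)) ≫
        (α_ _ _ _).inv ≫ X.component x n n₁ m₁ ▷ ((x ⊙ₗ m₁) ⟶[V] m) ≫
        X.prof.post n (x ⊙ₗ m₁) m
  tensor_comparison (X Y : LaxMod V C M M) (n k m : M) :
    S₂.toComposition.j (equiv.functor.obj X) (equiv.functor.obj Y) n k m ≫
        ((OmegaMod.forget V C M M).map (Functor.LaxMonoidal.μ equiv.functor X Y)).app n m ≫
        (underlying.hom.app (X ⊗ Y)).app n m =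
      ((underlying.hom.app X).app n k ⊗ₘ (underlying.hom.app Y).app k m) ≫
        S₁.toComposition.j X Y n k m
  unit_comparison (n m : M) :
    S₂.toComposition.u n m ≫
        ((OmegaMod.forget V C M M).map (Functor.LaxMonoidal.ε equiv.functor)).app n m ≫
        (underlying.hom.app (𝟙_ (LaxMod V C M M))).app n m =
      S₁.toComposition.u n m

/-- The canonical monoidal equivalence between modules over `H` and `Ω`-modules: the underlying
profunctor of a module over `H` is the transpose of that of the `Ω`-module, the two actions
correspond to each other under the transposition, and so do the tensor products and the units. -/
structure HOmegaEquiv [MonoidalCategory (HMod V C M M)] [MonoidalCategory (OmegaMod V C M M)]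
    (S₃ : HTensorSpec V C M) (S₂ : OmegaTensorSpec V C M) where
  equiv : HMod V C M M ≌ OmegaMod V C M M
  monoidal : equiv.functor.Monoidal
  underlying : equiv.functor ⋙ OmegaMod.forget V C M M ⋙ heartFunctor V M M ≅
    HMod.forget V C M M
  action (P : HMod V C M M) (x : C) (n n₁ m₁ m : M) :
    (equiv.functor.obj P).component x n n₁ m₁ m ≫
        (underlying.hom.app P).app (Opposite.op m, n) PUnit.unit =
      (n ⟶[V] (x ⊙ₗ n₁)) ◁
          ((underlying.hom.app P).app (Opposite.op m₁, n₁) PUnit.unit ▷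
            ((x ⊙ₗ m₁) ⟶[V] m)) ≫
        (n ⟶[V] (x ⊙ₗ n₁)) ◁ (β_ _ _).hom ≫ (α_ _ _ _).inv ≫ (β_ _ _).hom ▷ _ ≫
        P.component x (Opposite.op m, n) (Opposite.op m₁, n₁)
  tensor_comparison (X Y : HMod V C M M) (n k m : M) :
    S₂.toComposition.j (equiv.functor.obj X) (equiv.functor.obj Y) n k m ≫
        ((OmegaMod.forget V C M M).map (Functor.LaxMonoidal.μ equiv.functor X Y)).app n m ≫
        (underlying.hom.app (X ⊗ Y)).app (Opposite.op m, n) PUnit.unit =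
      ((underlying.hom.app X).app (Opposite.op k, n) PUnit.unit ⊗ₘ
          (underlying.hom.app Y).app (Opposite.op m, k) PUnit.unit) ≫
        (β_ _ _).hom ≫ S₃.j X Y (Opposite.op m, n) k
  unit_comparison (n m : M) :
    S₂.toComposition.u n m ≫
        ((OmegaMod.forget V C M M).map (Functor.LaxMonoidal.ε equiv.functor)).app n m ≫
        (underlying.hom.app (𝟙_ (HMod V C M M))).app (Opposite.op m, n) PUnit.unit =
      S₃.u (Opposite.op m, n)

end Specs

end

end LaxModuleProf

namespace LaxModuleProf

attribute [reducible] actFunctor unitInvFunctor prodFunctor assocFunctor assocInvFunctor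
  insertLeft insertRight VProf.idProf VProf.companion VProf.conjoint VProf.restrict VProf.tens
  VProf.heart VProf.bend VProf.coev

noncomputable section

/-! ### The monoidal category of profunctors -/

namespace VProf

set_option linter.unusedSectionVars false

section General

variable {V : Type u} [Category.{v} V] [MonoidalCategory V] [SymmetricCategory V]
  {C : Type v} [EnrichedCategory V C] {D : Type v} [EnrichedCategory V D]

/-- An isomorphism of profunctors from componentwise isomorphisms. -/
@[simps]
def isoOfComponents {F G : VProf V C D} (f : F ⟶ G) (g : ∀ d c, G.obj d c ⟶ F.obj d c)
    (hfg : ∀ d c, f.app d c ≫ g d c = 𝟙 _) (hgf : ∀ d c, g d c ≫ f.app d c = 𝟙 _) : F ≅ G where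
  hom := f
  inv :=
    { app := g
      pre_app := by
        intro d d' c
        have h := f.pre_app d d' c
        calc _ = (d ⟶[V] d') ◁ (g d' c ≫ f.app d' c) ≫ G.pre d d' c ≫ g d c := by
              rw [hgf, MonoidalCategory.whiskerLeft_id, Category.id_comp]
          _ = _ := by
              rw [MonoidalCategory.whiskerLeft_comp, Category.assoc, ← reassoc_of% h, hfg,
                Category.comp_id]
      post_app := by
        intro d c c'
        have h := f.post_app d c c'
        calc _ = (g d c ≫ f.app d c) ▷ (c ⟶[V] c') ≫ G.post d c c' ≫ g d c' := by
              rw [hgf, id_whiskerRight, Category.id_comp]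
          _ = _ := by
              rw [comp_whiskerRight, Category.assoc, ← reassoc_of% h, hfg, Category.comp_id] }
  hom_inv_id := by ext d c; exact hfg d c
  inv_hom_id := by ext d c; exact hgf d c

lemma iso_hom_inv_app {F G : VProf V C D} (f : F ≅ G) (d : D) (c : C) :
    f.hom.app d c ≫ f.inv.app d c = 𝟙 _ := by
  rw [← comp_app, f.hom_inv_id, id_app]

lemma iso_inv_hom_app {F G : VProf V C D} (f : F ≅ G) (d : D) (c : C) :
    f.inv.app d c ≫ f.hom.app d c = 𝟙 _ := by
  rw [← comp_app, f.inv_hom_id, id_app]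

lemma idLeft_pre (F : VProf V C D) (d : D) (c : C) :
    idLeft V d (F.obj d c) ≫ F.pre d d c = 𝟙 _ := by
  rw [idLeft, Category.assoc, F.pre_id, Iso.inv_hom_id]

lemma idRight_post (F : VProf V C D) (d : D) (c : C) :
    idRight V (F.obj d c) c ≫ F.post d c c = 𝟙 _ := by
  rw [idRight, Category.assoc, F.post_id, Iso.inv_hom_id]

lemma idLeft_naturality (d : D) {A B : V} (f : A ⟶ B) :
    f ≫ idLeft V d B = idLeft V d A ≫ _ ◁ f := by
  rw [idLeft, idLeft, leftUnitor_inv_naturality_assoc, Category.assoc, whisker_exchange]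

lemma idRight_naturality (d : D) {A B : V} (f : A ⟶ B) :
    f ≫ idRight V B d = idRight V A d ≫ f ▷ _ := by
  rw [idRight, idRight, rightUnitor_inv_naturality_assoc, Category.assoc, whisker_exchange]

lemma idLeft_tensor (d : D) (A B : V) :
    idLeft V d (A ⊗ B) = idLeft V d A ▷ B ≫ (α_ _ _ _).hom := by
  simp [idLeft]

lemma idRight_tensor (d : D) (A B : V) :
    idRight V (A ⊗ B) d = A ◁ idRight V B d ≫ (α_ _ _ _).inv := by
  simp [idRight]

lemma idLeft_idRight (d : D) (A B : V) :
    A ◁ idLeft V d B = idRight V A d ▷ B ≫ (α_ _ _ _).hom := by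
  simp [idRight, idLeft]

end General

section Coends

variable {V : Type u} [Category.{v} V] [MonoidalCategory V] [SymmetricCategory V]
  [MonoidalClosed V] [HasColimits V]
  {A : Type v} [EnrichedCategory V A] {B : Type v} [EnrichedCategory V B]
  {C : Type v} [EnrichedCategory V C] {D : Type v} [EnrichedCategory V D]
  {E : Type v} [EnrichedCategory V E]

/-- The coprojections of a composite of profunctors. -/
def j (G : VProf V D E) (F : VProf V C D) (e : E) (d : D) (c : C) :
    G.obj e d ⊗ F.obj d c ⟶ (comp G F).obj e c :=
  ι G F e d c

section

variable (G : VProf V D E) (F : VProf V C D)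

lemma j_dinat (e : E) (d d' : D) (c : C) :
    G.post e d d' ▷ F.obj d' c ≫ j G F e d' c =
      (α_ _ _ _).hom ≫ G.obj e d ◁ F.pre d d' c ≫ j G F e d c :=
  ι_dinatural G F e d d' c

lemma j_pre (e e' : E) (d : D) (c : C) :
    (e ⟶[V] e') ◁ j G F e' d c ≫ (comp G F).pre e e' c =
      (α_ _ _ _).inv ≫ G.pre e e' d ▷ F.obj d c ≫ j G F e d c :=
  ι_compPre G F e e' d c

lemma j_post (e : E) (d : D) (c c' : C) :
    j G F e d c ▷ (c ⟶[V] c') ≫ (comp G F).post e c c' =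
      (α_ _ _ _).hom ≫ G.obj e d ◁ F.post d c c' ≫ j G F e d c' :=
  ι_compPost G F e d c c'

variable {G F}

lemma j_map {G' : VProf V D E} {F' : VProf V C D} (g : G ⟶ G') (f : F ⟶ F') (e : E)
    (d : D) (c : C) :
    j G F e d c ≫ (compMap g f).app e c = (g.app e d ⊗ₘ f.app d c) ≫ j G' F' e d c :=
  ι_compObjMap g f e d c

lemma j_ext {e : E} {c : C} {Z : V} {f g : (comp G F).obj e c ⟶ Z}
    (h : ∀ d, j G F e d c ≫ f = j G F e d c ≫ g) : f = g :=
  compObj_ext h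

lemma whiskerLeft_j_ext {e : E} {c : C} {X Z : V} {f g : X ⊗ (comp G F).obj e c ⟶ Z}
    (h : ∀ d, X ◁ j G F e d c ≫ f = X ◁ j G F e d c ≫ g) : f = g :=
  whiskerLeft_compObj_ext h

lemma j_whiskerRight_ext {e : E} {c : C} {X Z : V} {f g : (comp G F).obj e c ⊗ X ⟶ Z}
    (h : ∀ d, j G F e d c ▷ X ≫ f = j G F e d c ▷ X ≫ g) : f = g :=
  compObj_whiskerRight_ext h

/-- Maps out of a composite. -/
def desc {e : E} {c : C} {Z : V} (f : ∀ d, G.obj e d ⊗ F.obj d c ⟶ Z)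
    (hf : ∀ d d', G.post e d d' ▷ F.obj d' c ≫ f d' =
      (α_ _ _ _).hom ≫ G.obj e d ◁ F.pre d d' c ≫ f d) : (comp G F).obj e c ⟶ Z :=
  compDesc f hf

lemma j_desc {e : E} {c : C} {Z : V} (f : ∀ d, G.obj e d ⊗ F.obj d c ⟶ Z) (hf) (d : D) :
    j G F e d c ≫ desc f hf = f d :=
  ι_compDesc f hf d

/-- Maps out of a composite with a parameter on the left. -/
def descLeft {e : E} {c : C} {X Z : V} (f : ∀ d, X ⊗ (G.obj e d ⊗ F.obj d c) ⟶ Z)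
    (hf : ∀ d d', X ◁ (G.post e d d' ▷ F.obj d' c) ≫ f d' =
      X ◁ (α_ _ _ _).hom ≫ X ◁ (G.obj e d ◁ F.pre d d' c) ≫ f d) :
    X ⊗ (comp G F).obj e c ⟶ Z :=
  compDescLeft f hf

lemma j_descLeft {e : E} {c : C} {X Z : V} (f : ∀ d, X ⊗ (G.obj e d ⊗ F.obj d c) ⟶ Z) (hf)
    (d : D) : X ◁ j G F e d c ≫ descLeft f hf = f d :=
  ι_compDescLeft f hf d

/-- Maps out of a composite with a parameter on the right. -/
def descRight {e : E} {c : C} {X Z : V} (f : ∀ d, (G.obj e d ⊗ F.obj d c) ⊗ X ⟶ Z)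
    (hf : ∀ d d', (G.post e d d' ▷ F.obj d' c) ▷ X ≫ f d' =
      (α_ _ _ _).hom ▷ X ≫ (G.obj e d ◁ F.pre d d' c) ▷ X ≫ f d) :
    (comp G F).obj e c ⊗ X ⟶ Z :=
  compDescRight f hf

lemma j_descRight {e : E} {c : C} {X Z : V} (f : ∀ d, (G.obj e d ⊗ F.obj d c) ⊗ X ⟶ Z) (hf)
    (d : D) : j G F e d c ▷ X ≫ descRight f hf = f d :=
  ι_compDescRight f hf d

end

section Associator

variable (H : VProf V D E) (G : VProf V C D) (F : VProf V B C)

/-- The components of the associator. -/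
def assocApp (e : E) (b : B) :
    (comp (comp H G) F).obj e b ⟶ (comp H (comp G F)).obj e b :=
  desc (fun c => descRight
      (fun d => (α_ _ _ _).hom ≫ H.obj e d ◁ j G F d c b ≫ j H (comp G F) e d b) (by
        intro d d'
        rw [associator_naturality_left_assoc, ← whisker_exchange_assoc, j_dinat,
          associator_naturality_middle_assoc, tensor_whiskerLeft]
        simp only [Category.assoc, Iso.inv_hom_id_assoc]
        rw [← MonoidalCategory.whiskerLeft_comp_assoc (H.obj e d), j_pre]
        simp)) (by
    intro c c'
    rw [← cancel_epi (α_ _ _ _).inv, Iso.inv_hom_id_assoc]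
    apply j_whiskerRight_ext
    intro d
    rw [associator_inv_naturality_left_assoc, ← comp_whiskerRight_assoc, j_post,
      ← whisker_exchange_assoc]
    simp only [comp_whiskerRight, Category.assoc, j_descRight]
    rw [associator_naturality_middle_assoc, ← MonoidalCategory.whiskerLeft_comp_assoc, j_dinat]
    simp)

/-- The components of the inverse of the associator. -/
def assocInvApp (e : E) (b : B) :
    (comp H (comp G F)).obj e b ⟶ (comp (comp H G) F).obj e b :=
  desc (fun d => descLeft
      (fun c => (α_ _ _ _).inv ≫ j H G e d c ▷ F.obj c b ≫ j (comp H G) F e c b) (by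
        intro c c'
        rw [associator_inv_naturality_middle_assoc, associator_inv_naturality_right_assoc,
          whisker_exchange_assoc, ← (Iso.inv_comp_eq _).2 (j_dinat (comp H G) F e c c' b),
          whiskerRight_tensor]
        simp only [Category.assoc, Iso.hom_inv_id_assoc]
        rw [← comp_whiskerRight_assoc (H.j G e d c ▷ (c ⟶[V] c')), j_post]
        simp)) (by
    intro d d'
    apply whiskerLeft_j_ext
    intro c
    rw [whisker_exchange_assoc, associator_naturality_right_assoc,
      ← MonoidalCategory.whiskerLeft_comp_assoc, j_pre, j_descLeft]
    simp only [MonoidalCategory.whiskerLeft_comp, Category.assoc, j_descLeft]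
    rw [associator_inv_naturality_left_assoc, ← comp_whiskerRight_assoc, j_dinat]
    simp)

variable {H G F} in
lemma j_assocApp (e : E) (d : D) (c : C) (b : B) :
    j H G e d c ▷ F.obj c b ≫ j (comp H G) F e c b ≫ assocApp H G F e b =
      (α_ _ _ _).hom ≫ H.obj e d ◁ j G F d c b ≫ j H (comp G F) e d b := by
  rw [assocApp, j_desc, j_descRight]

variable {H G F} in
lemma j_assocInvApp (e : E) (d : D) (c : C) (b : B) :
    H.obj e d ◁ j G F d c b ≫ j H (comp G F) e d b ≫ assocInvApp H G F e b =
      (α_ _ _ _).inv ≫ j H G e d c ▷ F.obj c b ≫ j (comp H G) F e c b := by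
  rw [assocInvApp, j_desc, j_descLeft]

lemma j_j_ext {e : E} {b : B} {Z : V} {f g : (comp (comp H G) F).obj e b ⟶ Z}
    (h : ∀ d c, j H G e d c ▷ F.obj c b ≫ j (comp H G) F e c b ≫ f =
      j H G e d c ▷ F.obj c b ≫ j (comp H G) F e c b ≫ g) : f = g :=
  j_ext fun c => j_whiskerRight_ext fun d => h d c

lemma j_j_ext' {e : E} {b : B} {Z : V} {f g : (comp H (comp G F)).obj e b ⟶ Z}
    (h : ∀ d c, H.obj e d ◁ j G F d c b ≫ j H (comp G F) e d b ≫ f =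
      H.obj e d ◁ j G F d c b ≫ j H (comp G F) e d b ≫ g) : f = g :=
  j_ext fun d => whiskerLeft_j_ext fun c => h d c

lemma whiskerLeft_j_j_ext {e : E} {b : B} {X Z : V} {f g : X ⊗ (comp (comp H G) F).obj e b ⟶ Z}
    (h : ∀ d c, X ◁ (j H G e d c ▷ F.obj c b ≫ j (comp H G) F e c b) ≫ f =
      X ◁ (j H G e d c ▷ F.obj c b ≫ j (comp H G) F e c b) ≫ g) : f = g := by
  apply MonoidalClosed.curry_injective
  apply j_j_ext
  intro d c
  have := h d c
  rw [← Category.assoc, ← Category.assoc, ← MonoidalClosed.curry_natural_left,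
    ← MonoidalClosed.curry_natural_left, this]

lemma j_j_whiskerRight_ext {e : E} {b : B} {X Z : V}
    {f g : (comp (comp H G) F).obj e b ⊗ X ⟶ Z}
    (h : ∀ d c, (j H G e d c ▷ F.obj c b ≫ j (comp H G) F e c b) ▷ X ≫ f =
      (j H G e d c ▷ F.obj c b ≫ j (comp H G) F e c b) ▷ X ≫ g) : f = g := by
  rw [← cancel_epi (β_ X _).hom]
  apply whiskerLeft_j_j_ext
  intro d c
  simp only [BraidedCategory.braiding_naturality_right_assoc, h]

/-- The associator of the composition of profunctors. -/
def assocIso : comp (comp H G) F ≅ comp H (comp G F) :=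
  isoOfComponents
    { app := assocApp H G F
      pre_app := by
        intro e e' b
        apply whiskerLeft_j_j_ext
        intro d c
        have h1 := j_assocApp (H := H) (G := G) (F := F) e' d c b
        rw [← MonoidalCategory.whiskerLeft_comp_assoc, Category.assoc, h1]
        simp only [MonoidalCategory.whiskerLeft_comp, Category.assoc, j_pre]
        rw [reassoc_of% (j_pre (comp H G) F e e' c b), associator_inv_naturality_middle_assoc,
          ← comp_whiskerRight_assoc, j_pre]
        simp only [comp_whiskerRight, Category.assoc, j_assocApp]
        rw [associator_inv_naturality_right_assoc, whisker_exchange_assoc,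
          associator_naturality_left_assoc]
        simp
      post_app := by
        intro e b b'
        apply j_j_whiskerRight_ext
        intro d c
        have h1 := j_assocApp (H := H) (G := G) (F := F) e d c b
        rw [← comp_whiskerRight_assoc, Category.assoc, h1]
        simp only [comp_whiskerRight, Category.assoc, j_post]
        rw [reassoc_of% (j_post (comp H G) F e c b b'), associator_naturality_left_assoc,
          ← whisker_exchange_assoc, j_assocApp, associator_naturality_middle_assoc,
          ← MonoidalCategory.whiskerLeft_comp_assoc, j_post]
        simp }
    (assocInvApp H G F)
    (by
      intro e b
      apply j_j_ext
      intro d c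
      change j H G e d c ▷ F.obj c b ≫ j (comp H G) F e c b ≫ assocApp H G F e b ≫ _ = _
      rw [reassoc_of% (j_assocApp (H := H) (G := G) (F := F) e d c b), j_assocInvApp]
      simp)
    (by
      intro e b
      apply j_j_ext'
      intro d c
      change _ ≫ _ ≫ assocInvApp H G F e b ≫ assocApp H G F e b = _
      rw [reassoc_of% (j_assocInvApp (H := H) (G := G) (F := F) e d c b), j_assocApp]
      simp)

variable {H G F} in
lemma j_assocIso_hom (e : E) (d : D) (c : C) (b : B) :
    j H G e d c ▷ F.obj c b ≫ j (comp H G) F e c b ≫ (assocIso H G F).hom.app e b =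
      (α_ _ _ _).hom ≫ H.obj e d ◁ j G F d c b ≫ j H (comp G F) e d b :=
  j_assocApp e d c b

variable {H G F} in
lemma j_assocIso_inv (e : E) (d : D) (c : C) (b : B) :
    H.obj e d ◁ j G F d c b ≫ j H (comp G F) e d b ≫ (assocIso H G F).inv.app e b =
      (α_ _ _ _).inv ≫ j H G e d c ▷ F.obj c b ≫ j (comp H G) F e c b :=
  j_assocInvApp e d c b

end Associator

section Unitors

variable (F : VProf V C D)

/-- The left unitor of the composition of profunctors. -/
def leftUnitIso : comp (idProf V D) F ≅ F :=
  isoOfComponents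
    { app := fun d c => desc (fun d' => F.pre d d' c) (fun d' d'' => F.pre_comp d d' d'' c)
      pre_app := by
        intro d d' c
        apply whiskerLeft_j_ext
        intro d''
        rw [reassoc_of% (j_pre (idProf V D) F d d' d'' c), j_desc,
          ← MonoidalCategory.whiskerLeft_comp_assoc, j_desc]
        exact (Iso.inv_comp_eq _).2 (F.pre_comp _ _ _ _)
      post_app := by
        intro d c c'
        apply j_whiskerRight_ext
        intro d'
        rw [reassoc_of% (j_post (idProf V D) F d d' c c'), j_desc,
          ← comp_whiskerRight_assoc, j_desc]
        exact (F.pre_post _ _ _ _).symm }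
    (fun d c => idLeft V d _ ≫ j (idProf V D) F d d c)
    (by
      intro d c
      apply j_ext
      intro d'
      have h1 := idLeft_naturality d (F.pre d d' c)
      rw [reassoc_of% (j_desc (G := idProf V D) (F := F) (fun d' => F.pre d d' c)
        (fun d' d'' => F.pre_comp d d' d'' c) d'), reassoc_of% h1, idLeft_tensor, Category.assoc]
      have h2 := j_dinat (idProf V D) F d d d' c
      have h3 := idLeft_pre (idProf V D) d d'
      change idLeft V d ((idProf V D).obj d d') ▷ _ ≫ (α_ _ _ _).hom ≫
        ((idProf V D).obj d d) ◁ F.pre d d' c ≫ j (idProf V D) F d d c = _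
      rw [← h2]
      change idLeft V d ((idProf V D).obj d d') ▷ _ ≫ (idProf V D).pre d d d' ▷ _ ≫ _ = _
      rw [← comp_whiskerRight_assoc, h3]
      simp)
    (by
      intro d c
      rw [Category.assoc, j_desc, idLeft_pre])

variable {F} in
lemma j_leftUnitIso_hom (d d' : D) (c : C) :
    j (idProf V D) F d d' c ≫ (leftUnitIso F).hom.app d c = F.pre d d' c :=
  j_desc (G := idProf V D) (fun d' => F.pre d d' c) (fun d' d'' => F.pre_comp d d' d'' c) d'

/-- The right unitor of the composition of profunctors. -/
def rightUnitIso : comp F (idProf V C) ≅ F :=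
  isoOfComponents
    { app := fun d c => desc (fun c' => F.post d c' c) (fun c' c'' => (F.post_comp d c' c'' c).symm)
      pre_app := by
        intro d d' c
        apply whiskerLeft_j_ext
        intro c'
        rw [reassoc_of% (j_pre F (idProf V C) d d' c' c), j_desc,
          ← MonoidalCategory.whiskerLeft_comp_assoc, j_desc]
        exact (Iso.inv_comp_eq _).2 (F.pre_post _ _ _ _)
      post_app := by
        intro d c c'
        apply j_whiskerRight_ext
        intro c''
        rw [reassoc_of% (j_post F (idProf V C) d c'' c c'), j_desc,
          ← comp_whiskerRight_assoc, j_desc]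
        exact F.post_comp _ _ _ _ }
    (fun d c => idRight V _ c ≫ j F (idProf V C) d c c)
    (by
      intro d c
      apply j_ext
      intro c'
      have h1 := idRight_naturality c (F.post d c' c)
      rw [reassoc_of% (j_desc (G := F) (F := idProf V C) (fun c' => F.post d c' c)
        (fun c' c'' => (F.post_comp d c' c'' c).symm) c'), reassoc_of% h1, idRight_tensor,
        Category.assoc]
      have h2 := j_dinat F (idProf V C) d c' c c
      have h3 := idRight_post (idProf V C) c' c
      change _ ◁ idRight V ((idProf V C).obj c' c) c ≫ (α_ _ _ _).inv ≫
        F.post d c' c ▷ ((idProf V C).obj c c) ≫ j F (idProf V C) d c c = _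
      rw [h2]
      change _ ◁ idRight V ((idProf V C).obj c' c) c ≫ (α_ _ _ _).inv ≫ (α_ _ _ _).hom ≫
        _ ◁ (idProf V C).post c' c c ≫ _ = _
      rw [Iso.inv_hom_id_assoc, ← MonoidalCategory.whiskerLeft_comp_assoc, h3]
      simp)
    (by
      intro d c
      rw [Category.assoc, j_desc, idRight_post])

variable {F} in
lemma j_rightUnitIso_hom (d : D) (c c' : C) :
    j F (idProf V C) d c' c ≫ (rightUnitIso F).hom.app d c = F.post d c' c :=
  j_desc (F := idProf V C) (fun c' => F.post d c' c)
    (fun c' c'' => (F.post_comp d c' c'' c).symm) c'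

end Unitors

end Coends

end VProf

end

end LaxModuleProf

namespace LaxModuleProf

noncomputable section

namespace VProf

section MonoidalStructure

set_option linter.unusedSectionVars false

variable {V : Type u} [Category.{v} V] [MonoidalCategory V] [SymmetricCategory V]
  [MonoidalClosed V] [HasColimits V]
  {A : Type v} [EnrichedCategory V A] {B : Type v} [EnrichedCategory V B]
  {C : Type v} [EnrichedCategory V C] {D : Type v} [EnrichedCategory V D]
  {E : Type v} [EnrichedCategory V E]

lemma assocIso_naturality {H H' : VProf V D E} {G G' : VProf V C D} {F F' : VProf V B C}
    (h : H ⟶ H') (g : G ⟶ G') (f : F ⟶ F') :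
    compMap (compMap h g) f ≫ (assocIso H' G' F').hom =
      (assocIso H G F).hom ≫ compMap h (compMap g f) := by
  ext e b
  apply j_j_ext
  intro d c
  rw [comp_app, comp_app, reassoc_of% (j_map (compMap h g) f e c b),
    reassoc_of% (j_assocIso_hom (H := H) (G := G) (F := F) e d c b), j_map,
    MonoidalCategory.tensorHom_def, Category.assoc, ← comp_whiskerRight_assoc, j_map,
    comp_whiskerRight_assoc, ← whisker_exchange_assoc, j_assocIso_hom,
    MonoidalCategory.tensorHom_def' (h.app e d) ((compMap g f).app d b), Category.assoc,
    ← MonoidalCategory.whiskerLeft_comp_assoc, j_map]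
  simp only [MonoidalCategory.tensorHom_def, comp_whiskerRight, Category.assoc,
    MonoidalCategory.whiskerLeft_comp, whisker_exchange_assoc, associator_naturality_left_assoc,
    associator_naturality_middle_assoc, tensor_whiskerLeft,
    Iso.inv_hom_id_assoc]

lemma assocIso_pentagon (K : VProf V D E) (H : VProf V C D) (G : VProf V B C) (F : VProf V A B) :
    compMap (assocIso K H G).hom (𝟙 F) ≫ (assocIso K (comp H G) F).hom ≫
        compMap (𝟙 K) (assocIso H G F).hom =
      (assocIso (comp K H) G F).hom ≫ (assocIso K H (comp G F)).hom := by
  ext e a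
  apply j_ext
  intro b
  apply j_j_whiskerRight_ext
  intro d c
  simp only [comp_app]
  have h1 := j_map (assocIso K H G).hom (𝟙 F) e b a
  have h2 := j_assocIso_hom (H := K) (G := H) (F := G) e d c b
  have h3 := j_assocIso_hom (H := K) (G := comp H G) (F := F) e d b a
  have h4 := j_map (𝟙 K) (assocIso H G F).hom e d a
  have h5 := j_assocIso_hom (H := H) (G := G) (F := F) d c b a
  have h6 := j_assocIso_hom (H := comp K H) (G := G) (F := F) e c b a
  have h7 := j_assocIso_hom (H := K) (G := H) (F := comp G F) e d c a
  rw [reassoc_of% h1, id_app, tensorHom_id, ← comp_whiskerRight_assoc, Category.assoc, h2]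
  simp only [comp_whiskerRight, Category.assoc]
  rw [reassoc_of% h3, h4, id_app, id_tensorHom, associator_naturality_middle_assoc,
    ← MonoidalCategory.whiskerLeft_comp_assoc, ← MonoidalCategory.whiskerLeft_comp_assoc,
    Category.assoc, h5, reassoc_of% h6]
  rw [associator_naturality_left_assoc, ← whisker_exchange_assoc, h7]
  simp

lemma comp_triangle (G : VProf V D E) (F : VProf V C D) :
    (assocIso G (idProf V D) F).hom ≫ compMap (𝟙 G) (leftUnitIso F).hom =
      compMap (rightUnitIso G).hom (𝟙 F) := by
  ext e c
  apply j_j_ext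
  intro d d'
  rw [comp_app, reassoc_of% (j_assocIso_hom (H := G) (G := idProf V D) (F := F) e d d' c), j_map,
    j_map, id_app, id_app, tensorHom_id, id_tensorHom, ← comp_whiskerRight_assoc,
    j_rightUnitIso_hom, j_dinat, ← MonoidalCategory.whiskerLeft_comp_assoc, j_leftUnitIso_hom]

lemma leftUnitIso_naturality {F F' : VProf V C D} (f : F ⟶ F') :
    compMap (𝟙 _) f ≫ (leftUnitIso F').hom = (leftUnitIso F).hom ≫ f := by
  ext d c
  apply j_ext
  intro d'
  rw [comp_app, comp_app, reassoc_of% (j_map (𝟙 (idProf V D)) f d d' c), j_leftUnitIso_hom,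
    reassoc_of% (j_leftUnitIso_hom (F := F) d d' c), id_app, id_tensorHom, f.pre_app]

lemma rightUnitIso_naturality {F F' : VProf V C D} (f : F ⟶ F') :
    compMap f (𝟙 _) ≫ (rightUnitIso F').hom = (rightUnitIso F).hom ≫ f := by
  ext d c
  apply j_ext
  intro c'
  rw [comp_app, comp_app, reassoc_of% (j_map f (𝟙 (idProf V C)) d c' c), j_rightUnitIso_hom,
    reassoc_of% (j_rightUnitIso_hom (F := F) d c c'), id_app, tensorHom_id, f.post_app]

instance monoidalCategoryStruct : MonoidalCategoryStruct (VProf V C C) where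
  tensorObj G F := comp G F
  tensorHom g f := compMap g f
  whiskerLeft G _ _ f := compMap (𝟙 G) f
  whiskerRight g F := compMap g (𝟙 F)
  tensorUnit := idProf V C
  associator := assocIso
  leftUnitor := leftUnitIso
  rightUnitor := rightUnitIso

instance monoidalCategory : MonoidalCategory (VProf V C C) :=
  MonoidalCategory.ofTensorHom
    (id_tensorHom_id := compMap_id)
    (tensorHom_comp_tensorHom := fun f₁ f₂ g₁ g₂ => (compMap_comp f₁ g₁ f₂ g₂).symm)
    (associator_naturality := assocIso_naturality)
    (leftUnitor_naturality := leftUnitIso_naturality)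
    (rightUnitor_naturality := rightUnitIso_naturality)
    (pentagon := assocIso_pentagon)
    (triangle := comp_triangle)

end MonoidalStructure

end VProf

end

end LaxModuleProf

namespace LaxModuleProf

noncomputable section

set_option linter.unusedSectionVars false

/-! ### Action maps of a module category on hom objects -/

section ActionLemmas

variable (V : Type u) [Category.{v} V] [MonoidalCategory V] [SymmetricCategory V]
  {C : Type v} [Category.{v} C] [MonoidalCategory C] [EnrichedOrdinaryCategory V C]
  [MonoidalEnriched V C] {M : Type v} [Category.{v} M] [EnrichedOrdinaryCategory V M]
  [MonoidalLeftAction C M] [ModuleEnriched V C M]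

/-- The action of a hom object of `C` on an object `n`, `C(x, x') ⟶ M(x ⊙ n, x' ⊙ n)`. -/
def actR (x x' : C) (n : M) : (x ⟶[V] x') ⟶ ((x ⊙ₗ n) ⟶[V] (x' ⊙ₗ n)) :=
  idRight V (x ⟶[V] x') n ≫ ModuleEnriched.actE x x' n n

lemma eId_comp_actL (x : C) (n : M) : eId V n ≫ actL V x n n = eId V (x ⊙ₗ n) :=
  (EnrichedFunctor.comp V (insertRight M x) (actFunctor V C M)).map_id n

lemma eId_comp_actR (x : C) (n : M) : eId V x ≫ actR V x x n = eId V (x ⊙ₗ n) :=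
  (EnrichedFunctor.comp V (insertLeft C n) (actFunctor V C M)).map_id x

lemma eComp_actL (x : C) (n n' n'' : M) :
    eComp V n n' n'' ≫ actL V x n n'' = (actL V x n n' ⊗ₘ actL V x n' n'') ≫ eComp V _ _ _ :=
  (EnrichedFunctor.comp V (insertRight M x) (actFunctor V C M)).map_comp n n' n''

lemma eComp_actR (x x' x'' : C) (n : M) :
    eComp V x x' x'' ≫ actR V x x'' n = (actR V x x' n ⊗ₘ actR V x' x'' n) ≫ eComp V _ _ _ :=
  (EnrichedFunctor.comp V (insertLeft C n) (actFunctor V C M)).map_comp x x' x''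

lemma eId_whiskerRight_eComp {C : Type v} [EnrichedCategory V C] (c c' : C) :
    eId V c ▷ (c ⟶[V] c') ≫ eComp V c c c' = (λ_ _).hom := (VProf.idProf V C).pre_id c c'

lemma whiskerLeft_eId_eComp {C : Type v} [EnrichedCategory V C] (c c' : C) :
    (c ⟶[V] c') ◁ eId V c' ≫ eComp V c c' c' = (ρ_ _).hom := (VProf.idProf V C).post_id c c'

lemma actR_actL (x x' : C) (n n' : M) :
    (actR V x x' n ⊗ₘ actL V x' n n') ≫ eComp V _ _ _ = ModuleEnriched.actE x x' n n' := by
  have h := ModuleEnriched.actE_comp (V := V) x x' x' n n n'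
  have k := insert_exchange' (eId V n) (eId V x') (eComp V x x' x') (eComp V n n n')
    (whiskerLeft_eId_eComp V x x') (eId_whiskerRight_eComp V n n')
  rw [actR, actL, idRight, idLeft, ← tensorHom_comp_tensorHom, Category.assoc, h,
    reassoc_of% k]

lemma actL_actR (x x' : C) (n n' : M) :
    (actL V x n n' ⊗ₘ actR V x x' n') ≫ eComp V _ _ _ =
      (β_ _ _).hom ≫ ModuleEnriched.actE x x' n n' := by
  have h := ModuleEnriched.actE_comp (V := V) x x x' n n' n'
  have k := insert_exchange (eId V x) (eId V n') (eComp V x x x') (eComp V n n' n')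
    (eId_whiskerRight_eComp V x x') (whiskerLeft_eId_eComp V n n')
  rw [actR, actL, idRight, idLeft, ← tensorHom_comp_tensorHom, Category.assoc, h,
    reassoc_of% k]

lemma actL_tensor (x y : C) (n m : M) :
    actL V (x ⊗ y) n m ≫ eHomWhiskerLeft V _ (αₗ x y m).hom =
      actL V y n m ≫ actL V x _ _ ≫ eHomWhiskerRight V (αₗ x y n).hom _ := by
  have h := ModuleEnriched.actionAssoc_enriched (V := V) x x y y n m
  have h1 := MonoidalEnriched.tensorE_hom (V := V) (𝟙 x) (𝟙 y)
  rw [eHomEquiv_id, eHomEquiv_id, id_tensorHom_id, eHomEquiv_id] at h1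
  have h2 := congrArg (fun t => (λ_ (n ⟶[V] m)).inv ≫ t ▷ (n ⟶[V] m)) h1
  rw [actL, idLeft, ← h1]
  simp only [comp_whiskerRight, Category.assoc, h]
  rw [actL, actL, idLeft, idLeft, MonoidalCategory.tensorHom_def']
  simp only [comp_whiskerRight, Category.assoc, associator_naturality_left_assoc,
    associator_naturality_middle_assoc, leftUnitor_inv_naturality_assoc, whisker_exchange_assoc]
  simp

lemma eHomEquiv_eHomWhiskerRight {n n' n'' : M} (f : n ⟶ n') (g : n' ⟶ n'') :
    eHomEquiv V g ≫ eHomWhiskerRight V f n'' = eHomEquiv V (f ≫ g) := by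
  rw [eHomWhiskerRight, leftUnitor_inv_naturality_assoc, eHomEquiv_comp,
    MonoidalCategory.tensorHom_def', Category.assoc]

lemma eHomEquiv_eHomWhiskerLeft {n n' n'' : M} (f : n ⟶ n') (g : n' ⟶ n'') :
    eHomEquiv V f ≫ eHomWhiskerLeft V n g = eHomEquiv V (f ≫ g) := by
  rw [eHomWhiskerLeft, rightUnitor_inv_naturality_assoc, eHomEquiv_comp,
    MonoidalCategory.tensorHom_def, Category.assoc, unitors_inv_equal]

end ActionLemmas

/-! ### Actions of morphisms of the underlying categories -/

namespace VProf

section Maps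

variable {V : Type u} [Category.{v} V] [MonoidalCategory V] [SymmetricCategory V]

section

variable {C : Type v} [EnrichedCategory V C] {M : Type v} [Category.{v} M]
  [EnrichedOrdinaryCategory V M]

/-- Contravariant action of a morphism of the underlying category of the codomain. -/
def mapLeft (F : VProf V C M) {d d' : M} (f : d ⟶ d') (c : C) : F.obj d' c ⟶ F.obj d c :=
  (λ_ _).inv ≫ eHomEquiv V f ▷ F.obj d' c ≫ F.pre d d' c

lemma mapLeft_id (F : VProf V C M) (d : M) (c : C) : F.mapLeft (𝟙 d) c = 𝟙 _ := by
  rw [mapLeft, eHomEquiv_id, F.pre_id, Iso.inv_hom_id]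

lemma whiskerLeft_mapLeft_pre (F : VProf V C M) (d : M) {d' d'' : M} (f : d' ⟶ d'') (c : C) :
    (d ⟶[V] d') ◁ F.mapLeft f c ≫ F.pre d d' c = eHomWhiskerLeft V d f ▷ _ ≫ F.pre d d'' c := by
  rw [eHomWhiskerLeft, comp_whiskerRight, comp_whiskerRight, Category.assoc, Category.assoc,
    F.pre_comp, mapLeft]
  simp

lemma pre_mapLeft (F : VProf V C M) {d d' : M} (d'' : M) (f : d ⟶ d') (c : C) :
    F.pre d' d'' c ≫ F.mapLeft f c = eHomWhiskerRight V f d'' ▷ _ ≫ F.pre d d'' c := by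
  rw [eHomWhiskerRight, comp_whiskerRight, comp_whiskerRight, Category.assoc, Category.assoc,
    F.pre_comp, mapLeft, leftUnitor_inv_naturality_assoc, whisker_exchange_assoc]
  simp

lemma mapLeft_comp (F : VProf V C M) {d d' d'' : M} (f : d ⟶ d') (g : d' ⟶ d'') (c : C) :
    F.mapLeft (f ≫ g) c = F.mapLeft g c ≫ F.mapLeft f c := by
  have h : F.mapLeft g c = (λ_ _).inv ≫ eHomEquiv V g ▷ F.obj d'' c ≫ F.pre d' d'' c := rfl
  rw [mapLeft, ← eHomEquiv_eHomWhiskerRight, h, Category.assoc, Category.assoc, F.pre_mapLeft,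
    comp_whiskerRight_assoc]

lemma mapLeft_post (F : VProf V C M) {d d' : M} (f : d ⟶ d') (c c' : C) :
    F.post d' c c' ≫ F.mapLeft f c' = F.mapLeft f c ▷ _ ≫ F.post d c c' := by
  simp only [mapLeft, comp_whiskerRight, Category.assoc, F.pre_post]
  rw [leftUnitor_inv_naturality_assoc, whisker_exchange_assoc]
  simp

end

section

variable {D : Type v} [EnrichedCategory V D] {M : Type v} [Category.{v} M]
  [EnrichedOrdinaryCategory V M]

lemma mapRight_id (F : VProf V M D) (d : D) (m : M) : F.mapRight d (𝟙 m) = 𝟙 _ := by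
  rw [mapRight, eHomEquiv_id, F.post_id, Iso.inv_hom_id]

lemma mapRight_whiskerRight_post (F : VProf V M D) (d : D) {m m' : M} (f : m ⟶ m') (m'' : M) :
    F.mapRight d f ▷ (m' ⟶[V] m'') ≫ F.post d m' m'' =
      _ ◁ eHomWhiskerRight V f m'' ≫ F.post d m m'' := by
  simp only [mapRight, comp_whiskerRight, Category.assoc, ← F.post_comp, eHomWhiskerRight,
    MonoidalCategory.whiskerLeft_comp]
  simp

lemma post_mapRight (F : VProf V M D) (d : D) (m : M) {m' m'' : M} (f : m' ⟶ m'') :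
    F.post d m m' ≫ F.mapRight d f = _ ◁ eHomWhiskerLeft V m f ≫ F.post d m m'' := by
  rw [mapRight, rightUnitor_inv_naturality_assoc, ← whisker_exchange_assoc, ← F.post_comp,
    eHomWhiskerLeft]
  simp

lemma mapRight_comp (F : VProf V M D) (d : D) {m m' m'' : M} (f : m ⟶ m') (g : m' ⟶ m'') :
    F.mapRight d (f ≫ g) = F.mapRight d f ≫ F.mapRight d g := by
  have h : F.mapRight d f = (ρ_ _).inv ≫ F.obj d m ◁ eHomEquiv V f ≫ F.post d m m' := rfl
  rw [mapRight, ← eHomEquiv_eHomWhiskerLeft, h, Category.assoc, Category.assoc, F.post_mapRight,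
    MonoidalCategory.whiskerLeft_comp_assoc]

lemma pre_mapRight (F : VProf V M D) (d d' : D) {m m' : M} (f : m ⟶ m') :
    F.pre d d' m ≫ F.mapRight d f = _ ◁ F.mapRight d' f ≫ F.pre d d' m' := by
  simp only [mapRight, MonoidalCategory.whiskerLeft_comp, Category.assoc]
  rw [rightUnitor_inv_naturality_assoc, ← whisker_exchange_assoc, F.pre_post]
  simp

end

section

variable {M : Type v} [Category.{v} M] [EnrichedOrdinaryCategory V M]
  {N : Type v} [Category.{v} N] [EnrichedOrdinaryCategory V N]

lemma mapLeft_mapRight (F : VProf V M N) {n n' : N} (g : n ⟶ n') {m m' : M} (f : m ⟶ m') :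
    F.mapLeft g m ≫ F.mapRight n f = F.mapRight n' f ≫ F.mapLeft g m' := by
  rw [mapLeft, Category.assoc, Category.assoc, F.pre_mapRight, mapLeft,
    leftUnitor_inv_naturality_assoc, whisker_exchange_assoc]

lemma idProf_mapLeft {n n' : M} (f : n ⟶ n') (m : M) :
    (idProf V M).mapLeft f m = eHomWhiskerRight V f m := rfl

lemma idProf_mapRight (n : M) {m m' : M} (f : m ⟶ m') :
    (idProf V M).mapRight n f = eHomWhiskerLeft V n f := rfl

end

section

variable [MonoidalClosed V] [HasColimits V]
variable {C : Type v} [EnrichedCategory V C] {D : Type v} [EnrichedCategory V D]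
  {M : Type v} [Category.{v} M] [EnrichedOrdinaryCategory V M]

lemma j_mapLeft (G : VProf V D M) (F : VProf V C D) {m m' : M} (f : m ⟶ m') (d : D) (c : C) :
    j G F m' d c ≫ (comp G F).mapLeft f c = G.mapLeft f d ▷ _ ≫ j G F m d c := by
  rw [mapLeft, leftUnitor_inv_naturality_assoc, whisker_exchange_assoc, j_pre, mapLeft]
  simp

lemma j_mapRight (G : VProf V D C) (F : VProf V M D) {m m' : M} (f : m ⟶ m') (c : C) (d : D) :
    j G F c d m ≫ (comp G F).mapRight c f = _ ◁ F.mapRight d f ≫ j G F c d m' := by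
  rw [mapRight, rightUnitor_inv_naturality_assoc, ← whisker_exchange_assoc, j_post, mapRight]
  simp

lemma mapRight_whiskerRight_j (G : VProf V M D) (F : VProf V C M) (d : D) {m m' : M} (f : m ⟶ m')
    (c : C) : G.mapRight d f ▷ _ ≫ j G F d m' c = _ ◁ F.mapLeft f c ≫ j G F d m c := by
  rw [mapRight, comp_whiskerRight, comp_whiskerRight, Category.assoc, Category.assoc, j_dinat,
    mapLeft]
  simp

end

end Maps

end VProf

end

end LaxModuleProf

namespace LaxModuleProf

noncomputable section

set_option linter.unusedSectionVars false

open VProf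

/-! ### Strong endoprofunctors

All three categories are equivalent to the category of profunctors `F : M ⇸ M` with maps
`F(n, m) ⟶ F(x ⊙ n, x ⊙ m)`. -/

/-- A profunctor `F : M ⇸ M` with a strength `F(n, m) ⟶ F(x ⊙ n, x ⊙ m)`. -/
structure StrMod (V : Type u) [Category.{v} V] [MonoidalCategory V] [SymmetricCategory V]
    (C : Type v) [Category.{v} C] [MonoidalCategory C] [EnrichedOrdinaryCategory V C]
    [MonoidalEnriched V C]
    (M : Type v) [Category.{v} M] [EnrichedOrdinaryCategory V M] [MonoidalLeftAction C M]
    [ModuleEnriched V C M] where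
  prof : VProf V M M
  s (x : C) (n m : M) : prof.obj n m ⟶ prof.obj (x ⊙ₗ n) (x ⊙ₗ m)
  pre_s (x : C) (n n' m : M) :
    prof.pre n n' m ≫ s x n m = (actL V x n n' ⊗ₘ s x n' m) ≫ prof.pre _ _ _
  post_s (x : C) (n m m' : M) :
    prof.post n m m' ≫ s x n m' = (s x n m ⊗ₘ actL V x m m') ≫ prof.post _ _ _
  actR_s (x x' : C) (n m : M) :
    (actR V x x' n ⊗ₘ s x' n m) ≫ prof.pre _ _ _ =
      (β_ _ _).hom ≫ (s x n m ⊗ₘ actR V x x' m) ≫ prof.post _ _ _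
  s_tensor (x y : C) (n m : M) :
    s (x ⊗ y) n m ≫ prof.mapRight _ (αₗ x y m).hom =
      s y n m ≫ s x _ _ ≫ prof.mapLeft (αₗ x y n).hom _
  s_unit (n m : M) :
    s (𝟙_ C) n m ≫ prof.mapRight _ (λₗ m).hom = prof.mapLeft (λₗ n).hom m

namespace StrMod

variable {V : Type u} [Category.{v} V] [MonoidalCategory V] [SymmetricCategory V]
  {C : Type v} [Category.{v} C] [MonoidalCategory C] [EnrichedOrdinaryCategory V C]
  [MonoidalEnriched V C]
  {M : Type v} [Category.{v} M] [EnrichedOrdinaryCategory V M] [MonoidalLeftAction C M]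
  [ModuleEnriched V C M]

/-- A morphism of strong profunctors. -/
@[ext]
structure Hom (X Y : StrMod V C M) where
  hom : X.prof ⟶ Y.prof
  s_hom (x : C) (n m : M) : X.s x n m ≫ hom.app _ _ = hom.app n m ≫ Y.s x n m

instance : Category (StrMod V C M) where
  Hom := Hom
  id X := ⟨𝟙 _, by intro x n m; rw [id_app, id_app, Category.comp_id, Category.id_comp]⟩
  comp f g := ⟨f.hom ≫ g.hom, by
    intro x n m
    rw [comp_app, comp_app, reassoc_of% (f.s_hom x n m), g.s_hom, Category.assoc]⟩
  id_comp f := Hom.ext (Category.id_comp _)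
  comp_id f := Hom.ext (Category.comp_id _)
  assoc f g h := Hom.ext (Category.assoc _ _ _)

variable (V C M) in
/-- The underlying profunctor. -/
def forget : StrMod V C M ⥤ VProf V M M where
  obj X := X.prof
  map f := f.hom
  map_id _ := rfl
  map_comp _ _ := rfl

instance : (forget V C M).Faithful where
  map_injective h := Hom.ext h

lemma s_hom {X Y : StrMod V C M} (f : X ⟶ Y) (x : C) (n m : M) :
    X.s x n m ≫ f.hom.app _ _ = f.hom.app n m ≫ Y.s x n m := Hom.s_hom f x n m

/-- An isomorphism of the underlying profunctors that commutes with the strength. -/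
def mkIso {X Y : StrMod V C M} (e : X.prof ≅ Y.prof)
    (h : ∀ (x : C) (n m : M), X.s x n m ≫ e.hom.app _ _ = e.hom.app n m ≫ Y.s x n m) : X ≅ Y where
  hom := ⟨e.hom, h⟩
  inv := ⟨e.inv, by
    intro x n m
    rw [← Category.comp_id (X.s x n m), ← iso_hom_inv_app e, reassoc_of% (h x n m),
      reassoc_of% (iso_inv_hom_app e n m)]⟩
  hom_inv_id := Hom.ext e.hom_inv_id
  inv_hom_id := Hom.ext e.inv_hom_id

/-- The identity profunctor, with the strength given by the action. -/
@[reducible] def idStr : StrMod V C M where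
  prof := idProf V M
  s x n m := actL V x n m
  pre_s x n n' m := eComp_actL V x n n' m
  post_s x n m m' := eComp_actL V x n m m'
  actR_s x x' n m := by
    change (actR V x x' n ⊗ₘ actL V x' n m) ≫ eComp V _ _ _ =
      (β_ _ _).hom ≫ (actL V x n m ⊗ₘ actR V x x' m) ≫ eComp V _ _ _
    rw [actR_actL, actL_actR, SymmetricCategory.symmetry_assoc]
  s_tensor x y n m := actL_tensor V x y n m
  s_unit n m := by
    rw [idProf_mapLeft, idProf_mapRight, ← ModuleEnriched.actionUnit_enriched, actL, idLeft]
    simp only [Category.assoc]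

variable [MonoidalClosed V] [HasColimits V]

/-- The strength of a composite. -/
def compS (X Y : StrMod V C M) (x : C) (n m : M) :
    (comp X.prof Y.prof).obj n m ⟶ (comp X.prof Y.prof).obj (x ⊙ₗ n) (x ⊙ₗ m) :=
  desc (fun k => (X.s x n k ⊗ₘ Y.s x k m) ≫ j X.prof Y.prof _ (x ⊙ₗ k) _) (by
    intro k k'
    have h1 := X.post_s x n k k'
    have h2 := Y.pre_s x k k' m
    rw [whiskerRight_comp_tensorHom_assoc, h1, ← tensorHom_comp_whiskerRight_assoc, j_dinat,
      associator_naturality_assoc, tensorHom_comp_whiskerLeft_assoc, ← h2,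
      ← whiskerLeft_comp_tensorHom_assoc])

lemma j_compS (X Y : StrMod V C M) (x : C) (n k m : M) :
    j X.prof Y.prof n k m ≫ compS X Y x n m =
      (X.s x n k ⊗ₘ Y.s x k m) ≫ j X.prof Y.prof _ (x ⊙ₗ k) _ :=
  j_desc _ _ _

/-- The composite of two strong profunctors. -/
@[reducible] def compStr (X Y : StrMod V C M) : StrMod V C M where
  prof := comp X.prof Y.prof
  s := compS X Y
  pre_s x n n' m := by
    apply whiskerLeft_j_ext
    intro k
    rw [reassoc_of% (j_pre X.prof Y.prof n n' k m), j_compS, whiskerRight_comp_tensorHom_assoc,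
      X.pre_s, ← tensorHom_comp_whiskerRight_assoc, ← associator_inv_naturality_assoc, ← j_pre,
      tensorHom_comp_whiskerLeft_assoc, ← j_compS, ← whiskerLeft_comp_tensorHom_assoc]
  post_s x n m m' := by
    apply j_whiskerRight_ext
    intro k
    rw [reassoc_of% (j_post X.prof Y.prof n k m m'), j_compS, whiskerLeft_comp_tensorHom_assoc,
      Y.post_s, ← tensorHom_comp_whiskerLeft_assoc, ← associator_naturality_assoc, ← j_post,
      tensorHom_comp_whiskerRight_assoc, ← j_compS, ← whiskerRight_comp_tensorHom_assoc]
  actR_s x x' n m := by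
    apply whiskerLeft_j_ext
    intro k
    rw [BraidedCategory.braiding_naturality_right_assoc, whiskerLeft_comp_tensorHom_assoc,
      whiskerRight_comp_tensorHom_assoc, j_compS, j_compS, ← tensorHom_comp_whiskerLeft_assoc,
      j_pre, associator_inv_naturality_assoc, tensorHom_comp_whiskerRight_assoc, X.actR_s,
      ← whiskerRight_comp_tensorHom_assoc, ← tensorHom_comp_whiskerRight_assoc, j_dinat,
      associator_naturality_assoc, tensorHom_comp_whiskerLeft_assoc, Y.actR_s,
      ← whiskerLeft_comp_tensorHom_assoc, ← tensorHom_comp_whiskerLeft_assoc,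
      ← tensorHom_comp_whiskerRight_assoc, j_post, associator_naturality_assoc,
      BraidedCategory.braiding_tensor_right_hom]
    simp only [Category.assoc, Iso.inv_hom_id_assoc]
  s_tensor x y n m := by
    apply j_ext
    intro k
    rw [reassoc_of% (j_compS X Y (x ⊗ y) n k m), j_mapRight, reassoc_of% (j_compS X Y y n k m),
      reassoc_of% (j_compS X Y x (y ⊙ₗ n) (y ⊙ₗ k) (y ⊙ₗ m)), j_mapLeft,
      tensorHom_comp_whiskerLeft_assoc, Y.s_tensor, tensorHom_comp_whiskerRight_assoc,
      tensorHom_comp_tensorHom_assoc, ← X.s_tensor, ← tensorHom_comp_whiskerRight_assoc,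
      mapRight_whiskerRight_j, tensorHom_comp_whiskerLeft_assoc, Category.assoc]
  s_unit n m := by
    apply j_ext
    intro k
    rw [reassoc_of% (j_compS X Y (𝟙_ C) n k m), j_mapRight, j_mapLeft,
      tensorHom_comp_whiskerLeft_assoc, Y.s_unit, ← X.s_unit, comp_whiskerRight, Category.assoc,
      mapRight_whiskerRight_j, MonoidalCategory.tensorHom_def, Category.assoc]

instance : MonoidalCategoryStruct (StrMod V C M) where
  tensorObj := compStr
  tensorUnit := idStr
  tensorHom {X X' Y Y'} f g := ⟨compMap f.hom g.hom, by
    intro x n m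
    apply j_ext
    intro k
    change j X.prof Y.prof n k m ≫ compS X Y x n m ≫ _ = _ ≫ _ ≫ compS X' Y' x n m
    rw [reassoc_of% (j_compS X Y x n k m), j_map, reassoc_of% (j_map f.hom g.hom n k m), j_compS,
      tensorHom_comp_tensorHom_assoc, tensorHom_comp_tensorHom_assoc, s_hom, s_hom]⟩
  whiskerLeft X {Y Y'} g := ⟨compMap (𝟙 X.prof) g.hom, by
    intro x n m
    apply j_ext
    intro k
    change j X.prof Y.prof n k m ≫ compS X Y x n m ≫ _ = _ ≫ _ ≫ compS X Y' x n m
    rw [reassoc_of% (j_compS X Y x n k m), j_map, reassoc_of% (j_map (𝟙 X.prof) g.hom n k m),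
      j_compS, tensorHom_comp_tensorHom_assoc, tensorHom_comp_tensorHom_assoc, s_hom, id_app,
      id_app, Category.comp_id, Category.id_comp]⟩
  whiskerRight {X X'} f Y := ⟨compMap f.hom (𝟙 Y.prof), by
    intro x n m
    apply j_ext
    intro k
    change j X.prof Y.prof n k m ≫ compS X Y x n m ≫ _ = _ ≫ _ ≫ compS X' Y x n m
    rw [reassoc_of% (j_compS X Y x n k m), j_map, reassoc_of% (j_map f.hom (𝟙 Y.prof) n k m),
      j_compS, tensorHom_comp_tensorHom_assoc, tensorHom_comp_tensorHom_assoc, s_hom, id_app,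
      id_app, Category.comp_id, Category.id_comp]⟩
  associator X Y Z := mkIso (assocIso X.prof Y.prof Z.prof) (by
    intro x n m
    apply j_j_ext
    intro k l
    have h1 := j_compS (compStr X Y) Z x n l m
    have h3 := j_compS X (compStr Y Z) x n k m
    rw [reassoc_of% h1, whiskerRight_comp_tensorHom_assoc, j_compS X Y x n k l,
      ← tensorHom_comp_whiskerRight_assoc, j_assocIso_hom, associator_naturality_assoc,
      reassoc_of% (j_assocIso_hom (H := X.prof) (G := Y.prof) (F := Z.prof) n k l m), h3,
      whiskerLeft_comp_tensorHom_assoc, j_compS Y Z x k l m, ← tensorHom_comp_whiskerLeft_assoc])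
  leftUnitor X := mkIso (leftUnitIso X.prof) (by
    intro x n m
    apply j_ext
    intro k
    have h1 := j_compS (idStr (V := V) (C := C) (M := M)) X x n k m
    rw [reassoc_of% h1, reassoc_of% (j_leftUnitIso_hom (F := X.prof) n k m), X.pre_s,
      j_leftUnitIso_hom])
  rightUnitor X := mkIso (rightUnitIso X.prof) (by
    intro x n m
    apply j_ext
    intro k
    have h1 := j_compS X (idStr (V := V) (C := C) (M := M)) x n k m
    rw [reassoc_of% h1, reassoc_of% (j_rightUnitIso_hom (F := X.prof) n m k), X.post_s,
      j_rightUnitIso_hom])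

/-- The forgetful functor preserves the monoidal structure strictly. -/
def forgetInducingData : Monoidal.InducingFunctorData (forget V C M) where
  μIso X Y := Iso.refl (comp X.prof Y.prof)
  εIso := Iso.refl (idProf V M)
  whiskerLeft_eq X Y Z f := ((Category.id_comp _).trans (Category.comp_id _)).symm
  whiskerRight_eq f X := ((Category.id_comp _).trans (Category.comp_id _)).symm
  tensorHom_eq f g := ((Category.id_comp _).trans (Category.comp_id _)).symm
  associator_eq X Y Z := by
    have h1 := MonoidalCategory.id_tensorHom_id (C := VProf V M M) (X.prof ⊗ Y.prof) Z.prof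
    have h2 := MonoidalCategory.id_tensorHom_id (C := VProf V M M) X.prof (Y.prof ⊗ Z.prof)
    refine Eq.symm (Eq.trans (congrArg₂ (fun a b => (𝟙 ((X.prof ⊗ Y.prof) ⊗ Z.prof) ≫ a) ≫
      (α_ X.prof Y.prof Z.prof).hom ≫ b ≫ 𝟙 (X.prof ⊗ (Y.prof ⊗ Z.prof))) h1 h2) ?_)
    simp only [Category.id_comp, Category.comp_id]
    rfl
  leftUnitor_eq X := by
    have h1 := MonoidalCategory.id_tensorHom_id (C := VProf V M M) (𝟙_ (VProf V M M)) X.prof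
    refine Eq.symm (Eq.trans (congrArg (fun a => (𝟙 (𝟙_ (VProf V M M) ⊗ X.prof) ≫ a) ≫
      (λ_ X.prof).hom) h1) ?_)
    simp only [Category.id_comp]
    rfl
  rightUnitor_eq X := by
    have h1 := MonoidalCategory.id_tensorHom_id (C := VProf V M M) X.prof (𝟙_ (VProf V M M))
    refine Eq.symm (Eq.trans (congrArg (fun a => (𝟙 (X.prof ⊗ 𝟙_ (VProf V M M)) ≫ a) ≫
      (ρ_ X.prof).hom) h1) ?_)
    simp only [Category.id_comp]
    rfl

instance : MonoidalCategory (StrMod V C M) :=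
  Monoidal.induced (forget V C M) forgetInducingData

instance : (forget V C M).Monoidal :=
  Monoidal.fromInducedMonoidal (forget V C M) forgetInducingData

end StrMod

end

end LaxModuleProf

namespace LaxModuleProf

noncomputable section

set_option linter.unusedSectionVars false

namespace VProf

/-! ### Morphisms out of composites with companions and conjoints -/

section Companion

variable {V : Type u} [Category.{v} V] [MonoidalCategory V] [SymmetricCategory V]
  [MonoidalClosed V] [HasColimits V]
  {A : Type v} [EnrichedCategory V A] {B : Type v} [EnrichedCategory V B]
  {X : Type v} [EnrichedCategory V X] (H : EnrichedFunctor V A B)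

/-- Restriction of a profunctor in the covariant variable, `(d, c) ↦ F(d, H c)`. -/
@[reducible] def restrictRight (F : VProf V B X) : VProf V A X where
  obj d c := F.obj d (H.obj c)
  pre d d' c := F.pre d d' (H.obj c)
  post d c c' := _ ◁ H.map c c' ≫ F.post _ _ _
  pre_id d c := F.pre_id d _
  pre_comp d d' d'' c := F.pre_comp d d' d'' _
  post_id := (F.restrict (EnrichedFunctor.id V X) H).post_id
  post_comp := (F.restrict (EnrichedFunctor.id V X) H).post_comp
  pre_post d d' c c' := by
    rw [← whisker_exchange_assoc, F.pre_post]
    simp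

/-- Restriction of a profunctor in the contravariant variable, `(d, c) ↦ F(H d, c)`. -/
@[reducible] def restrictLeft (F : VProf V X B) : VProf V X A where
  obj d c := F.obj (H.obj d) c
  pre d d' c := H.map d d' ▷ _ ≫ F.pre _ _ _
  post d c c' := F.post (H.obj d) c c'
  pre_id := (F.restrict H (EnrichedFunctor.id V X)).pre_id
  pre_comp := (F.restrict H (EnrichedFunctor.id V X)).pre_comp
  post_id d c := F.post_id _ c
  post_comp d c c' c'' := F.post_comp _ c c' c''
  pre_post d d' c c' := by
    rw [comp_whiskerRight, Category.assoc, F.pre_post, whisker_exchange_assoc]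
    simp

section

variable {G : VProf V X A} {K : VProf V X B}

/-- The restriction of a morphism out of a composite with a companion to the identities. -/
def companionRestrict (κ : comp (companion H) G ⟶ K) (a : A) (x : X) :
    G.obj a x ⟶ K.obj (H.obj a) x :=
  idLeft V (H.obj a) _ ≫ j (companion H) G (H.obj a) a x ≫ κ.app _ _

lemma j_companion_hom (κ : comp (companion H) G ⟶ K) (b : B) (a : A) (x : X) :
    j (companion H) G b a x ≫ κ.app b x =
      (b ⟶[V] H.obj a) ◁ companionRestrict H κ a x ≫ K.pre b (H.obj a) x := by
  have h := κ.pre_app b (H.obj a) x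
  rw [companionRestrict, MonoidalCategory.whiskerLeft_comp, MonoidalCategory.whiskerLeft_comp,
    Category.assoc, Category.assoc, ← h, reassoc_of% (j_pre (companion H) G b (H.obj a) a x),
    idLeft_idRight]
  have h1 := idRight_post (companion H) b a
  have h2 : idRight V (b ⟶[V] H.obj a) (H.obj a) ≫ (companion H).pre b (H.obj a) a = 𝟙 _ :=
    idRight_post (idProf V B) b (H.obj a)
  have h3 := congrArg (fun t => t ▷ G.obj a x ≫ j (companion H) G b a x ≫ κ.app b x) h2
  simp only [comp_whiskerRight, Category.assoc, id_whiskerRight, Category.id_comp] at h3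
  simp only [Category.assoc, Iso.hom_inv_id_assoc]
  exact h3.symm

lemma companionRestrict_pre (κ : comp (companion H) G ⟶ K) (a a' : A) (x : X) :
    G.pre a a' x ≫ companionRestrict H κ a x =
      (a ⟶[V] a') ◁ companionRestrict H κ a' x ≫ H.map a a' ▷ _ ≫ K.pre _ _ _ := by
  have h := j_dinat (companion H) G (H.obj a) a a' x
  have h1 := j_companion_hom H κ (H.obj a) a' x
  have h2 := idLeft_naturality (H.obj a) (G.pre a a' x)
  rw [companionRestrict, reassoc_of% h2, idLeft_tensor, Category.assoc, ← reassoc_of% h, h1]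
  have h3 : idLeft V (H.obj a) (a ⟶[V] a') ≫ (companion H).post (H.obj a) a a' = H.map a a' := by
    change _ ≫ _ ◁ H.map a a' ≫ _ = _
    rw [← reassoc_of% (idLeft_naturality (V := V) (H.obj a) (H.map a a'))]
    exact (congrArg (fun t => H.map a a' ≫ t) (idLeft_pre (idProf V B) _ _)).trans
      (Category.comp_id _)
  rw [← comp_whiskerRight_assoc, h3, whisker_exchange_assoc]

lemma companionRestrict_post (κ : comp (companion H) G ⟶ K) (a : A) (x x' : X) :
    G.post a x x' ≫ companionRestrict H κ a x' =
      companionRestrict H κ a x ▷ (x ⟶[V] x') ≫ K.post _ _ _ := by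
  have h2 := idLeft_naturality (H.obj a) (G.post a x x')
  rw [companionRestrict, reassoc_of% h2, companionRestrict]
  simp only [comp_whiskerRight, Category.assoc, ← κ.post_app]
  rw [reassoc_of% (j_post (companion H) G (H.obj a) a x x'), idLeft_tensor]
  simp

lemma companion_hom_ext {κ κ' : comp (companion H) G ⟶ K}
    (h : ∀ a x, companionRestrict H κ a x = companionRestrict H κ' a x) : κ = κ' := by
  ext b x
  apply j_ext
  intro a
  rw [j_companion_hom, j_companion_hom, h]

lemma companionDesc_dinat (t : ∀ a x, G.obj a x ⟶ K.obj (H.obj a) x)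
    (hpre : ∀ a a' x, G.pre a a' x ≫ t a x =
      (a ⟶[V] a') ◁ t a' x ≫ H.map a a' ▷ _ ≫ K.pre _ _ _) (b : B) (x : X) (a a' : A) :
    (companion H).post b a a' ▷ G.obj a' x ≫ (b ⟶[V] H.obj a') ◁ t a' x ≫ K.pre b (H.obj a') x =
      (α_ ((companion H).obj b a) (a ⟶[V] a') (G.obj a' x)).hom ≫
        (companion H).obj b a ◁ G.pre a a' x ≫ (b ⟶[V] H.obj a) ◁ t a x ≫ K.pre b (H.obj a) x := by
  change ((b ⟶[V] H.obj a) ◁ H.map a a' ≫ eComp V _ _ _) ▷ _ ≫ _ = _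
  rw [← MonoidalCategory.whiskerLeft_comp_assoc, hpre, comp_whiskerRight, Category.assoc,
    ← whisker_exchange_assoc, K.pre_comp]
  change _ = (α_ (b ⟶[V] H.obj a) (a ⟶[V] a') (G.obj a' x)).hom ≫ (b ⟶[V] H.obj a) ◁ _ ≫ _
  simp only [MonoidalCategory.whiskerLeft_comp, Category.assoc]
  rw [← associator_naturality_right_assoc, ← associator_naturality_middle_assoc,
    whisker_exchange_assoc]

/-- A morphism out of a composite with a companion. -/
def companionDesc (t : ∀ a x, G.obj a x ⟶ K.obj (H.obj a) x)
    (hpre : ∀ a a' x, G.pre a a' x ≫ t a x =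
      (a ⟶[V] a') ◁ t a' x ≫ H.map a a' ▷ _ ≫ K.pre _ _ _)
    (hpost : ∀ a x x', G.post a x x' ≫ t a x' = t a x ▷ (x ⟶[V] x') ≫ K.post _ _ _) :
    comp (companion H) G ⟶ K where
  app b x := desc (fun a => (b ⟶[V] H.obj a) ◁ t a x ≫ K.pre b (H.obj a) x)
    (companionDesc_dinat H t hpre b x)
  pre_app b b' x := by
    apply whiskerLeft_j_ext
    intro a
    rw [reassoc_of% (j_pre (companion H) G b b' a x), j_desc,
      ← MonoidalCategory.whiskerLeft_comp_assoc, j_desc, ← whisker_exchange_assoc]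
    change _ ≫ _ ≫ eComp V _ _ _ ▷ _ ≫ _ = _
    rw [K.pre_comp]
    simp
  post_app b x x' := by
    apply j_whiskerRight_ext
    intro a
    rw [reassoc_of% (j_post (companion H) G b a x x'), j_desc, ← comp_whiskerRight_assoc, j_desc,
      ← MonoidalCategory.whiskerLeft_comp_assoc, hpost, comp_whiskerRight, Category.assoc,
      K.pre_post]
    simp

lemma j_companionDesc (t : ∀ a x, G.obj a x ⟶ K.obj (H.obj a) x) (hpre) (hpost)
    (b : B) (a : A) (x : X) :
    j (companion H) G b a x ≫ (companionDesc H t hpre hpost).app b x =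
      (b ⟶[V] H.obj a) ◁ t a x ≫ K.pre b (H.obj a) x :=
  j_desc _ (companionDesc_dinat H t hpre b x) a

lemma companionRestrict_companionDesc (t : ∀ a x, G.obj a x ⟶ K.obj (H.obj a) x) (hpre) (hpost)
    (a : A) (x : X) : companionRestrict H (companionDesc H t hpre hpost) a x = t a x := by
  rw [companionRestrict, j_companionDesc, ← reassoc_of% (idLeft_naturality (H.obj a) (t a x)),
      idLeft_pre, Category.comp_id]

end

section

variable {G : VProf V A X} {K : VProf V B X}

/-- The restriction of a morphism out of a composite with a conjoint to the identities. -/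
def conjointRestrict (κ : comp G (conjoint H) ⟶ K) (x : X) (a : A) :
    G.obj x a ⟶ K.obj x (H.obj a) :=
  idRight V _ (H.obj a) ≫ j G (conjoint H) x a (H.obj a) ≫ κ.app _ _

lemma j_conjoint_hom (κ : comp G (conjoint H) ⟶ K) (x : X) (a : A) (b : B) :
    j G (conjoint H) x a b ≫ κ.app x b =
      conjointRestrict H κ x a ▷ (H.obj a ⟶[V] b) ≫ K.post x (H.obj a) b := by
  have h := κ.post_app x (H.obj a) b
  rw [conjointRestrict, comp_whiskerRight, comp_whiskerRight, Category.assoc, Category.assoc, ← h,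
    reassoc_of% (j_post G (conjoint H) x a (H.obj a) b)]
  have h2 : idLeft V (H.obj a) (H.obj a ⟶[V] b) ≫ (conjoint H).post a (H.obj a) b = 𝟙 _ :=
    idLeft_pre (idProf V B) (H.obj a) b
  have h3 := congrArg (fun t => G.obj x a ◁ t ≫ j G (conjoint H) x a b ≫ κ.app x b) h2
  simp only [MonoidalCategory.whiskerLeft_comp, Category.assoc, MonoidalCategory.whiskerLeft_id,
    Category.id_comp, idLeft_idRight] at h3
  exact h3.symm

lemma conjointRestrict_post (κ : comp G (conjoint H) ⟶ K) (x : X) (a a' : A) :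
    G.post x a a' ≫ conjointRestrict H κ x a' =
      conjointRestrict H κ x a ▷ (a ⟶[V] a') ≫ _ ◁ H.map a a' ≫ K.post _ _ _ := by
  have h := j_dinat G (conjoint H) x a a' (H.obj a')
  have h1 := j_conjoint_hom H κ x a (H.obj a')
  have h2 := idRight_naturality (H.obj a') (G.post x a a')
  rw [conjointRestrict, reassoc_of% h2, idRight_tensor, Category.assoc, reassoc_of% h,
    Iso.inv_hom_id_assoc, h1]
  have h3 : idRight V (a ⟶[V] a') (H.obj a') ≫ (conjoint H).pre a a' (H.obj a') = H.map a a' := by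
    change _ ≫ H.map a a' ▷ _ ≫ _ = _
    rw [← reassoc_of% (idRight_naturality (V := V) (H.obj a') (H.map a a'))]
    exact (congrArg (fun t => H.map a a' ≫ t) (idRight_post (idProf V B) _ _)).trans
      (Category.comp_id _)
  rw [← MonoidalCategory.whiskerLeft_comp_assoc, h3, whisker_exchange_assoc]

lemma conjointRestrict_pre (κ : comp G (conjoint H) ⟶ K) (x x' : X) (a : A) :
    G.pre x x' a ≫ conjointRestrict H κ x a =
      (x ⟶[V] x') ◁ conjointRestrict H κ x' a ≫ K.pre _ _ _ := by
  have h2 := idRight_naturality (H.obj a) (G.pre x x' a)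
  rw [conjointRestrict, reassoc_of% h2, conjointRestrict]
  simp only [MonoidalCategory.whiskerLeft_comp, Category.assoc, ← κ.pre_app]
  rw [reassoc_of% (j_pre G (conjoint H) x x' a (H.obj a)), idRight_tensor, Category.assoc]

lemma conjoint_hom_ext {κ κ' : comp G (conjoint H) ⟶ K}
    (h : ∀ x a, conjointRestrict H κ x a = conjointRestrict H κ' x a) : κ = κ' := by
  ext x b
  apply j_ext
  intro a
  rw [j_conjoint_hom, j_conjoint_hom, h]

lemma conjointDesc_dinat (t : ∀ x a, G.obj x a ⟶ K.obj x (H.obj a))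
    (hpost : ∀ x a a', G.post x a a' ≫ t x a' =
      t x a ▷ (a ⟶[V] a') ≫ _ ◁ H.map a a' ≫ K.post _ _ _) (x : X) (b : B) (a a' : A) :
    G.post x a a' ▷ (conjoint H).obj a' b ≫ t x a' ▷ (H.obj a' ⟶[V] b) ≫ K.post x (H.obj a') b =
      (α_ (G.obj x a) (a ⟶[V] a') ((conjoint H).obj a' b)).hom ≫
        G.obj x a ◁ (conjoint H).pre a a' b ≫ t x a ▷ (H.obj a ⟶[V] b) ≫ K.post x (H.obj a) b := by
  change _ = _ ≫ _ ◁ (H.map a a' ▷ (H.obj a' ⟶[V] b) ≫ eComp V _ _ _) ≫ _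
  rw [← comp_whiskerRight_assoc, hpost, comp_whiskerRight, comp_whiskerRight, Category.assoc,
    Category.assoc, ← K.post_comp, MonoidalCategory.whiskerLeft_comp, Category.assoc,
    whisker_exchange_assoc, whisker_exchange_assoc]
  simp

/-- A morphism out of a composite with a conjoint. -/
def conjointDesc (t : ∀ x a, G.obj x a ⟶ K.obj x (H.obj a))
    (hpre : ∀ x x' a, G.pre x x' a ≫ t x a = (x ⟶[V] x') ◁ t x' a ≫ K.pre _ _ _)
    (hpost : ∀ x a a', G.post x a a' ≫ t x a' =
      t x a ▷ (a ⟶[V] a') ≫ _ ◁ H.map a a' ≫ K.post _ _ _) :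
    comp G (conjoint H) ⟶ K where
  app x b := desc (fun a => t x a ▷ (H.obj a ⟶[V] b) ≫ K.post x (H.obj a) b)
    (conjointDesc_dinat H t hpost x b)
  post_app x b b' := by
    apply j_whiskerRight_ext
    intro a
    rw [reassoc_of% (j_post G (conjoint H) x a b b'), j_desc, ← comp_whiskerRight_assoc, j_desc,
      whisker_exchange_assoc]
    change _ ≫ _ ≫ _ ◁ eComp V _ _ _ ≫ _ = _
    rw [comp_whiskerRight, Category.assoc, ← K.post_comp]
    simp
  pre_app x x' b := by
    apply whiskerLeft_j_ext
    intro a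
    rw [reassoc_of% (j_pre G (conjoint H) x x' a b), j_desc,
      ← MonoidalCategory.whiskerLeft_comp_assoc, j_desc, ← comp_whiskerRight_assoc, hpre,
      comp_whiskerRight, Category.assoc, K.pre_post]
    simp

lemma j_conjointDesc (t : ∀ x a, G.obj x a ⟶ K.obj x (H.obj a)) (hpre) (hpost)
    (x : X) (a : A) (b : B) :
    j G (conjoint H) x a b ≫ (conjointDesc H t hpre hpost).app x b =
      t x a ▷ (H.obj a ⟶[V] b) ≫ K.post x (H.obj a) b :=
  j_desc _ (conjointDesc_dinat H t hpost x b) a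

lemma conjointRestrict_conjointDesc (t : ∀ x a, G.obj x a ⟶ K.obj x (H.obj a)) (hpre) (hpost)
    (x : X) (a : A) : conjointRestrict H (conjointDesc H t hpre hpost) x a = t x a := by
  rw [conjointRestrict, j_conjointDesc, ← reassoc_of% (idRight_naturality (H.obj a) (t x a)),
      idRight_post, Category.comp_id]

end

/-- Contraction of a companion, by the action of the hom objects. -/
def contractApp (F : VProf V B X) (x : X) (a : A) :
    (comp F (companion H)).obj x a ⟶ F.obj x (H.obj a) :=
  contract F H x a

lemma j_contractApp (F : VProf V B X) (x : X) (b : B) (a : A) :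
    j F (companion H) x b a ≫ contractApp H F x a = F.post x b (H.obj a) :=
  j_desc (G := F) (F := companion H) (fun d => F.post x d (H.obj a))
    (fun d d' => (F.post_comp x d d' (H.obj a)).symm) b

lemma contractApp_pre (F : VProf V B X) (x x' : X) (a : A) :
    (comp F (companion H)).pre x x' a ≫ contractApp H F x a =
      (x ⟶[V] x') ◁ contractApp H F x' a ≫ F.pre x x' (H.obj a) := by
  apply whiskerLeft_j_ext
  intro b
  rw [reassoc_of% (j_pre F (companion H) x x' b a),
    ← MonoidalCategory.whiskerLeft_comp_assoc, j_contractApp, j_contractApp]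
  exact (Iso.inv_comp_eq _).2 (F.pre_post _ _ _ _)

lemma contractApp_post (F : VProf V B X) (x : X) (a a' : A) :
    (comp F (companion H)).post x a a' ≫ contractApp H F x a' =
      contractApp H F x a ▷ (a ⟶[V] a') ≫ _ ◁ H.map a a' ≫ F.post x (H.obj a) (H.obj a') := by
  apply j_whiskerRight_ext
  intro b
  rw [reassoc_of% (j_post F (companion H) x b a a'), ← comp_whiskerRight_assoc,
    j_contractApp, j_contractApp]
  have h := F.post_comp x b (H.obj a) (H.obj a')
  change (α_ (F.obj x b) (b ⟶[V] H.obj a) (a ⟶[V] a')).hom ≫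
    F.obj x b ◁ ((b ⟶[V] H.obj a) ◁ H.map a a' ≫ eComp V _ _ _) ≫ F.post _ _ _ = _
  rw [← whisker_exchange_assoc, ← h]
  simp

/-- The inverse of the contraction of a companion. -/
def contractInvApp (F : VProf V B X) (x : X) (a : A) :
    F.obj x (H.obj a) ⟶ (comp F (companion H)).obj x a :=
  idRight V _ (H.obj a) ≫ j F (companion H) x (H.obj a) a

lemma contractApp_inv (F : VProf V B X) (x : X) (a : A) :
    contractApp H F x a ≫ contractInvApp H F x a = 𝟙 _ := by
  apply j_ext
  intro b
  have hd : F.post x b (H.obj a) ▷ (H.obj a ⟶[V] H.obj a) ≫ j F (companion H) x (H.obj a) a =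
      (α_ _ _ _).hom ≫ F.obj x b ◁ (companion H).pre b (H.obj a) a ≫ j F (companion H) x b a :=
    j_dinat F (companion H) x b (H.obj a) a
  rw [contractInvApp, reassoc_of% (j_contractApp H F x b a),
    reassoc_of% (idRight_naturality (H.obj a) (F.post x b (H.obj a))), idRight_tensor,
    Category.assoc, hd, Iso.inv_hom_id_assoc]
  have h : idRight V (b ⟶[V] H.obj a) (H.obj a) ≫ (companion H).pre b (H.obj a) a = 𝟙 _ :=
    idRight_post (idProf V B) b (H.obj a)
  have h' := congrArg (fun t => F.obj x b ◁ t ≫ j F (companion H) x b a) h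
  simp only [MonoidalCategory.whiskerLeft_comp, Category.assoc,
    MonoidalCategory.whiskerLeft_id, Category.id_comp] at h'
  exact h'.trans (Category.comp_id _).symm

lemma contractInvApp_contractApp (F : VProf V B X) (x : X) (a : A) :
    contractInvApp H F x a ≫ contractApp H F x a = 𝟙 _ := by
  rw [contractInvApp, Category.assoc, j_contractApp, idRight_post]

/-- Contraction of a companion is an isomorphism. -/
def contractIso (F : VProf V B X) : comp F (companion H) ≅ restrictRight H F :=
  isoOfComponents
    { app := contractApp H F
      pre_app := contractApp_pre H F
      post_app := contractApp_post H F }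
    (contractInvApp H F) (contractApp_inv H F) (contractInvApp_contractApp H F)

end Companion

end VProf

end

end LaxModuleProf

namespace LaxModuleProf

noncomputable section

set_option linter.unusedSectionVars false

open VProf

/-! ### Strengths as morphisms of profunctors -/

namespace VProf

variable {V : Type u} [Category.{v} V] [MonoidalCategory V] [SymmetricCategory V]
  {C : Type v} [EnrichedCategory V C] {D : Type v} [EnrichedCategory V D] (F : VProf V C D)

lemma eComp_tensor_pre (a b d e : D) (c : C) :
    (eComp V a b d ⊗ₘ F.pre d e c) ≫ F.pre a d c =
      (α_ _ _ _).hom ≫ _ ◁ ((α_ _ _ _).inv ≫ eComp V b d e ▷ _ ≫ F.pre b e c) ≫ F.pre a b c := by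
  rw [MonoidalCategory.tensorHom_def', Category.assoc, F.pre_comp, F.pre_comp,
    Iso.inv_hom_id_assoc, associator_naturality_right_assoc, MonoidalCategory.whiskerLeft_comp,
    Category.assoc]

lemma eComp_tensor_post (a b d : D) (c c' : C) :
    (eComp V a b d ⊗ₘ F.post d c c') ≫ F.pre a d c' =
      (α_ _ _ _).hom ≫ _ ◁ ((α_ _ _ _).inv ≫ F.pre b d c ▷ _ ≫ F.post b c c') ≫
        F.pre a b c' := by
  rw [MonoidalCategory.tensorHom_def', Category.assoc, F.pre_comp, F.pre_post,
    Iso.inv_hom_id_assoc, associator_naturality_right_assoc, MonoidalCategory.whiskerLeft_comp,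
    Category.assoc]

lemma pre_tensor_eComp (a b : D) (c c' c'' : C) :
    (F.pre a b c ⊗ₘ eComp V c c' c'') ≫ F.post a c c'' =
      (α_ _ _ _).hom ≫ _ ◁ ((α_ _ _ _).inv ≫ F.post b c c' ▷ _ ≫ F.post b c' c'') ≫
        F.pre a b c'' := by
  rw [MonoidalCategory.tensorHom_def', Category.assoc, F.pre_post, ← F.post_comp,
    Iso.inv_hom_id_assoc, associator_naturality_right_assoc, MonoidalCategory.whiskerLeft_comp,
    Category.assoc]

lemma tensor_eComp_pre {a b d e : D} {c : C} {X Y Z W : V} (f : X ⟶ (a ⟶[V] b))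
    (g : Y ⟶ (b ⟶[V] d)) (h : Z ⟶ (d ⟶[V] e)) (k : W ⟶ F.obj e c) :
    ((f ⊗ₘ g) ≫ eComp V a b d ⊗ₘ (h ⊗ₘ k) ≫ F.pre d e c) ≫ F.pre a d c =
      (α_ _ _ _).hom ≫ (f ⊗ₘ ((α_ _ _ _).inv ≫ ((g ⊗ₘ h) ≫ eComp V b d e ⊗ₘ k) ≫
        F.pre b e c)) ≫ F.pre a b c := by
  rw [← tensorHom_comp_tensorHom_assoc, eComp_tensor_pre, associator_naturality_assoc,
    tensorHom_comp_whiskerLeft_assoc, associator_inv_naturality_assoc,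
    tensorHom_comp_whiskerRight_assoc]

lemma tensor_eComp_post {a b d : D} {c c' : C} {X Y Z W : V} (f : X ⟶ (a ⟶[V] b))
    (g : Y ⟶ (b ⟶[V] d)) (h : Z ⟶ F.obj d c) (k : W ⟶ (c ⟶[V] c')) :
    ((f ⊗ₘ g) ≫ eComp V a b d ⊗ₘ (h ⊗ₘ k) ≫ F.post d c c') ≫ F.pre a d c' =
      (α_ _ _ _).hom ≫ (f ⊗ₘ ((α_ _ _ _).inv ≫ ((g ⊗ₘ h) ≫ F.pre b d c ⊗ₘ k) ≫
        F.post b c c')) ≫ F.pre a b c' := by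
  rw [← tensorHom_comp_tensorHom_assoc, eComp_tensor_post, associator_naturality_assoc,
    tensorHom_comp_whiskerLeft_assoc, associator_inv_naturality_assoc,
    tensorHom_comp_whiskerRight_assoc]

lemma tensor_pre_eComp {a b : D} {c c' c'' : C} {X Y Z W : V} (f : X ⟶ (a ⟶[V] b))
    (g : Y ⟶ F.obj b c) (h : Z ⟶ (c ⟶[V] c')) (k : W ⟶ (c' ⟶[V] c'')) :
    ((f ⊗ₘ g) ≫ F.pre a b c ⊗ₘ (h ⊗ₘ k) ≫ eComp V c c' c'') ≫ F.post a c c'' =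
      (α_ _ _ _).hom ≫ (f ⊗ₘ ((α_ _ _ _).inv ≫ ((g ⊗ₘ h) ≫ F.post b c c' ⊗ₘ k) ≫
        F.post b c' c'')) ≫ F.pre a b c'' := by
  rw [← tensorHom_comp_tensorHom_assoc, pre_tensor_eComp, associator_naturality_assoc,
    tensorHom_comp_whiskerLeft_assoc, associator_inv_naturality_assoc,
    tensorHom_comp_whiskerRight_assoc]

end VProf

section Strength

variable {V : Type u} [Category.{v} V] [MonoidalCategory V] [SymmetricCategory V]

lemma tensorμ_associator {X Y Z W T A B : V} (f : X ⟶ A) (q : (Z ⊗ Y) ⊗ W ⟶ B)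
    (p : A ⊗ B ⟶ T) :
    tensorμ X Y Z W ≫ (α_ _ _ _).hom ≫ (f ⊗ₘ ((α_ _ _ _).inv ≫ q)) ≫ p =
      (α_ _ _ _).hom ≫ (f ⊗ₘ ((α_ _ _ _).inv ≫ (β_ _ _).hom ▷ W ≫ q)) ≫ p := by
  rw [← whiskerLeft_comp_tensorHom_assoc, tensorμ]
  simp only [Category.assoc, Iso.inv_hom_id_assoc]
  rw [whiskerLeft_hom_inv_assoc, whiskerLeft_comp_tensorHom_assoc, whiskerLeft_comp_tensorHom_assoc]

variable {C : Type v} [Category.{v} C] [MonoidalCategory C] [EnrichedOrdinaryCategory V C]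
  [MonoidalEnriched V C]
  {M : Type v} [Category.{v} M] [EnrichedOrdinaryCategory V M] [MonoidalLeftAction C M]
  [ModuleEnriched V C M]

/-- Compatibility of maps `F(n, m) ⟶ G(x ⊙ n, x ⊙ m)` with the actions of hom objects. -/
structure IsStrength (F G : VProf V M M)
    (s : ∀ (x : C) (n m : M), F.obj n m ⟶ G.obj (x ⊙ₗ n) (x ⊙ₗ m)) : Prop where
  pre_s (x : C) (n n' m : M) :
    F.pre n n' m ≫ s x n m = (actL V x n n' ⊗ₘ s x n' m) ≫ G.pre _ _ _
  post_s (x : C) (n m m' : M) :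
    F.post n m m' ≫ s x n m' = (s x n m ⊗ₘ actL V x m m') ≫ G.post _ _ _
  actR_s (x x' : C) (n m : M) :
    (actR V x x' n ⊗ₘ s x' n m) ≫ G.pre _ _ _ =
      (β_ _ _).hom ≫ (s x n m ⊗ₘ actR V x x' m) ≫ G.post _ _ _

lemma StrMod.isStrength (X : StrMod V C M) : IsStrength X.prof X.prof X.s :=
  ⟨X.pre_s, X.post_s, X.actR_s⟩

variable {F G : VProf V M M}

/-- The morphism of profunctors given by a strength. -/
def strHom (s : ∀ (x : C) (n m : M), F.obj n m ⟶ G.obj (x ⊙ₗ n) (x ⊙ₗ m))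
    (hs : IsStrength F G s) :
    tens (idProf V C) F ⟶ G.restrict (actFunctor V C M) (actFunctor V C M) where
  app p q := (actR V p.1 q.1 p.2 ⊗ₘ s q.1 p.2 q.2) ≫ G.pre (p.1 ⊙ₗ p.2) (q.1 ⊙ₗ p.2) (q.1 ⊙ₗ q.2)
  pre_app := by
    rintro ⟨x, n⟩ ⟨x', n'⟩ ⟨y, m⟩
    change (tensorμ _ _ _ _ ≫ (eComp V x x' y ⊗ₘ F.pre n n' m)) ≫ (actR V x y n ⊗ₘ s y n m) ≫
        G.pre _ _ _ =
      ((x ⟶[V] x') ⊗ (n ⟶[V] n')) ◁ ((actR V x' y n' ⊗ₘ s y n' m) ≫ G.pre _ _ _) ≫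
        ModuleEnriched.actE x x' n n' ▷ _ ≫ G.pre _ _ _
    have h : (β_ (n ⟶[V] n') (x' ⟶[V] y)).hom ≫ (actR V x' y n ⊗ₘ actL V y n n') ≫ eComp V _ _ _ =
        (actL V x' n n' ⊗ₘ actR V x' y n') ≫ eComp V _ _ _ := by
      rw [actR_actL, actL_actR]
    rw [Category.assoc, tensorHom_comp_tensorHom_assoc, eComp_actR, hs.pre_s,
      tensor_eComp_pre, tensorμ_associator, whiskerRight_comp_tensorHom_assoc, h,
      whisker_exchange_assoc, ← actR_actL, ← MonoidalCategory.tensorHom_def_assoc,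
      tensor_eComp_pre]
  post_app := by
    rintro ⟨x, n⟩ ⟨y, m⟩ ⟨y', m'⟩
    change (tensorμ _ _ _ _ ≫ (eComp V x y y' ⊗ₘ F.post n m m')) ≫ (actR V x y' n ⊗ₘ s y' n m') ≫
        G.pre _ _ _ =
      ((actR V x y n ⊗ₘ s y n m) ≫ G.pre _ _ _) ▷ ((y ⟶[V] y') ⊗ (m ⟶[V] m')) ≫
        _ ◁ ModuleEnriched.actE y y' m m' ≫ G.post _ _ _
    rw [Category.assoc, tensorHom_comp_tensorHom_assoc, eComp_actR, hs.post_s,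
      tensor_eComp_post, tensorμ_associator, whiskerRight_comp_tensorHom_assoc, hs.actR_s,
      SymmetricCategory.symmetry_assoc, ← actR_actL, ← MonoidalCategory.tensorHom_def_assoc,
      tensor_pre_eComp]

section

variable (σ : tens (idProf V C) F ⟶ G.restrict (actFunctor V C M) (actFunctor V C M))

/-- The components of a morphism `Id_C ⊗ F ⟶ G(- ⊙ -, - ⊙ -)`. -/
def actApp (x y : C) (n m : M) : (x ⟶[V] y) ⊗ F.obj n m ⟶ G.obj (x ⊙ₗ n) (y ⊙ₗ m) :=
  σ.app (x, n) (y, m)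

lemma actApp_pre (x x' y : C) (n n' m : M) :
    tensorμ _ _ _ _ ≫ (eComp V x x' y ⊗ₘ F.pre n n' m) ≫ actApp σ x y n m =
      (ModuleEnriched.actE x x' n n' ⊗ₘ actApp σ x' y n' m) ≫ G.pre _ _ _ := by
  have h := σ.pre_app (x, n) (x', n') (y, m)
  rw [MonoidalCategory.tensorHom_def' (ModuleEnriched.actE x x' n n'), Category.assoc]
  exact (Category.assoc _ _ _).symm.trans h

lemma actApp_post (x y y' : C) (n m m' : M) :
    tensorμ _ _ _ _ ≫ (eComp V x y y' ⊗ₘ F.post n m m') ≫ actApp σ x y' n m' =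
      (actApp σ x y n m ⊗ₘ ModuleEnriched.actE y y' m m') ≫ G.post _ _ _ := by
  have h := σ.post_app (x, n) (y, m) (y', m')
  rw [MonoidalCategory.tensorHom_def (actApp σ x y n m), Category.assoc]
  exact (Category.assoc _ _ _).symm.trans h

/-- The strength given by a morphism of profunctors. -/
def homS (x : C) (n m : M) : F.obj n m ⟶ G.obj (x ⊙ₗ n) (x ⊙ₗ m) :=
  idLeft V x _ ≫ actApp σ x x n m

lemma homS_app (x y : C) (n m : M) :
    (actR V x y n ⊗ₘ homS σ y n m) ≫ G.pre _ _ _ = actApp σ x y n m := by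
  have k := insert_exchange' (eId V n) (eId V y) (eComp V x y y) (F.pre n n m)
    (whiskerLeft_eId_eComp V x y) (F.pre_id n m)
  rw [homS, actR, ← tensorHom_comp_tensorHom_assoc, ← actApp_pre, idRight, idLeft, reassoc_of% k]

lemma homS_app' (x y : C) (n m : M) :
    (β_ _ _).hom ≫ (homS σ x n m ⊗ₘ actR V x y m) ≫ G.post _ _ _ = actApp σ x y n m := by
  have k := insert_exchange (eId V x) (eId V m) (eComp V x x y) (F.post n m m)
    (eId_whiskerRight_eComp V x y) (F.post_id n m)
  rw [homS, actR, ← tensorHom_comp_tensorHom_assoc, ← actApp_post, idRight, idLeft,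
    reassoc_of% k, SymmetricCategory.symmetry_assoc]

lemma isStrength_homS : IsStrength F G (homS σ) where
  pre_s x n n' m := by
    have k := insert_left_comp (F.pre n n' m) (eId V x) (eComp V x x x)
      (eId_whiskerRight_eComp V x x)
    rw [homS, homS, actL, ← tensorHom_comp_tensorHom_assoc, ← actApp_pre, idLeft, idLeft, idLeft]
    simpa only [Category.assoc] using congrArg (fun t => t ≫ actApp σ x x n m) k
  post_s x n m m' := by
    have k := insert_left_comp (F.post n m m') (eId V x) (eComp V x x x)
      (eId_whiskerRight_eComp V x x)
    rw [homS, homS, actL, ← tensorHom_comp_tensorHom_assoc, ← actApp_post, idLeft, idLeft, idLeft]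
    simpa only [Category.assoc] using congrArg (fun t => t ≫ actApp σ x x n m') k
  actR_s x y n m := (homS_app σ x y n m).trans (by rw [← homS_app' σ x y n m])

end

lemma homS_strHom (s : ∀ (x : C) (n m : M), F.obj n m ⟶ G.obj (x ⊙ₗ n) (x ⊙ₗ m))
    (hs : IsStrength F G s) (x : C) (n m : M) : homS (strHom s hs) x n m = s x n m := by
  change idLeft V x _ ≫ (actR V x x n ⊗ₘ s x n m) ≫ _ = _
  rw [MonoidalCategory.tensorHom_def', Category.assoc, ← reassoc_of% (idLeft_naturality x),
    idLeft, Category.assoc, ← comp_whiskerRight_assoc, eId_comp_actR, G.pre_id, Iso.inv_hom_id,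
    Category.comp_id]

lemma str_hom_ext {σ τ : tens (idProf V C) F ⟶ G.restrict (actFunctor V C M) (actFunctor V C M)}
    (h : ∀ x n m, homS σ x n m = homS τ x n m) : σ = τ := by
  ext ⟨x, n⟩ ⟨y, m⟩
  change actApp σ x y n m = actApp τ x y n m
  rw [← homS_app, ← homS_app, h]

end Strength

end

end LaxModuleProf

namespace LaxModuleProf

noncomputable section

set_option linter.unusedSectionVars false

open VProf

/-! ### Lax module profunctors and strengths -/

section LaxStrength

variable {V : Type u} [Category.{v} V] [MonoidalCategory V] [SymmetricCategory V]

section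

variable {C : Type v} [Category.{v} C] [MonoidalCategory C] [EnrichedOrdinaryCategory V C]
  [MonoidalEnriched V C]
  {M : Type v} [Category.{v} M] [EnrichedOrdinaryCategory V M] [MonoidalLeftAction C M]
  [ModuleEnriched V C M]

lemma actComp_pre (F : VProf V M M) (x y : C) (n n₁ n₂ m : M) :
    (α_ _ _ _).inv ≫ actComp V x y n n₁ n₂ ▷ F.obj _ m ≫ F.pre n ((x ⊗ y) ⊙ₗ n₂) m =
      _ ◁ (actL V x n₁ (y ⊙ₗ n₂) ▷ _ ≫ _ ◁ F.mapLeft (αₗ x y n₂).inv m ≫ F.pre _ _ m) ≫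
        F.pre n (x ⊙ₗ n₁) m := by
  rw [actComp, comp_whiskerRight, comp_whiskerRight, Category.assoc, Category.assoc,
    ← F.whiskerLeft_mapLeft_pre, ← whisker_exchange_assoc, F.pre_comp]
  simp only [MonoidalCategory.whiskerLeft_comp, Category.assoc, tensor_whiskerLeft]
  simp

lemma coactComp_post (F : VProf V M M) (x y : C) (k n n₁ n₂ : M) :
    (α_ _ _ _).hom ≫ F.obj k _ ◁ coactComp V x y n n₁ n₂ ≫ F.post k ((x ⊗ y) ⊙ₗ n₂) n =
      (_ ◁ actL V x (y ⊙ₗ n₂) n₁ ≫ F.mapRight k (αₗ x y n₂).hom ▷ _ ≫ F.post k _ _) ▷ _ ≫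
        F.post k (x ⊙ₗ n₁) n := by
  rw [coactComp, MonoidalCategory.whiskerLeft_comp, MonoidalCategory.whiskerLeft_comp,
    Category.assoc, Category.assoc, ← F.mapRight_whiskerRight_post, whisker_exchange_assoc,
    comp_whiskerRight, comp_whiskerRight, Category.assoc, Category.assoc, ← F.post_comp,
    whiskerRight_tensor]
  simp

variable (F : VProf V M M) (s : ∀ (x : C) (n m : M), F.obj n m ⟶ F.obj (x ⊙ₗ n) (x ⊙ₗ m))

/-- Compatibility of a strength with the tensor product of `C`. -/
def TensorCompat : Prop := ∀ (x y : C) (n m : M),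
  s (x ⊗ y) n m ≫ F.mapRight _ (αₗ x y m).hom =
    s y n m ≫ s x _ _ ≫ F.mapLeft (αₗ x y n).hom _

/-- Compatibility of a strength with the unit of `C`. -/
def UnitCompat : Prop := ∀ n m : M,
  s (𝟙_ C) n m ≫ F.mapRight _ (λₗ m).hom = F.mapLeft (λₗ n).hom m

lemma mapRight_hom_inv {D : Type v} [EnrichedCategory V D] (K : VProf V M D) (d : D) {m m' : M}
    (e : m ≅ m') : K.mapRight d e.hom ≫ K.mapRight d e.inv = 𝟙 _ := by
  rw [← mapRight_comp, e.hom_inv_id, mapRight_id]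

lemma mapRight_inv_hom {D : Type v} [EnrichedCategory V D] (K : VProf V M D) (d : D) {m m' : M}
    (e : m ≅ m') : K.mapRight d e.inv ≫ K.mapRight d e.hom = 𝟙 _ := by
  rw [← mapRight_comp, e.inv_hom_id, mapRight_id]

lemma mapLeft_hom_inv {D : Type v} [EnrichedCategory V D] (K : VProf V D M) (d : D) {m m' : M}
    (e : m ≅ m') : K.mapLeft e.hom d ≫ K.mapLeft e.inv d = 𝟙 _ := by
  rw [← mapLeft_comp, e.inv_hom_id, mapLeft_id]

lemma mapLeft_inv_hom {D : Type v} [EnrichedCategory V D] (K : VProf V D M) (d : D) {m m' : M}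
    (e : m ≅ m') : K.mapLeft e.inv d ≫ K.mapLeft e.hom d = 𝟙 _ := by
  rw [← mapLeft_comp, e.hom_inv_id, mapLeft_id]

lemma tensorCompat_iff_mapLeft : TensorCompat F s ↔ ∀ (x y : C) (n m : M),
    s (x ⊗ y) n m ≫ F.mapLeft (αₗ x y n).inv _ =
      s y n m ≫ s x _ _ ≫ F.mapRight _ (αₗ x y m).inv := by
  refine forall₄_congr fun x y n m => ⟨fun h => ?_, fun h => ?_⟩
  · have h' := congrArg (fun t => t ≫ F.mapLeft (αₗ x y n).inv _ ≫
      F.mapRight _ (αₗ x y m).inv) h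
    simp only [Category.assoc] at h'
    rw [reassoc_of% (mapLeft_hom_inv F (x ⊙ₗ (y ⊙ₗ m)) (αₗ x y n)), F.mapLeft_mapRight,
      reassoc_of% (mapRight_hom_inv F _ (αₗ x y m))] at h'
    exact h'
  · have h' := congrArg (fun t => t ≫ F.mapLeft (αₗ x y n).hom _ ≫
      F.mapRight _ (αₗ x y m).hom) h
    simp only [Category.assoc] at h'
    rw [reassoc_of% (mapLeft_inv_hom F ((x ⊗ y) ⊙ₗ m) (αₗ x y n)), F.mapLeft_mapRight,
      reassoc_of% (mapRight_inv_hom F _ (αₗ x y m))] at h'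
    exact h'

lemma tensorCompat_iff_conj : TensorCompat F s ↔ ∀ (x y : C) (n m : M),
    s (x ⊗ y) n m ≫ F.mapRight _ (αₗ x y m).hom ≫ F.mapLeft (αₗ x y n).inv _ =
      s y n m ≫ s x _ _ := by
  refine forall₄_congr fun x y n m => ⟨fun h => ?_, fun h => ?_⟩
  · rw [reassoc_of% h, mapLeft_hom_inv, Category.comp_id]
  · rw [← reassoc_of% h, mapLeft_inv_hom, Category.comp_id]

lemma unitCompat_iff_conj : UnitCompat F s ↔ ∀ n m : M,
    s (𝟙_ C) n m ≫ F.mapRight _ (λₗ m).hom ≫ F.mapLeft (λₗ n).inv _ = 𝟙 _ := by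
  refine forall₂_congr fun n _ => ⟨fun h => ?_, fun h => ?_⟩
  · rw [reassoc_of% h, mapLeft_hom_inv]
  · have h' := congrArg (fun t => t ≫ F.mapLeft (λₗ[C] n).hom _) h
    simp only [Category.assoc, mapLeft_inv_hom, Category.comp_id, Category.id_comp] at h'
    exact h'

lemma left_action_injective {X : V} {n' m : M} {f g : X ⟶ F.obj n' m}
    (h : ∀ n, (n ⟶[V] n') ◁ f ≫ F.pre n n' m = (n ⟶[V] n') ◁ g ≫ F.pre n n' m) : f = g := by
  have h' := congrArg (fun t => idLeft V n' X ≫ t) (h n')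
  simp only [← reassoc_of% (idLeft_naturality (V := V) n'), idLeft_pre, Category.comp_id] at h'
  exact h'

lemma idLeft_actL (x : C) (n : M) (X : V) :
    idLeft V n X ≫ actL V x n n ▷ X = idLeft V (x ⊙ₗ n) X := by
  rw [idLeft, Category.assoc, ← comp_whiskerRight, eId_comp_actL, idLeft]

lemma idRight_actL (x : C) (n : M) (X : V) :
    idRight V X n ≫ X ◁ actL V x n n = idRight V X (x ⊙ₗ n) := by
  rw [idRight, Category.assoc, ← MonoidalCategory.whiskerLeft_comp, eId_comp_actL, idRight]

lemma actL_left_injective {X : V} {x : C} {n m : M} {f g : X ⟶ F.obj (x ⊙ₗ n) m}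
    (h : actL V x n n ▷ _ ≫ _ ◁ f ≫ F.pre _ _ m = actL V x n n ▷ _ ≫ _ ◁ g ≫ F.pre _ _ m) :
    f = g := by
  have h' := congrArg (fun t => idLeft V n X ≫ t) h
  simp only [reassoc_of% (idLeft_actL (V := V) x n X),
    ← reassoc_of% (idLeft_naturality (V := V) (x ⊙ₗ n)), idLeft_pre, Category.comp_id] at h'
  exact h'

lemma companion_strength_assoc {s} (hs : IsStrength F F s) (x y : C) (n n₁ n₂ m : M) :
    _ ◁ (_ ◁ s y n₂ m ≫ F.pre n₁ (y ⊙ₗ n₂) _) ≫ _ ◁ s x n₁ _ ≫ F.pre n (x ⊙ₗ n₁) _ =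
      _ ◁ (actL V x n₁ (y ⊙ₗ n₂) ▷ _ ≫ _ ◁ (s y n₂ m ≫ s x _ _) ≫ F.pre _ _ _) ≫
        F.pre n (x ⊙ₗ n₁) _ := by
  rw [← MonoidalCategory.whiskerLeft_comp_assoc, Category.assoc, hs.pre_s,
    MonoidalCategory.tensorHom_def, Category.assoc, whisker_exchange_assoc,
    MonoidalCategory.whiskerLeft_comp, Category.assoc]
  simp only [MonoidalCategory.whiskerLeft_comp, Category.assoc]

end

variable [MonoidalClosed V] [HasColimits V]
  {C : Type v} [Category.{v} C] [MonoidalCategory C] [EnrichedOrdinaryCategory V C]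
  [MonoidalEnriched V C]
  {M : Type v} [Category.{v} M] [EnrichedOrdinaryCategory V M] [MonoidalLeftAction C M]
  [ModuleEnriched V C M]

variable {F G : VProf V M M}

/-- The morphism of profunctors given by a lax structure. -/
def laxSigma (β : laxDom C F ⟶ laxCod C G) :
    tens (idProf V C) F ⟶ G.restrict (actFunctor V C M) (actFunctor V C M) where
  app p q := companionRestrict (actFunctor V C M)
    (β ≫ (contractIso (actFunctor V C M) G).hom) p q
  pre_app p p' q := companionRestrict_pre (actFunctor V C M)
    (β ≫ (contractIso (actFunctor V C M) G).hom) p p' q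
  post_app p q q' := companionRestrict_post (actFunctor V C M)
    (β ≫ (contractIso (actFunctor V C M) G).hom) p q q'

/-- The strength given by a lax structure. -/
def laxS (β : laxDom C F ⟶ laxCod C G) (x : C) (n m : M) :
    F.obj n m ⟶ G.obj (x ⊙ₗ n) (x ⊙ₗ m) :=
  homS (laxSigma β) x n m

lemma isStrength_laxS (β : laxDom C F ⟶ laxCod C G) : IsStrength F G (laxS β) :=
  isStrength_homS _

lemma lax_hom_ext {β β' : laxDom C F ⟶ laxCod C G} (h : ∀ x n m, laxS β x n m = laxS β' x n m) :
    β = β' := by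
  have h1 : laxSigma β = laxSigma β' := str_hom_ext h
  rw [← cancel_mono (contractIso (actFunctor V C M) G).hom]
  apply companion_hom_ext
  intro p q
  exact congrArg (fun t => VProf.Hom.app t p q) h1

/-- The lax structure given by a strength. -/
def laxOfStrength (s : ∀ (x : C) (n m : M), F.obj n m ⟶ G.obj (x ⊙ₗ n) (x ⊙ₗ m))
    (hs : IsStrength F G s) : laxDom C F ⟶ laxCod C G :=
  companionDesc (actFunctor V C M) (K := restrictRight (actFunctor V C M) G)
    (strHom s hs).app (strHom s hs).pre_app (strHom s hs).post_app ≫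
        (contractIso (actFunctor V C M) G).inv

lemma laxS_laxOfStrength (s : ∀ (x : C) (n m : M), F.obj n m ⟶ G.obj (x ⊙ₗ n) (x ⊙ₗ m))
    (hs : IsStrength F G s) (x : C) (n m : M) : laxS (laxOfStrength s hs) x n m = s x n m := by
  have h : laxSigma (laxOfStrength s hs) = strHom s hs := by
    ext p q
    change companionRestrict (actFunctor V C M) ((_ ≫ (contractIso (actFunctor V C M) G).inv) ≫
      (contractIso (actFunctor V C M) G).hom) p q = _
    rw [Category.assoc, Iso.inv_hom_id, Category.comp_id, companionRestrict_companionDesc]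
  rw [laxS, h, homS_strHom]

lemma laxS_eq (β : laxDom C F ⟶ laxCod C G) (x : C) (n m : M) :
    laxS β x n m = idLeft V x _ ≫ idLeft V (x ⊙ₗ n) _ ≫
      j (companion (actFunctor V C M)) (tens (idProf V C) F) (x ⊙ₗ n) (x, n) (x, m) ≫
      β.app (x ⊙ₗ n) (x, m) ≫ contractApp (actFunctor V C M) G (x ⊙ₗ n) (x, m) := rfl

lemma laxComponent_eq (β : laxDom C F ⟶ laxCod C F) (x : C) (n n₁ m : M) :
    laxComponent β x n n₁ m = _ ◁ laxS β x n₁ m ≫ F.pre n (x ⊙ₗ n₁) (x ⊙ₗ m) := by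
  have h := j_companion_hom (actFunctor V C M)
    (β ≫ (contractIso (actFunctor V C M) F).hom) n (x, n₁) (x, m)
  rw [laxS, homS, MonoidalCategory.whiskerLeft_comp, Category.assoc]
  exact congrArg (fun t => (n ⟶[V] (x ⊙ₗ n₁)) ◁ idLeft V x (F.obj n₁ m) ≫ t) h

lemma contractApp_naturality {F G : VProf V M M} (f : F ⟶ G) (n : M) (p : C × M) :
    (compMap f (𝟙 (companion (actFunctor V C M)))).app n p ≫ contractApp (actFunctor V C M) G n p =
      contractApp (actFunctor V C M) F n p ≫ f.app n (p.1 ⊙ₗ p.2) := by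
  apply j_ext
  intro b
  have h := j_contractApp (actFunctor V C M) F n b p
  rw [reassoc_of% (j_map f (𝟙 (companion (actFunctor V C M))) n b p), j_contractApp, reassoc_of% h,
    id_app, tensorHom_id]
  exact (f.post_app _ _ _).symm

lemma laxS_comp_laxCodMap {H : VProf V M M} (β : laxDom C F ⟶ laxCod C G) (f : G ⟶ H) (x : C)
    (n m : M) : laxS (β ≫ laxCodMap C f) x n m = laxS β x n m ≫ f.app _ _ := by
  have h := contractApp_naturality (C := C) f (x ⊙ₗ n) (x, m)
  rw [laxS_eq, laxS_eq]
  simp only [Category.assoc, comp_app, ← h]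
  rfl

lemma laxS_laxDomMap_comp {H : VProf V M M} (f : H ⟶ F) (β : laxDom C F ⟶ laxCod C G) (x : C)
    (n m : M) : laxS (laxDomMap C f ≫ β) x n m = f.app _ _ ≫ laxS β x n m := by
  have h := j_map (𝟙 (companion (actFunctor V C M))) (tensMap (𝟙 (idProf V C)) f) (x ⊙ₗ n)
    (x, n) (x, m)
  have h2 : (tensMap (𝟙 (idProf V C)) f).app (x, n) (x, m) = _ ◁ f.app n m := id_tensorHom _ _
  rw [h2, id_app, id_tensorHom] at h
  rw [laxS_eq, laxS_eq, comp_app, laxDomMap]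
  simp only [Category.assoc]
  rw [reassoc_of% h, ← reassoc_of% (idLeft_naturality (V := V) (x ⊙ₗ n)),
    reassoc_of% (idLeft_naturality x (f.app n m))]

lemma lax_comm_iff {F G : VProf V M M} (β : laxDom C F ⟶ laxCod C F) (γ : laxDom C G ⟶ laxCod C G)
    (f : F ⟶ G) : β ≫ laxCodMap C f = laxDomMap C f ≫ γ ↔
      ∀ x n m, laxS β x n m ≫ f.app _ _ = f.app n m ≫ laxS γ x n m := by
  refine ⟨fun h x n m => ?_, fun h => lax_hom_ext fun x n m => ?_⟩
  · rw [← laxS_comp_laxCodMap, h, laxS_laxDomMap_comp]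
  · rw [laxS_comp_laxCodMap, laxS_laxDomMap_comp, h]

lemma lax_assoc_iff (β : laxDom C F ⟶ laxCod C F) :
    (∀ (x y : C) (n n₁ n₂ : M) (m : M),
      (n ⟶[V] (x ⊙ₗ n₁)) ◁ laxComponent β y n₁ n₂ m ≫ laxComponent β x n n₁ (y ⊙ₗ m) ≫
        F.mapRight n (αₗ x y m).inv =
      (α_ _ _ _).inv ≫ actComp V x y n n₁ n₂ ▷ F.obj n₂ m ≫ laxComponent β (x ⊗ y) n n₂ m) ↔
    TensorCompat F (laxS β) := by
  rw [tensorCompat_iff_mapLeft]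
  have hl (x y : C) (n n₁ n₂ m : M) :
      (n ⟶[V] (x ⊙ₗ n₁)) ◁ laxComponent β y n₁ n₂ m ≫ laxComponent β x n n₁ (y ⊙ₗ m) ≫
        F.mapRight n (αₗ x y m).inv =
      _ ◁ (actL V x n₁ (y ⊙ₗ n₂) ▷ _ ≫ _ ◁ (laxS β y n₂ m ≫ laxS β x _ _ ≫
        F.mapRight _ (αₗ x y m).inv) ≫ F.pre _ _ _) ≫ F.pre n (x ⊙ₗ n₁) _ := by
    have h := companion_strength_assoc F (isStrength_laxS β) x y n n₁ n₂ m
    rw [laxComponent_eq, laxComponent_eq, ← Category.assoc, h, Category.assoc, F.pre_mapRight]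
    simp only [MonoidalCategory.whiskerLeft_comp, Category.assoc]
    simp only [← MonoidalCategory.whiskerLeft_comp_assoc, F.pre_mapRight]
  have hr (x y : C) (n n₁ n₂ m : M) :
      (α_ _ _ _).inv ≫ actComp V x y n n₁ n₂ ▷ F.obj n₂ m ≫ laxComponent β (x ⊗ y) n n₂ m =
      _ ◁ (actL V x n₁ (y ⊙ₗ n₂) ▷ _ ≫ _ ◁ (laxS β (x ⊗ y) n₂ m ≫
        F.mapLeft (αₗ x y n₂).inv _) ≫ F.pre _ _ _) ≫ F.pre n (x ⊙ₗ n₁) _ := by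
    have h := actComp_pre F x y n n₁ n₂ ((x ⊗ y) ⊙ₗ m)
    rw [laxComponent_eq, ← whisker_exchange_assoc, ← associator_inv_naturality_right_assoc, h]
    simp only [MonoidalCategory.whiskerLeft_comp, Category.assoc]
    simp only [← MonoidalCategory.whiskerLeft_comp_assoc, whisker_exchange_assoc]
  simp only [hl, hr]
  refine ⟨fun h x y n m => ?_, fun h x y n n₁ n₂ m => by rw [h]⟩
  have h1 := left_action_injective F fun k => h x y k (y ⊙ₗ n) n m
  exact (actL_left_injective F h1).symm

lemma lax_unit_iff (β : laxDom C F ⟶ laxCod C F) :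
    (∀ (n n₁ m : M), laxComponent β (𝟙_ C) n n₁ m ≫ F.mapRight n (λₗ m).hom =
      eHomWhiskerLeft V n (λₗ n₁).hom ▷ F.obj n₁ m ≫ F.pre n n₁ m) ↔ UnitCompat F (laxS β) := by
  have hl (n n₁ m : M) : laxComponent β (𝟙_ C) n n₁ m ≫ F.mapRight n (λₗ m).hom =
      _ ◁ (laxS β (𝟙_ C) n₁ m ≫ F.mapRight _ (λₗ m).hom) ≫ F.pre n _ m := by
    rw [laxComponent_eq, Category.assoc, F.pre_mapRight, MonoidalCategory.whiskerLeft_comp,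
      Category.assoc]
  simp only [hl, ← whiskerLeft_mapLeft_pre]
  exact ⟨fun h n m => left_action_injective F fun k => h k n m, fun h n n₁ m => by rw [h]⟩

end LaxStrength

end

end LaxModuleProf

namespace LaxModuleProf

noncomputable section

set_option linter.unusedSectionVars false

open VProf

/-! ### Modules over the monad of pro-tensors and strengths -/

section OmegaStrength

variable {V : Type u} [Category.{v} V] [MonoidalCategory V] [SymmetricCategory V]

section

variable {C : Type v} [Category.{v} C] [MonoidalCategory C] [EnrichedOrdinaryCategory V C]
  [MonoidalEnriched V C]
  {M : Type v} [Category.{v} M] [EnrichedOrdinaryCategory V M] [MonoidalLeftAction C M]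
  [ModuleEnriched V C M]

variable (F : VProf V M M)

lemma right_action_injective {X : V} {n m : M} {f g : X ⟶ F.obj n m}
    (h : ∀ m', f ▷ (m ⟶[V] m') ≫ F.post n m m' = g ▷ (m ⟶[V] m') ≫ F.post n m m') : f = g := by
  have h' := congrArg (fun t => idRight V X m ≫ t) (h m)
  simp only [← reassoc_of% (idRight_naturality (V := V) m), idRight_post, Category.comp_id] at h'
  exact h'

lemma actL_right_injective {X : V} {x : C} {n m : M} {f g : X ⟶ F.obj n (x ⊙ₗ m)}
    (h : _ ◁ actL V x m m ≫ f ▷ _ ≫ F.post n _ _ = _ ◁ actL V x m m ≫ g ▷ _ ≫ F.post n _ _) :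
    f = g := by
  have h' := congrArg (fun t => idRight V X m ≫ t) h
  simp only [reassoc_of% (idRight_actL (V := V) x m X),
    ← reassoc_of% (idRight_naturality (V := V) (x ⊙ₗ m)), idRight_post, Category.comp_id] at h'
  exact h'

lemma conjoint_strength_assoc {s} (hs : IsStrength F F s) (x y : C) (n₁ n₂ m₂ m₁ m : M) :
    (_ ◁ (s y n₂ m₂ ▷ _ ≫ F.post (y ⊙ₗ n₂) (y ⊙ₗ m₂) m₁) ≫ F.pre n₁ (y ⊙ₗ n₂) m₁) ▷ _ ≫
        s x n₁ m₁ ▷ ((x ⊙ₗ m₁) ⟶[V] m) ≫ F.post _ _ _ =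
      (α_ _ _ _).hom ≫ (actL V x n₁ (y ⊙ₗ n₂) ⊗ₘ
        (((s y n₂ m₂ ≫ s x _ _) ⊗ₘ actL V x (y ⊙ₗ m₂) m₁) ≫ F.post _ _ _) ▷ _ ≫
          F.post _ _ _) ≫ F.pre _ _ _ := by
  rw [← comp_whiskerRight_assoc, Category.assoc, hs.pre_s, whiskerLeft_comp_tensorHom_assoc,
    Category.assoc, hs.post_s, whiskerRight_comp_tensorHom_assoc, comp_whiskerRight,
    Category.assoc, F.pre_post, ← tensorHom_id (_ ⊗ₘ _), associator_naturality_assoc,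
    tensorHom_id, tensorHom_comp_whiskerLeft_assoc]

lemma coactComp_strength (s : ∀ (x : C) (n m : M), F.obj n m ⟶ F.obj (x ⊙ₗ n) (x ⊙ₗ m)) (x y : C)
    (n₂ m₂ m₁ m : M) :
    (α_ _ _ _).hom ≫ F.obj n₂ m₂ ◁ coactComp V x y m m₁ m₂ ≫ s (x ⊗ y) n₂ m₂ ▷ _ ≫
        F.post _ _ _ ≫ F.mapLeft (αₗ x y n₂).inv m =
      (((s (x ⊗ y) n₂ m₂ ≫ F.mapRight _ (αₗ x y m₂).hom ≫ F.mapLeft (αₗ x y n₂).inv _) ⊗ₘ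
        actL V x (y ⊙ₗ m₂) m₁) ≫ F.post _ _ _) ▷ _ ≫ F.post _ _ _ := by
  have h2 := coactComp_post F x y ((x ⊗ y) ⊙ₗ n₂) m m₁ m₂
  rw [whisker_exchange_assoc, ← associator_naturality_left_assoc, reassoc_of% h2,
    F.mapLeft_post, ← comp_whiskerRight_assoc, ← comp_whiskerRight_assoc]
  simp only [Category.assoc]
  rw [F.mapLeft_post, ← comp_whiskerRight_assoc, MonoidalCategory.tensorHom_def',
    ← whisker_exchange_assoc]
  simp only [comp_whiskerRight, Category.assoc]

/-- The action given by a strength. -/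
def omegaOfS (s : ∀ (x : C) (n m : M), F.obj n m ⟶ F.obj (x ⊙ₗ n) (x ⊙ₗ m)) (x : C)
    (n n₁ m₁ m : M) :
    (n ⟶[V] (x ⊙ₗ n₁)) ⊗ (F.obj n₁ m₁ ⊗ ((x ⊙ₗ m₁) ⟶[V] m)) ⟶ F.obj n m :=
  _ ◁ (s x n₁ m₁ ▷ _ ≫ F.post _ _ _) ≫ F.pre n (x ⊙ₗ n₁) m

lemma omegaOfS_assoc_iff {s} (hs : IsStrength F F s) :
    (∀ (x y : C) (n n₁ n₂ m₂ m₁ m : M),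
      (n ⟶[V] (x ⊙ₗ n₁)) ◁ (omegaOfS F s y n₁ n₂ m₂ m₁ ▷ ((x ⊙ₗ m₁) ⟶[V] m)) ≫
        omegaOfS F s x n n₁ m₁ m =
      _ ◁ (α_ _ _ _).hom ≫ (α_ _ _ _).inv ≫
        (actComp V x y n n₁ n₂ ⊗ₘ
          ((α_ _ _ _).hom ≫ F.obj n₂ m₂ ◁ coactComp V x y m m₁ m₂)) ≫
        omegaOfS F s (x ⊗ y) n n₂ m₂ m) ↔ TensorCompat F s := by
  rw [tensorCompat_iff_conj]
  have hl (x y : C) (n n₁ n₂ m₂ m₁ m : M) :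
      (n ⟶[V] (x ⊙ₗ n₁)) ◁ (omegaOfS F s y n₁ n₂ m₂ m₁ ▷ ((x ⊙ₗ m₁) ⟶[V] m)) ≫
        omegaOfS F s x n n₁ m₁ m =
      _ ◁ ((α_ _ _ _).hom ≫ (actL V x n₁ (y ⊙ₗ n₂) ⊗ₘ
        (((s y n₂ m₂ ≫ s x _ _) ⊗ₘ actL V x (y ⊙ₗ m₂) m₁) ≫ F.post _ _ _) ▷ _ ≫
          F.post _ _ _) ≫ F.pre _ _ _) ≫ F.pre n (x ⊙ₗ n₁) m := by
    have h := conjoint_strength_assoc F hs x y n₁ n₂ m₂ m₁ m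
    rw [omegaOfS, omegaOfS, ← MonoidalCategory.whiskerLeft_comp_assoc, h]
  have hr (x y : C) (n n₁ n₂ m₂ m₁ m : M) :
      _ ◁ (α_ _ _ _).hom ≫ (α_ _ _ _).inv ≫
        (actComp V x y n n₁ n₂ ⊗ₘ
          ((α_ _ _ _).hom ≫ F.obj n₂ m₂ ◁ coactComp V x y m m₁ m₂)) ≫
        omegaOfS F s (x ⊗ y) n n₂ m₂ m =
      _ ◁ ((α_ _ _ _).hom ≫ (actL V x n₁ (y ⊙ₗ n₂) ⊗ₘ
        (((s (x ⊗ y) n₂ m₂ ≫ F.mapRight _ (αₗ x y m₂).hom ≫ F.mapLeft (αₗ x y n₂).inv _) ⊗ₘ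
          actL V x (y ⊙ₗ m₂) m₁) ≫ F.post _ _ _) ▷ _ ≫
          F.post _ _ _) ≫ F.pre _ _ _) ≫ F.pre n (x ⊙ₗ n₁) m := by
    have h1 := actComp_pre F x y n n₁ n₂ m
    have h2 := coactComp_strength F s x y n₂ m₂ m₁ m
    rw [omegaOfS, tensorHom_comp_whiskerLeft_assoc, MonoidalCategory.tensorHom_def',
      Category.assoc, ← associator_inv_naturality_right_assoc, h1, ← h2,
      ← MonoidalCategory.whiskerLeft_comp_assoc, ← MonoidalCategory.whiskerLeft_comp_assoc]
    simp only [Category.assoc, MonoidalCategory.tensorHom_def, whisker_exchange_assoc,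
      MonoidalCategory.whiskerLeft_comp]
  simp only [hl, hr]
  refine ⟨fun h x y n m => ?_, fun h x y n n₁ n₂ m₂ m₁ m => by rw [h]⟩
  have h1 m' := left_action_injective F fun k => h x y k (y ⊙ₗ n) n m (y ⊙ₗ m) m'
  simp only [Iso.cancel_iso_hom_left, MonoidalCategory.tensorHom_def, Category.assoc] at h1
  have h2 := right_action_injective F fun m' => actL_left_injective F (h1 m')
  simp only [← MonoidalCategory.tensorHom_def_assoc] at h2
  simp only [MonoidalCategory.tensorHom_def', Category.assoc] at h2
  exact (actL_right_injective F h2).symm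

lemma omegaOfS_unit (s : ∀ (x : C) (n m : M), F.obj n m ⟶ F.obj (x ⊙ₗ n) (x ⊙ₗ m)) (n m : M) :
    (λ_ _).inv ≫ (eHomEquiv V (λₗ[C] n).inv ⊗ₘ
        ((ρ_ _).inv ≫ F.obj n m ◁ eHomEquiv V (λₗ m).hom)) ≫
      omegaOfS F s (𝟙_ C) n n m m =
      s (𝟙_ C) n m ≫ F.mapRight _ (λₗ m).hom ≫ F.mapLeft (λₗ n).inv _ := by
  rw [omegaOfS, tensorHom_comp_whiskerLeft_assoc, Category.assoc,
    whisker_exchange_assoc, mapRight, mapLeft, MonoidalCategory.tensorHom_def',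
    Category.assoc, ← leftUnitor_inv_naturality_assoc]
  simp only [Category.assoc]
  rw [rightUnitor_inv_naturality_assoc]

end

variable [MonoidalClosed V] [HasColimits V]
  {C : Type v} [Category.{v} C] [MonoidalCategory C] [EnrichedOrdinaryCategory V C]
  [MonoidalEnriched V C]
  {M : Type v} [Category.{v} M] [EnrichedOrdinaryCategory V M] [MonoidalLeftAction C M]
  [ModuleEnriched V C M]

variable {F G : VProf V M M}

/-- The restriction of an action to the identities in the contravariant variable. -/
def omegaLeft (κ : omega C F ⟶ G) :
    comp (tens (idProf V C) F) (conjoint (actFunctor V C M)) ⟶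
      restrictLeft (actFunctor V C M) G where
  app p m := companionRestrict (actFunctor V C M) κ p m
  pre_app p p' m := companionRestrict_pre (actFunctor V C M) κ p p' m
  post_app p m m' := companionRestrict_post (actFunctor V C M) κ p m m'

/-- The morphism of profunctors given by an action. -/
def omegaSigma (κ : omega C F ⟶ G) :
    tens (idProf V C) F ⟶ G.restrict (actFunctor V C M) (actFunctor V C M) where
  app p q := conjointRestrict (actFunctor V C M) (omegaLeft κ) p q
  pre_app p p' q := conjointRestrict_pre (actFunctor V C M) (omegaLeft κ) p p' q
  post_app p q q' := conjointRestrict_post (actFunctor V C M) (omegaLeft κ) p q q'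

/-- The strength given by an action. -/
def omegaS (κ : omega C F ⟶ G) (x : C) (n m : M) :
    F.obj n m ⟶ G.obj (x ⊙ₗ n) (x ⊙ₗ m) :=
  homS (omegaSigma κ) x n m

lemma isStrength_omegaS (κ : omega C F ⟶ G) : IsStrength F G (omegaS κ) :=
  isStrength_homS _

lemma omega_hom_ext {κ κ' : omega C F ⟶ G} (h : ∀ x n m, omegaS κ x n m = omegaS κ' x n m) :
    κ = κ' := by
  have h1 : omegaSigma κ = omegaSigma κ' := str_hom_ext h
  have h2 : omegaLeft κ = omegaLeft κ' := by
    apply conjoint_hom_ext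
    intro p q
    exact congrArg (fun t => VProf.Hom.app t p q) h1
  apply companion_hom_ext
  intro p m
  exact congrArg (fun t => VProf.Hom.app t p m) h2

/-- The action given by a strength. -/
def omegaOfStrength (s : ∀ (x : C) (n m : M), F.obj n m ⟶ G.obj (x ⊙ₗ n) (x ⊙ₗ m))
    (hs : IsStrength F G s) : omega C F ⟶ G :=
  letI t : comp (tens (idProf V C) F) (conjoint (actFunctor V C M)) ⟶
      restrictLeft (actFunctor V C M) G :=
    conjointDesc (actFunctor V C M) (K := restrictLeft (actFunctor V C M) G)
      (strHom s hs).app (strHom s hs).pre_app (strHom s hs).post_app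
  companionDesc (actFunctor V C M) t.app t.pre_app t.post_app

lemma omegaS_omegaOfStrength (s : ∀ (x : C) (n m : M), F.obj n m ⟶ G.obj (x ⊙ₗ n) (x ⊙ₗ m))
    (hs : IsStrength F G s) (x : C) (n m : M) :
    omegaS (omegaOfStrength s hs) x n m = s x n m := by
  have h1 : omegaLeft (omegaOfStrength s hs) = conjointDesc (actFunctor V C M)
      (K := restrictLeft (actFunctor V C M) G) (strHom s hs).app (strHom s hs).pre_app
      (strHom s hs).post_app := by
    ext p q
    exact companionRestrict_companionDesc _ _ _ _ _ _
  have h : omegaSigma (omegaOfStrength s hs) = strHom s hs := by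
    ext p q
    change conjointRestrict (actFunctor V C M) (omegaLeft _) p q = _
    rw [h1, conjointRestrict_conjointDesc]
  rw [omegaS, h, homS_strHom]

lemma omegaS_eq (κ : omega C F ⟶ G) (x : C) (n m : M) :
    omegaS κ x n m = idLeft V x _ ≫ idRight V _ (x ⊙ₗ m) ≫
      j (tens (idProf V C) F) (conjoint (actFunctor V C M)) (x, n) (x, m) (x ⊙ₗ m) ≫
      idLeft V (x ⊙ₗ n) _ ≫
      j (companion (actFunctor V C M)) (comp (tens (idProf V C) F) (conjoint (actFunctor V C M)))
        (x ⊙ₗ n) (x, n) (x ⊙ₗ m) ≫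
      κ.app (x ⊙ₗ n) (x ⊙ₗ m) := rfl

lemma omegaComponent_eq (κ : omega C F ⟶ F) (x : C) (n n₁ m₁ m : M) :
    omegaComponent κ x n n₁ m₁ m = omegaOfS F (omegaS κ) x n n₁ m₁ m := by
  have h := j_companion_hom (actFunctor V C M) κ n (x, n₁) m
  have h2 : j (tens (idProf V C) F) (conjoint (actFunctor V C M)) (x, n₁) (x, m₁) m ≫
      companionRestrict (actFunctor V C M) κ (x, n₁) m = _ :=
    j_conjoint_hom (actFunctor V C M) (omegaLeft κ) (x, n₁) (x, m₁) m
  have h3 : omegaι F x n n₁ m₁ m = _ ◁ (idLeft V x (F.obj n₁ m₁) ▷ _ ≫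
      j (tens (idProf V C) F) (conjoint (actFunctor V C M)) (x, n₁) (x, m₁) m) ≫
      j (companion (actFunctor V C M))
        (comp (tens (idProf V C) F) (conjoint (actFunctor V C M))) n (x, n₁) m := rfl
  rw [omegaComponent, h3, Category.assoc, h, ← MonoidalCategory.whiskerLeft_comp_assoc,
    Category.assoc, h2, ← comp_whiskerRight_assoc]
  rfl

lemma omegaS_comp {H : VProf V M M} (κ : omega C F ⟶ G) (f : G ⟶ H) (x : C)
    (n m : M) : omegaS (κ ≫ f) x n m = omegaS κ x n m ≫ f.app _ _ := by
  rw [omegaS_eq, omegaS_eq]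
  simp only [Category.assoc, comp_app]

lemma omegaS_omegaMap_comp {H : VProf V M M} (f : H ⟶ F) (κ : omega C F ⟶ G) (x : C)
    (n m : M) : omegaS (omegaMap C f ≫ κ) x n m = f.app _ _ ≫ omegaS κ x n m := by
  have h1 := j_map (𝟙 (companion (actFunctor V C M)))
    (compMap (tensMap (𝟙 (idProf V C)) f) (𝟙 (conjoint (actFunctor V C M)))) (x ⊙ₗ n)
    (x, n) (x ⊙ₗ m)
  have h := j_map (tensMap (𝟙 (idProf V C)) f) (𝟙 (conjoint (actFunctor V C M))) (x, n)
    (x, m) (x ⊙ₗ m)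
  have h2 : (tensMap (𝟙 (idProf V C)) f).app (x, n) (x, m) = _ ◁ f.app n m := id_tensorHom _ _
  rw [h2, id_app, tensorHom_id] at h
  rw [id_app, id_tensorHom] at h1
  rw [omegaS_eq, omegaS_eq, comp_app, omegaMap, reassoc_of% h1,
    ← reassoc_of% (idLeft_naturality (V := V) (x ⊙ₗ n)), reassoc_of% h,
    ← reassoc_of% (idRight_naturality (V := V) (x ⊙ₗ m)),
    reassoc_of% (idLeft_naturality x (f.app n m))]

lemma omega_comm_iff {F G : VProf V M M} (κ : omega C F ⟶ F) (κ' : omega C G ⟶ G)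
    (f : F ⟶ G) : κ ≫ f = omegaMap C f ≫ κ' ↔
      ∀ x n m, omegaS κ x n m ≫ f.app _ _ = f.app n m ≫ omegaS κ' x n m := by
  refine ⟨fun h x n m => ?_, fun h => omega_hom_ext fun x n m => ?_⟩
  · rw [← omegaS_comp, h, omegaS_omegaMap_comp]
  · rw [omegaS_comp, omegaS_omegaMap_comp, h]

lemma omega_unit_iff (κ : omega C F ⟶ F) :
    (∀ (n m : M), (λ_ _).inv ≫ (eHomEquiv V (λₗ n).inv ⊗ₘ
        ((ρ_ _).inv ≫ F.obj n m ◁ eHomEquiv V (λₗ m).hom)) ≫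
      omegaComponent κ (𝟙_ C) n n m m = 𝟙 _) ↔ UnitCompat F (omegaS κ) := by
  simp only [unitCompat_iff_conj, omegaComponent_eq, omegaOfS_unit]

lemma omega_assoc_iff (κ : omega C F ⟶ F) :
    (∀ (x y : C) (n n₁ n₂ m₂ m₁ m : M),
      (n ⟶[V] (x ⊙ₗ n₁)) ◁ (omegaComponent κ y n₁ n₂ m₂ m₁ ▷ ((x ⊙ₗ m₁) ⟶[V] m)) ≫
        omegaComponent κ x n n₁ m₁ m =
      _ ◁ (α_ _ _ _).hom ≫ (α_ _ _ _).inv ≫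
        (actComp V x y n n₁ n₂ ⊗ₘ
          ((α_ _ _ _).hom ≫ F.obj n₂ m₂ ◁ coactComp V x y m m₁ m₂)) ≫
        omegaComponent κ (x ⊗ y) n n₂ m₂ m) ↔ TensorCompat F (omegaS κ) := by
  simp only [omegaComponent_eq, omegaOfS_assoc_iff F (isStrength_omegaS κ)]

end OmegaStrength

end

end LaxModuleProf

namespace LaxModuleProf

noncomputable section

set_option linter.unusedSectionVars false

open VProf Functor.LaxMonoidal Functor.OplaxMonoidal

/-! ### Monoidal structures over strong endoprofunctors -/

section Equivalence

variable {T₁ T₂ S : Type*} [Category* T₁] [Category* T₂] [Category* S] [MonoidalCategory T₁]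
  [MonoidalCategory T₂] [MonoidalCategory S] (e₁ : T₁ ≌ S) (e₂ : T₂ ≌ S)
  [e₁.functor.Monoidal] [e₂.functor.Monoidal] [e₂.inverse.Monoidal] [e₂.IsMonoidal]

lemma μ_comp_counit (X Y : T₁) :
    μ e₂.functor (e₂.inverse.obj (e₁.functor.obj X)) (e₂.inverse.obj (e₁.functor.obj Y)) ≫
        e₂.functor.map (μ (e₁.functor ⋙ e₂.inverse) X Y) ≫
        e₂.counitIso.hom.app (e₁.functor.obj (X ⊗ Y)) =
      (e₂.counitIso.hom.app (e₁.functor.obj X) ⊗ₘ e₂.counitIso.hom.app (e₁.functor.obj Y)) ≫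
        μ e₁.functor X Y := by
  have h := e₂.counitIso.hom.naturality (μ e₁.functor X Y)
  simp only [Functor.comp_map, Functor.id_map] at h
  rw [Functor.LaxMonoidal.comp_μ, Functor.map_comp, Category.assoc, h,
    reassoc_of% (e₂.functor_map_μ_inverse_comp_counitIso_hom_app_tensor (e₁.functor.obj X)
      (e₁.functor.obj Y)), Functor.Monoidal.μ_δ_assoc]

lemma ε_comp_counit :
    ε e₂.functor ≫ e₂.functor.map (ε (e₁.functor ⋙ e₂.inverse)) ≫
        e₂.counitIso.hom.app (e₁.functor.obj (𝟙_ T₁)) = ε e₁.functor := by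
  have h := e₂.counitIso.hom.naturality (ε e₁.functor)
  simp only [Functor.comp_map, Functor.id_map] at h
  rw [Functor.LaxMonoidal.comp_ε, Functor.map_comp, Category.assoc, h,
    reassoc_of% e₂.functor_map_ε_inverse_comp_counitIso_hom_app, Functor.Monoidal.ε_η_assoc]

end Equivalence

variable {V : Type u} [Category.{v} V] [MonoidalCategory V] [SymmetricCategory V]
  [MonoidalClosed V] [HasColimits V]
  {M : Type v} [Category.{v} M] [EnrichedOrdinaryCategory V M]

section Composition

variable {T : Type*} [Category* T] [MonoidalCategory T] (U : T ⥤ VProf V M M) [U.Monoidal]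

/-- The coprojections of a tensor product, for a strong monoidal functor to profunctors. -/
def tensorJ (X Y : T) (n k m : M) :
    (U.obj X).obj n k ⊗ (U.obj Y).obj k m ⟶ (U.obj (X ⊗ Y)).obj n m :=
  j (U.obj X) (U.obj Y) n k m ≫ (μ U X Y).app n m

/-- The identification of the unit, for a strong monoidal functor to profunctors. -/
def tensorU (n m : M) : (n ⟶[V] m) ⟶ (U.obj (𝟙_ T)).obj n m :=
  (ε U).app n m

lemma tensorJ_pre (X Y : T) (n n' k m : M) :
    (n ⟶[V] n') ◁ tensorJ U X Y n' k m ≫ (U.obj (X ⊗ Y)).pre n n' m =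
      (α_ _ _ _).inv ≫ (U.obj X).pre n n' k ▷ _ ≫ tensorJ U X Y n k m := by
  have h := (μ U X Y).pre_app n n' m
  rw [tensorJ, MonoidalCategory.whiskerLeft_comp, Category.assoc, ← h]
  exact (reassoc_of% (j_pre (U.obj X) (U.obj Y) n n' k m)) ((μ U X Y).app n m)

lemma tensorJ_post (X Y : T) (n k m m' : M) :
    tensorJ U X Y n k m ▷ (m ⟶[V] m') ≫ (U.obj (X ⊗ Y)).post n m m' =
      (α_ _ _ _).hom ≫ _ ◁ (U.obj Y).post k m m' ≫ tensorJ U X Y n k m' := by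
  have h := (μ U X Y).post_app n m m'
  rw [tensorJ, comp_whiskerRight, Category.assoc, ← h]
  exact (reassoc_of% (j_post (U.obj X) (U.obj Y) n k m m')) ((μ U X Y).app n m')

lemma tensorJ_natural {X X' Y Y' : T} (f : X ⟶ X') (g : Y ⟶ Y') (n k m : M) :
    ((U.map f).app n k ⊗ₘ (U.map g).app k m) ≫ tensorJ U X' Y' n k m =
      tensorJ U X Y n k m ≫ (U.map (f ⊗ₘ g)).app n m := by
  have h := congrArg (fun t => VProf.Hom.app t n m) (μ_natural U f g)
  refine ((reassoc_of% (j_map (U.map f) (U.map g) n k m)) ((μ U X' Y').app n m)).symm.trans ?_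
  refine Eq.trans ?_ (Category.assoc _ _ _).symm
  exact congrArg (fun t => j (U.obj X) (U.obj Y) n k m ≫ t) h

lemma tensorJ_associativity (X Y Z : T) (n k l m : M) :
    tensorJ U X Y n k l ▷ (U.obj Z).obj l m ≫ tensorJ U (X ⊗ Y) Z n l m ≫
        (U.map (α_ X Y Z).hom).app n m =
      (α_ _ _ _).hom ≫ (U.obj X).obj n k ◁ tensorJ U Y Z k l m ≫ tensorJ U X (Y ⊗ Z) n k m := by
  have h := congrArg (fun t => VProf.Hom.app t n m) (Functor.LaxMonoidal.associativity U X Y Z)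
  have h1 := j_map (μ U X Y) (𝟙 (U.obj Z)) n l m
  have h2 := j_map (𝟙 (U.obj X)) (μ U Y Z) n k m
  rw [id_app, tensorHom_id] at h1
  rw [id_app, id_tensorHom] at h2
  have h3 : (compMap (μ U X Y) (𝟙 (U.obj Z))).app n m ≫ (μ U (X ⊗ Y) Z).app n m ≫
      (U.map (α_ X Y Z).hom).app n m = (assocIso (U.obj X) (U.obj Y) (U.obj Z)).hom.app n m ≫
      (compMap (𝟙 (U.obj X)) (μ U Y Z)).app n m ≫ (μ U X (Y ⊗ Z)).app n m := h
  have h4 := j_assocIso_hom (H := U.obj X) (G := U.obj Y) (F := U.obj Z) n k l m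
  have h5 : tensorJ U X Y n k l ▷ (U.obj Z).obj l m ≫ tensorJ U (X ⊗ Y) Z n l m ≫
        (U.map (α_ X Y Z).hom).app n m =
      j (U.obj X) (U.obj Y) n k l ▷ _ ≫ ((μ U X Y).app n l ▷ _ ≫
        j (U.obj (X ⊗ Y)) (U.obj Z) n l m) ≫ (μ U (X ⊗ Y) Z).app n m ≫
        (U.map (α_ X Y Z).hom).app n m := by
    simp only [tensorJ, comp_whiskerRight, Category.assoc]
  have h6 : (U.obj X).obj n k ◁ tensorJ U Y Z k l m ≫ tensorJ U X (Y ⊗ Z) n k m =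
      (U.obj X).obj n k ◁ j (U.obj Y) (U.obj Z) k l m ≫ ((U.obj X).obj n k ◁ (μ U Y Z).app k m ≫
        j (U.obj X) (U.obj (Y ⊗ Z)) n k m) ≫ (μ U X (Y ⊗ Z)).app n m := by
    simp only [tensorJ, MonoidalCategory.whiskerLeft_comp, Category.assoc]
  rw [h5, h6]
  refine (congrArg (fun t => j (U.obj X) (U.obj Y) n k l ▷ _ ≫ t ≫ (μ U (X ⊗ Y) Z).app n m ≫
        (U.map (α_ X Y Z).hom).app n m) h1.symm).trans ?_
  refine Eq.trans ?_ (congrArg (fun t => (α_ _ _ _).hom ≫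
    (U.obj X).obj n k ◁ j (U.obj Y) (U.obj Z) k l m ≫ t ≫ (μ U X (Y ⊗ Z)).app n m) h2)
  simp only [Category.assoc]
  refine Eq.trans ?_ ((reassoc_of% h4) ((compMap (𝟙 (U.obj X)) (μ U Y Z)).app n m ≫
    (μ U X (Y ⊗ Z)).app n m))
  exact congrArg (fun t => j (U.obj X) (U.obj Y) n k l ▷ _ ≫
    j (comp (U.obj X) (U.obj Y)) (U.obj Z) n l m ≫ t) h3

lemma tensorJ_left_unit (X : T) (n k m : M) :
    tensorU U n k ▷ (U.obj X).obj k m ≫ tensorJ U (𝟙_ T) X n k m ≫ (U.map (λ_ X).hom).app n m =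
      (U.obj X).pre n k m := by
  have h := congrArg (fun t => VProf.Hom.app t n m) (Functor.LaxMonoidal.left_unitality U X)
  have h1 := j_map (ε U) (𝟙 (U.obj X)) n k m
  rw [id_app, tensorHom_id] at h1
  rw [← j_leftUnitIso_hom (F := U.obj X) n k m, tensorU, tensorJ, Category.assoc,
    ← reassoc_of% h1]
  exact congrArg (fun t => j (idProf V M) (U.obj X) n k m ≫ t) h.symm

lemma tensorJ_right_unit (X : T) (n k m : M) :
    (U.obj X).obj n k ◁ tensorU U k m ≫ tensorJ U X (𝟙_ T) n k m ≫ (U.map (ρ_ X).hom).app n m =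
      (U.obj X).post n k m := by
  have h := congrArg (fun t => VProf.Hom.app t n m) (Functor.LaxMonoidal.right_unitality U X)
  have h1 := j_map (𝟙 (U.obj X)) (ε U) n k m
  rw [id_app, id_tensorHom] at h1
  rw [← j_rightUnitIso_hom (F := U.obj X) n m k, tensorU, tensorJ, Category.assoc,
    ← reassoc_of% h1]
  exact congrArg (fun t => j (U.obj X) (idProf V M) n k m ≫ t) h.symm

/-- A strong monoidal functor to profunctors exhibits a monoidal structure over the composition. -/
def compositionTensor : CompositionTensor U where
  tensorIso X Y := (Functor.Monoidal.μIso U X Y).symm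
  unitIso := (Functor.Monoidal.εIso U).symm
  natural := tensorJ_natural U
  associativity := tensorJ_associativity U
  left_unit := tensorJ_left_unit U
  right_unit := tensorJ_right_unit U

end Composition

section Strong

variable {C : Type v} [Category.{v} C] [MonoidalCategory C] [EnrichedOrdinaryCategory V C]
  [MonoidalEnriched V C] [MonoidalLeftAction C M] [ModuleEnriched V C M]
  {T : Type*} [Category* T] [MonoidalCategory T] (R : T ⥤ StrMod V C M) [R.Monoidal]

lemma μ_comp_forget (X Y : T) :
    μ (R ⋙ StrMod.forget V C M) X Y = (μ R X Y).hom :=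
  Category.id_comp _

lemma ε_comp_forget : ε (R ⋙ StrMod.forget V C M) = (ε R).hom :=
  Category.id_comp _

lemma tensorJ_s (X Y : T) (x : C) (n k m : M) :
    tensorJ (R ⋙ StrMod.forget V C M) X Y n k m ≫ (R.obj (X ⊗ Y)).s x n m =
      ((R.obj X).s x n k ⊗ₘ (R.obj Y).s x k m) ≫
        tensorJ (R ⋙ StrMod.forget V C M) X Y (x ⊙ₗ n) (x ⊙ₗ k) (x ⊙ₗ m) := by
  have h := StrMod.s_hom (μ R X Y) x n m
  have h1 := StrMod.j_compS (R.obj X) (R.obj Y) x n k m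
  rw [tensorJ, tensorJ, μ_comp_forget]
  refine (Category.assoc _ _ _).trans ?_
  refine (congrArg (fun t => j (R.obj X).prof (R.obj Y).prof n k m ≫ t) h.symm).trans ?_
  exact (reassoc_of% h1) ((μ R X Y).hom.app (x ⊙ₗ n) (x ⊙ₗ m))

lemma tensorU_s (x : C) (n m : M) :
    tensorU (R ⋙ StrMod.forget V C M) n m ≫ (R.obj (𝟙_ T)).s x n m =
      actL V x n m ≫ tensorU (R ⋙ StrMod.forget V C M) (x ⊙ₗ n) (x ⊙ₗ m) := by
  have h := StrMod.s_hom (ε R) x n m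
  rw [tensorU, tensorU, ε_comp_forget]
  exact h.symm

end Strong

section Comparison

variable {C : Type v} [Category.{v} C] [MonoidalCategory C] [EnrichedOrdinaryCategory V C]
  [MonoidalEnriched V C] [MonoidalLeftAction C M] [ModuleEnriched V C M]
  {T₁ T₂ : Type*} [Category* T₁] [Category* T₂] [MonoidalCategory T₁] [MonoidalCategory T₂]
  (e₁ : T₁ ≌ StrMod V C M) (e₂ : T₂ ≌ StrMod V C M)
  [e₁.functor.Monoidal] [e₂.functor.Monoidal] [e₂.inverse.Monoidal] [e₂.IsMonoidal]

/-- The comparison of the underlying profunctors. -/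
def counitApp (Y : StrMod V C M) (n m : M) :
    (e₂.functor.obj (e₂.inverse.obj Y)).prof.obj n m ⟶ Y.prof.obj n m :=
  (e₂.counitIso.hom.app Y).hom.app n m

lemma tensorJ_comparison (X Y : T₁) (n k m : M) :
    tensorJ (e₂.functor ⋙ StrMod.forget V C M) (e₂.inverse.obj (e₁.functor.obj X))
        (e₂.inverse.obj (e₁.functor.obj Y)) n k m ≫
        (e₂.functor.map (μ (e₁.functor ⋙ e₂.inverse) X Y)).hom.app n m ≫
        counitApp e₂ (e₁.functor.obj (X ⊗ Y)) n m =
      (counitApp e₂ (e₁.functor.obj X) n k ⊗ₘ counitApp e₂ (e₁.functor.obj Y) k m) ≫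
        tensorJ (e₁.functor ⋙ StrMod.forget V C M) X Y n k m := by
  have h := congrArg (fun t => VProf.Hom.app (StrMod.Hom.hom t) n m) (μ_comp_counit e₁ e₂ X Y)
  have h1 := j_map (e₂.counitIso.hom.app (e₁.functor.obj X)).hom
    (e₂.counitIso.hom.app (e₁.functor.obj Y)).hom n k m
  rw [tensorJ, tensorJ, μ_comp_forget, μ_comp_forget, Category.assoc]
  refine (congrArg (fun t => j _ _ n k m ≫ t) h).trans ?_
  exact (reassoc_of% h1) ((μ e₁.functor X Y).hom.app n m)

lemma tensorU_comparison (n m : M) :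
    tensorU (e₂.functor ⋙ StrMod.forget V C M) n m ≫
        (e₂.functor.map (ε (e₁.functor ⋙ e₂.inverse))).hom.app n m ≫
        counitApp e₂ (e₁.functor.obj (𝟙_ T₁)) n m =
      tensorU (e₁.functor ⋙ StrMod.forget V C M) n m := by
  have h := congrArg (fun t => VProf.Hom.app (StrMod.Hom.hom t) n m) (ε_comp_counit e₁ e₂)
  rw [tensorU, tensorU, ε_comp_forget, ε_comp_forget]
  exact h

end Comparison

end

end LaxModuleProf

namespace LaxModuleProf

noncomputable section

set_option linter.unusedSectionVars false

open VProf

variable {V : Type u} [Category.{v} V] [MonoidalCategory V] [SymmetricCategory V]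
  [MonoidalClosed V] [HasColimits V]
  {C : Type v} [Category.{v} C] [MonoidalCategory C] [EnrichedOrdinaryCategory V C]
  [MonoidalEnriched V C]
  {M : Type v} [Category.{v} M] [EnrichedOrdinaryCategory V M] [MonoidalLeftAction C M]
  [ModuleEnriched V C M]

/-- The strong profunctor given by a strength that is compatible with the tensor product and the
unit. -/
@[reducible] def StrMod.ofStrength (F : VProf V M M)
    (s : ∀ (x : C) (n m : M), F.obj n m ⟶ F.obj (x ⊙ₗ n) (x ⊙ₗ m)) (hs : IsStrength F F s)
    (ht : TensorCompat F s) (hu : UnitCompat F s) : StrMod V C M where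
  prof := F
  s := s
  pre_s := hs.pre_s
  post_s := hs.post_s
  actR_s := hs.actR_s
  s_tensor := ht
  s_unit := hu

/-! ### Lax module profunctors -/

namespace LaxMod

variable (V C M) in
/-- The strength of a lax module profunctor. -/
def toStr : LaxMod V C M M ⥤ StrMod V C M where
  obj X := StrMod.ofStrength X.prof (laxS X.β) (isStrength_laxS X.β)
    ((lax_assoc_iff X.β).1 X.assoc) ((lax_unit_iff X.β).1 X.unit)
  map f := ⟨Hom.hom f, (lax_comm_iff _ _ _).1 (Hom.comm f)⟩
  map_id _ := rfl
  map_comp _ _ := rfl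

lemma laxS_ofStr (X : StrMod V C M) : laxS (laxOfStrength X.s X.isStrength) = X.s := by
  funext x n m
  exact laxS_laxOfStrength X.s X.isStrength x n m

/-- The lax structure of a strong profunctor. -/
@[reducible] def ofStrObj (X : StrMod V C M) : LaxMod V C M M where
  prof := X.prof
  β := laxOfStrength X.s X.isStrength
  assoc := (lax_assoc_iff _).2 (by rw [laxS_ofStr]; exact X.s_tensor)
  unit := (lax_unit_iff _).2 (by rw [laxS_ofStr]; exact X.s_unit)

variable (V C M) in
/-- The lax module profunctor of a strong profunctor. -/
def ofStr : StrMod V C M ⥤ LaxMod V C M M where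
  obj X := ofStrObj X
  map {X Y} f := ⟨StrMod.Hom.hom f, (lax_comm_iff _ _ _).2 (by
    rw [laxS_ofStr, laxS_ofStr]; exact StrMod.s_hom f)⟩
  map_id _ := rfl
  map_comp _ _ := rfl

/-- An isomorphism of profunctors that commutes with the strengths. -/
def mkIso {X Y : LaxMod V C M M} (e : X.prof ≅ Y.prof)
    (h : X.β ≫ laxCodMap C e.hom = laxDomMap C e.hom ≫ Y.β) : X ≅ Y where
  hom := ⟨e.hom, h⟩
  inv := ⟨e.inv, by
    have h1 := congrArg (fun t => laxDomMap C e.inv ≫ t ≫ laxCodMap C e.inv) h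
    simp only [Category.assoc, ← laxCodMap_comp, Iso.hom_inv_id, laxCodMap_id, Category.comp_id]
      at h1
    rw [h1, ← Category.assoc, ← laxDomMap_comp, Iso.inv_hom_id, laxDomMap_id, Category.id_comp]⟩
  hom_inv_id := Hom.ext e.hom_inv_id
  inv_hom_id := Hom.ext e.inv_hom_id

variable (V C M) in
/-- Lax module profunctors are strong profunctors. -/
def equivStr : LaxMod V C M M ≌ StrMod V C M where
  functor := toStr V C M
  inverse := ofStr V C M
  unitIso := NatIso.ofComponents (fun X => mkIso (Iso.refl X.prof) ((lax_comm_iff _ _ _).2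
    fun x n m => by
      have h := laxS_laxOfStrength (laxS X.β) (isStrength_laxS X.β) x n m
      exact ((Category.comp_id _).trans h.symm).trans (Category.id_comp _).symm))
    fun f => Hom.ext ((Category.comp_id _).trans (Category.id_comp _).symm)
  counitIso := NatIso.ofComponents (fun X => StrMod.mkIso (Iso.refl X.prof) fun x n m => by
      have h := laxS_laxOfStrength X.s X.isStrength x n m
      exact ((Category.comp_id _).trans h).trans (Category.id_comp _).symm)
    fun f => StrMod.Hom.ext ((Category.comp_id _).trans (Category.id_comp _).symm)
  functor_unitIso_comp X := StrMod.Hom.ext (Category.comp_id _)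

instance : MonoidalCategory (LaxMod V C M M) := Monoidal.transport (equivStr V C M).symm

instance : (equivStr V C M).functor.Monoidal :=
  inferInstanceAs (Monoidal.equivalenceTransported (equivStr V C M).symm).inverse.Monoidal

end LaxMod

/-! ### Modules over the monad of pro-tensors -/

namespace OmegaMod

variable (V C M) in
/-- The strength of an `Ω`-module. -/
def toStr : OmegaMod V C M M ⥤ StrMod V C M where
  obj X := StrMod.ofStrength X.prof (omegaS X.κ) (isStrength_omegaS X.κ)
    ((omega_assoc_iff X.κ).1 X.assoc) ((omega_unit_iff X.κ).1 X.unit)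
  map f := ⟨Hom.hom f, (omega_comm_iff _ _ _).1 (Hom.comm f)⟩
  map_id _ := rfl
  map_comp _ _ := rfl

lemma omegaS_ofStr (X : StrMod V C M) : omegaS (omegaOfStrength X.s X.isStrength) = X.s := by
  funext x n m
  exact omegaS_omegaOfStrength X.s X.isStrength x n m

/-- The action on a strong profunctor. -/
@[reducible] def ofStrObj (X : StrMod V C M) : OmegaMod V C M M where
  prof := X.prof
  κ := omegaOfStrength X.s X.isStrength
  assoc := (omega_assoc_iff _).2 (by rw [omegaS_ofStr]; exact X.s_tensor)
  unit := (omega_unit_iff _).2 (by rw [omegaS_ofStr]; exact X.s_unit)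

variable (V C M) in
/-- The `Ω`-module of a strong profunctor. -/
def ofStr : StrMod V C M ⥤ OmegaMod V C M M where
  obj X := ofStrObj X
  map {X Y} f := ⟨StrMod.Hom.hom f, (omega_comm_iff _ _ _).2 (by
    rw [omegaS_ofStr, omegaS_ofStr]; exact StrMod.s_hom f)⟩
  map_id _ := rfl
  map_comp _ _ := rfl

/-- An isomorphism of profunctors that commutes with the actions. -/
def mkIso {X Y : OmegaMod V C M M} (e : X.prof ≅ Y.prof)
    (h : X.κ ≫ e.hom = omegaMap C e.hom ≫ Y.κ) : X ≅ Y where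
  hom := ⟨e.hom, h⟩
  inv := ⟨e.inv, by
    have h1 := congrArg (fun t => omegaMap C e.inv ≫ t ≫ e.inv) h
    simp only [Category.assoc, Iso.hom_inv_id, Category.comp_id] at h1
    rw [h1, ← Category.assoc, ← omegaMap_comp, Iso.inv_hom_id, omegaMap_id, Category.id_comp]⟩
  hom_inv_id := Hom.ext e.hom_inv_id
  inv_hom_id := Hom.ext e.inv_hom_id

variable (V C M) in
/-- `Ω`-modules are strong profunctors. -/
def equivStr : OmegaMod V C M M ≌ StrMod V C M where
  functor := toStr V C M
  inverse := ofStr V C M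
  unitIso := NatIso.ofComponents (fun X => mkIso (Iso.refl X.prof) ((omega_comm_iff _ _ _).2
    fun x n m => by
      have h := omegaS_omegaOfStrength (omegaS X.κ) (isStrength_omegaS X.κ) x n m
      exact ((Category.comp_id _).trans h.symm).trans (Category.id_comp _).symm))
    fun f => Hom.ext ((Category.comp_id _).trans (Category.id_comp _).symm)
  counitIso := NatIso.ofComponents (fun X => StrMod.mkIso (Iso.refl X.prof) fun x n m => by
      have h := omegaS_omegaOfStrength X.s X.isStrength x n m
      exact ((Category.comp_id _).trans h).trans (Category.id_comp _).symm)
    fun f => StrMod.Hom.ext ((Category.comp_id _).trans (Category.id_comp _).symm)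
  functor_unitIso_comp X := StrMod.Hom.ext (Category.comp_id _)

instance : MonoidalCategory (OmegaMod V C M M) := Monoidal.transport (equivStr V C M).symm

instance : (equivStr V C M).functor.Monoidal :=
  inferInstanceAs (Monoidal.equivalenceTransported (equivStr V C M).symm).inverse.Monoidal

instance : (equivStr V C M).inverse.Monoidal := (equivStr V C M).inverseMonoidal

instance : (equivStr V C M).IsMonoidal :=
  { leftAdjoint_ε := rfl
    leftAdjoint_μ := fun _ _ => rfl }

end OmegaMod

end

end LaxModuleProf

namespace LaxModuleProf

noncomputable section

set_option linter.unusedSectionVars false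

open VProf

/-! ### The monoidal structures on lax module profunctors and on `Ω`-modules -/

section

variable {V : Type u} [Category.{v} V] [MonoidalCategory V] [SymmetricCategory V]
  {M : Type v} [Category.{v} M] [EnrichedOrdinaryCategory V M]

lemma idLeft_whiskerLeft_pre {F : VProf V M M} {A : V} {n m : M} (f : A ⟶ F.obj n m) :
    idLeft V n A ≫ _ ◁ f ≫ F.pre n n m = f := by
  rw [← reassoc_of% (idLeft_naturality n f), idLeft_pre, Category.comp_id]

lemma idRight_whiskerRight_post {F : VProf V M M} {A : V} {n m : M} (f : A ⟶ F.obj n m) :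
    idRight V A m ≫ f ▷ _ ≫ F.post n m m = f := by
  rw [← reassoc_of% (idRight_naturality m f), idRight_post, Category.comp_id]

end

section

variable {V : Type u} [Category.{v} V] [MonoidalCategory V] [SymmetricCategory V]
  {C : Type v} [Category.{v} C] [MonoidalCategory C] [EnrichedOrdinaryCategory V C]
  [MonoidalEnriched V C]
  {M : Type v} [Category.{v} M] [EnrichedOrdinaryCategory V M] [MonoidalLeftAction C M]
  [ModuleEnriched V C M]
  {F G H : VProf V M M}
  {sF : ∀ (x : C) (n m : M), F.obj n m ⟶ F.obj (x ⊙ₗ n) (x ⊙ₗ m)}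
  {sG : ∀ (x : C) (n m : M), G.obj n m ⟶ G.obj (x ⊙ₗ n) (x ⊙ₗ m)}
  {sH : ∀ (x : C) (n m : M), H.obj n m ⟶ H.obj (x ⊙ₗ n) (x ⊙ₗ m)}

/-- The action of a lax structure given by a strength. -/
def laxOfS (F : VProf V M M) (s : ∀ (x : C) (n m : M), F.obj n m ⟶ F.obj (x ⊙ₗ n) (x ⊙ₗ m))
    (x : C) (n n₁ m : M) : (n ⟶[V] (x ⊙ₗ n₁)) ⊗ F.obj n₁ m ⟶ F.obj n (x ⊙ₗ m) :=
  _ ◁ s x n₁ m ≫ F.pre n (x ⊙ₗ n₁) (x ⊙ₗ m)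

lemma idLeft_laxOfS (x : C) (k m : M) :
    idLeft V (x ⊙ₗ k) (F.obj k m) ≫ laxOfS F sF x (x ⊙ₗ k) k m = sF x k m :=
  idLeft_whiskerLeft_pre _

lemma laxOfS_post (x : C) (n n₁ m₁ m : M) :
    (α_ _ _ _).inv ≫ laxOfS F sF x n n₁ m₁ ▷ ((x ⊙ₗ m₁) ⟶[V] m) ≫ F.post n (x ⊙ₗ m₁) m =
      omegaOfS F sF x n n₁ m₁ m := by
  rw [laxOfS, omegaOfS, comp_whiskerRight, Category.assoc, F.pre_post,
    MonoidalCategory.whiskerLeft_comp, Category.assoc, whisker_assoc, Category.assoc,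
    Category.assoc, Iso.inv_hom_id_assoc, Iso.inv_hom_id_assoc]

lemma whiskerLeft_idRight_omegaOfS (x : C) (n n₁ k : M) :
    (n ⟶[V] (x ⊙ₗ n₁)) ◁ idRight V (F.obj n₁ k) (x ⊙ₗ k) ≫ omegaOfS F sF x n n₁ k (x ⊙ₗ k) =
      laxOfS F sF x n n₁ k := by
  rw [omegaOfS, ← MonoidalCategory.whiskerLeft_comp_assoc, idRight_whiskerRight_post, laxOfS]

lemma idLeft_omegaOfS (x : C) (k m₁ m : M) :
    idLeft V (x ⊙ₗ k) (F.obj k m₁ ⊗ ((x ⊙ₗ m₁) ⟶[V] m)) ≫ omegaOfS F sF x (x ⊙ₗ k) k m₁ m =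
      sF x k m₁ ▷ _ ≫ F.post _ _ _ :=
  idLeft_whiskerLeft_pre _

variable {J : ∀ n k m, F.obj n k ⊗ G.obj k m ⟶ H.obj n m}

lemma laxOfS_tensor
    (hs : ∀ x n k m, J n k m ≫ sH x n m = (sF x n k ⊗ₘ sG x k m) ≫ J (x ⊙ₗ n) (x ⊙ₗ k) (x ⊙ₗ m))
    (hpre : ∀ n n' k m, (n ⟶[V] n') ◁ J n' k m ≫ H.pre n n' m =
      (α_ _ _ _).inv ≫ F.pre n n' k ▷ _ ≫ J n k m) (x : C) (n n₁ k m : M) :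
    (n ⟶[V] (x ⊙ₗ n₁)) ◁ J n₁ k m ≫ laxOfS H sH x n n₁ m =
      (α_ _ _ _).inv ≫ laxOfS F sF x n n₁ k ▷ G.obj k m ≫
        F.obj n (x ⊙ₗ k) ◁ (idLeft V (x ⊙ₗ k) (G.obj k m) ≫ laxOfS G sG x (x ⊙ₗ k) k m) ≫
        J n (x ⊙ₗ k) (x ⊙ₗ m) := by
  rw [idLeft_laxOfS, laxOfS, laxOfS, ← MonoidalCategory.whiskerLeft_comp_assoc, hs,
    MonoidalCategory.whiskerLeft_comp_assoc, hpre, comp_whiskerRight_assoc,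
    ← whisker_exchange_assoc, MonoidalCategory.tensorHom_def, MonoidalCategory.whiskerLeft_comp,
    Category.assoc, associator_inv_naturality_right_assoc,
    associator_inv_naturality_middle_assoc]

lemma omegaOfS_tensor
    (hs : ∀ x n k m, J n k m ≫ sH x n m = (sF x n k ⊗ₘ sG x k m) ≫ J (x ⊙ₗ n) (x ⊙ₗ k) (x ⊙ₗ m))
    (hpre : ∀ n n' k m, (n ⟶[V] n') ◁ J n' k m ≫ H.pre n n' m =
      (α_ _ _ _).inv ≫ F.pre n n' k ▷ _ ≫ J n k m)
    (hpost : ∀ n k m m', J n k m ▷ (m ⟶[V] m') ≫ H.post n m m' =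
      (α_ _ _ _).hom ≫ _ ◁ G.post k m m' ≫ J n k m') (x : C) (n n₁ k m₁ m : M) :
    (n ⟶[V] (x ⊙ₗ n₁)) ◁ (J n₁ k m₁ ▷ ((x ⊙ₗ m₁) ⟶[V] m)) ≫ omegaOfS H sH x n n₁ m₁ m =
      (n ⟶[V] (x ⊙ₗ n₁)) ◁ (α_ (F.obj n₁ k) (G.obj k m₁) ((x ⊙ₗ m₁) ⟶[V] m)).hom ≫
        (α_ _ _ _).inv ≫
        (((n ⟶[V] (x ⊙ₗ n₁)) ◁ idRight V (F.obj n₁ k) (x ⊙ₗ k) ≫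
            omegaOfS F sF x n n₁ k (x ⊙ₗ k)) ⊗ₘ
          (idLeft V (x ⊙ₗ k) (G.obj k m₁ ⊗ ((x ⊙ₗ m₁) ⟶[V] m)) ≫
            omegaOfS G sG x (x ⊙ₗ k) k m₁ m)) ≫
        J n (x ⊙ₗ k) m := by
  have h1 : (sF x n₁ k ⊗ₘ sG x k m₁) ▷ ((x ⊙ₗ m₁) ⟶[V] m) ≫ (α_ _ _ _).hom ≫
        F.obj (x ⊙ₗ n₁) (x ⊙ₗ k) ◁ G.post (x ⊙ₗ k) (x ⊙ₗ m₁) m =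
      (α_ _ _ _).hom ≫ (sF x n₁ k ⊗ₘ (sG x k m₁ ▷ _ ≫ G.post (x ⊙ₗ k) (x ⊙ₗ m₁) m)) := by
    rw [← tensorHom_id, associator_naturality_assoc, tensorHom_comp_whiskerLeft, tensorHom_id]
  have h2 {A B : V} (t : A ⟶ B) : (n ⟶[V] (x ⊙ₗ n₁)) ◁ (sF x n₁ k ⊗ₘ t) ≫ (α_ _ _ _).inv =
      (α_ _ _ _).inv ≫ ((n ⟶[V] (x ⊙ₗ n₁)) ◁ sF x n₁ k ⊗ₘ t) := by
    rw [← id_tensorHom, associator_inv_naturality, id_tensorHom]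
  rw [whiskerLeft_idRight_omegaOfS, idLeft_omegaOfS, omegaOfS,
    ← MonoidalCategory.whiskerLeft_comp_assoc, ← comp_whiskerRight_assoc, hs,
    comp_whiskerRight_assoc, hpost, reassoc_of% h1, MonoidalCategory.whiskerLeft_comp,
    MonoidalCategory.whiskerLeft_comp, Category.assoc, Category.assoc, hpre, reassoc_of% h2,
    tensorHom_comp_whiskerRight_assoc, laxOfS]

lemma laxOfS_unit {U : ∀ n m : M, (n ⟶[V] m) ⟶ H.obj n m}
    (hs : ∀ x n m, U n m ≫ sH x n m = actL V x n m ≫ U (x ⊙ₗ n) (x ⊙ₗ m))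
    (hpre : ∀ n n' m, eComp V n n' m ≫ U n m = (n ⟶[V] n') ◁ U n' m ≫ H.pre n n' m)
    (x : C) (n n₁ m : M) :
    (n ⟶[V] (x ⊙ₗ n₁)) ◁ U n₁ m ≫ laxOfS H sH x n n₁ m =
      (n ⟶[V] (x ⊙ₗ n₁)) ◁ actL V x n₁ m ≫ eComp V n (x ⊙ₗ n₁) (x ⊙ₗ m) ≫ U n (x ⊙ₗ m) := by
  rw [laxOfS, ← MonoidalCategory.whiskerLeft_comp_assoc, hs,
    MonoidalCategory.whiskerLeft_comp_assoc, hpre]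

lemma omegaOfS_unit_map {U : ∀ n m : M, (n ⟶[V] m) ⟶ H.obj n m}
    (hs : ∀ x n m, U n m ≫ sH x n m = actL V x n m ≫ U (x ⊙ₗ n) (x ⊙ₗ m))
    (hpre : ∀ n n' m, eComp V n n' m ≫ U n m = (n ⟶[V] n') ◁ U n' m ≫ H.pre n n' m)
    (hpost : ∀ n m m', eComp V n m m' ≫ U n m' = U n m ▷ (m ⟶[V] m') ≫ H.post n m m')
    (x : C) (n n₁ m₁ m : M) :
    (n ⟶[V] (x ⊙ₗ n₁)) ◁ (U n₁ m₁ ▷ ((x ⊙ₗ m₁) ⟶[V] m)) ≫ omegaOfS H sH x n n₁ m₁ m =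
      (n ⟶[V] (x ⊙ₗ n₁)) ◁ (actL V x n₁ m₁ ▷ ((x ⊙ₗ m₁) ⟶[V] m) ≫
          eComp V (x ⊙ₗ n₁) (x ⊙ₗ m₁) m) ≫
        eComp V n (x ⊙ₗ n₁) m ≫ U n m := by
  rw [omegaOfS, ← MonoidalCategory.whiskerLeft_comp_assoc, ← comp_whiskerRight_assoc, hs,
    comp_whiskerRight_assoc, ← hpost, hpre n (x ⊙ₗ n₁) m, ← MonoidalCategory.whiskerLeft_comp_assoc,
    Category.assoc]

end

variable {V : Type u} [Category.{v} V] [MonoidalCategory V] [SymmetricCategory V]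
  [MonoidalClosed V] [HasColimits V]
  {C : Type v} [Category.{v} C] [MonoidalCategory C] [EnrichedOrdinaryCategory V C]
  [MonoidalEnriched V C]
  {M : Type v} [Category.{v} M] [EnrichedOrdinaryCategory V M] [MonoidalLeftAction C M]
  [ModuleEnriched V C M]

lemma LaxMod.component_eq (X : LaxMod V C M M) (x : C) (n n₁ m : M) :
    X.component x n n₁ m = laxOfS X.prof ((equivStr V C M).functor.obj X).s x n n₁ m :=
  laxComponent_eq _ _ _ _ _

lemma OmegaMod.component_eq (X : OmegaMod V C M M) (x : C) (n n₁ m₁ m : M) :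
    X.component x n n₁ m₁ m =
      omegaOfS X.prof ((equivStr V C M).functor.obj X).s x n n₁ m₁ m :=
  omegaComponent_eq _ _ _ _ _ _

variable (V C M) in
/-- The monoidal structure on lax module profunctors. -/
def laxTensorSpec : LaxTensorSpec V C M where
  toComposition := compositionTensor ((LaxMod.equivStr V C M).functor ⋙ StrMod.forget V C M)
  tensor_component X Y x n n₁ k m := by
    rw [LaxMod.component_eq, LaxMod.component_eq, LaxMod.component_eq]
    exact laxOfS_tensor (tensorJ_s (LaxMod.equivStr V C M).functor X Y)
      (tensorJ_pre ((LaxMod.equivStr V C M).functor ⋙ StrMod.forget V C M) X Y) x n n₁ k m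
  unit_component x n n₁ m := by
    rw [LaxMod.component_eq]
    exact laxOfS_unit (tensorU_s (LaxMod.equivStr V C M).functor)
      (Functor.LaxMonoidal.ε ((LaxMod.equivStr V C M).functor ⋙ StrMod.forget V C M)).pre_app
      x n n₁ m

variable (V C M) in
/-- The monoidal structure on `Ω`-modules. -/
def omegaTensorSpec : OmegaTensorSpec V C M where
  toComposition := compositionTensor ((OmegaMod.equivStr V C M).functor ⋙ StrMod.forget V C M)
  tensor_component X Y x n n₁ k m₁ m := by
    rw [OmegaMod.component_eq, OmegaMod.component_eq, OmegaMod.component_eq]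
    exact omegaOfS_tensor (tensorJ_s (OmegaMod.equivStr V C M).functor X Y)
      (tensorJ_pre ((OmegaMod.equivStr V C M).functor ⋙ StrMod.forget V C M) X Y)
      (tensorJ_post ((OmegaMod.equivStr V C M).functor ⋙ StrMod.forget V C M) X Y) x n n₁ k m₁ m
  unit_component x n n₁ m₁ m := by
    rw [OmegaMod.component_eq]
    exact omegaOfS_unit_map (tensorU_s (OmegaMod.equivStr V C M).functor)
      (Functor.LaxMonoidal.ε ((OmegaMod.equivStr V C M).functor ⋙ StrMod.forget V C M)).pre_app
      (Functor.LaxMonoidal.ε ((OmegaMod.equivStr V C M).functor ⋙ StrMod.forget V C M)).post_app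
      x n n₁ m₁ m

lemma omegaOfS_map {F G : VProf V M M}
    {sF : ∀ (x : C) (n m : M), F.obj n m ⟶ F.obj (x ⊙ₗ n) (x ⊙ₗ m)}
    {sG : ∀ (x : C) (n m : M), G.obj n m ⟶ G.obj (x ⊙ₗ n) (x ⊙ₗ m)} (f : F ⟶ G)
    (hs : ∀ x n m, sF x n m ≫ f.app _ _ = f.app n m ≫ sG x n m) (x : C) (n n₁ m₁ m : M) :
    omegaOfS F sF x n n₁ m₁ m ≫ f.app n m =
      (n ⟶[V] (x ⊙ₗ n₁)) ◁ (f.app n₁ m₁ ▷ ((x ⊙ₗ m₁) ⟶[V] m)) ≫ omegaOfS G sG x n n₁ m₁ m := by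
  rw [omegaOfS, omegaOfS, Category.assoc, f.pre_app, ← MonoidalCategory.whiskerLeft_comp_assoc,
    ← MonoidalCategory.whiskerLeft_comp_assoc, Category.assoc, f.post_app,
    ← comp_whiskerRight_assoc, ← comp_whiskerRight_assoc, hs]

/-- The canonical monoidal equivalence between lax module profunctors and `Ω`-modules. -/
def laxOmegaEquiv : LaxOmegaEquiv (laxTensorSpec V C M) (omegaTensorSpec V C M) where
  equiv := (LaxMod.equivStr V C M).trans (OmegaMod.equivStr V C M).symm
  monoidal := inferInstanceAs
    ((LaxMod.equivStr V C M).functor ⋙ (OmegaMod.equivStr V C M).inverse).Monoidal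
  underlying := Functor.isoWhiskerLeft (LaxMod.equivStr V C M).functor
    (Functor.isoWhiskerRight (OmegaMod.equivStr V C M).counitIso (StrMod.forget V C M))
  action X x n n₁ m₁ m := by
    have h := omegaOfS_map _ (StrMod.s_hom ((OmegaMod.equivStr V C M).counitIso.hom.app
      ((LaxMod.equivStr V C M).functor.obj X))) x n n₁ m₁ m
    have h1 : (α_ _ _ _).inv ≫ X.component x n n₁ m₁ ▷ ((x ⊙ₗ m₁) ⟶[V] m) ≫
        X.prof.post n (x ⊙ₗ m₁) m =
          omegaOfS X.prof ((LaxMod.equivStr V C M).functor.obj X).s x n n₁ m₁ m :=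
      (congrArg (fun t => (α_ _ _ _).inv ≫ t ▷ ((x ⊙ₗ m₁) ⟶[V] m) ≫ X.prof.post n (x ⊙ₗ m₁) m)
        (LaxMod.component_eq X x n n₁ m₁)).trans (laxOfS_post x n n₁ m₁ m)
    refine (congrArg (fun t => t ≫ _) (OmegaMod.component_eq _ x n n₁ m₁ m)).trans (h.trans ?_)
    exact congrArg (fun t => _ ≫ t) h1.symm
  tensor_comparison X Y n k m :=
    tensorJ_comparison (LaxMod.equivStr V C M) (OmegaMod.equivStr V C M) X Y n k m
  unit_comparison n m :=
    tensorU_comparison (LaxMod.equivStr V C M) (OmegaMod.equivStr V C M) n m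

end

end LaxModuleProf

namespace LaxModuleProf

noncomputable section

set_option linter.unusedSectionVars false

open VProf

/-! ### Profunctors with trivial domain into a product -/

namespace VProf

variable {V : Type u} [Category.{v} V] [MonoidalCategory V] [SymmetricCategory V]
  {C : Type v} [EnrichedCategory V C] {D : Type v} [EnrichedCategory V D]
  {E : Type v} [EnrichedCategory V E]

lemma insertLeft_tensor_insertRight_eComp (x x' : C) (e e' : E) :
    ((insertLeft (V := V) C e).map x x' ⊗ₘ (insertRight (V := V) E x').map e e') ≫
      eComp V (x, e) (x', e) (x', e') = 𝟙 _ :=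
  insert_exchange' _ _ _ _ (by rw [← Iso.inv_comp_eq_id, e_comp_id])
    (by rw [← Iso.inv_comp_eq_id, e_id_comp])

lemma pre_eq_preSnd_preFst (K : VProf V D (C × E)) (p q : C × E) (d : D) :
    K.pre p q d = (α_ _ _ _).hom ≫ _ ◁ K.preSnd q.1 p.2 q.2 d ≫ K.preFst p.1 q.1 p.2 d := by
  have h := action_comp_aux ((insertLeft (V := V) C p.2).map p.1 q.1)
    ((insertRight (V := V) E q.1).map p.2 q.2) _ _ _ _
      (K.pre_comp (p.1, p.2) (q.1, p.2) (q.1, q.2) d)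
  refine Eq.trans ?_ (congrArg (fun t => (α_ _ _ _).hom ≫ t) h.symm)
  rw [insertLeft_tensor_insertRight_eComp, Iso.hom_inv_id_assoc, id_whiskerRight, Category.id_comp]

lemma preSnd_preFst (K : VProf V D (C × E)) (x x' : C) (e e' : E) (d : D) :
    (x ⟶[V] x') ◁ K.preSnd x' e e' d ≫ K.preFst x x' e d =
      (α_ _ _ _).inv ≫ (β_ _ _).hom ▷ K.obj (x', e') d ≫ (α_ _ _ _).hom ≫
        (e ⟶[V] e') ◁ K.preFst x x' e' d ≫ K.preSnd x e e' d := by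
  rw [preFst_preSnd, Iso.hom_inv_id_assoc, ← comp_whiskerRight_assoc, SymmetricCategory.symmetry,
    id_whiskerRight, Category.id_comp, Iso.inv_hom_id_assoc]

lemma post_punit (P : VProf V PUnit.{v + 1} D) (d : D) :
    P.post d PUnit.unit PUnit.unit = (ρ_ _).hom := by
  have h := P.post_id d PUnit.unit
  rw [← h]
  exact ((congrArg (fun t => t ≫ P.post d _ _) (MonoidalCategory.whiskerLeft_id _ _)).trans
    (Category.id_comp _)).symm

/-- The profunctor `C ⇸ D` with transpose `P`. -/
@[reducible] def unheart (P : VProf V PUnit.{v + 1} (Cᵒᵖ × D)) : VProf V C D where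
  obj d c := P.obj (Opposite.op c, d) PUnit.unit
  pre d d' c := P.preSnd (Opposite.op c) d d' PUnit.unit
  post d c c' := (β_ _ _).hom ≫ P.preFst (Opposite.op c') (Opposite.op c) d PUnit.unit
  pre_id d c := (P.restrict (insertRight D (Opposite.op c)) (EnrichedFunctor.id V _)).pre_id _ _
  pre_comp d d' d'' c :=
    (P.restrict (insertRight D (Opposite.op c)) (EnrichedFunctor.id V _)).pre_comp _ _ _ _
  post_id d c := right_op_id _ _
    ((P.restrict (insertLeft Cᵒᵖ d) (EnrichedFunctor.id V _)).pre_id _ _)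
  post_comp d c c' c'' := by
    have h := right_action_op _ _ _ _
      ((P.restrict (insertLeft Cᵒᵖ d) (EnrichedFunctor.id V _)).pre_comp (Opposite.op c'')
        (Opposite.op c') (Opposite.op c) PUnit.unit)
    have e : eComp V c c' c'' = (β_ _ _).hom ≫
        eComp V (Opposite.op c'') (Opposite.op c') (Opposite.op c) :=
      (SymmetricCategory.symmetry_assoc _ _ _).symm
    rw [e]
    exact h
  pre_post d d' c c' :=
    left_left_commute _ _ _ _ (P.preSnd_preFst (Opposite.op c') (Opposite.op c) d d' PUnit.unit)

lemma pre_eq_unheart (P : VProf V PUnit.{v + 1} (Cᵒᵖ × D)) (p q : Cᵒᵖ × D) :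
    P.pre p q PUnit.unit = (α_ _ _ _).hom ≫ _ ◁ (unheart P).pre p.2 q.2 q.1.unop ≫ (β_ _ _).hom ≫
      (unheart P).post p.2 q.1.unop p.1.unop := by
  rw [pre_eq_preSnd_preFst]
  change _ = (α_ _ _ _).hom ≫ _ ◁ P.preSnd _ _ _ _ ≫ (β_ _ _).hom ≫ (β_ _ _).hom ≫ P.preFst _ _ _ _
  rw [SymmetricCategory.symmetry_assoc]

/-- A profunctor with trivial domain is the transpose of its transpose. -/
def heartUnheartIso (P : VProf V PUnit.{v + 1} (Cᵒᵖ × D)) : heart (unheart P) ≅ P :=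
  isoOfComponents
    { app := fun p _ => 𝟙 (P.obj p PUnit.unit)
      pre_app := fun p q _ => by
        have h := pre_eq_unheart P p q
        exact ((Category.comp_id _).trans h.symm).trans
          ((congrArg (fun t => t ≫ P.pre p q PUnit.unit)
            (MonoidalCategory.whiskerLeft_id _ _)).trans (Category.id_comp _)).symm
      post_app := fun p _ _ => by
        have h := post_punit P p
        exact ((Category.comp_id _).trans h.symm).trans
          ((congrArg (fun t => t ≫ P.post p PUnit.unit PUnit.unit)
            (MonoidalCategory.id_whiskerRight _ _)).trans (Category.id_comp _)).symm }
    (fun p _ => 𝟙 (P.obj p PUnit.unit)) (fun _ _ => Category.comp_id _)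
    (fun _ _ => Category.comp_id _)

lemma preSnd_app {D' : Type v} [EnrichedCategory V D'] {K L : VProf V D' (C × E)} (f : K ⟶ L)
    (x : C) (e e' : E) (d : D') :
    K.preSnd x e e' d ≫ f.app (x, e) d = _ ◁ f.app (x, e') d ≫ L.preSnd x e e' d := by
  have h := f.pre_app (x, e) (x, e') d
  simp only [preSnd, Category.assoc]
  rw [whisker_exchange_assoc]
  exact congrArg _ h

lemma preFst_app {D' : Type v} [EnrichedCategory V D'] {K L : VProf V D' (C × E)} (f : K ⟶ L)
    (x x' : C) (e : E) (d : D') :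
    K.preFst x x' e d ≫ f.app (x, e) d = _ ◁ f.app (x', e) d ≫ L.preFst x x' e d := by
  have h := f.pre_app (x, e) (x', e) d
  simp only [preFst, Category.assoc]
  rw [whisker_exchange_assoc]
  exact congrArg _ h

/-- Transposition of morphisms. -/
@[reducible] def unheartMap {P Q : VProf V PUnit.{v + 1} (Cᵒᵖ × D)} (f : P ⟶ Q) :
    unheart P ⟶ unheart Q where
  app d c := f.app (Opposite.op c, d) PUnit.unit
  pre_app d d' c := preSnd_app f _ _ _ _
  post_app d c c' := by
    have h := preFst_app f (Opposite.op c') (Opposite.op c) d PUnit.unit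
    change ((β_ _ _).hom ≫ P.preFst _ _ _ _) ≫ _ = _ ▷ _ ≫ (β_ _ _).hom ≫ Q.preFst _ _ _ _
    rw [Category.assoc, h]
    exact (BraidedCategory.braiding_naturality_left_assoc _ _ _).symm

lemma insert_left_action {X Y F F₁ : V} (i : 𝟙_ V ⟶ X) (b : Y ⊗ F ⟶ F₁) (a : X ⊗ F₁ ⟶ F₁)
    (ha : i ▷ F₁ ≫ a = (λ_ F₁).hom) :
    ((λ_ Y).inv ≫ i ▷ Y) ▷ F ≫ (α_ X Y F).hom ≫ X ◁ b ≫ a = b := by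
  rw [comp_whiskerRight, Category.assoc, associator_naturality_left_assoc,
    ← whisker_exchange_assoc, ha]
  simp

lemma insert_right_action {X Y F F₁ : V} (i : 𝟙_ V ⟶ Y) (b : Y ⊗ F ⟶ F) (a : X ⊗ F ⟶ F₁)
    (hb : i ▷ F ≫ b = (λ_ F).hom) :
    ((ρ_ X).inv ≫ X ◁ i) ▷ F ≫ (α_ X Y F).hom ≫ X ◁ b ≫ a = a := by
  rw [comp_whiskerRight, Category.assoc, associator_naturality_middle_assoc,
    ← MonoidalCategory.whiskerLeft_comp_assoc, hb]
  simp

lemma heart_preSnd (F : VProf V C D) (c : C) (d d' : D) :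
    (heart F).preSnd (Opposite.op c) d d' PUnit.unit = F.pre d d' c :=
  insert_left_action _ _ _ (left_op_id _ _ (F.post_id _ _))

lemma heart_preFst (F : VProf V C D) (c c' : C) (d : D) :
    (heart F).preFst (Opposite.op c') (Opposite.op c) d PUnit.unit =
      (β_ (c ⟶[V] c') (F.obj d c)).hom ≫ F.post d c c' :=
  insert_right_action _ _ _ (F.pre_id _ _)

/-- A profunctor is the transpose of its transpose. -/
def unheartHeartIso (F : VProf V C D) : unheart (heart F) ≅ F :=
  isoOfComponents
    { app := fun d c => 𝟙 (F.obj d c)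
      pre_app := fun d d' c => by
        have h := heart_preSnd F c d d'
        exact ((Category.comp_id _).trans h).trans
          ((congrArg (fun t => t ≫ F.pre d d' c)
            (MonoidalCategory.whiskerLeft_id _ _)).trans (Category.id_comp _)).symm
      post_app := fun d c c' => by
        have h := heart_preFst F c c' d
        have h2 : (β_ (F.obj d c) (c ⟶[V] c')).hom ≫
            (heart F).preFst (Opposite.op c') (Opposite.op c) d PUnit.unit = F.post d c c' := by
          rw [h, SymmetricCategory.symmetry_assoc]
        exact ((Category.comp_id _).trans h2).trans
          ((congrArg (fun t => t ≫ F.post d c c')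
            (MonoidalCategory.id_whiskerRight _ _)).trans (Category.id_comp _)).symm }
    (fun d c => 𝟙 (F.obj d c)) (fun _ _ => Category.comp_id _)
    (fun _ _ => Category.comp_id _)

end VProf

end

end LaxModuleProf

namespace LaxModuleProf

noncomputable section

set_option linter.unusedSectionVars false

open VProf

/-! ### Partial actions on products -/

section Partial

variable {V : Type u} [Category.{v} V] [MonoidalCategory V] [SymmetricCategory V]

lemma insert_tensorμ_right {X K G T Z W : V} (k : 𝟙_ V ⟶ K) (c₁ : X ⊗ G ⟶ Z) (c₂ : K ⊗ T ⟶ W)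
    (f : T ⟶ W) (h : k ▷ T ≫ c₂ = (λ_ T).hom ≫ f) :
    ((ρ_ X).inv ≫ X ◁ k) ▷ (G ⊗ T) ≫ tensorμ X K G T ≫ (c₁ ⊗ₘ c₂) =
      (α_ _ _ _).inv ≫ (c₁ ⊗ₘ f) := by
  have h2 := tensorμ_natural_left (𝟙 X) k G T
  rw [id_tensorHom, id_whiskerRight] at h2
  rw [comp_whiskerRight, Category.assoc, reassoc_of% h2, tensorHom_comp_tensorHom, h,
    Category.id_comp, ← whiskerLeft_comp_tensorHom]
  simp only [← Category.assoc]
  congr 1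
  simp [tensorμ]
  monoidal

lemma insert_tensorμ_left {X K G T Z W : V} (k : 𝟙_ V ⟶ K) (c₁ : K ⊗ G ⟶ Z) (c₂ : X ⊗ T ⟶ W)
    (f : G ⟶ Z) (h : k ▷ G ≫ c₁ = (λ_ G).hom ≫ f) :
    ((λ_ X).inv ≫ k ▷ X) ▷ (G ⊗ T) ≫ tensorμ K X G T ≫ (c₁ ⊗ₘ c₂) =
      (α_ _ _ _).inv ≫ (β_ _ _).hom ▷ T ≫ (α_ _ _ _).hom ≫ (f ⊗ₘ c₂) := by
  have h2 := tensorμ_natural_left k (𝟙 X) G T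
  rw [tensorHom_id, id_whiskerRight] at h2
  rw [comp_whiskerRight, Category.assoc, reassoc_of% h2, tensorHom_comp_tensorHom, h,
    Category.id_comp, ← whiskerRight_comp_tensorHom]
  simp only [← Category.assoc]
  congr 1
  simp [tensorμ]

lemma insert_tensorμ_comp {X X₀ K G G₀ T Z : V} (r : X₀ ⟶ X) (g : G₀ ⟶ G) (k : 𝟙_ V ⟶ K)
    (c₁ : X ⊗ G ⟶ Z) (c₂ : K ⊗ T ⟶ T) (h : k ▷ T ≫ c₂ = (λ_ T).hom) :
    (r ≫ (ρ_ X).inv ≫ X ◁ k ⊗ₘ (g ⊗ₘ 𝟙 T)) ≫ tensorμ X K G T ≫ (c₁ ⊗ₘ c₂) =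
      (α_ _ _ _).inv ≫ ((r ⊗ₘ g) ≫ c₁) ▷ T := by
  have h' := insert_tensorμ_right k c₁ c₂ (𝟙 _) (by rw [h, Category.comp_id])
  rw [MonoidalCategory.tensorHom_def', comp_whiskerRight r, Category.assoc, Category.assoc, h',
    MonoidalCategory.tensorHom_def' r, tensorHom_id, tensorHom_id, Category.assoc,
        comp_whiskerRight,
    comp_whiskerRight, associator_inv_naturality_left_assoc, associator_inv_naturality_middle_assoc]

lemma insert_units_comp {X Y I K L : V} (f : X ⟶ Y) (i : 𝟙_ V ⟶ I) (k : 𝟙_ V ⟶ K)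
    (c : Y ⊗ I ⟶ Y) (g : K ⟶ L) (h : Y ◁ i ≫ c = (ρ_ Y).hom) :
    X ◁ ((λ_ (𝟙_ V)).inv ≫ (i ⊗ₘ k)) ≫ (α_ _ _ _).inv ≫ (f ▷ I ≫ c) ▷ K ≫ (𝟙 Y ⊗ₘ g) =
      (ρ_ X).hom ≫ f ≫ (ρ_ Y).inv ≫ Y ◁ (k ≫ g) := by
  have h1 : (X ◁ i) ≫ f ▷ I ≫ c = (ρ_ X).hom ≫ f := by
    rw [whisker_exchange_assoc, h, rightUnitor_naturality]
  have h2 : X ◁ (i ⊗ₘ k) ≫ (α_ _ _ _).inv ≫ (f ▷ I ≫ c) ▷ K =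
      (α_ _ _ _).inv ≫ ((ρ_ X).hom ≫ f) ▷ 𝟙_ V ≫ Y ◁ k := by
    rw [← h1, MonoidalCategory.tensorHom_def, MonoidalCategory.whiskerLeft_comp, Category.assoc,
      associator_inv_naturality_right_assoc, whisker_exchange,
      associator_inv_naturality_middle_assoc]
    simp only [comp_whiskerRight, Category.assoc]
  rw [MonoidalCategory.whiskerLeft_comp, Category.assoc, reassoc_of% h2, id_tensorHom,
    MonoidalCategory.whiskerLeft_comp, comp_whiskerRight, Category.assoc,
    rightUnitor_inv_naturality_assoc]
  simp

end Partial

namespace VProf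

variable {V : Type u} [Category.{v} V] [MonoidalCategory V] [SymmetricCategory V]
  {A : Type v} [EnrichedCategory V A] {B : Type v} [EnrichedCategory V B]
  {C : Type v} [EnrichedCategory V C] {D : Type v} [EnrichedCategory V D]
  {E : Type v} [EnrichedCategory V E]

lemma tens_preFst (F : VProf V A C) (G : VProf V B D) (c c' : C) (d : D) (p : A × B) :
    (tens F G).preFst c c' d p = (α_ _ _ _).inv ≫ F.pre c c' p.1 ▷ _ := by
  have h := insert_tensorμ_right (X := c ⟶[V] c') (G := F.obj c' p.1) (eId V d)
    (F.pre c c' p.1) (G.pre d d p.2) (𝟙 _) (by rw [G.pre_id, Category.comp_id])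
  rw [tensorHom_id] at h
  exact h

lemma tens_preSnd (F : VProf V A C) (G : VProf V B D) (c : C) (d d' : D) (p : A × B) :
    (tens F G).preSnd c d d' p =
      (α_ _ _ _).inv ≫ (β_ _ _).hom ▷ _ ≫ (α_ _ _ _).hom ≫ _ ◁ G.pre d d' p.2 := by
  have h := insert_tensorμ_left (X := d ⟶[V] d') (T := G.obj d' p.2) (eId V c)
    (F.pre c c p.1) (G.pre d d' p.2) (𝟙 _) (by rw [F.pre_id, Category.comp_id])
  rw [id_tensorHom] at h
  exact h

lemma bend_preFst (K : VProf V D (C × E)) (p p' : Dᵒᵖ) (c : C) (e : Eᵒᵖ) :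
    (bend K).preFst p p' c e = (β_ _ _).hom ≫ K.post (c, e.unop) p'.unop p.unop :=
  insert_right_action _ _ _
    ((K.restrict (insertLeft C e.unop) (EnrichedFunctor.id V D)).pre_id c p'.unop)

lemma bend_preSnd (K : VProf V D (C × E)) (p : Dᵒᵖ) (c c' : C) (e : Eᵒᵖ) :
    (bend K).preSnd p c c' e = K.preFst c c' e.unop p.unop :=
  insert_left_action _ _ _ (left_op_id _ _ (K.post_id _ _))

/-- Equivariance for a composite of two families of arrows. -/
lemma pre_app_comp {K L : VProf V C D} {c : C} (app : ∀ d, K.obj d c ⟶ L.obj d c) {d d₁ d' : D}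
    {X Y : V} (l : X ⟶ (d ⟶[V] d₁)) (r : Y ⟶ (d₁ ⟶[V] d'))
    (hl : l ▷ _ ≫ K.pre d d₁ c ≫ app d = X ◁ app d₁ ≫ l ▷ _ ≫ L.pre d d₁ c)
    (hr : r ▷ _ ≫ K.pre d₁ d' c ≫ app d₁ = Y ◁ app d' ≫ r ▷ _ ≫ L.pre d₁ d' c) :
    ((l ⊗ₘ r) ≫ eComp V d d₁ d') ▷ _ ≫ K.pre d d' c ≫ app d =
      (X ⊗ Y) ◁ app d' ≫ ((l ⊗ₘ r) ≫ eComp V d d₁ d') ▷ _ ≫ L.pre d d' c := by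
  have h1 := action_comp_aux l r _ _ _ _ (K.pre_comp d d₁ d' c)
  have h2 := action_comp_aux l r _ _ _ _ (L.pre_comp d d₁ d' c)
  rw [← cancel_epi (α_ _ _ _).inv, ← reassoc_of% h1, hl,
    ← associator_inv_naturality_right_assoc, ← h2, ← MonoidalCategory.whiskerLeft_comp_assoc,
    ← MonoidalCategory.whiskerLeft_comp_assoc, Category.assoc, hr,
    MonoidalCategory.whiskerLeft_comp_assoc]

end VProf

end

end LaxModuleProf

namespace LaxModuleProf

noncomputable section

set_option linter.unusedSectionVars false

open VProf

/-! ### Strengths of actions of the probimonad -/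

section Legs

variable (V : Type u) [Category.{v} V] [MonoidalCategory V] [SymmetricCategory V]
  (C : Type v) [Category.{v} C] [MonoidalCategory C] [EnrichedOrdinaryCategory V C]
  [MonoidalEnriched V C]
  (M : Type v) [Category.{v} M] [EnrichedOrdinaryCategory V M] [MonoidalLeftAction C M]
  [ModuleEnriched V C M]

/-- The `V`-functor `((p, x), m) ↦ (p, x ⊙ m)`. -/
@[reducible] def hFunctor : EnrichedFunctor V ((Mᵒᵖ × C) × M) (Mᵒᵖ × M) :=
  EnrichedFunctor.comp V (assocFunctor V Mᵒᵖ C M)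
    (prodFunctor V (EnrichedFunctor.id V Mᵒᵖ) (actFunctor V C M))

/-- The first factor of `H`. -/
abbrev hLeft : VProf V ((Mᵒᵖ × C) × M) (Mᵒᵖ × M) :=
  (tens (idProf V Mᵒᵖ) (companion (actFunctor V C M))).restrict
    (EnrichedFunctor.id V (Mᵒᵖ × M)) (assocFunctor V Mᵒᵖ C M)

/-- The second factor of `H`. -/
abbrev hRight : VProf V (Mᵒᵖ × M) ((Mᵒᵖ × C) × M) :=
  tens (bend (conjoint (actFunctor V C M))) (idProf V M)

/-- The first factor of `H` is a companion. -/
def hLeftIso : hLeft V C M ≅ companion (hFunctor V C M) :=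
  isoOfComponents
    { app := fun b d => 𝟙 (b ⟶[V] (hFunctor V C M).obj d)
      pre_app := fun b b' d => by
        change (𝟙 (b ⟶[V] b') ▷ (b' ⟶[V] (hFunctor V C M).obj d) ≫ eComp V _ _ _) ≫ 𝟙 _ =
          _ ◁ 𝟙 _ ≫ eComp V _ _ _
        simp
      post_app := fun b d d' => by
        change (_ ◁ (α_ _ _ _).hom ≫ tensorμ _ _ _ _ ≫ (eComp V _ _ _ ⊗ₘ
            (_ ◁ ModuleEnriched.actE _ _ _ _ ≫ eComp V _ _ _))) ≫ 𝟙 _ =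
          𝟙 _ ▷ _ ≫ _ ◁ ((α_ _ _ _).hom ≫ (𝟙 _ ⊗ₘ ModuleEnriched.actE _ _ _ _)) ≫
            tensorμ _ _ _ _ ≫ (eComp V _ _ _ ⊗ₘ eComp V _ _ _)
        rw [Category.comp_id, id_whiskerRight, Category.id_comp, MonoidalCategory.whiskerLeft_comp,
          Category.assoc, tensorμ_natural_right_assoc, tensorHom_comp_tensorHom,
          MonoidalCategory.whiskerLeft_id, Category.id_comp] }
    (fun b d => 𝟙 (b ⟶[V] (hFunctor V C M).obj d)) (fun _ _ => Category.comp_id _)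
    (fun _ _ => Category.comp_id _)

variable {C M}

/-- The `V`-functor `(p, m) ↦ (p, x ⊙ m)`. -/
@[reducible] def sndActFunctor (x : C) : EnrichedFunctor V (Mᵒᵖ × M) (Mᵒᵖ × M) :=
  prodFunctor V (EnrichedFunctor.id V Mᵒᵖ)
    (EnrichedFunctor.comp V (insertRight M x) (actFunctor V C M))

/-- The `V`-functor `(p, m) ↦ ((p, x), m)`. -/
@[reducible] def insertMid (x : C) : EnrichedFunctor V (Mᵒᵖ × M) ((Mᵒᵖ × C) × M) :=
  prodFunctor V (insertLeft Mᵒᵖ x) (EnrichedFunctor.id V M)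

/-- The action of `x` on both variables. -/
abbrev actPair (x : C) (a : Mᵒᵖ × M) : Mᵒᵖ × M := (Opposite.op (x ⊙ₗ a.1.unop), x ⊙ₗ a.2)

/-- The action of `x` on the first variable. -/
abbrev actFst (x : C) (a : Mᵒᵖ × M) : Mᵒᵖ × M := (Opposite.op (x ⊙ₗ a.1.unop), a.2)

/-- The action of `x` on the second variable. -/
abbrev actSnd (x : C) (a : Mᵒᵖ × M) : Mᵒᵖ × M := (a.1, x ⊙ₗ a.2)

/-- The action of `x` on hom objects, in both variables. -/
def actPairHom (x : C) (a a' : Mᵒᵖ × M) : (a ⟶[V] a') ⟶ (actPair x a ⟶[V] actPair x a') :=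
  actL V x a'.1.unop a.1.unop ⊗ₘ actL V x a.2 a'.2

/-- The action of `x` on hom objects, in the first variable. -/
def actFstHom (x : C) (a a' : Mᵒᵖ × M) : (a ⟶[V] a') ⟶ (actFst x a ⟶[V] actFst x a') :=
  actL V x a'.1.unop a.1.unop ▷ _

/-- The action of `x` on hom objects, in the second variable. -/
def actSndHom (x : C) (b b' : Mᵒᵖ × M) : (b ⟶[V] b') ⟶ (actSnd x b ⟶[V] actSnd x b') :=
  (sndActFunctor V x).map b b'

lemma eId_actSndHom (x : C) (b : Mᵒᵖ × M) : eId V b ≫ actSndHom V x b b = eId V (actSnd x b) :=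
  (sndActFunctor V x).map_id b

lemma actFstHom_actSndHom (x : C) (a a' : Mᵒᵖ × M) :
    actFstHom V x a a' ≫ actSndHom V x (actFst x a) (actFst x a') = actPairHom V x a a' := by
  change _ ▷ _ ≫ (𝟙 _ ⊗ₘ actL V x _ _) = _ ⊗ₘ _
  rw [id_tensorHom]
  exact (MonoidalCategory.tensorHom_def _ _).symm

lemma eComp_actSndHom (x : C) (b b' b'' : Mᵒᵖ × M) :
    eComp V b b' b'' ≫ actSndHom V x b b'' =
      (actSndHom V x b b' ⊗ₘ actSndHom V x b' b'') ≫ eComp V _ _ _ :=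
  (sndActFunctor V x).map_comp b b' b''

/-- The maps on hom objects of the `V`-functor `(p, m) ↦ ((p, x), m)`. -/
def insertMidHom (x : C) (b b' : Mᵒᵖ × M) :
    (b ⟶[V] b') ⟶ (((b.1, x), b.2) ⟶[V] ((b'.1, x), b'.2)) :=
  (insertMid V x).map b b'

lemma insertMid_pre (x : C) (b b' a : Mᵒᵖ × M) :
    insertMidHom V x b b' ▷ (hRight V C M).obj ((b'.1, x), b'.2) a ≫
        (hRight V C M).pre ((b.1, x), b.2) ((b'.1, x), b'.2) a =
      eComp V b b' (actFst x a) := by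
  have h := bend_preFst (conjoint (actFunctor V C M)) b.1 b'.1 x a.1
  change ((insertLeft (V := V) Mᵒᵖ x).map b.1 b'.1 ⊗ₘ 𝟙 (b.2 ⟶[V] b'.2)) ▷ _ ≫
      tensorμ _ _ _ _ ≫ ((bend (conjoint (actFunctor V C M))).pre (b.1, x) (b'.1, x) a.1 ⊗ₘ
        eComp V b.2 b'.2 a.2) =
    tensorμ _ _ _ _ ≫ (((β_ _ _).hom ≫
      eComp V (x ⊙ₗ a.1.unop) b'.1.unop b.1.unop) ⊗ₘ eComp V b.2 b'.2 a.2)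
  rw [tensorμ_natural_left_assoc, tensorHom_comp_tensorHom, id_whiskerRight, Category.id_comp]
  exact congrArg (fun t => tensorμ _ _ _ _ ≫ (t ⊗ₘ eComp V b.2 b'.2 a.2)) h

lemma insertMid_map (x : C) (b b' : Mᵒᵖ × M) :
    insertMidHom V x b b' ≫ (hFunctor V C M).map _ _ = actSndHom V x b b' := by
  change (((ρ_ _).inv ≫ _ ◁ eId V x) ⊗ₘ 𝟙 _) ≫ (α_ _ _ _).hom ≫ (𝟙 _ ⊗ₘ ModuleEnriched.actE _ _ _ _)
    = 𝟙 _ ⊗ₘ (((λ_ _).inv ≫ eId V x ▷ _) ≫ ModuleEnriched.actE _ _ _ _)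
  simp only [tensorHom_id, id_tensorHom, comp_whiskerRight, Category.assoc,
    MonoidalCategory.whiskerLeft_comp, associator_naturality_middle_assoc]
  simp

/-- The maps on hom objects of the `V`-functor `x ↦ ((p, x), m)`. -/
def insertArrow (p : Mᵒᵖ) (m : M) (x x' : C) : (x ⟶[V] x') ⟶ (((p, x), m) ⟶[V] ((p, x'), m)) :=
  (insertRight C p).map x x' ≫ (insertLeft (Mᵒᵖ × C) m).map (p, x) (p, x')

lemma insertArrow_map (p : Mᵒᵖ) (m : M) (x x' : C) :
    insertArrow V p m x x' ≫ (hFunctor V C M).map _ _ =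
      actR V x x' m ≫ (insertRight M p).map (x ⊙ₗ m) (x' ⊙ₗ m) := by
  change (((λ_ _).inv ≫ eId V p ▷ _) ≫ (ρ_ _).inv ≫ _ ◁ eId V m) ≫ (α_ _ _ _).hom ≫
      (𝟙 _ ⊗ₘ ModuleEnriched.actE _ _ _ _) =
    (((ρ_ _).inv ≫ _ ◁ eId V m) ≫ ModuleEnriched.actE _ _ _ _) ≫ (λ_ _).inv ≫ eId V p ▷ _
  rw [leftUnitor_inv_naturality_assoc, whisker_exchange, id_tensorHom]
  simp only [Category.assoc]
  simp

lemma insertArrow_pre (p : Mᵒᵖ) (m : M) (x x' : C) (a : Mᵒᵖ × M) :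
    insertArrow V p m x x' ▷ (hRight V C M).obj ((p, x'), m) a ≫
        (hRight V C M).pre ((p, x), m) ((p, x'), m) a =
      (α_ _ _ _).inv ≫ (actR V x x' a.1.unop ▷ _ ≫ eComp V _ _ _) ▷ _ := by
  have h1 := tens_preFst (bend (conjoint (actFunctor V C M))) (idProf V M) (p, x) (p, x') m a
  have h2 := bend_preSnd (conjoint (actFunctor V C M)) p x x' a.1
  have h3 := congrArg (fun t => (insertRight C p).map x x' ▷ _ ≫ t) h1
  have h4 : (conjoint (actFunctor V C M)).preFst x x' a.1.unop p.unop =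
      actR V x x' a.1.unop ▷ _ ≫ eComp V _ _ _ := by
    change ((ρ_ _).inv ≫ _ ◁ eId V a.1.unop) ▷ _ ≫ ModuleEnriched.actE _ _ _ _ ▷ _ ≫ _ =
      (((ρ_ _).inv ≫ _ ◁ eId V a.1.unop) ≫ ModuleEnriched.actE _ _ _ _) ▷ _ ≫ _
    rw [comp_whiskerRight _ (ModuleEnriched.actE _ _ _ _), Category.assoc]
  rw [insertArrow, comp_whiskerRight, Category.assoc]
  refine h3.trans ?_
  rw [← h4, ← h2, associator_inv_naturality_left_assoc, ← comp_whiskerRight]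
  rfl

lemma hRight_post (b : Mᵒᵖ × M) (x : C) (a a' : Mᵒᵖ × M) :
    (hRight V C M).post ((b.1, x), b.2) a a' =
      (b ⟶[V] actFst x a) ◁ actFstHom V x a a' ≫ eComp V b (actFst x a) (actFst x a') := by
  change tensorμ _ _ _ _ ≫ (((β_ _ _).hom ≫ (insertRight (V := V) M x).map _ _ ▷ _ ≫
      ModuleEnriched.actE x x a'.1.unop a.1.unop ▷ _ ≫ eComp V _ _ _) ⊗ₘ eComp V b.2 a.2 a'.2) =
    _ ◁ (actL V x a'.1.unop a.1.unop ▷ _) ≫ tensorμ _ _ _ _ ≫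
      (((β_ _ _).hom ≫ eComp V _ _ _) ⊗ₘ eComp V b.2 a.2 a'.2)
  rw [← tensorHom_id (actL V x a'.1.unop a.1.unop), tensorμ_natural_right_assoc,
    tensorHom_comp_tensorHom, MonoidalCategory.whiskerLeft_id, Category.id_comp,
    BraidedCategory.braiding_naturality_right_assoc, ← comp_whiskerRight_assoc]
  rfl

lemma insertArrow_insertMid (p p' : Mᵒᵖ) (m m' : M) (x x' : C) :
    (insertArrow V p m x x' ⊗ₘ insertMidHom V x' (p, m) (p', m')) ≫
        eComp V ((p, x), m) ((p, x'), m) ((p', x'), m') =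
      (α_ _ _ _).inv ≫ (β_ (x ⟶[V] x') (p ⟶[V] p')).hom ▷ (m ⟶[V] m') := by
  have h2 : ((insertRight C p).map x x' ⊗ₘ (insertLeft Mᵒᵖ x').map p p') ≫
      eComp V (p, x) (p, x') (p', x') = (β_ (x ⟶[V] x') (p ⟶[V] p')).hom :=
    insert_exchange _ _ _ _ (eId_whiskerRight_eComp V _ _) (whiskerLeft_eId_eComp V _ _)
  rw [← h2]
  exact insert_tensorμ_comp _ _ _ _ _ (eId_whiskerRight_eComp V _ _)

lemma insertLeft_actSndHom (x x' : C) (a : Mᵒᵖ × M) :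
    (x ⟶[V] x') ◁ eId V (actFst x' a) ≫ (α_ _ _ _).inv ≫
        (actR V x x' a.1.unop ▷ _ ≫ eComp V _ _ _) ▷ _ ≫ actSndHom V x ((actFst x' a).1,
            a.2) (actFst x a) =
      (ρ_ _).hom ≫ actR V x x' a.1.unop ≫
        (insertLeft Mᵒᵖ (x ⊙ₗ a.2)).map (actFst x' a).1 (actFst x a).1 := by
  have h := insert_units_comp (actR V x x' a.1.unop) (eId V (x' ⊙ₗ a.1.unop)) (eId V a.2)
    (eComp V _ _ _) (actL V x a.2 a.2) (whiskerLeft_eId_eComp V _ _)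
  rw [eId_comp_actL] at h
  exact h

end Legs

end

end LaxModuleProf

namespace LaxModuleProf

noncomputable section

set_option linter.unusedSectionVars false

open VProf

/-! ### Morphisms out of a composite with the probimonad -/

section HStrength

variable {V : Type u} [Category.{v} V] [MonoidalCategory V] [SymmetricCategory V]
  [MonoidalClosed V] [HasColimits V]
  {C : Type v} [Category.{v} C] [MonoidalCategory C] [EnrichedOrdinaryCategory V C]
  [MonoidalEnriched V C]
  {M : Type v} [Category.{v} M] [EnrichedOrdinaryCategory V M] [MonoidalLeftAction C M]
  [ModuleEnriched V C M]
  {P Q : VProf V PUnit.{v + 1} (Mᵒᵖ × M)}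

variable (P) in
/-- A composite with `H` as a composite with a companion. -/
def hIso : comp (hProf V C M M) P ≅ comp (companion (hFunctor V C M)) (comp (hRight V C M) P) :=
  assocIso (hLeft V C M) (hRight V C M) P ≪≫
    { hom := compMap (hLeftIso V C M).hom (𝟙 _)
      inv := compMap (hLeftIso V C M).inv (𝟙 _)
      hom_inv_id := by rw [← compMap_comp, Iso.hom_inv_id, Category.comp_id, compMap_id]
      inv_hom_id := by rw [← compMap_comp, Iso.inv_hom_id, Category.comp_id, compMap_id] }

/-- The coprojections of `H`. -/
def hJ (b : Mᵒᵖ × M) (d : (Mᵒᵖ × C) × M) (a : Mᵒᵖ × M) :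
    (b ⟶[V] (hFunctor V C M).obj d) ⊗ (hRight V C M).obj d a ⟶ (hProf V C M M).obj b a :=
  j (hLeft V C M) (hRight V C M) b d a

lemma j_hIso_inv (b : Mᵒᵖ × M) (d : (Mᵒᵖ × C) × M) (a : Mᵒᵖ × M) :
    (b ⟶[V] (hFunctor V C M).obj d) ◁ j (hRight V C M) P d a PUnit.unit ≫
        j (companion (hFunctor V C M)) (comp (hRight V C M) P) b d PUnit.unit ≫
        (hIso P).inv.app b PUnit.unit =
      (α_ _ _ _).inv ≫ hJ b d a ▷ P.obj a PUnit.unit ≫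
        j (hProf V C M M) P b a PUnit.unit := by
  have h1 := j_map (hLeftIso V C M).inv (𝟙 (comp (hRight V C M) P)) b d PUnit.unit
  have h2 := j_assocIso_inv (H := hLeft V C M) (G := hRight V C M) (F := P) b d a PUnit.unit
  have h3 : ((hLeftIso V C M).inv.app b d ⊗ₘ
      Hom.app (𝟙 (comp (hRight V C M) P)) d PUnit.unit) = 𝟙 _ := id_tensorHom_id _ _
  have h4 := h1.trans ((congrArg (fun t => t ≫ j (hLeft V C M) (comp (hRight V C M) P) b d
    PUnit.unit) h3).trans (Category.id_comp _))
  refine Eq.trans ?_ h2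
  refine Eq.trans ?_ (congrArg (fun t => _ ◁ j (hRight V C M) P d a PUnit.unit ≫ t ≫
    (assocIso (hLeft V C M) (hRight V C M) P).inv.app b PUnit.unit) h4)
  exact congrArg _ (Category.assoc _ _ _).symm

/-- A morphism out of a composite with `H`, as a morphism out of a composite with a companion. -/
abbrev hCompanion (κ : comp (hProf V C M M) P ⟶ Q) :
    comp (companion (hFunctor V C M)) (comp (hRight V C M) P) ⟶ Q :=
  (hIso P).inv ≫ κ

/-- The restriction of a morphism out of a composite with `H` to the identities of the first factor
of `H`. -/
def hTau (κ : comp (hProf V C M M) P ⟶ Q) (d : (Mᵒᵖ × C) × M) :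
    (comp (hRight V C M) P).obj d PUnit.unit ⟶ Q.obj ((hFunctor V C M).obj d) PUnit.unit :=
  companionRestrict (hFunctor V C M) (hCompanion κ) d PUnit.unit

/-- The components of `hTau`. -/
def hLeg (κ : comp (hProf V C M M) P ⟶ Q) (d : (Mᵒᵖ × C) × M) (a : Mᵒᵖ × M) :
    (hRight V C M).obj d a ⊗ P.obj a PUnit.unit ⟶ Q.obj ((hFunctor V C M).obj d) PUnit.unit :=
  j (hRight V C M) P d a PUnit.unit ≫ hTau κ d

lemma j_j_hom (κ : comp (hProf V C M M) P ⟶ Q) (b : Mᵒᵖ × M) (d : (Mᵒᵖ × C) × M) (a : Mᵒᵖ × M) :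
    hJ b d a ▷ P.obj a PUnit.unit ≫ j (hProf V C M M) P b a PUnit.unit ≫ κ.app b PUnit.unit =
      (α_ _ _ _).hom ≫ (b ⟶[V] (hFunctor V C M).obj d) ◁ hLeg κ d a ≫ Q.pre _ _ PUnit.unit := by
  have h := j_companion_hom (hFunctor V C M) (hCompanion κ) b d PUnit.unit
  have h1 := j_hIso_inv (P := P) b d a
  rw [← Iso.inv_comp_eq, hLeg, MonoidalCategory.whiskerLeft_comp, Category.assoc]
  refine Eq.trans ?_ (congrArg (fun t => _ ◁ j (hRight V C M) P d a PUnit.unit ≫ t) h)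
  rw [comp_app, reassoc_of% h1]

lemma hLeg_pre (κ : comp (hProf V C M M) P ⟶ Q) (d d' : (Mᵒᵖ × C) × M) (a : Mᵒᵖ × M) :
    (hRight V C M).pre d d' a ▷ P.obj a PUnit.unit ≫ hLeg κ d a =
      (α_ _ _ _).hom ≫ (d ⟶[V] d') ◁ hLeg κ d' a ≫ (hFunctor V C M).map d d' ▷ _ ≫
        Q.pre _ _ PUnit.unit := by
  have h := companionRestrict_pre (hFunctor V C M) (hCompanion κ) d d' PUnit.unit
  have h1 := j_pre (hRight V C M) P d d' a PUnit.unit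
  rw [hLeg, hLeg, MonoidalCategory.whiskerLeft_comp, Category.assoc, ← Iso.inv_comp_eq,
    ← reassoc_of% h1]
  exact congrArg (fun t => (d ⟶[V] d') ◁ j (hRight V C M) P d' a PUnit.unit ≫ t) h

lemma hLeg_dinat (κ : comp (hProf V C M M) P ⟶ Q) (d : (Mᵒᵖ × C) × M) (a a' : Mᵒᵖ × M) :
    (hRight V C M).post d a a' ▷ P.obj a' PUnit.unit ≫ hLeg κ d a' =
      (α_ _ _ _).hom ≫ _ ◁ P.pre a a' PUnit.unit ≫ hLeg κ d a := by
  have h1 := j_dinat (hRight V C M) P d a a' PUnit.unit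
  rw [hLeg, reassoc_of% h1, hLeg]

/-- The components of `hTau` with a fixed object of `C`. -/
def hMid (κ : comp (hProf V C M M) P ⟶ Q) (x : C) (b a : Mᵒᵖ × M) :
    (b ⟶[V] actFst x a) ⊗ P.obj a PUnit.unit ⟶ Q.obj (actSnd x b) PUnit.unit :=
  hLeg κ ((b.1, x), b.2) a

lemma hMid_eComp (κ : comp (hProf V C M M) P ⟶ Q) (x : C) (b b' a : Mᵒᵖ × M) :
    eComp V b b' (actFst x a) ▷ P.obj a PUnit.unit ≫ hMid κ x b a =
      (α_ _ _ _).hom ≫ (b ⟶[V] b') ◁ hMid κ x b' a ≫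
        actSndHom V x b b' ▷ _ ≫ Q.pre _ _ PUnit.unit := by
  have h := hLeg_pre κ ((b.1, x), b.2) ((b'.1, x), b'.2) a
  have h1 := congrArg (fun t => t ▷ P.obj a PUnit.unit ≫ hLeg κ ((b.1, x), b.2) a)
    (insertMid_pre V x b b' a)
  refine h1.symm.trans ?_
  rw [← insertMid_map]
  refine (congrArg (fun t => t ≫ hLeg κ ((b.1, x), b.2) a) (comp_whiskerRight _ _ _)).trans ?_
  refine (Category.assoc _ _ _).trans ?_
  refine (congrArg (fun t => _ ▷ _ ≫ t) h).trans ?_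
  refine (associator_naturality_left_assoc _ _ _ _).trans (congrArg _ ?_)
  refine (whisker_exchange_assoc _ _ _).symm.trans (congrArg _ ?_)
  exact (Category.assoc _ _ _).symm.trans
    (congrArg (fun t => t ≫ VProf.pre Q _ _ _) (comp_whiskerRight _ _ _).symm)

lemma hMid_actFstHom (κ : comp (hProf V C M M) P ⟶ Q) (x : C) (b a a' : Mᵒᵖ × M) :
    ((b ⟶[V] actFst x a) ◁ actFstHom V x a a' ≫ eComp V _ _ _) ▷ P.obj a' PUnit.unit ≫
        hMid κ x b a' =
      (α_ _ _ _).hom ≫ _ ◁ P.pre a a' PUnit.unit ≫ hMid κ x b a := by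
  have h := hLeg_dinat κ ((b.1, x), b.2) a a'
  rw [hRight_post] at h
  exact h

lemma hMid_actR (κ : comp (hProf V C M M) P ⟶ Q) (x x' : C) (b a : Mᵒᵖ × M) :
    ((α_ _ _ _).inv ≫ (actR V x x' a.1.unop ▷ _ ≫ eComp V _ _ _) ▷ _) ▷ P.obj a PUnit.unit ≫
        hMid κ x b a =
      (α_ (x ⟶[V] x') (b ⟶[V] actFst x' a) _).hom ≫ _ ◁ hMid κ x' b a ≫
        actR V x x' b.2 ▷ _ ≫ Q.preSnd b.1 _ _ PUnit.unit := by
  have h := hLeg_pre κ ((b.1, x), b.2) ((b.1, x'), b.2) a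
  have h1 := congrArg (fun t => t ▷ P.obj a PUnit.unit ≫ hLeg κ ((b.1, x), b.2) a)
    (insertArrow_pre V b.1 b.2 x x' a)
  refine h1.symm.trans ?_
  refine (congrArg (fun t => t ≫ hLeg κ ((b.1, x), b.2) a) (comp_whiskerRight _ _ _)).trans ?_
  refine (Category.assoc _ _ _).trans ?_
  refine (congrArg (fun t => _ ▷ _ ≫ t) h).trans ?_
  refine (associator_naturality_left_assoc _ _ _ _).trans (congrArg _ ?_)
  refine (whisker_exchange_assoc _ _ _).symm.trans (congrArg _ ?_)
  refine (Category.assoc _ _ _).symm.trans ?_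
  have h2 := insertArrow_map (V := V) b.1 b.2 x x'
  refine (congrArg (fun t => t ≫ VProf.pre Q _ _ _) (comp_whiskerRight _ _ _).symm).trans ?_
  refine (congrArg (fun t => t ▷ _ ≫ VProf.pre Q _ _ _) h2).trans ?_
  refine (congrArg (fun t => t ≫ VProf.pre Q _ _ _) (comp_whiskerRight _ _ _)).trans ?_
  exact Category.assoc _ _ _

/-- The strength of a morphism out of a composite with `H`. -/
def hS (κ : comp (hProf V C M M) P ⟶ Q) (x : C) (a : Mᵒᵖ × M) :
    P.obj a PUnit.unit ⟶ Q.obj (actPair x a) PUnit.unit :=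
  idLeft V (actFst x a) (P.obj a PUnit.unit) ≫ hMid κ x (actFst x a) a

lemma hMid_eq (κ : comp (hProf V C M M) P ⟶ Q) (x : C) (b a : Mᵒᵖ × M) :
    hMid κ x b a = (actSndHom V x b (actFst x a) ⊗ₘ hS κ x a) ≫ Q.pre _ _ PUnit.unit := by
  have h := hMid_eComp κ x b (actFst x a) a
  have h1 := congrArg (fun t => _ ◁ idLeft V (actFst x a) (P.obj a PUnit.unit) ≫
    (α_ _ _ _).inv ≫ t) h
  have h2 : (b ⟶[V] actFst x a) ◁ idLeft V (actFst x a) (P.obj a PUnit.unit) ≫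
      (α_ _ _ _).inv ≫ eComp V b (actFst x a) (actFst x a) ▷ P.obj a PUnit.unit = 𝟙 _ := by
    have h3 := idRight_post (idProf V (Mᵒᵖ × M)) b (actFst x a)
    rw [idLeft_idRight, Category.assoc, Iso.hom_inv_id_assoc, ← comp_whiskerRight]
    exact (congrArg (fun t => t ▷ _) h3).trans (id_whiskerRight _ _)
  simp only [reassoc_of% h2, Iso.inv_hom_id_assoc] at h1
  rw [h1, MonoidalCategory.tensorHom_def', hS, MonoidalCategory.whiskerLeft_comp]
  simp only [Category.assoc]

lemma pre_hS (κ : comp (hProf V C M M) P ⟶ Q) (x : C) (a a' : Mᵒᵖ × M) :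
    P.pre a a' PUnit.unit ≫ hS κ x a =
      (actPairHom V x a a' ⊗ₘ hS κ x a') ≫ Q.pre _ _ PUnit.unit := by
  have h := hMid_actFstHom κ x (actFst x a) a a'
  have h1 : (idLeft V (actFst x a) (a ⟶[V] a')) ≫
      (actFst x a ⟶[V] actFst x a) ◁ actFstHom V x a a' ≫ eComp V _ _ _ = actFstHom V x a a' := by
    rw [← reassoc_of% (idLeft_naturality (actFst x a) (actFstHom V x a a'))]
    exact (congrArg _ (idLeft_pre (idProf V (Mᵒᵖ × M)) (actFst x a) (actFst x a'))).trans
      (Category.comp_id _)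
  rw [hS, reassoc_of% (idLeft_naturality (actFst x a) (P.pre a a' PUnit.unit)), idLeft_tensor,
    Category.assoc, ← h, ← comp_whiskerRight_assoc, h1, hMid_eq, whiskerRight_comp_tensorHom_assoc,
    actFstHom_actSndHom]

lemma actR_hS (κ : comp (hProf V C M M) P ⟶ Q) (x x' : C) (a : Mᵒᵖ × M) :
    (actR V x x' a.2 ⊗ₘ hS κ x' a) ≫ Q.preSnd (Opposite.op (x' ⊙ₗ a.1.unop)) _ _ PUnit.unit =
      (actR V x x' a.1.unop ⊗ₘ hS κ x a) ≫
        Q.preFst (Opposite.op (x' ⊙ₗ a.1.unop)) (Opposite.op (x ⊙ₗ a.1.unop)) (x ⊙ₗ a.2)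
          PUnit.unit := by
  have h := hMid_actR κ x x' (actFst x' a) a
  have h1 := congrArg (fun t => (x ⟶[V] x') ◁ idLeft V (actFst x' a) (P.obj a PUnit.unit) ≫
    (α_ _ _ _).inv ≫ t) h
  have h2 := insertLeft_actSndHom V x x' a
  simp only [Iso.inv_hom_id_assoc, ← MonoidalCategory.whiskerLeft_comp_assoc] at h1
  rw [MonoidalCategory.tensorHom_def', Category.assoc]
  refine h1.symm.trans ?_
  have h3 : idRight V (x ⟶[V] x') (actFst x' a) ≫ ((α_ _ _ _).inv ≫
      (actR V x x' a.1.unop ▷ _ ≫ eComp V (x ⊙ₗ a.1.unop) (x' ⊙ₗ a.1.unop) (x' ⊙ₗ a.1.unop)) ▷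
        (a.2 ⟶[V] a.2)) ≫
        actSndHom V x ((actFst x' a).1, a.2) (actFst x a) =
      actR V x x' a.1.unop ≫
        (insertLeft Mᵒᵖ (x ⊙ₗ a.2)).map (actFst x' a).1 (actFst x a).1 := by
    have h4 := (Iso.eq_inv_comp _).2 h2.symm
    rw [h4, idRight]
    simp only [Category.assoc]
  rw [hMid_eq, whiskerRight_comp_tensorHom_assoc, idLeft_idRight, Category.assoc,
    Iso.hom_inv_id_assoc, whiskerRight_comp_tensorHom_assoc, preFst]
  exact (congrArg (fun t => (t ⊗ₘ hS κ x a) ≫ VProf.pre Q _ _ _) h3).trans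
    (tensorHom_comp_whiskerRight_assoc _ _ _ _).symm

end HStrength

end

end LaxModuleProf

namespace LaxModuleProf

noncomputable section

set_option linter.unusedSectionVars false

open VProf

lemma actR_coherence {V : Type u} [Category.{v} V] [MonoidalCategory V] [SymmetricCategory V]
    {R R₁ R₂ H H₁ K P F₁ F₁' F₂ G₁ G' : V} (r₁ : R ⟶ R₁) (r₂ : R ⟶ R₂) (w : K ⊗ P ⟶ F₁)
    (w' : K ⊗ P ⟶ F₁') (c : R₁ ⊗ H ⟶ H₁) (q₁ : H₁ ⊗ F₁ ⟶ G₁) (q' : H ⊗ F₁' ⟶ G') (q : H ⊗ F₂ ⟶ G₁)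
    (t : R₁ ⊗ F₁ ⟶ F₂) (u : R₂ ⊗ F₁' ⟶ F₂) (u' : R₂ ⊗ G' ⟶ G₁)
    (h₁ : R₂ ◁ q' ≫ u' = (α_ _ _ _).inv ≫ (β_ _ _).hom ▷ _ ≫ (α_ _ _ _).hom ≫ H ◁ u ≫ q)
    (h₂ : (r₂ ⊗ₘ w') ≫ u = (r₁ ⊗ₘ w) ≫ t)
    (h₃ : c ▷ F₁ ≫ q₁ = (β_ _ _).hom ▷ _ ≫ (α_ _ _ _).hom ≫ H ◁ t ≫ q) :
    ((α_ _ _ _).inv ≫ (r₁ ▷ H ≫ c) ▷ K) ▷ P ≫ (α_ _ _ _).hom ≫ H₁ ◁ w ≫ q₁ =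
      (α_ R (H ⊗ K) P).hom ≫ R ◁ ((α_ _ _ _).hom ≫ H ◁ w' ≫ q') ≫ r₂ ▷ G' ≫ u' := by
  have e₁ : R ◁ H ◁ w' ≫ R ◁ q' ≫ r₂ ▷ G' ≫ u' =
      (α_ _ _ _).inv ≫ (β_ R H).hom ▷ _ ≫ (α_ _ _ _).hom ≫ H ◁ ((r₂ ⊗ₘ w') ≫ u) ≫ q := by
    rw [whisker_exchange_assoc, h₁, MonoidalCategory.tensorHom_def']
    simp only [MonoidalCategory.whiskerLeft_comp, Category.assoc]
    rw [associator_inv_naturality_left_assoc, associator_inv_naturality_right_assoc,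
      ← associator_naturality_right_assoc, ← associator_naturality_middle_assoc,
      ← whisker_exchange_assoc, ← comp_whiskerRight_assoc, ← comp_whiskerRight_assoc,
      BraidedCategory.braiding_naturality_left]
  have e₂ : (c ▷ K) ▷ P ≫ (α_ _ _ _).hom ≫ H₁ ◁ w ≫ q₁ =
      (α_ _ _ _).hom ≫ (β_ R₁ H).hom ▷ _ ≫ (α_ _ _ _).hom ≫ H ◁ (R₁ ◁ w ≫ t) ≫ q := by
    rw [associator_naturality_left_assoc, ← whisker_exchange_assoc, h₃,
      MonoidalCategory.whiskerLeft_comp, Category.assoc, ← associator_naturality_right_assoc,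
      ← whisker_exchange_assoc]
  simp only [MonoidalCategory.whiskerLeft_comp, comp_whiskerRight, Category.assoc]
  rw [e₁, e₂, h₂, MonoidalCategory.tensorHom_def, associator_naturality_left_assoc]
  simp only [MonoidalCategory.whiskerLeft_comp, Category.assoc]
  rw [← associator_naturality_middle_assoc, ← comp_whiskerRight_assoc (β_ R H).hom,
    ← BraidedCategory.braiding_naturality_left, comp_whiskerRight_assoc]
  monoidal

section HStrength

variable {V : Type u} [Category.{v} V] [MonoidalCategory V] [SymmetricCategory V]
  [MonoidalClosed V] [HasColimits V]
  {C : Type v} [Category.{v} C] [MonoidalCategory C] [EnrichedOrdinaryCategory V C]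
  [MonoidalEnriched V C]
  {M : Type v} [Category.{v} M] [EnrichedOrdinaryCategory V M] [MonoidalLeftAction C M]
  [ModuleEnriched V C M]
  {P Q : VProf V PUnit.{v + 1} (Mᵒᵖ × M)}

lemma tensor_eComp_tensor_pre {D E : Type v} [EnrichedCategory V D] [EnrichedCategory V E]
    (F : VProf V D E) {e e' e'' : E} {d : D} {X Y Z : V} (f : X ⟶ (e ⟶[V] e'))
    (g : Y ⟶ (e' ⟶[V] e'')) (h : Z ⟶ F.obj e'' d) :
    ((f ⊗ₘ g) ≫ eComp V e e' e'' ⊗ₘ h) ≫ F.pre e e'' d =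
      (α_ _ _ _).hom ≫ (f ⊗ₘ (g ⊗ₘ h) ≫ F.pre e' e'' d) ≫ F.pre e e' d := by
  rw [← tensorHom_comp_whiskerRight_assoc, F.pre_comp, associator_naturality_assoc,
    tensorHom_comp_whiskerLeft_assoc]

lemma tensor_pre_tensor_post {D E : Type v} [EnrichedCategory V D] [EnrichedCategory V E]
    (F : VProf V D E) {e e' : E} {d d' : D} {X Y Z : V} (f : X ⟶ (e ⟶[V] e'))
    (g : Y ⟶ F.obj e' d) (h : Z ⟶ (d ⟶[V] d')) :
    ((f ⊗ₘ g) ≫ F.pre e e' d ⊗ₘ h) ≫ F.post e d d' =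
      (α_ _ _ _).hom ≫ (f ⊗ₘ (g ⊗ₘ h) ≫ F.post e' d d') ≫ F.pre e e' d' := by
  rw [← tensorHom_comp_whiskerRight_assoc, F.pre_post, associator_naturality_assoc,
    tensorHom_comp_whiskerLeft_assoc]

lemma IsStrength.actR_pre {F G : VProf V M M}
    {s : ∀ (x : C) (n m : M), F.obj n m ⟶ G.obj (x ⊙ₗ n) (x ⊙ₗ m)} (hs : IsStrength F G s)
    (x x' : C) (n n' m : M) :
    (actR V x x' n ⊗ₘ (actL V x' n n' ⊗ₘ s x' n' m) ≫ G.pre _ _ _) ≫ G.pre _ _ _ =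
      (actR V x x' m ⊗ₘ (actL V x n n' ⊗ₘ s x n' m) ≫ G.pre _ _ _) ≫ (β_ _ _).hom ≫
        G.post _ _ _ := by
  have h1 := tensor_eComp_tensor_pre G (actR V x x' n) (actL V x' n n') (s x' n' m)
  have h2 := tensor_eComp_tensor_pre G (actL V x n n') (actR V x x' n') (s x' n' m)
  have h3 := tensor_pre_tensor_post G (actL V x n n') (s x n' m) (actR V x x' m)
  have h4 := (Iso.eq_inv_comp _).2 h1.symm
  have h5 : (β_ (x ⟶[V] x') (n ⟶[V] n')).hom ≫ (actL V x n n' ⊗ₘ actR V x x' n') ≫ eComp V _ _ _ =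
      (actR V x x' n ⊗ₘ actL V x' n n') ≫ eComp V _ _ _ := by
    rw [actL_actR, SymmetricCategory.symmetry_assoc, actR_actL]
  rw [BraidedCategory.braiding_naturality_assoc, h3, h4, ← h5, ← whiskerRight_comp_tensorHom_assoc,
    h2, hs.actR_s, ← whiskerLeft_comp_tensorHom_assoc, BraidedCategory.braiding_tensor_right_hom]
  simp only [Category.assoc, Iso.inv_hom_id_assoc]

lemma insertRight_actPairHom (x : C) (p : Mᵒᵖ) (n n' : M) :
    (insertRight M p).map n n' ≫ actPairHom V x (p, n) (p, n') =
      actL V x n n' ≫ (insertRight M (Opposite.op (x ⊙ₗ p.unop))).map (x ⊙ₗ n) (x ⊙ₗ n') := by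
  change ((λ_ _).inv ≫ eId V p.unop ▷ _) ≫ (actL V x _ _ ⊗ₘ actL V x n n') =
    actL V x n n' ≫ (λ_ _).inv ≫ eId V (x ⊙ₗ p.unop) ▷ _
  rw [Category.assoc, whiskerRight_comp_tensorHom, eId_comp_actL, leftUnitor_inv_naturality_assoc,
    MonoidalCategory.tensorHom_def']

lemma insertLeft_actPairHom (x : C) (p p' : Mᵒᵖ) (n : M) :
    (insertLeft Mᵒᵖ n).map p p' ≫ actPairHom V x (p, n) (p', n) =
      actL V x p'.unop p.unop ≫ (insertLeft Mᵒᵖ (x ⊙ₗ n)).map (Opposite.op (x ⊙ₗ p.unop))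
        (Opposite.op (x ⊙ₗ p'.unop)) := by
  change ((ρ_ _).inv ≫ _ ◁ eId V n) ≫ (actL V x p'.unop p.unop ⊗ₘ actL V x n n) =
    actL V x p'.unop p.unop ≫ (ρ_ _).inv ≫ _ ◁ eId V (x ⊙ₗ n)
  rw [Category.assoc, whiskerLeft_comp_tensorHom, eId_comp_actL, rightUnitor_inv_naturality_assoc,
    MonoidalCategory.tensorHom_def]

/-- The strength of a morphism out of a composite with `H`, on transposes. -/
@[reducible] def unheartS (σ : ∀ (x : C) (a : Mᵒᵖ × M), P.obj a PUnit.unit ⟶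
    Q.obj (actPair x a) PUnit.unit) (x : C) (n m : M) :
    (unheart P).obj n m ⟶ (unheart Q).obj (x ⊙ₗ n) (x ⊙ₗ m) :=
  σ x (Opposite.op m, n)

lemma isStrength_hS (κ : comp (hProf V C M M) P ⟶ Q) :
    IsStrength (unheart P) (unheart Q) (unheartS (hS κ)) where
  pre_s x n n' m := by
    have h := pre_hS κ x (Opposite.op m, n) (Opposite.op m, n')
    have h2 := insertRight_actPairHom (V := V) x (Opposite.op m) n n'
    change P.preSnd _ _ _ _ ≫ _ = (_ ⊗ₘ _) ≫ Q.preSnd _ _ _ _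
    rw [preSnd, preSnd, Category.assoc]
    refine (congrArg (fun t => _ ▷ _ ≫ t) h).trans ?_
    refine (whiskerRight_comp_tensorHom_assoc _ _ _ _).trans ?_
    refine (congrArg (fun t => (t ⊗ₘ hS κ x (Opposite.op m, n')) ≫ VProf.pre Q _ _ _) h2).trans ?_
    exact (tensorHom_comp_whiskerRight_assoc _ _ _ _).symm
  post_s x n m m' := by
    have h := pre_hS κ x (Opposite.op m', n) (Opposite.op m, n)
    have h2 := insertLeft_actPairHom (V := V) x (Opposite.op m') (Opposite.op m) n
    change ((β_ _ _).hom ≫ P.preFst _ _ _ _) ≫ _ = (_ ⊗ₘ _) ≫ (β_ _ _).hom ≫ Q.preFst _ _ _ _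
    rw [BraidedCategory.braiding_naturality_assoc, Category.assoc]
    congr 1
    rw [preFst, preFst, Category.assoc]
    refine (congrArg (fun t => _ ▷ _ ≫ t) h).trans ?_
    refine (whiskerRight_comp_tensorHom_assoc _ _ _ _).trans ?_
    refine (congrArg (fun t => (t ⊗ₘ hS κ x (Opposite.op m, n)) ≫ VProf.pre Q _ _ _) h2).trans ?_
    exact (tensorHom_comp_whiskerRight_assoc _ _ _ _).symm
  actR_s x x' n m := by
    have h := actR_hS κ x x' (Opposite.op m, n)
    refine h.trans ?_
    change _ = (β_ _ _).hom ≫ (_ ⊗ₘ _) ≫ (β_ _ _).hom ≫ Q.preFst _ _ _ _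
    rw [BraidedCategory.braiding_naturality_assoc, SymmetricCategory.symmetry_assoc]

lemma h_hom_ext {κ κ' : comp (hProf V C M M) P ⟶ Q} (h : ∀ x a, hS κ x a = hS κ' x a) :
    κ = κ' := by
  rw [← cancel_epi (hIso P).inv]
  apply companion_hom_ext
  rintro ⟨⟨p, x⟩, m⟩ _
  refine j_ext fun a => ?_
  have h1 := hMid_eq κ x (p, m) a
  rw [h, ← hMid_eq] at h1
  exact h1

section Construct

variable {σ : ∀ (x : C) (a : Mᵒᵖ × M), P.obj a PUnit.unit ⟶ Q.obj (actPair x a) PUnit.unit}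

lemma pre_of_isStrength (hσ : IsStrength (unheart P) (unheart Q) (unheartS σ)) (x : C)
    (a a' : Mᵒᵖ × M) :
    P.pre a a' PUnit.unit ≫ σ x a = (actPairHom V x a a' ⊗ₘ σ x a') ≫ Q.pre _ _ PUnit.unit := by
  have h1 := hσ.pre_s x a.2 a'.2 a'.1.unop
  have h2 := hσ.post_s x a.2 a'.1.unop a.1.unop
  rw [pre_eq_unheart, pre_eq_unheart, Category.assoc, Category.assoc, Category.assoc]
  refine (congrArg (fun t => (α_ _ _ _).hom ≫ _ ◁ VProf.pre _ _ _ _ ≫ (β_ _ _).hom ≫ t) h2).trans ?_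
  rw [← BraidedCategory.braiding_naturality_assoc, whiskerLeft_comp_tensorHom_assoc, actPairHom]
  refine (congrArg (fun t => (α_ _ _ _).hom ≫ (actL V x a'.1.unop a.1.unop ⊗ₘ t) ≫
    (β_ _ _).hom ≫ VProf.post _ _ _ _) h1).trans ?_
  refine (congrArg (fun t => (α_ _ _ _).hom ≫ t)
    (tensorHom_comp_whiskerLeft_assoc _ _ _ _).symm).trans ?_
  exact (associator_naturality_assoc _ _ _ _).symm

/-- The components of the morphism given by a strength. -/
def midOfS (σ : ∀ (x : C) (a : Mᵒᵖ × M), P.obj a PUnit.unit ⟶ Q.obj (actPair x a) PUnit.unit)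
    (x : C) (b a : Mᵒᵖ × M) :
    (b ⟶[V] actFst x a) ⊗ P.obj a PUnit.unit ⟶ Q.obj (actSnd x b) PUnit.unit :=
  (actSndHom V x b (actFst x a) ⊗ₘ σ x a) ≫ Q.pre _ _ PUnit.unit

lemma midOfS_actFstHom (hσ : IsStrength (unheart P) (unheart Q) (unheartS σ)) (x : C)
    (b a a' : Mᵒᵖ × M) :
    ((b ⟶[V] actFst x a) ◁ actFstHom V x a a' ≫ eComp V _ _ _) ▷ P.obj a' PUnit.unit ≫
        midOfS σ x b a' =
      (α_ _ _ _).hom ≫ _ ◁ P.pre a a' PUnit.unit ≫ midOfS σ x b a := by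
  rw [midOfS, midOfS, whiskerLeft_comp_tensorHom_assoc, pre_of_isStrength hσ,
    whiskerRight_comp_tensorHom_assoc, Category.assoc, eComp_actSndHom,
    whiskerLeft_comp_tensorHom_assoc, actFstHom_actSndHom]
  exact tensor_eComp_tensor_pre Q _ _ _

lemma midOfS_eComp (x : C) (b b' a : Mᵒᵖ × M) :
    eComp V b b' (actFst x a) ▷ P.obj a PUnit.unit ≫ midOfS σ x b a =
      (α_ _ _ _).hom ≫ (b ⟶[V] b') ◁ midOfS σ x b' a ≫
        actSndHom V x b b' ▷ _ ≫ Q.pre _ _ PUnit.unit := by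
  rw [midOfS, midOfS, whiskerRight_comp_tensorHom_assoc, eComp_actSndHom,
    ← MonoidalCategory.tensorHom_def'_assoc]
  exact tensor_eComp_tensor_pre Q _ _ _

lemma midOfS_eq (x : C) (b a : Mᵒᵖ × M) :
    midOfS σ x b a = (α_ ((x ⊙ₗ a.1.unop) ⟶[V] b.1.unop) (b.2 ⟶[V] a.2) _).hom ≫
      _ ◁ ((actL V x b.2 a.2 ⊗ₘ σ x a) ≫ Q.preSnd (actFst x a).1 _ _ PUnit.unit) ≫
      Q.preFst b.1 (actFst x a).1 (x ⊙ₗ b.2) PUnit.unit := by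
  have h : actSndHom V x b (actFst x a) =
      𝟙 ((x ⊙ₗ a.1.unop) ⟶[V] b.1.unop) ⊗ₘ actL V x b.2 a.2 := rfl
  rw [midOfS, pre_eq_preSnd_preFst, h]
  refine (associator_naturality_assoc _ _ _ _).trans (congrArg (fun t => (α_ _ _ _).hom ≫ t) ?_)
  refine (tensorHom_comp_whiskerLeft_assoc _ _ _ _).trans ?_
  rw [id_tensorHom]

lemma midOfS_actR (hσ : IsStrength (unheart P) (unheart Q) (unheartS σ)) (x x' : C)
    (b a : Mᵒᵖ × M) :
    ((α_ _ _ _).inv ≫ (actR V x x' a.1.unop ▷ _ ≫ eComp V _ _ _) ▷ _) ▷ P.obj a PUnit.unit ≫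
        midOfS σ x b a =
      (α_ (x ⟶[V] x') (b ⟶[V] actFst x' a) _).hom ≫ _ ◁ midOfS σ x' b a ≫
        actR V x x' b.2 ▷ _ ≫ Q.preSnd b.1 _ _ PUnit.unit := by
  have h := hσ.actR_pre x x' b.2 a.2 a.1.unop
  have h1 := Q.preFst_preSnd b.1 (actFst x' a).1 (x ⊙ₗ b.2) (x' ⊙ₗ b.2) PUnit.unit
  rw [midOfS_eq, midOfS_eq]
  refine actR_coherence _ _ _ _ _ _ _ _
    (Q.preFst (actFst x' a).1 (actFst x a).1 (x ⊙ₗ b.2) PUnit.unit) _ _ h1 (h.trans ?_) ?_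
  · change _ ≫ (β_ _ _).hom ≫ (β_ _ _).hom ≫ Q.preFst _ _ _ _ = _
    rw [SymmetricCategory.symmetry_assoc]
  · have h2 := (Q.restrict (insertLeft Mᵒᵖ (x ⊙ₗ b.2)) (EnrichedFunctor.id V _)).pre_comp b.1
      (actFst x' a).1 (actFst x a).1 PUnit.unit
    have h3 : eComp V (x ⊙ₗ a.1.unop) (x' ⊙ₗ a.1.unop) b.1.unop = (β_ _ _).hom ≫
        eComp V b.1 (actFst x' a).1 (actFst x a).1 :=
      (SymmetricCategory.symmetry_assoc _ _ _).symm
    rw [h3]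
    refine (congrArg (fun t => t ≫ VProf.preFst Q _ _ _ _) (comp_whiskerRight _ _ _)).trans ?_
    exact (Category.assoc _ _ _).trans (congrArg (fun t => (β_ _ _).hom ▷ _ ≫ t) h2)

end Construct

end HStrength

end

end LaxModuleProf

namespace LaxModuleProf

noncomputable section

set_option linter.unusedSectionVars false

open VProf

lemma VProf.whiskerLeft_j_pre {V : Type u} [Category.{v} V] [MonoidalCategory V]
    [SymmetricCategory V] [MonoidalClosed V] [HasColimits V] {C D E : Type v}
    [EnrichedCategory V C] [EnrichedCategory V D] [EnrichedCategory V E] (G : VProf V D E)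
    (F : VProf V C D) {X : V} {e e' : E} (l : X ⟶ (e ⟶[V] e')) (d : D) (c : C) :
    X ◁ j G F e' d c ≫ l ▷ _ ≫ (comp G F).pre e e' c =
      (α_ _ _ _).inv ≫ (l ▷ _ ≫ G.pre e e' d) ▷ _ ≫ j G F e d c := by
  rw [whisker_exchange_assoc, j_pre, comp_whiskerRight, Category.assoc,
    associator_inv_naturality_left_assoc]

lemma tensor_comp_whiskerRight_comp {V : Type u} [Category.{v} V] [MonoidalCategory V]
    {S A B X Y H P W Z : V} (b : S ⟶ A ⊗ B) (l : A ⟶ X) (r : B ⟶ Y) (i : X ⊗ Y ⟶ H)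
    (t : H ⊗ P ⟶ Z) (w : Y ⊗ P ⟶ W) (p : X ⊗ W ⟶ Z)
    (h : i ▷ P ≫ t = (α_ _ _ _).hom ≫ X ◁ w ≫ p) :
    ((b ≫ (l ⊗ₘ r)) ≫ i) ▷ P ≫ t = b ▷ P ≫ (α_ _ _ _).hom ≫ (l ⊗ₘ r ▷ P ≫ w) ≫ p := by
  rw [comp_whiskerRight, comp_whiskerRight, Category.assoc, Category.assoc, h,
    ← tensorHom_id (l ⊗ₘ r), associator_naturality_assoc, tensorHom_id,
    tensorHom_comp_whiskerLeft_assoc]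

/-- Moving the first factor to the end. -/
def rotate {V : Type u} [Category.{v} V] [MonoidalCategory V] [BraidedCategory V] (X Y F : V) :
    (X ⊗ Y) ⊗ F ⟶ Y ⊗ (F ⊗ X) :=
  (α_ X Y F).hom ≫ (β_ X (Y ⊗ F)).hom ≫ (α_ Y F X).hom

lemma rotate_pre_post {V : Type u} [Category.{v} V] [MonoidalCategory V] [BraidedCategory V]
    {X Y F₀ F₁ F₂ F₃ F₄ : V} (s : F₀ ⟶ F₁) (a : Y ⊗ F₁ ⟶ F₂) (p : F₂ ⊗ X ⟶ F₃)
    (q : F₁ ⊗ X ⟶ F₄) (a' : Y ⊗ F₄ ⟶ F₃) (h : a ▷ X ≫ p = (α_ _ _ _).hom ≫ Y ◁ q ≫ a') :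
    (X ⊗ Y) ◁ s ≫ (α_ _ _ _).hom ≫ X ◁ a ≫ (β_ _ _).hom ≫ p =
      rotate X Y F₀ ≫ Y ◁ (s ▷ X ≫ q) ≫ a' := by
  rw [rotate, Category.assoc, Category.assoc, BraidedCategory.braiding_naturality_right_assoc, h,
      associator_naturality_right_assoc,
    BraidedCategory.braiding_naturality_right_assoc, associator_naturality_middle_assoc,
    MonoidalCategory.whiskerLeft_comp, Category.assoc]

section HStrength

variable {V : Type u} [Category.{v} V] [MonoidalCategory V] [SymmetricCategory V]
  [MonoidalClosed V] [HasColimits V]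
  {C : Type v} [Category.{v} C] [MonoidalCategory C] [EnrichedOrdinaryCategory V C]
  [MonoidalEnriched V C]
  {M : Type v} [Category.{v} M] [EnrichedOrdinaryCategory V M] [MonoidalLeftAction C M]
  [ModuleEnriched V C M]
  {P Q : VProf V PUnit.{v + 1} (Mᵒᵖ × M)}

section Construct

variable (σ : ∀ (x : C) (a : Mᵒᵖ × M), P.obj a PUnit.unit ⟶ Q.obj (actPair x a) PUnit.unit)
  (hσ : IsStrength (unheart P) (unheart Q) (unheartS σ))

/-- The morphism given by a strength, restricted to the identities of the first factor of `H`. -/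
def tauOfS (d : (Mᵒᵖ × C) × M) :
    (comp (hRight V C M) P).obj d PUnit.unit ⟶ Q.obj ((hFunctor V C M).obj d) PUnit.unit :=
  desc (fun a => midOfS σ d.1.2 (d.1.1, d.2) a) (fun a a' => by
    have h := midOfS_actFstHom hσ d.1.2 (d.1.1, d.2) a a'
    rw [← hRight_post] at h
    exact h)

lemma j_tauOfS (d : (Mᵒᵖ × C) × M) (a : Mᵒᵖ × M) :
    j (hRight V C M) P d a PUnit.unit ≫ tauOfS σ hσ d = midOfS σ d.1.2 (d.1.1, d.2) a :=
  j_desc _ _ a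

lemma insertArrow_tauOfS (b : Mᵒᵖ × M) (x x' : C) :
    insertArrow V b.1 b.2 x x' ▷ _ ≫ (comp (hRight V C M) P).pre _ _ PUnit.unit ≫
        tauOfS σ hσ ((b.1, x), b.2) =
      _ ◁ tauOfS σ hσ ((b.1, x'), b.2) ≫ insertArrow V b.1 b.2 x x' ▷ _ ≫
        (restrictLeft (hFunctor V C M) Q).pre _ _ PUnit.unit := by
  apply whiskerLeft_j_ext
  intro a
  have h := midOfS_actR hσ x x' b a
  have h1 := insertArrow_pre V b.1 b.2 x x' a
  have h2 := insertArrow_map (V := V) b.1 b.2 x x'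
  rw [reassoc_of% (whiskerLeft_j_pre (hRight V C M) P (insertArrow V b.1 b.2 x x')), h1, j_tauOfS,
    ← MonoidalCategory.whiskerLeft_comp_assoc, j_tauOfS, Iso.inv_comp_eq]
  refine h.trans (congrArg (fun t => (α_ _ _ _).hom ≫ _ ◁ midOfS σ x' b a ≫ t) ?_)
  refine (Category.assoc _ _ _).symm.trans ?_
  refine (congrArg (fun t => t ≫ Q.pre _ _ _) (comp_whiskerRight _ _ _).symm).trans ?_
  refine (congrArg (fun t => t ▷ _ ≫ Q.pre _ _ _) h2.symm).trans ?_
  exact (congrArg (fun t => t ≫ Q.pre _ _ _) (comp_whiskerRight _ _ _)).trans (Category.assoc _ _ _)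

lemma insertMid_tauOfS (x : C) (b b' : Mᵒᵖ × M) :
    insertMidHom V x b b' ▷ _ ≫ (comp (hRight V C M) P).pre _ _ PUnit.unit ≫
        tauOfS σ hσ ((b.1, x), b.2) =
      _ ◁ tauOfS σ hσ ((b'.1, x), b'.2) ≫ insertMidHom V x b b' ▷ _ ≫
        (restrictLeft (hFunctor V C M) Q).pre _ _ PUnit.unit := by
  apply whiskerLeft_j_ext
  intro a
  have h := midOfS_eComp (σ := σ) x b b' a
  have h1 := insertMid_pre V x b b' a
  have h2 := insertMid_map (V := V) x b b'
  rw [reassoc_of% (whiskerLeft_j_pre (hRight V C M) P (insertMidHom V x b b')), h1, j_tauOfS,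
    ← MonoidalCategory.whiskerLeft_comp_assoc, j_tauOfS, Iso.inv_comp_eq]
  refine h.trans (congrArg (fun t => (α_ _ _ _).hom ≫ _ ◁ midOfS σ x b' a ≫ t) ?_)
  refine (congrArg (fun t => t ▷ _ ≫ Q.pre _ _ _) h2.symm).trans ?_
  exact (congrArg (fun t => t ≫ Q.pre _ _ _) (comp_whiskerRight _ _ _)).trans (Category.assoc _ _ _)

lemma tauOfS_pre (d d' : (Mᵒᵖ × C) × M) :
    (comp (hRight V C M) P).pre d d' PUnit.unit ≫ tauOfS σ hσ d =
      (d ⟶[V] d') ◁ tauOfS σ hσ d' ≫ (hFunctor V C M).map d d' ▷ _ ≫ Q.pre _ _ PUnit.unit := by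
  obtain ⟨⟨p, x⟩, m⟩ := d
  obtain ⟨⟨p', x'⟩, m'⟩ := d'
  have h := pre_app_comp (K := comp (hRight V C M) P) (L := restrictLeft (hFunctor V C M) Q)
    (tauOfS σ hσ) (insertArrow V p m x x') (insertMidHom V x' (p, m) (p', m'))
    (insertArrow_tauOfS σ hσ (p, m) x x') (insertMid_tauOfS σ hσ x' (p, m) (p', m'))
  rw [insertArrow_insertMid] at h
  have h' := h.trans (whisker_exchange_assoc _ _ _)
  exact (cancel_epi (((α_ (x ⟶[V] x') (p ⟶[V] p') (m ⟶[V] m')).inv ≫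
    (β_ (x ⟶[V] x') (p ⟶[V] p')).hom ▷ (m ⟶[V] m')) ▷
      (comp (hRight V C M) P).obj ((p', x'), m') PUnit.unit)).1 h'

/-- The morphism out of a composite with `H` given by a strength. -/
def hOfS : comp (hProf V C M M) P ⟶ Q :=
  (hIso P).hom ≫ companionDesc (hFunctor V C M) (fun d _ => tauOfS σ hσ d)
    (fun d d' _ => tauOfS_pre σ hσ d d') (fun d _ _ => by
      rw [post_punit, post_punit]
      exact (rightUnitor_naturality _).symm)

lemma hS_hOfS (x : C) (a : Mᵒᵖ × M) : hS (hOfS σ hσ) x a = σ x a := by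
  have h : hCompanion (hOfS σ hσ) = companionDesc (hFunctor V C M) (fun d _ => tauOfS σ hσ d)
    (fun d d' _ => tauOfS_pre σ hσ d d') _ := Iso.inv_hom_id_assoc _ _
  have h1 : hMid (hOfS σ hσ) x (actFst x a) a = midOfS σ x (actFst x a) a := by
    rw [hMid, hLeg, hTau, h, companionRestrict_companionDesc]
    exact j_tauOfS σ hσ _ _
  have h2 : idLeft V (actFst x a) (P.obj a PUnit.unit) ≫
      actSndHom V x (actFst x a) (actFst x a) ▷ _ = idLeft V (actPair x a) _ := by
    rw [idLeft, Category.assoc, ← comp_whiskerRight, eId_actSndHom, idLeft]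
  rw [hS, h1, midOfS, MonoidalCategory.tensorHom_def, Category.assoc, reassoc_of% h2,
    ← reassoc_of% (idLeft_naturality (actPair x a) (σ x a)), idLeft_pre, Category.comp_id]

end Construct

lemma idLeft_idRight_actSndHom (x : C) (b a : Mᵒᵖ × M) :
    (idLeft V b.1 (b.2 ⟶[V] (x ⊙ₗ a.2)) ⊗ₘ idRight V ((x ⊙ₗ a.1.unop) ⟶[V] b.1.unop) a.2 ≫
        actSndHom V x (b.1, a.2) (actFst x a)) ≫
      eComp V b (b.1, x ⊙ₗ a.2) (actPair x a) = (β_ _ _).hom := by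
  have h : idRight V ((x ⊙ₗ a.1.unop) ⟶[V] b.1.unop) a.2 ≫
      actSndHom V x (b.1, a.2) (actFst x a) = idRight V _ (x ⊙ₗ a.2) := by
    change ((ρ_ _).inv ≫ _ ◁ eId V a.2) ≫ (𝟙 _ ⊗ₘ actL V x a.2 a.2) = (ρ_ _).inv ≫ _ ◁ _
    rw [Category.assoc, id_tensorHom, ← MonoidalCategory.whiskerLeft_comp, eId_comp_actL]
  rw [h]
  exact insert_exchange _ _ _ _ (eId_whiskerRight_eComp V (C := Mᵒᵖ) _ _)
    (whiskerLeft_eId_eComp V _ _)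

/-- The components of an action in terms of its strength. -/
lemma hComponent_eq_pre (κ : comp (hProf V C M M) P ⟶ P) (x : C) (b a : Mᵒᵖ × M) :
    hComponent κ x b a =
      (b ⟶[V] actPair x a) ◁ hS κ x a ≫ P.pre b (actPair x a) PUnit.unit := by
  have h := j_j_hom κ b ((b.1, x), a.2) a
  have h1 := hMid_eq κ x (b.1, a.2) a
  have h2 : hι x b a = ((β_ _ _).hom ≫ (idLeft V b.1 (b.2 ⟶[V] (x ⊙ₗ a.2)) ⊗ₘ
      idRight V ((x ⊙ₗ a.1.unop) ⟶[V] b.1.unop) a.2)) ≫ hJ b ((b.1, x), a.2) a :=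
    (Category.assoc _ _ _).symm
  have h3 := tensor_eComp_tensor_pre P (idLeft V b.1 (b.2 ⟶[V] (x ⊙ₗ a.2)))
    (idRight V ((x ⊙ₗ a.1.unop) ⟶[V] b.1.unop) a.2 ≫ actSndHom V x (b.1, a.2) (actFst x a))
    (hS κ x a)
  rw [idLeft_idRight_actSndHom] at h3
  have h4 : (b ⟶[V] actPair x a) ◁ hS κ x a ≫ P.pre b (actPair x a) PUnit.unit =
      (β_ _ _).hom ▷ P.obj a PUnit.unit ≫
        ((β_ (b.2 ⟶[V] (x ⊙ₗ a.2)) ((x ⊙ₗ a.1.unop) ⟶[V] b.1.unop)).hom ⊗ₘ hS κ x a) ≫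
          P.pre b (actPair x a) PUnit.unit := by
    rw [whiskerRight_comp_tensorHom_assoc, SymmetricCategory.symmetry, id_tensorHom]
    rfl
  have h5 : (idLeft V b.1 (b.2 ⟶[V] (x ⊙ₗ a.2)) ⊗ₘ
      (idRight V ((x ⊙ₗ a.1.unop) ⟶[V] b.1.unop) a.2 ≫ actSndHom V x (b.1, a.2) (actFst x a) ⊗ₘ
        hS κ x a) ≫ P.pre (b.1, x ⊙ₗ a.2) (actPair x a) PUnit.unit) =
      (idLeft V b.1 (b.2 ⟶[V] (x ⊙ₗ a.2)) ⊗ₘ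
        idRight V ((x ⊙ₗ a.1.unop) ⟶[V] b.1.unop) a.2 ▷ P.obj a PUnit.unit ≫
          hMid κ x (b.1, a.2) a) := by
    rw [h1, whiskerRight_comp_tensorHom_assoc]
  rw [h4, h3, h5, hComponent, h2]
  exact tensor_comp_whiskerRight_comp _ _ _ _ _ _ _ h

lemma hComponent_eq (κ : comp (hProf V C M M) P ⟶ P) (x : C) (b a : Mᵒᵖ × M) :
    hComponent κ x b a = rotate _ _ _ ≫
      omegaOfS (unheart P) (unheartS (hS κ)) x b.2 a.2 a.1.unop b.1.unop := by
  have h := (unheart P).pre_post b.2 (x ⊙ₗ a.2) (x ⊙ₗ a.1.unop) b.1.unop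
  have h1 := pre_eq_unheart P b (actPair x a)
  rw [hComponent_eq_pre, h1]
  exact rotate_pre_post _ _ _ _ _ h

end HStrength

end

end LaxModuleProf

namespace LaxModuleProf

noncomputable section

set_option linter.unusedSectionVars false

open VProf

/-! ### Modules over the probimonad and strengths -/

section Rotate

variable {V : Type u} [Category.{v} V] [MonoidalCategory V] [SymmetricCategory V]

lemma braiding_rotate (X₁ Y₁ X₂ G : V) :
   X₁ ◁ Y₁ ◁ (β_ X₂ G).hom ≫ X₁ ◁ (α_ Y₁ G X₂).inv ≫ (α_ X₁ (Y₁ ⊗ G) X₂).inv ≫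
       (β_ X₁ (Y₁ ⊗ G)).hom ▷ X₂ =
   X₁ ◁ (α_ _ _ _).inv ≫ X₁ ◁ (β_ Y₁ X₂).hom ▷ G ≫ X₁ ◁ (α_ _ _ _).hom ≫ (α_ _ _ _).inv ≫
       (β_ (X₁ ⊗ X₂) (Y₁ ⊗ G)).hom ≫ (α_ _ _ _).inv := by
  have h : (β_ Y₁ X₂).hom ▷ G ≫ (α_ _ _ _).hom ≫ (β_ X₂ (Y₁ ⊗ G)).hom = (α_ _ _ _).hom ≫
      Y₁ ◁ (β_ X₂ G).hom ≫ (α_ _ _ _).inv := by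
    rw [BraidedCategory.braiding_tensor_right_hom, Iso.hom_inv_id_assoc, ← comp_whiskerRight_assoc]
    simp
  rw [BraidedCategory.braiding_tensor_left_hom]
  simp only [Category.assoc, Iso.inv_hom_id_assoc, Iso.hom_inv_id, Category.comp_id]
  have h2 := congrArg (fun t => X₁ ◁ t) h
  simp only [MonoidalCategory.whiskerLeft_comp] at h2
  rw [reassoc_of% h2]
  simp

lemma rotate_rotate (X₁ Y₁ X₂ Y₂ F : V) :
   (X₁ ⊗ Y₁) ◁ rotate X₂ Y₂ F ≫ rotate X₁ Y₁ (Y₂ ⊗ (F ⊗ X₂)) ≫ Y₁ ◁ (α_ _ _ _).hom ≫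
       (α_ _ _ _).inv ≫ (Y₁ ⊗ Y₂) ◁ (α_ _ _ _).hom =
   (α_ _ _ _).inv ≫ tensorμ X₁ Y₁ X₂ Y₂ ▷ F ≫ rotate (X₁ ⊗ X₂) (Y₁ ⊗ Y₂) F ≫
       (Y₁ ⊗ Y₂) ◁ (F ◁ (β_ X₁ X₂).hom) := by
  have h := braiding_rotate X₁ Y₁ X₂ (Y₂ ⊗ F)
  have e1 : rotate X₁ Y₁ (Y₂ ⊗ (F ⊗ X₂)) ≫ Y₁ ◁ (α_ _ _ _).hom ≫ (α_ _ _ _).inv ≫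
      (Y₁ ⊗ Y₂) ◁ (α_ _ _ _).hom =
    (α_ _ _ _).hom ≫ X₁ ◁ Y₁ ◁ (α_ _ _ _).inv ≫ X₁ ◁ (α_ _ _ _).inv ≫
        (α_ X₁ (Y₁ ⊗ (Y₂ ⊗ F)) X₂).inv ≫ (β_ X₁ (Y₁ ⊗ (Y₂ ⊗ F))).hom ▷ X₂ ≫ (α_ _ _ _).hom ≫
        (Y₁ ⊗ (Y₂ ⊗ F)) ◁ (β_ X₁ X₂).hom ≫ (α_ _ _ _).hom ≫ Y₁ ◁ (α_ _ _ _).hom ≫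
        (α_ _ _ _).inv := by
    have h2 : (β_ X₁ (Y₁ ⊗ (Y₂ ⊗ (F ⊗ X₂)))).hom =
        X₁ ◁ (Y₁ ◁ (α_ Y₂ F X₂).inv ≫ (α_ _ _ _).inv) ≫ (β_ X₁ ((Y₁ ⊗ (Y₂ ⊗ F)) ⊗ X₂)).hom ≫
          ((α_ _ _ _).hom ≫ Y₁ ◁ (α_ Y₂ F X₂).hom) ▷ X₁ := by
      rw [BraidedCategory.braiding_naturality_right_assoc, ← comp_whiskerRight]
      simp
    rw [rotate, h2, BraidedCategory.braiding_tensor_right_hom]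
    simp only [MonoidalCategory.whiskerLeft_comp, Category.assoc]
    congr 6
    monoidal
  have e2 : (X₁ ⊗ Y₁) ◁ rotate X₂ Y₂ F ≫ (α_ X₁ Y₁ (Y₂ ⊗ (F ⊗ X₂))).hom ≫
      X₁ ◁ Y₁ ◁ (α_ _ _ _).inv = (X₁ ⊗ Y₁) ◁ (α_ _ _ _).hom ≫ (α_ _ _ _).hom ≫
      X₁ ◁ Y₁ ◁ (β_ X₂ (Y₂ ⊗ F)).hom := by
    simp [rotate]
  rw [e1, reassoc_of% e2, reassoc_of% h]
  have e3 : (β_ (X₁ ⊗ X₂) ((Y₁ ⊗ Y₂) ⊗ F)).hom = (X₁ ⊗ X₂) ◁ (α_ _ _ _).hom ≫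
      (β_ (X₁ ⊗ X₂) (Y₁ ⊗ (Y₂ ⊗ F))).hom ≫ (α_ _ _ _).inv ▷ (X₁ ⊗ X₂) := by
    rw [BraidedCategory.braiding_naturality_right_assoc, ← comp_whiskerRight]
    simp
  have e4 : X₁ ◁ (β_ Y₁ X₂).hom ▷ (Y₂ ⊗ F) = X₁ ◁ ((α_ _ _ _).inv ≫ (β_ Y₁ X₂).hom ▷ Y₂ ▷ F ≫
      (α_ _ _ _).hom) := by
    simp
  rw [rotate, tensorμ, e3, e4]
  simp only [MonoidalCategory.whiskerLeft_comp, comp_whiskerRight, Category.assoc]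
  monoidal


lemma rotate_naturality {X Y F X' Y' F' : V} (f : X ⟶ X') (g : Y ⟶ Y') (h : F ⟶ F') :
    ((f ⊗ₘ g) ⊗ₘ h) ≫ rotate X' Y' F' = rotate X Y F ≫ (g ⊗ₘ (h ⊗ₘ f)) := by
  rw [rotate, rotate, associator_naturality_assoc, BraidedCategory.braiding_naturality_assoc,
    associator_naturality]
  simp only [Category.assoc]

lemma unit_rotate {X Y F : V} (u : 𝟙_ V ⟶ X) (w : 𝟙_ V ⟶ Y) :
    (λ_ F).inv ≫ ((λ_ (𝟙_ V)).inv ≫ (u ⊗ₘ w)) ▷ F ≫ rotate X Y F =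
      (λ_ F).inv ≫ (w ⊗ₘ ((ρ_ F).inv ≫ F ◁ u)) := by
  have h := rotate_naturality u w (𝟙 F)
  rw [tensorHom_id, id_tensorHom] at h
  rw [comp_whiskerRight, Category.assoc, h, ← whiskerLeft_comp_tensorHom]
  simp only [← Category.assoc]
  congr 1
  simp [rotate]

lemma rotate_assoc {X₁ Y₁ X₂ Y₂ F X Y : V} (a : Y₁ ⊗ Y₂ ⟶ Y) (c : X₂ ⊗ X₁ ⟶ X) :
    (X₁ ⊗ Y₁) ◁ rotate X₂ Y₂ F ≫ rotate X₁ Y₁ (Y₂ ⊗ (F ⊗ X₂)) ≫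
        Y₁ ◁ (α_ _ _ _).hom ≫ (α_ _ _ _).inv ≫ (a ⊗ₘ ((α_ _ _ _).hom ≫ F ◁ c)) =
      (α_ _ _ _).inv ≫ (tensorμ X₁ Y₁ X₂ Y₂ ≫ (((β_ _ _).hom ≫ c) ⊗ₘ a)) ▷ F ≫
        rotate X Y F := by
  have h := rotate_naturality ((β_ X₁ X₂).hom ≫ c) a (𝟙 F)
  have h2 := rotate_rotate X₁ Y₁ X₂ Y₂ F
  rw [tensorHom_id, id_tensorHom] at h
  rw [comp_whiskerRight, Category.assoc, h, ← whiskerLeft_comp_tensorHom, reassoc_of% h2,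
    MonoidalCategory.whiskerLeft_comp, ← whiskerLeft_comp_tensorHom]

instance (X Y F : V) : IsIso (rotate X Y F) := by
  rw [rotate]
  infer_instance

lemma rotate_assoc_iff {X₁ Y₁ X₂ Y₂ F F₁ F₂ X Y : V} (a : Y₁ ⊗ Y₂ ⟶ Y) (c : X₂ ⊗ X₁ ⟶ X)
    (q : Y₂ ⊗ (F ⊗ X₂) ⟶ F₁) (p : Y₁ ⊗ (F₁ ⊗ X₁) ⟶ F₂) (r : Y ⊗ (F ⊗ X) ⟶ F₂) :
    (X₁ ⊗ Y₁) ◁ (rotate X₂ Y₂ F ≫ q) ≫ rotate X₁ Y₁ F₁ ≫ p =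
        (α_ _ _ _).inv ≫ (tensorμ X₁ Y₁ X₂ Y₂ ≫ (((β_ _ _).hom ≫ c) ⊗ₘ a)) ▷ F ≫
          rotate X Y F ≫ r ↔
      Y₁ ◁ (q ▷ X₁) ≫ p =
        Y₁ ◁ (α_ _ _ _).hom ≫ (α_ _ _ _).inv ≫ (a ⊗ₘ ((α_ _ _ _).hom ≫ F ◁ c)) ≫ r := by
  have h := rotate_naturality (𝟙 X₁) (𝟙 Y₁) q
  rw [id_tensorHom_id, id_tensorHom, tensorHom_id, id_tensorHom] at h
  rw [← cancel_epi ((X₁ ⊗ Y₁) ◁ rotate X₂ Y₂ F ≫ rotate X₁ Y₁ (Y₂ ⊗ (F ⊗ X₂)))]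
  have h2 := rotate_assoc (F := F) a c
  simp only [Category.assoc]
  rw [reassoc_of% h2, MonoidalCategory.whiskerLeft_comp, Category.assoc, reassoc_of% h]

end Rotate

lemma idLeft_idLeft_naturality {V : Type u} [Category.{v} V] [MonoidalCategory V]
    [SymmetricCategory V] {D : Type v} [EnrichedCategory V D] (d e : D) {A B H : V} (f : A ⟶ B)
    (i : (e ⟶[V] e) ⊗ (d ⟶[V] d) ⟶ H) :
    idLeft V d A ≫ idLeft V e _ ≫ (α_ _ _ _).inv ≫ i ▷ A ≫ H ◁ f =
      f ≫ idLeft V d B ≫ idLeft V e _ ≫ (α_ _ _ _).inv ≫ i ▷ B := by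
  rw [← whisker_exchange, ← associator_inv_naturality_right_assoc,
    ← reassoc_of% (idLeft_naturality e (_ ◁ f)), ← reassoc_of% (idLeft_naturality d f)]

section HStrength

variable {V : Type u} [Category.{v} V] [MonoidalCategory V] [SymmetricCategory V]
  [MonoidalClosed V] [HasColimits V]
  {C : Type v} [Category.{v} C] [MonoidalCategory C] [EnrichedOrdinaryCategory V C]
  [MonoidalEnriched V C]
  {M : Type v} [Category.{v} M] [EnrichedOrdinaryCategory V M] [MonoidalLeftAction C M]
  [ModuleEnriched V C M]
  {P Q : VProf V PUnit.{v + 1} (Mᵒᵖ × M)}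

lemma h_unit_iff (κ : comp (hProf V C M M) P ⟶ P) :
    (∀ b : Mᵒᵖ × M, (λ_ _).inv ≫ hUnit C b ▷ P.obj b PUnit.unit ≫ hComponent κ (𝟙_ C) b b = 𝟙 _) ↔
      UnitCompat (unheart P) (unheartS (hS κ)) := by
  have h (b : Mᵒᵖ × M) : (λ_ _).inv ≫ hUnit C b ▷ P.obj b PUnit.unit ≫ hComponent κ (𝟙_ C) b b =
      unheartS (hS κ) (𝟙_ C) b.2 b.1.unop ≫ (unheart P).mapRight _ (λₗ b.1.unop).hom ≫
        (unheart P).mapLeft (λₗ b.2).inv _ := by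
    have h1 := omegaOfS_unit (unheart P) (unheartS (hS κ)) b.2 b.1.unop
    refine Eq.trans ?_ h1
    rw [hComponent_eq, hUnit]
    have h2 := unit_rotate (F := P.obj b PUnit.unit) (eHomEquiv V (λₗ[C] b.1.unop).hom)
      (eHomEquiv V (λₗ[C] b.2).inv)
    exact ((Category.assoc _ _ _).symm.trans ((Category.assoc _ _ _).symm.trans
      (congrArg (fun t => t ≫ _) ((Category.assoc _ _ _).trans h2)))).trans (Category.assoc _ _ _)
  rw [unitCompat_iff_conj]
  simp only [h]
  exact ⟨fun t n m => t (Opposite.op m, n), fun t b => t b.2 b.1.unop⟩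

lemma h_assoc_iff (κ : comp (hProf V C M M) P ⟶ P) :
    (∀ (x y : C) (c b a : Mᵒᵖ × M),
      hSummand V x c b ◁ hComponent κ y b a ≫ hComponent κ x c b =
        (α_ _ _ _).inv ≫ hMul x y c b a ▷ P.obj a PUnit.unit ≫ hComponent κ (x ⊗ y) c a) ↔
      TensorCompat (unheart P) (unheartS (hS κ)) := by
  rw [← omegaOfS_assoc_iff (unheart P) (isStrength_hS κ)]
  simp only [hComponent_eq]
  exact ⟨fun h x y n n₁ n₂ m₂ m₁ m => (rotate_assoc_iff _ _ _ _ _).1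
      (h x y (Opposite.op m, n) (Opposite.op m₁, n₁) (Opposite.op m₂, n₂)),
    fun h x y c b a => (rotate_assoc_iff _ _ _ _ _).2
      (h x y c.2 b.2 a.2 a.1.unop b.1.unop c.1.unop)⟩

/-- The coprojections of `H` at the objects `(x ⊙ a₁, x ⊙ a₂)` and `(a₁, a₂)`. -/
def hJPair (x : C) (a : Mᵒᵖ × M) : (actPair x a ⟶[V] actPair x a) ⊗ (actFst x a ⟶[V] actFst x a) ⟶
    (hProf V C M M).obj (actPair x a) a :=
  hJ (actPair x a) (((actFst x a).1, x), a.2) a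

/-- The coprojections of a composite with `H` on which a morphism restricts to its strength. -/
def hUnitJ (P : VProf V PUnit.{v + 1} (Mᵒᵖ × M)) (x : C) (a : Mᵒᵖ × M) :
    P.obj a PUnit.unit ⟶ (comp (hProf V C M M) P).obj (actPair x a) PUnit.unit :=
  idLeft V (actFst x a) (P.obj a PUnit.unit) ≫ idLeft V (actPair x a) _ ≫ (α_ _ _ _).inv ≫
    hJPair x a ▷ P.obj a PUnit.unit ≫
      j (hProf V C M M) P (actPair x a) a PUnit.unit

lemma hS_eq (κ : comp (hProf V C M M) P ⟶ Q) (x : C) (a : Mᵒᵖ × M) :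
    hS κ x a = hUnitJ P x a ≫ κ.app _ PUnit.unit := by
  have h := j_j_hom κ (actPair x a) (((actFst x a).1, x), a.2) a
  have h1 := reassoc_of% (idLeft_naturality (actPair x a) (hLeg κ (((actFst x a).1, x), a.2) a))
  have h2 := h1 (Q.pre (actPair x a) (actPair x a) PUnit.unit)
  have h3 := idLeft_pre Q (actPair x a) PUnit.unit
  rw [← Iso.inv_comp_eq] at h
  rw [hS, hMid, hUnitJ, Category.assoc, Category.assoc, Category.assoc, Category.assoc]
  refine congrArg (fun t => idLeft V (actFst x a) (P.obj a PUnit.unit) ≫ t) ?_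
  refine Eq.trans ?_ (congrArg (fun t => idLeft V (actPair x a) _ ≫ t) h.symm)
  refine Eq.trans ?_ h2
  exact ((congrArg (fun t => hLeg κ (((actFst x a).1, x), a.2) a ≫ t) h3).trans
    (Category.comp_id _)).symm

lemma hS_comp {R : VProf V PUnit.{v + 1} (Mᵒᵖ × M)} (κ : comp (hProf V C M M) P ⟶ Q) (f : Q ⟶ R)
    (x : C) (a : Mᵒᵖ × M) : hS (κ ≫ f) x a = hS κ x a ≫ f.app _ PUnit.unit := by
  rw [hS_eq, hS_eq, comp_app, Category.assoc]

lemma hUnitJ_map (f : P ⟶ Q) (x : C) (a : Mᵒᵖ × M) :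
    hUnitJ P x a ≫ (compMap (𝟙 (hProf V C M M)) f).app _ PUnit.unit =
      f.app a PUnit.unit ≫ hUnitJ Q x a := by
  have h := j_map (𝟙 (hProf V C M M)) f (actPair x a) a PUnit.unit
  have h1 : (Hom.app (𝟙 (hProf V C M M)) (actPair x a) a ⊗ₘ f.app a PUnit.unit) =
    _ ◁ f.app a PUnit.unit := id_tensorHom _ _
  rw [h1] at h
  have h2 := idLeft_idLeft_naturality (actFst x a) (actPair x a) (f.app a PUnit.unit)
    (hJPair x a)
  rw [hUnitJ, hUnitJ]
  simp only [Category.assoc]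
  rw [h]
  exact (reassoc_of% h2) (j (hProf V C M M) Q (actPair x a) a PUnit.unit)

lemma hS_compMap_comp {R : VProf V PUnit.{v + 1} (Mᵒᵖ × M)} (f : P ⟶ Q)
    (κ : comp (hProf V C M M) Q ⟶ R) (x : C) (a : Mᵒᵖ × M) :
    hS (compMap (𝟙 (hProf V C M M)) f ≫ κ) x a = f.app a PUnit.unit ≫ hS κ x a := by
  rw [hS_eq, hS_eq, comp_app, ← Category.assoc, hUnitJ_map, Category.assoc]

lemma h_comm_iff (κ : comp (hProf V C M M) P ⟶ P) (κ' : comp (hProf V C M M) Q ⟶ Q) (f : P ⟶ Q) :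
    κ ≫ f = compMap (𝟙 _) f ≫ κ' ↔
      ∀ (x : C) (a : Mᵒᵖ × M), hS κ x a ≫ f.app _ PUnit.unit = f.app a PUnit.unit ≫ hS κ' x a := by
  refine ⟨fun h x a => ?_, fun h => h_hom_ext fun x a => ?_⟩
  · rw [← hS_comp, h, hS_compMap_comp]
  · rw [hS_comp, h, hS_compMap_comp]

end HStrength

end

end LaxModuleProf

namespace LaxModuleProf

noncomputable section

set_option linter.unusedSectionVars false

open VProf

/-! ### Modules over the probimonad are strong profunctors -/

section

variable {V : Type u} [Category.{v} V] [MonoidalCategory V] [SymmetricCategory V]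

namespace VProf

lemma unheart_heart_pre {C : Type v} [EnrichedCategory V C] {D : Type v} [EnrichedCategory V D]
    (F : VProf V C D) (d d' : D) (c : C) : (unheart (heart F)).pre d d' c = F.pre d d' c :=
  heart_preSnd F c d d'

lemma unheart_heart_post {C : Type v} [EnrichedCategory V C] {D : Type v} [EnrichedCategory V D]
    (F : VProf V C D) (d : D) (c c' : C) : (unheart (heart F)).post d c c' = F.post d c c' :=
  (congrArg (fun t => (β_ _ _).hom ≫ t) (heart_preFst F c c' d)).trans
    (SymmetricCategory.symmetry_assoc _ _ _)

variable {M : Type v} [Category.{v} M] [EnrichedOrdinaryCategory V M]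

lemma unheart_heart_mapLeft {C : Type v} [EnrichedCategory V C] (F : VProf V C M) {d d' : M}
    (f : d ⟶ d') (c : C) : (unheart (heart F)).mapLeft f c = F.mapLeft f c := by
  rw [mapLeft, unheart_heart_pre]
  rfl

lemma unheart_heart_mapRight {D : Type v} [EnrichedCategory V D] (F : VProf V M D) (d : D)
    {m m' : M} (f : m ⟶ m') : (unheart (heart F)).mapRight d f = F.mapRight d f := by
  rw [mapRight, unheart_heart_post]
  rfl

end VProf

end

variable {V : Type u} [Category.{v} V] [MonoidalCategory V] [SymmetricCategory V]
  [MonoidalClosed V] [HasColimits V]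
  {C : Type v} [Category.{v} C] [MonoidalCategory C] [EnrichedOrdinaryCategory V C]
  [MonoidalEnriched V C]
  {M : Type v} [Category.{v} M] [EnrichedOrdinaryCategory V M] [MonoidalLeftAction C M]
  [ModuleEnriched V C M]

/-- The strength of a strong profunctor, on the transpose. -/
def StrMod.heartS (X : StrMod V C M) (x : C) (a : Mᵒᵖ × M) :
    (heart X.prof).obj a PUnit.unit ⟶ (heart X.prof).obj (actPair x a) PUnit.unit :=
  X.s x a.2 a.1.unop

lemma StrMod.isStrength_heartS (X : StrMod V C M) :
    IsStrength (unheart (heart X.prof)) (unheart (heart X.prof)) (unheartS X.heartS) where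
  pre_s x n n' m := by
    rw [unheart_heart_pre, unheart_heart_pre]
    exact X.pre_s x n n' m
  post_s x n m m' := by
    rw [unheart_heart_post, unheart_heart_post]
    exact X.post_s x n m m'
  actR_s x x' n m := by
    rw [unheart_heart_pre, unheart_heart_post]
    exact X.actR_s x x' n m

namespace HMod

variable (V C M) in
/-- The strength of a module over `H`. -/
def toStr : HMod V C M M ⥤ StrMod V C M where
  obj X := StrMod.ofStrength (unheart X.prof) (unheartS (hS X.κ)) (isStrength_hS X.κ)
    ((h_assoc_iff X.κ).1 X.assoc) ((h_unit_iff X.κ).1 X.unit)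
  map f := ⟨unheartMap (Hom.hom f), fun x n m =>
    (h_comm_iff _ _ _).1 (Hom.comm f) x (Opposite.op m, n)⟩
  map_id _ := rfl
  map_comp _ _ := rfl

/-- The action of `H` on a strong profunctor. -/
def ofStrObj (X : StrMod V C M) : HMod V C M M where
  prof := heart X.prof
  κ := hOfS X.heartS X.isStrength_heartS
  assoc := (h_assoc_iff _).2 fun x y n m => by
    rw [unheart_heart_mapRight, unheart_heart_mapLeft, unheartS, unheartS, unheartS, hS_hOfS,
      hS_hOfS, hS_hOfS]
    exact X.s_tensor x y n m
  unit := (h_unit_iff _).2 fun n m => by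
    rw [unheart_heart_mapRight, unheart_heart_mapLeft, unheartS, hS_hOfS]
    exact X.s_unit n m

instance : (toStr V C M).Faithful where
  map_injective {X Y f g} h := Hom.ext (by
    ext p u
    exact congrArg (fun t => (StrMod.Hom.hom t).app p.2 p.1.unop) h)

instance : (toStr V C M).Full where
  map_surjective {X Y} g := by
    have h : ∀ (p : Mᵒᵖ × M), ((heartUnheartIso X.prof).inv ≫ heartMap (StrMod.Hom.hom g) ≫
        (heartUnheartIso Y.prof).hom).app p PUnit.unit = (StrMod.Hom.hom g).app p.2 p.1.unop :=
      fun p => (Category.id_comp _).trans (Category.comp_id _)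
    refine ⟨⟨(heartUnheartIso X.prof).inv ≫ heartMap (StrMod.Hom.hom g) ≫
        (heartUnheartIso Y.prof).hom, (h_comm_iff _ _ _).2 fun x a => ?_⟩, StrMod.Hom.ext ?_⟩
    · rw [h, h]
      exact StrMod.s_hom g x a.2 a.1.unop
    · ext n m
      exact h (Opposite.op m, n)

instance : (toStr V C M).EssSurj where
  mem_essImage X := ⟨ofStrObj X, ⟨StrMod.mkIso (unheartHeartIso X.prof) fun x n m => by
    have h := hS_hOfS X.heartS X.isStrength_heartS x (Opposite.op m, n)
    exact ((Category.comp_id _).trans h).trans (Category.id_comp _).symm⟩⟩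

instance : (toStr V C M).IsEquivalence where

variable (V C M) in
/-- Modules over `H` are strong profunctors. -/
def equivStr : HMod V C M M ≌ StrMod V C M := (toStr V C M).asEquivalence

instance : MonoidalCategory (HMod V C M M) := Monoidal.transport (equivStr V C M).symm

instance : (equivStr V C M).functor.Monoidal :=
  inferInstanceAs (Monoidal.equivalenceTransported (equivStr V C M).symm).inverse.Monoidal

lemma component_eq (X : HMod V C M M) (x : C) (b a : Mᵒᵖ × M) :
    X.component x b a = rotate _ _ _ ≫
      omegaOfS (unheart X.prof) ((equivStr V C M).functor.obj X).s x b.2 a.2 a.1.unop b.1.unop :=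
  hComponent_eq _ _ _ _

end HMod

end

end LaxModuleProf

namespace LaxModuleProf

noncomputable section

set_option linter.unusedSectionVars false

open VProf

/-! ### The multiplication profunctor -/

section Insert

variable {V : Type u} [Category.{v} V] [MonoidalCategory V] [SymmetricCategory V]

lemma whiskerLeft_insert_tensorμ_fst {F G X K Z : V} (k : 𝟙_ V ⟶ K) (c₁ : F ⊗ X ⟶ Z)
    (c₂ : G ⊗ K ⟶ G) (h : G ◁ k ≫ c₂ = (ρ_ G).hom) :
    (F ⊗ G) ◁ ((ρ_ X).inv ≫ X ◁ k) ≫ tensorμ F G X K ≫ (c₁ ⊗ₘ c₂) =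
      (α_ _ _ _).hom ≫ F ◁ (β_ G X).hom ≫ (α_ _ _ _).inv ≫ c₁ ▷ G := by
  have h2 := tensorμ_natural_right F G (𝟙 X) k
  rw [id_tensorHom, MonoidalCategory.whiskerLeft_id] at h2
  rw [MonoidalCategory.whiskerLeft_comp, Category.assoc, reassoc_of% h2, tensorHom_comp_tensorHom,
    h, Category.id_comp, ← tensorHom_id c₁, ← Category.comp_id (ρ_ G).hom,
    ← whiskerLeft_comp_tensorHom]
  simp only [← Category.assoc]
  congr 1
  simp [tensorμ]

lemma whiskerLeft_insert_tensorμ_snd {F G X K Z : V} (k : 𝟙_ V ⟶ K) (c₁ : F ⊗ K ⟶ F)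
    (c₂ : G ⊗ X ⟶ Z) (h : F ◁ k ≫ c₁ = (ρ_ F).hom) :
    (F ⊗ G) ◁ ((λ_ X).inv ≫ k ▷ X) ≫ tensorμ F G K X ≫ (c₁ ⊗ₘ c₂) =
      (α_ _ _ _).hom ≫ F ◁ c₂ := by
  have h2 := tensorμ_natural_right F G k (𝟙 X)
  rw [tensorHom_id, MonoidalCategory.whiskerLeft_id] at h2
  rw [MonoidalCategory.whiskerLeft_comp, Category.assoc, reassoc_of% h2, tensorHom_comp_tensorHom,
    h, Category.id_comp, ← id_tensorHom, ← Category.comp_id (ρ_ F).hom,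
    ← whiskerRight_comp_tensorHom]
  simp only [← Category.assoc]
  congr 1
  · simp [tensorμ]
    monoidal
  · rw [id_tensorHom]

lemma insert_assoc_fst {X₁ X₂ I K : V} (i : 𝟙_ V ⟶ I) (k : 𝟙_ V ⟶ K) :
    ((ρ_ (X₁ ⊗ X₂)).inv ≫ (X₁ ⊗ X₂) ◁ ((λ_ (𝟙_ V)).inv ≫ (i ⊗ₘ k))) ≫ (α_ _ _ _).inv ≫
        ((α_ _ _ _).hom ⊗ₘ 𝟙 K) =
      X₁ ◁ ((ρ_ X₂).inv ≫ X₂ ◁ i) ≫ (ρ_ _).inv ≫ (X₁ ⊗ (X₂ ⊗ I)) ◁ k := by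
  rw [MonoidalCategory.tensorHom_def, tensorHom_id]
  monoidal

lemma insert_assoc_mid {I₁ I₂ X K : V} (i₁ : 𝟙_ V ⟶ I₁) (i₂ : 𝟙_ V ⟶ I₂) (k : 𝟙_ V ⟶ K) :
    (((ρ_ X).inv ≫ X ◁ k) ≫ (λ_ _).inv ≫ ((λ_ (𝟙_ V)).inv ≫ (i₁ ⊗ₘ i₂)) ▷ _) ≫ (α_ _ _ _).inv ≫
        ((α_ _ _ _).hom ⊗ₘ 𝟙 K) =
      (((λ_ X).inv ≫ i₂ ▷ X) ≫ (λ_ _).inv ≫ i₁ ▷ _) ≫ (ρ_ _).inv ≫ (I₁ ⊗ (I₂ ⊗ X)) ◁ k := by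
  rw [tensorHom_id]
  simp only [Category.assoc]
  rw [leftUnitor_inv_naturality_assoc, whisker_exchange_assoc,
    associator_inv_naturality_right_assoc, whisker_exchange, MonoidalCategory.tensorHom_def']
  monoidal

lemma insert_assoc_snd {I₁ I₂ I₃ X : V} (i₁ : 𝟙_ V ⟶ I₁) (i₂ : 𝟙_ V ⟶ I₂) (i₃ : 𝟙_ V ⟶ I₃) :
    (((λ_ X).inv ≫ i₃ ▷ X) ≫ (λ_ _).inv ≫ ((λ_ (𝟙_ V)).inv ≫ (i₁ ⊗ₘ i₂)) ▷ _) ≫ (α_ _ _ _).inv ≫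
        ((α_ _ _ _).hom ⊗ₘ 𝟙 X) =
      (λ_ X).inv ≫ ((λ_ (𝟙_ V)).inv ≫ (i₁ ⊗ₘ ((λ_ (𝟙_ V)).inv ≫ (i₂ ⊗ₘ i₃)))) ▷ X := by
  rw [tensorHom_id, MonoidalCategory.tensorHom_def' i₁, MonoidalCategory.tensorHom_def' i₁,
    MonoidalCategory.tensorHom_def' i₂]
  monoidal

end Insert

namespace VProf

variable {V : Type u} [Category.{v} V] [MonoidalCategory V] [SymmetricCategory V]
  {M : Type v} [Category.{v} M] [EnrichedOrdinaryCategory V M]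

/-- The values of the multiplication profunctor. -/
abbrev mulObj (V : Type u) [Category.{v} V] [MonoidalCategory V] [SymmetricCategory V]
    {M : Type v} [Category.{v} M] [EnrichedOrdinaryCategory V M] (m a b : Mᵒᵖ × M) : V :=
  ((m.1 ⟶[V] a.1) ⊗ (b.1.unop ⟶[V] a.2)) ⊗ (m.2 ⟶[V] b.2)

/-- The right action on the coevaluation. -/
def coevPost (V : Type u) [Category.{v} V] [MonoidalCategory V] [SymmetricCategory V]
    {M : Type v} [Category.{v} M] [EnrichedOrdinaryCategory V M] (p p' : M) (q q' : Mᵒᵖ) :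
    (q.unop ⟶[V] p) ⊗ ((p ⟶[V] p') ⊗ (q ⟶[V] q')) ⟶ (q'.unop ⟶[V] p') :=
  (coev V M).post PUnit.unit (p, q) (p', q')

lemma coev_post_fst (p : M) (q : Mᵒᵖ) (p' : M) :
    (q.unop ⟶[V] p) ◁ ((ρ_ (p ⟶[V] p')).inv ≫ (p ⟶[V] p') ◁ eId V q) ≫
        coevPost V p p' q q = eComp V q.unop p p' := by
  change _ ◁ ((ρ_ _).inv ≫ _ ◁ eId V q.unop) ≫ (α_ _ _ _).inv ≫ eComp V q.unop p p' ▷ _ ≫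
    (β_ _ _).hom ≫ eComp V q.unop q.unop p' = _
  have h := eId_whiskerRight_eComp V q.unop p'
  rw [MonoidalCategory.whiskerLeft_comp, Category.assoc, associator_inv_naturality_right_assoc,
    whisker_exchange_assoc, BraidedCategory.braiding_naturality_right_assoc, h]
  simp

lemma coev_post_snd (p : M) (q q' : Mᵒᵖ) :
    (q.unop ⟶[V] p) ◁ ((λ_ (q ⟶[V] q')).inv ≫ eId V p ▷ (q ⟶[V] q')) ≫
        coevPost V p p q q' = (β_ _ _).hom ≫ eComp V q'.unop q.unop p := by
  change _ ◁ ((λ_ _).inv ≫ eId V p ▷ _) ≫ (α_ _ _ _).inv ≫ eComp V q.unop p p ▷ _ ≫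
    (β_ _ _).hom ≫ eComp V q'.unop q.unop p = _
  have h := whiskerLeft_eId_eComp V q.unop p
  rw [MonoidalCategory.whiskerLeft_comp, Category.assoc, associator_inv_naturality_middle_assoc,
    ← comp_whiskerRight_assoc, h, triangle_assoc_comp_right_assoc,
    ← MonoidalCategory.whiskerLeft_comp_assoc, Iso.inv_hom_id, MonoidalCategory.whiskerLeft_id,
    Category.id_comp]

/-- The action of the first factor on the multiplication profunctor. -/
lemma mulProf_post_fst (m a a' b : Mᵒᵖ × M) :
    mulObj V m a b ◁ (insertLeft (Mᵒᵖ × M) b).map a a' ≫ (mulProf V M).post m (a, b) (a', b) =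
      (α_ _ _ _).hom ≫ _ ◁ (β_ _ _).hom ≫ (α_ _ _ _).inv ≫
        eComp V (m.1, b.1.unop) a a' ▷ (m.2 ⟶[V] b.2) := by
  have h1 := insert_assoc_fst (X₁ := a.1 ⟶[V] a'.1) (X₂ := a.2 ⟶[V] a'.2) (eId V b.1) (eId V b.2)
  have h2 := whiskerLeft_insert_tensorμ_fst
    (eId V b.2) (tensorμ _ _ _ _ ≫ (eComp V m.1 a.1 a'.1 ⊗ₘ
      coevPost V a.2 a'.2 b.1 b.1))
    (eComp V m.2 b.2 b.2) (whiskerLeft_eId_eComp V m.2 b.2)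
  have h3 : ((m.1 ⟶[V] a.1) ⊗ (b.1.unop ⟶[V] a.2)) ◁ ((a.1 ⟶[V] a'.1) ◁
      ((ρ_ (a.2 ⟶[V] a'.2)).inv ≫ (a.2 ⟶[V] a'.2) ◁ eId V b.1)) ≫ tensorμ _ _ _ _ ≫
        (eComp V m.1 a.1 a'.1 ⊗ₘ coevPost V a.2 a'.2 b.1 b.1) =
      eComp V (m.1, b.1.unop) a a' := by
    rw [← id_tensorHom (a.1 ⟶[V] a'.1), tensorμ_natural_right_assoc, tensorHom_comp_tensorHom,
      coev_post_fst, MonoidalCategory.whiskerLeft_id, Category.id_comp]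
    rfl
  change _ ◁ ((ρ_ _).inv ≫ _ ◁ ((λ_ _).inv ≫ (eId V b.1 ⊗ₘ eId V b.2))) ≫
    _ ◁ ((α_ _ _ _).inv ≫ ((α_ _ _ _).hom ⊗ₘ 𝟙 _)) ≫ tensorμ _ _ _ _ ≫ ((tensorμ _ _ _ _ ≫
      (eComp V m.1 a.1 a'.1 ⊗ₘ coevPost V a.2 a'.2 b.1 b.1)) ⊗ₘ
        eComp V m.2 b.2 b.2) = _
  rw [← MonoidalCategory.whiskerLeft_comp_assoc]
  refine (congrArg (fun t => _ ◁ t ≫ _) h1).trans ?_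
  rw [MonoidalCategory.whiskerLeft_comp, Category.assoc]
  refine (congrArg (fun t => _ ◁ _ ≫ t) h2).trans ?_
  rw [associator_naturality_right_assoc, ← MonoidalCategory.whiskerLeft_comp_assoc,
    BraidedCategory.braiding_naturality_right, MonoidalCategory.whiskerLeft_comp_assoc,
    associator_inv_naturality_middle_assoc, ← comp_whiskerRight, h3]
  rfl

lemma mulProf_post_mid (m a b : Mᵒᵖ × M) (q : Mᵒᵖ) :
    mulObj V m a b ◁ ((insertLeft Mᵒᵖ b.2).map b.1 q ≫
        (insertRight (Mᵒᵖ × M) a).map (b.1, b.2) (q, b.2)) ≫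
        (mulProf V M).post m (a, b) (a, (q, b.2)) =
      (α_ _ _ _).hom ≫ _ ◁ (β_ _ _).hom ≫ (α_ _ _ _).inv ≫
        ((α_ _ _ _).hom ≫ _ ◁ ((β_ _ _).hom ≫ eComp V q.unop b.1.unop a.2)) ▷
          (m.2 ⟶[V] b.2) := by
  have h1 := insert_assoc_mid (X := b.1 ⟶[V] q) (eId V a.1) (eId V a.2) (eId V b.2)
  have h2 := whiskerLeft_insert_tensorμ_fst
    (eId V b.2) (tensorμ _ _ _ _ ≫ (eComp V m.1 a.1 a.1 ⊗ₘ
      coevPost V a.2 a.2 b.1 q))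
    (eComp V m.2 b.2 b.2) (whiskerLeft_eId_eComp V m.2 b.2)
  have h3 := whiskerLeft_insert_tensorμ_snd (X := (a.2 ⟶[V] a.2) ⊗ (b.1 ⟶[V] q)) (eId V a.1)
    (eComp V m.1 a.1 a.1) (coevPost V a.2 a.2 b.1 q)
    (whiskerLeft_eId_eComp V m.1 a.1)
  have h4 := congrArg (fun t => (m.1 ⟶[V] a.1) ◁ t) (coev_post_snd a.2 b.1 q)
  simp only [MonoidalCategory.whiskerLeft_comp _ (_ ◁ _)] at h4
  change _ ◁ (((ρ_ _).inv ≫ _ ◁ eId V b.2) ≫ ((λ_ _).inv ≫ ((λ_ _).inv ≫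
      (eId V a.1 ⊗ₘ eId V a.2)) ▷ _)) ≫
    _ ◁ ((α_ _ _ _).inv ≫ ((α_ _ _ _).hom ⊗ₘ 𝟙 _)) ≫ tensorμ _ _ _ _ ≫ ((tensorμ _ _ _ _ ≫
      (eComp V m.1 a.1 a.1 ⊗ₘ coevPost V a.2 a.2 b.1 q)) ⊗ₘ
        eComp V m.2 b.2 b.2) = _
  rw [← MonoidalCategory.whiskerLeft_comp_assoc]
  refine (congrArg (fun t => _ ◁ t ≫ _) h1).trans ?_
  rw [MonoidalCategory.whiskerLeft_comp, Category.assoc]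
  refine (congrArg (fun t => _ ◁ _ ≫ t) h2).trans ?_
  rw [associator_naturality_right_assoc, ← MonoidalCategory.whiskerLeft_comp_assoc,
    BraidedCategory.braiding_naturality_right, MonoidalCategory.whiskerLeft_comp_assoc,
    associator_inv_naturality_middle_assoc, ← comp_whiskerRight,
    MonoidalCategory.whiskerLeft_comp _ ((λ_ _).inv ≫ _), Category.assoc, h3,
    associator_naturality_right_assoc, h4]
  rfl

lemma mulProf_post_snd (m a b : Mᵒᵖ × M) (n : M) :
    mulObj V m a b ◁ ((insertRight M b.1).map b.2 n ≫
        (insertRight (Mᵒᵖ × M) a).map (b.1, b.2) (b.1, n)) ≫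
        (mulProf V M).post m (a, b) (a, (b.1, n)) =
      (α_ _ _ _).hom ≫ _ ◁ eComp V m.2 b.2 n := by
  have h1 := insert_assoc_snd (X := b.2 ⟶[V] n) (eId V a.1) (eId V a.2) (eId V b.1)
  have h2 := whiskerLeft_insert_tensorμ_snd (X := b.2 ⟶[V] n)
    (eId V (a.1, (a.2, b.1))) ((tens (idProf V Mᵒᵖ) (coev V M)).post (m.1, PUnit.unit) _ _)
    (eComp V m.2 b.2 n) ((tens (idProf V Mᵒᵖ) (coev V M)).post_id (m.1, PUnit.unit) _)
  change _ ◁ (((λ_ _).inv ≫ eId V b.1 ▷ _) ≫ ((λ_ _).inv ≫ ((λ_ _).inv ≫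
      (eId V a.1 ⊗ₘ eId V a.2)) ▷ _)) ≫
    _ ◁ ((α_ _ _ _).inv ≫ ((α_ _ _ _).hom ⊗ₘ 𝟙 _)) ≫ tensorμ _ _ _ _ ≫ ((tensorμ _ _ _ _ ≫
      (eComp V m.1 a.1 a.1 ⊗ₘ coevPost V a.2 a.2 b.1 b.1)) ⊗ₘ
        eComp V m.2 b.2 n) = _
  rw [← MonoidalCategory.whiskerLeft_comp_assoc]
  exact (congrArg (fun t => _ ◁ t ≫ _) h1).trans h2

/-- The action on the first variable of the multiplication profunctor. -/
lemma mulProf_preFst (m a b : Mᵒᵖ × M) (p : Mᵒᵖ) :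
    (mulProf V M).preFst p m.1 m.2 (a, b) =
      (α_ _ _ _).inv ≫ ((α_ _ _ _).inv ≫ eComp V p m.1 a.1 ▷ (b.1.unop ⟶[V] a.2)) ▷
        (m.2 ⟶[V] b.2) := by
  have h1 := insert_tensorμ_right (X := (p ⟶[V] m.1) ⊗ 𝟙_ V)
    (G := (m.1 ⟶[V] a.1) ⊗ (b.1.unop ⟶[V] a.2)) (T := m.2 ⟶[V] b.2)
    (eId V m.2) (tensorμ _ _ _ _ ≫ (eComp V p m.1 a.1 ⊗ₘ (λ_ (b.1.unop ⟶[V] a.2)).hom))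
    (eComp V m.2 m.2 b.2) (𝟙 _) (by rw [eId_whiskerRight_eComp, Category.comp_id])
  have h2 := insert_tensorμ_right (X := p ⟶[V] m.1) (𝟙 (𝟙_ V)) (eComp V p m.1 a.1)
    (λ_ (b.1.unop ⟶[V] a.2)).hom (𝟙 _) (by rw [id_whiskerRight, Category.comp_id, Category.id_comp])
  have h3 : ((ρ_ (p ⟶[V] m.1)).inv ≫ (p ⟶[V] m.1) ◁ eId V m.2) ≫
      ((ρ_ (p ⟶[V] m.1)).inv ⊗ₘ 𝟙 _) =
    (ρ_ (p ⟶[V] m.1)).inv ≫ (ρ_ ((p ⟶[V] m.1) ⊗ 𝟙_ V)).inv ≫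
      ((p ⟶[V] m.1) ⊗ 𝟙_ V) ◁ eId V m.2 := by
    rw [tensorHom_id, Category.assoc, whisker_exchange, ← rightUnitor_inv_naturality_assoc]
  rw [MonoidalCategory.whiskerLeft_id, Category.comp_id, tensorHom_id] at h2
  rw [tensorHom_id] at h1
  change ((ρ_ _).inv ≫ _ ◁ eId V m.2) ▷ _ ≫ ((ρ_ _).inv ⊗ₘ 𝟙 _) ▷ _ ≫ tensorμ _ _ _ _ ≫
    ((tensorμ _ _ _ _ ≫ (eComp V p m.1 a.1 ⊗ₘ (λ_ _).hom)) ⊗ₘ eComp V m.2 m.2 b.2) = _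
  rw [← comp_whiskerRight_assoc, h3, comp_whiskerRight, Category.assoc]
  refine (congrArg (fun t => (ρ_ _).inv ▷ _ ≫ t) h1).trans ?_
  rw [associator_inv_naturality_left_assoc, ← comp_whiskerRight, h2]

/-- The action on the second variable of the multiplication profunctor. -/
lemma mulProf_preSnd (m a b : Mᵒᵖ × M) (n : M) :
    (mulProf V M).preSnd m.1 n m.2 (a, b) =
      (α_ _ _ _).inv ≫ (β_ _ _).hom ▷ _ ≫ (α_ _ _ _).hom ≫ _ ◁ eComp V n m.2 b.2 := by
  have h1 := insert_tensorμ_left (X := n ⟶[V] m.2) (T := m.2 ⟶[V] b.2)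
    (eId V (m.1, PUnit.unit))
    ((tens (idProf V Mᵒᵖ) (coev V M)).pre (m.1, PUnit.unit) (m.1, PUnit.unit) (a.1, (a.2, b.1)))
    (eComp V n m.2 b.2) (𝟙 _) (by
      rw [Category.comp_id]
      exact (tens (idProf V Mᵒᵖ) (coev V M)).pre_id (m.1, PUnit.unit) (a.1, (a.2, b.1)))
  have h2 : eId V (m.1, PUnit.unit.{v + 1}) = eId V m.1 ≫ (ρ_ _).inv :=
    ((unitInvFunctor V Mᵒᵖ).map_id m.1).symm
  have h3 : ((λ_ (n ⟶[V] m.2)).inv ≫ eId V m.1 ▷ (n ⟶[V] m.2)) ≫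
      ((ρ_ (m.1 ⟶[V] m.1)).inv ⊗ₘ 𝟙 _) =
    (λ_ (n ⟶[V] m.2)).inv ≫ (eId V (m.1, PUnit.unit.{v + 1})) ▷ (n ⟶[V] m.2) := by
    rw [tensorHom_id, Category.assoc, ← comp_whiskerRight, h2]
  rw [id_tensorHom] at h1
  change ((λ_ _).inv ≫ eId V m.1 ▷ _) ▷ _ ≫ ((ρ_ _).inv ⊗ₘ 𝟙 _) ▷ _ ≫ tensorμ _ _ _ _ ≫
    ((tensorμ _ _ _ _ ≫ (eComp V m.1 m.1 a.1 ⊗ₘ (λ_ _).hom)) ⊗ₘ eComp V n m.2 b.2) = _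
  rw [← comp_whiskerRight_assoc, h3]
  exact h1

end VProf

end

end LaxModuleProf

namespace LaxModuleProf

noncomputable section

set_option linter.unusedSectionVars false

open VProf

/-! ### Dinatural families on the multiplication profunctor -/

section SymmetricCoherence

variable {V : Type u} [Category.{v} V] [MonoidalCategory V] [SymmetricCategory V]

lemma braiding_braiding_assoc (X Y Z : V) :
    (β_ Y (X ⊗ Z)).hom ≫ (β_ X Z).hom ▷ Y ≫ (α_ _ _ _).hom =
      (α_ _ _ _).inv ≫ (β_ Y X).hom ▷ Z ≫ (β_ (X ⊗ Y) Z).hom := by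
  rw [BraidedCategory.braiding_tensor_left_hom, BraidedCategory.braiding_tensor_right_hom]
  simp

lemma braiding_tensor_tensor_cancel (A B P X : V) :
    (β_ ((A ⊗ B) ⊗ P) X).hom ≫ (α_ _ _ _).inv ≫ ((α_ _ _ _).inv ≫ (β_ X A).hom ▷ B ≫
        (α_ _ _ _).hom) ▷ P =
      (α_ _ _ _).hom ≫ _ ◁ (β_ P X).hom ≫ (α_ _ _ _).inv ≫
        ((α_ _ _ _).hom ≫ A ◁ (β_ B X).hom) ▷ P := by
  rw [BraidedCategory.braiding_tensor_left_hom, BraidedCategory.braiding_tensor_left_hom]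
  simp only [comp_whiskerRight, Category.assoc, Iso.hom_inv_id_assoc]
  simp only [← comp_whiskerRight_assoc, ← comp_whiskerRight, Iso.hom_inv_id_assoc]
  simp

lemma tensorμ_braid_past (G C X P Q : V) :
    (α_ (G ⊗ C) X (P ⊗ Q)).hom ≫ (G ⊗ C) ◁ ((α_ _ _ _).inv ≫ (β_ X P).hom ▷ Q ≫ (α_ _ _ _).hom) ≫
      tensorμ G C P (X ⊗ Q) ≫ _ ◁ ((α_ _ _ _).inv ≫ (β_ C X).hom ▷ Q ≫ (α_ _ _ _).hom) ≫
        (α_ _ _ _).inv ≫ ((α_ _ _ _).hom ≫ G ◁ (β_ P X).hom ≫ (α_ _ _ _).inv) ▷ (C ⊗ Q) =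
    ((α_ _ _ _).hom ≫ G ◁ (β_ C X).hom ≫ (α_ _ _ _).inv) ▷ (P ⊗ Q) ≫ tensorμ (G ⊗ X) C P Q := by
  have h1 : C ◁ (β_ X P).hom ≫ (α_ _ _ _).inv ≫ (β_ C P).hom ▷ X ≫ (α_ _ _ _).hom ≫
      P ◁ (β_ C X).hom ≫ (α_ _ _ _).inv ≫ (β_ P X).hom ▷ C =
      (α_ _ _ _).inv ≫ (β_ C X).hom ▷ P ≫ (α_ _ _ _).hom ≫ X ◁ (β_ C P).hom ≫ (α_ _ _ _).inv := by
    have a1 := BraidedCategory.braiding_tensor_right_hom C P X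
    have a2 := BraidedCategory.braiding_tensor_right_hom C X P
    have a3 := BraidedCategory.braiding_naturality_right C (β_ X P).hom
    rw [a1, a2] at a3
    rw [reassoc_of% a3]
    simp [← comp_whiskerRight]
  have h2 := congrArg (fun t => (α_ _ _ _).hom ≫ (G ⊗ C) ◁ (α_ _ _ _).inv ≫ (α_ _ _ _).hom ≫
      G ◁ (α_ _ _ _).inv ≫ G ◁ (t ▷ Q) ≫ G ◁ (α_ _ _ _).hom ≫ (α_ _ _ _).inv ≫
      (α_ _ _ _).inv ▷ (C ⊗ Q)) h1
  refine Eq.trans ?_ (h2.trans ?_)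
  · simp [tensorμ]
    monoidal
  · simp [tensorμ]
    monoidal

variable {A B B' C C' G G' P P' Q Q' X Y P₀ P₁ Q₀ Q₁ Z : V}

lemma dinat_fst (c : G ⊗ X ⟶ G') (e : X ⊗ P' ⟶ P) (p : G ⊗ P ⟶ P₀) (p' : G' ⊗ P' ⟶ P₀)
    (h : c ▷ P' ≫ p' = (α_ _ _ _).hom ≫ G ◁ e ≫ p) (r : C ⊗ Q ⟶ Q₀) :
    ((α_ G C X).hom ≫ G ◁ (β_ C X).hom ≫ (α_ _ _ _).inv ≫ c ▷ C) ▷ (P' ⊗ Q) ≫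
        tensorμ _ _ _ _ ≫ (p' ⊗ₘ r) =
      (α_ _ _ _).hom ≫ _ ◁ ((α_ _ _ _).inv ≫ e ▷ Q) ≫ tensorμ _ _ _ _ ≫ (p ⊗ₘ r) := by
  have h1 := tensorμ_natural_left c (𝟙 C) P' Q
  have h2 := tensorμ_natural_right G C e (𝟙 Q)
  rw [tensorHom_id, id_whiskerRight] at h1
  rw [tensorHom_id, MonoidalCategory.whiskerLeft_id] at h2
  simp only [comp_whiskerRight, MonoidalCategory.whiskerLeft_comp, Category.assoc]
  rw [reassoc_of% h1, reassoc_of% h2, tensorHom_comp_tensorHom, tensorHom_comp_tensorHom, h,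
    ← whiskerRight_comp_tensorHom]
  simp only [← Category.assoc, Category.id_comp]
  congr 1
  simp [tensorμ]
  monoidal

lemma dinat_snd (c : C ⊗ Y ⟶ C') (e : Y ⊗ Q' ⟶ Q) (q : C ⊗ Q ⟶ Q₀) (q' : C' ⊗ Q' ⟶ Q₀)
    (h : c ▷ Q' ≫ q' = (α_ _ _ _).hom ≫ C ◁ e ≫ q) (p : G ⊗ P ⟶ P₀) :
    ((α_ G C Y).hom ≫ G ◁ c) ▷ (P ⊗ Q') ≫ tensorμ _ _ _ _ ≫ (p ⊗ₘ q') =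
      (α_ _ _ _).hom ≫ _ ◁ ((α_ _ _ _).inv ≫ (β_ _ _).hom ▷ Q' ≫ (α_ _ _ _).hom ≫ P ◁ e) ≫
        tensorμ _ _ _ _ ≫ (p ⊗ₘ q) := by
  have h1 := tensorμ_natural_left (𝟙 G) c P Q'
  have h2 := tensorμ_natural_right G C (𝟙 P) e
  rw [id_tensorHom, id_whiskerRight] at h1
  rw [id_tensorHom, MonoidalCategory.whiskerLeft_id] at h2
  simp only [comp_whiskerRight, MonoidalCategory.whiskerLeft_comp, Category.assoc]
  rw [reassoc_of% h1, reassoc_of% h2, tensorHom_comp_tensorHom, tensorHom_comp_tensorHom, h,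
    Category.id_comp, ← whiskerLeft_comp_tensorHom]
  simp only [← Category.assoc]
  congr 1
  simp [tensorμ]
  monoidal

lemma dinat_mid (pG : (A ⊗ B) ⊗ P ⟶ P₁) (s : X ⊗ P₁ ⟶ P₀) (p' : (A ⊗ B') ⊗ P ⟶ P₀)
    (c : X ⊗ B ⟶ B')
    (h1 : X ◁ pG ≫ s = (α_ _ _ _).inv ≫
      ((α_ _ _ _).inv ≫ (β_ _ _).hom ▷ B ≫ (α_ _ _ _).hom ≫ A ◁ c) ▷ P ≫ p')
    (f : X ⊗ Q' ⟶ Q) (r : C ⊗ Q ⟶ Q₁) (r' : C ⊗ Q' ⟶ Q₀) (g : X ⊗ Q₀ ⟶ Q₁)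
    (h2 : C ◁ f ≫ r = (α_ _ _ _).inv ≫ (β_ _ _).hom ▷ Q' ≫ (α_ _ _ _).hom ≫ X ◁ r' ≫ g)
    (i' : Q₁ ⊗ P₁ ⟶ Z) (i : Q₀ ⊗ P₀ ⟶ Z)
    (h3 : ((β_ _ _).hom ≫ g) ▷ P₁ ≫ i' = (α_ _ _ _).hom ≫ Q₀ ◁ s ≫ i) :
    ((α_ (A ⊗ B) C X).hom ≫ (A ⊗ B) ◁ (β_ _ _).hom ≫ (α_ _ _ _).inv ≫
        ((α_ _ _ _).hom ≫ A ◁ ((β_ _ _).hom ≫ c)) ▷ C) ▷ (P ⊗ Q') ≫ tensorμ _ _ _ _ ≫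
        (p' ⊗ₘ r') ≫ (β_ _ _).hom ≫ i =
      (α_ _ _ _).hom ≫ _ ◁ ((α_ _ _ _).inv ≫ (β_ _ _).hom ▷ Q' ≫ (α_ _ _ _).hom ≫ P ◁ f) ≫
        tensorμ _ _ _ _ ≫ (pG ⊗ₘ r) ≫ (β_ _ _).hom ≫ i' := by
  have n1 := tensorμ_natural_left (A ◁ c) (𝟙 C) P Q'
  have n2 := tensorμ_natural_right (A ⊗ B) C (𝟙 P) f
  have n3 := tensorμ_natural_left ((α_ A B X).hom ≫ A ◁ (β_ B X).hom) (𝟙 C) P Q'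
  rw [tensorHom_id, id_whiskerRight, tensorHom_id] at n1 n3
  rw [id_tensorHom, MonoidalCategory.whiskerLeft_id, id_tensorHom] at n2
  have e1 : (pG ⊗ₘ (X ◁ r' ≫ g)) ≫ (β_ P₁ Q₁).hom ≫ i' =
      (α_ _ _ _).inv ≫ (β_ ((A ⊗ B) ⊗ P) X).hom ▷ (C ⊗ Q') ≫
        ((X ◁ pG ≫ s) ⊗ₘ r') ≫ (β_ _ _).hom ≫ i := by
    have h3' : g ▷ P₁ ≫ i' = (β_ _ _).hom ▷ P₁ ≫ (α_ _ _ _).hom ≫ Q₀ ◁ s ≫ i := by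
      rw [← h3, ← comp_whiskerRight_assoc, SymmetricCategory.symmetry_assoc]
    have h4 := braiding_braiding_assoc X P₁ Q₀
    rw [← tensorHom_comp_whiskerLeft_assoc, BraidedCategory.braiding_naturality_right_assoc, h3',
      reassoc_of% h4, ← BraidedCategory.braiding_naturality_left_assoc,
      MonoidalCategory.tensorHom_def', Category.assoc, associator_inv_naturality_left_assoc,
      ← comp_whiskerRight_assoc, BraidedCategory.braiding_naturality_left,
      associator_inv_naturality_right_assoc, comp_whiskerRight_assoc, whisker_exchange_assoc]
    rw [MonoidalCategory.tensorHom_def', comp_whiskerRight]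
    simp only [Category.assoc]
  have h5 := tensorμ_braid_past (A ⊗ B) C X P Q'
  have h6 := braiding_tensor_tensor_cancel A B P X
  have e2 : (pG ⊗ₘ (C ◁ f ≫ r)) = _ ◁ ((α_ _ _ _).inv ≫ (β_ _ _).hom ▷ Q' ≫ (α_ _ _ _).hom) ≫
      (pG ⊗ₘ (X ◁ r' ≫ g)) := by
    rw [whiskerLeft_comp_tensorHom, h2]
    simp only [Category.assoc]
  have e3 : (β_ ((A ⊗ B) ⊗ P) X).hom ▷ (C ⊗ Q') ≫ ((X ◁ pG ≫ s) ⊗ₘ r') =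
      ((α_ _ _ _).hom ≫ (A ⊗ B) ◁ (β_ P X).hom ≫ (α_ _ _ _).inv) ▷ (C ⊗ Q') ≫
      (((α_ _ _ _).hom ≫ A ◁ (β_ B X).hom) ▷ P ▷ (C ⊗ Q')) ≫ ((A ◁ c) ▷ P ≫ p' ⊗ₘ r') := by
    rw [h1, whiskerRight_comp_tensorHom, whiskerRight_comp_tensorHom, whiskerRight_comp_tensorHom]
    congr 1
    simp only [comp_whiskerRight, Category.assoc] at h6 ⊢
    rw [reassoc_of% h6]
  have e4 : ((α_ (A ⊗ B) C X).hom ≫ (A ⊗ B) ◁ (β_ C X).hom ≫ (α_ _ _ _).inv ≫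
        ((α_ _ _ _).hom ≫ A ◁ ((β_ B X).hom ≫ c)) ▷ C) ▷ (P ⊗ Q') ≫ tensorμ _ _ _ _ =
      ((α_ _ _ _).hom ≫ (A ⊗ B) ◁ (β_ C X).hom ≫ (α_ _ _ _).inv) ▷ (P ⊗ Q') ≫
        tensorμ _ _ _ _ ≫ ((α_ _ _ _).hom ≫ A ◁ (β_ B X).hom) ▷ P ▷ (C ⊗ Q') ≫
          (A ◁ c) ▷ P ▷ (C ⊗ Q') := by
    simp only [comp_whiskerRight, MonoidalCategory.whiskerLeft_comp, Category.assoc] at n1 n3 ⊢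
    rw [n1, reassoc_of% n3]
  have e5 : ((A ⊗ B) ⊗ C) ◁ ((α_ _ _ _).inv ≫ (β_ X P).hom ▷ Q' ≫ (α_ _ _ _).hom ≫ P ◁ f) ≫
        tensorμ _ _ _ _ ≫ (pG ⊗ₘ r) =
      ((A ⊗ B) ⊗ C) ◁ ((α_ _ _ _).inv ≫ (β_ X P).hom ▷ Q' ≫ (α_ _ _ _).hom) ≫
        tensorμ _ _ _ _ ≫ (pG ⊗ₘ (C ◁ f ≫ r)) := by
    rw [← whiskerLeft_comp_tensorHom, ← reassoc_of% n2]
    simp only [MonoidalCategory.whiskerLeft_comp, Category.assoc]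
  have e6 := congrArg (fun t => (α_ _ _ _).hom ≫ t ≫ (β_ P₁ Q₁).hom ≫ i') e5
  simp only [Category.assoc] at e6
  rw [e6, e2, Category.assoc, e1, reassoc_of% e3, ← whiskerRight_comp_tensorHom, reassoc_of% e4,
    ← reassoc_of% h5]
  simp only [Category.assoc]
lemma right_action_comp {G L R K X Y G₁ G₂ : V} (l : X ⟶ L) (r : Y ⟶ R) (q₁ : G ⊗ L ⟶ G₁)
    (q₂ : G₁ ⊗ R ⟶ G₂) (q₃ : G ⊗ K ⟶ G₂) (c : L ⊗ R ⟶ K)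
    (h : (α_ _ _ _).hom ≫ G ◁ c ≫ q₃ = q₁ ▷ R ≫ q₂) :
    G ◁ ((l ⊗ₘ r) ≫ c) ≫ q₃ = (α_ _ _ _).inv ≫ (G ◁ l ≫ q₁) ▷ Y ≫ G₁ ◁ r ≫ q₂ := by
  rw [comp_whiskerRight, Category.assoc, ← whisker_exchange_assoc, ← h,
      MonoidalCategory.tensorHom_def]
  simp

end SymmetricCoherence

namespace VProf

section Dinat

variable {V : Type u} [Category.{v} V] [MonoidalCategory V] [SymmetricCategory V]
  {C : Type v} [EnrichedCategory V C] {D : Type v} [EnrichedCategory V D]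
  {E : Type v} [EnrichedCategory V E] {G : VProf V D E} {F : VProf V C D} {e : E} {c : C} {Z : V}

/-- Dinaturality of a family of maps along a family of arrows. -/
def Dinat (f : ∀ d, G.obj e d ⊗ F.obj d c ⟶ Z) {d d' : D} {X : V} (l : X ⟶ (d ⟶[V] d')) : Prop :=
  (G.obj e d ◁ l ≫ G.post e d d') ▷ F.obj d' c ≫ f d' =
    (α_ (G.obj e d) X (F.obj d' c)).hom ≫ G.obj e d ◁ (l ▷ F.obj d' c ≫ F.pre d d' c) ≫ f d

lemma Dinat.comp {f : ∀ d, G.obj e d ⊗ F.obj d c ⟶ Z} {d d₁ d' : D} {X Y : V}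
    {l : X ⟶ (d ⟶[V] d₁)} {r : Y ⟶ (d₁ ⟶[V] d')} (hl : Dinat f l) (hr : Dinat f r) :
    Dinat f ((l ⊗ₘ r) ≫ eComp V d d₁ d') := by
  have h1 := action_comp_aux l r _ _ _ _ (F.pre_comp d d₁ d' c)
  have h2 : G.obj e d ◁ ((l ⊗ₘ r) ≫ eComp V d d₁ d') ≫ G.post e d d' =
      (α_ _ _ _).inv ≫ (G.obj e d ◁ l ≫ G.post e d d₁) ▷ Y ≫
        G.obj e d₁ ◁ r ≫ G.post e d₁ d'  :=
    right_action_comp _ _ _ _ _ _ (G.post_comp e d d₁ d')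
  unfold Dinat at hl hr ⊢
  have h3 : ((l ⊗ₘ r) ≫ eComp V d d₁ d') ▷ F.obj d' c ≫ F.pre d d' c = (α_ _ _ _).hom ≫
      X ◁ (r ▷ F.obj d' c ≫ F.pre d₁ d' c) ≫ l ▷ F.obj d₁ c ≫ F.pre d d₁ c := by
    rw [h1, Iso.hom_inv_id_assoc]
  rw [h2, h3, comp_whiskerRight (α_ _ _ _).inv, Category.assoc,
    comp_whiskerRight ((G.obj e d ◁ l ≫ G.post e d d₁) ▷ Y), Category.assoc, hr,
    associator_naturality_left_assoc, ← whisker_exchange_assoc, hl]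
  simp

lemma dinat_id_iff {f : ∀ d, G.obj e d ⊗ F.obj d c ⟶ Z} {d d' : D} :
    Dinat f (𝟙 (d ⟶[V] d')) ↔ G.post e d d' ▷ F.obj d' c ≫ f d' =
      (α_ _ _ _).hom ≫ G.obj e d ◁ F.pre d d' c ≫ f d := by
  rw [Dinat, MonoidalCategory.whiskerLeft_id, Category.id_comp, id_whiskerRight, Category.id_comp]

end Dinat

/-- Dinaturality over a product can be checked in each variable. -/
lemma dinat_prod {V : Type u} [Category.{v} V] [MonoidalCategory V] [SymmetricCategory V]
    {C : Type v} [EnrichedCategory V C] {A : Type v} [EnrichedCategory V A]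
    {B : Type v} [EnrichedCategory V B]
    {E : Type v} [EnrichedCategory V E] {G : VProf V (A × B) E} {F : VProf V C (A × B)} {e : E}
    {c : C} {Z : V} (f : ∀ d, G.obj e d ⊗ F.obj d c ⟶ Z)
    (hl : ∀ a a' b, Dinat f ((insertLeft A b).map a a'))
    (hr : ∀ a b b', Dinat f ((insertRight B a).map b b')) (d d' : A × B) :
    G.post e d d' ▷ F.obj d' c ≫ f d' =
      (α_ _ _ _).hom ≫ G.obj e d ◁ F.pre d d' c ≫ f d := by
  have h := (hl d.1 d'.1 d.2).comp (hr d'.1 d.2 d'.2)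
  have e := insertLeft_tensor_insertRight_eComp (V := V) d.1 d'.1 d.2 d'.2
  rw [← dinat_id_iff]
  exact e ▸ h

lemma dinat_prod_prod {V : Type u} [Category.{v} V] [MonoidalCategory V] [SymmetricCategory V]
    {C : Type v} [EnrichedCategory V C] {A : Type v} [EnrichedCategory V A]
    {B₁ : Type v} [EnrichedCategory V B₁] {B₂ : Type v} [EnrichedCategory V B₂]
    {E : Type v} [EnrichedCategory V E] {G : VProf V (A × (B₁ × B₂)) E}
    {F : VProf V C (A × (B₁ × B₂))} {e : E}
    {c : C} {Z : V} (f : ∀ d, G.obj e d ⊗ F.obj d c ⟶ Z)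
    (hl : ∀ a a' b, Dinat f ((insertLeft A b).map a a'))
    (hm : ∀ a b₁ b₁' b₂, Dinat f ((insertLeft B₁ b₂).map b₁ b₁' ≫
      (insertRight (B₁ × B₂) a).map (b₁, b₂) (b₁', b₂)))
    (hr : ∀ a b₁ b₂ b₂', Dinat f ((insertRight B₂ b₁).map b₂ b₂' ≫
      (insertRight (B₁ × B₂) a).map (b₁, b₂) (b₁, b₂'))) (d d' : A × (B₁ × B₂)) :
    G.post e d d' ▷ F.obj d' c ≫ f d' =
      (α_ _ _ _).hom ≫ G.obj e d ◁ F.pre d d' c ≫ f d := by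
  refine dinat_prod f hl (fun a b b' => ?_) d d'
  have h := (hm a b.1 b'.1 b.2).comp (hr a b'.1 b.2 b'.2)
  have h1 := insertLeft_tensor_insertRight_eComp (V := V) b.1 b'.1 b.2 b'.2
  have h2 := (insertRight (V := V) (B₁ × B₂) a).map_comp (b.1, b.2) (b'.1, b.2) (b'.1, b'.2)
  have h3 : (((insertLeft (V := V) B₁ b.2).map b.1 b'.1 ≫
      (insertRight (B₁ × B₂) a).map (b.1, b.2) (b'.1, b.2)) ⊗ₘ
      ((insertRight (V := V) B₂ b'.1).map b.2 b'.2 ≫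
      (insertRight (B₁ × B₂) a).map (b'.1, b.2) (b'.1, b'.2))) ≫ eComp V (a, b) (a, (b'.1,
          b.2)) (a, b') =
      (insertRight (V := V) (B₁ × B₂) a).map b b' := by
    rw [← tensorHom_comp_tensorHom, Category.assoc]
    refine (congrArg (fun t => _ ≫ t) h2.symm).trans ?_
    rw [← Category.assoc]
    refine (congrArg (fun t => t ≫ _) h1).trans ?_
    exact Category.id_comp _
  exact h3 ▸ h

end VProf

end

end LaxModuleProf

namespace LaxModuleProf

noncomputable section

set_option linter.unusedSectionVars false

open VProf

/-! ### Convolution is the transpose of composition -/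

namespace VProf

lemma precomp_right_action {V : Type u} [Category.{v} V] [MonoidalCategory V]
    [SymmetricCategory V] {X B I P Q Q' : V} (l : X ⟶ B) (i : B ⟶ I) (p : I ⊗ (P ⊗ Q') ⟶ P ⊗ Q)
    (g : B ⊗ Q' ⟶ Q) (h : i ▷ (P ⊗ Q') ≫ p =
      (α_ _ _ _).inv ≫ (β_ _ _).hom ▷ _ ≫ (α_ _ _ _).hom ≫ P ◁ g) :
    (l ≫ i) ▷ (P ⊗ Q') ≫ p =
      (α_ _ _ _).inv ≫ (β_ _ _).hom ▷ _ ≫ (α_ _ _ _).hom ≫ P ◁ (l ▷ Q' ≫ g) := by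
  rw [comp_whiskerRight, Category.assoc, h, associator_inv_naturality_left_assoc,
    ← comp_whiskerRight_assoc, BraidedCategory.braiding_naturality_left, comp_whiskerRight_assoc,
    associator_naturality_middle_assoc, ← MonoidalCategory.whiskerLeft_comp]

variable {V : Type u} [Category.{v} V] [MonoidalCategory V] [SymmetricCategory V]
  [MonoidalClosed V] [HasColimits V]
  {M : Type v} [Category.{v} M] [EnrichedOrdinaryCategory V M]

/-- The external tensor product of two profunctors with trivial domain. -/
abbrev extTens (P Q : VProf V PUnit.{v + 1} (Mᵒᵖ × M)) :
    VProf V PUnit.{v + 1} ((Mᵒᵖ × M) × (Mᵒᵖ × M)) :=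
  (tens P Q).restrict (EnrichedFunctor.id V ((Mᵒᵖ × M) × (Mᵒᵖ × M)))
    (unitInvFunctor V PUnit.{v + 1})

lemma extTens_pre (P Q : VProf V PUnit.{v + 1} (Mᵒᵖ × M)) (z z' : (Mᵒᵖ × M) × (Mᵒᵖ × M)) :
    (extTens P Q).pre z z' PUnit.unit = (tens P Q).pre z z' (PUnit.unit, PUnit.unit) :=
  (congrArg (fun t => t ≫ _) (id_whiskerRight _ _)).trans (Category.id_comp _)

lemma extTens_pre_fst (P Q : VProf V PUnit.{v + 1} (Mᵒᵖ × M)) (a a' b : Mᵒᵖ × M) :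
    (insertLeft (Mᵒᵖ × M) b).map a a' ▷ (P.obj a' PUnit.unit ⊗ Q.obj b PUnit.unit) ≫
        (extTens P Q).pre (a, b) (a', b) PUnit.unit =
      (α_ _ _ _).inv ≫ P.pre a a' PUnit.unit ▷ _ := by
  rw [extTens_pre]
  exact tens_preFst P Q a a' b (PUnit.unit, PUnit.unit)

lemma extTens_pre_snd (P Q : VProf V PUnit.{v + 1} (Mᵒᵖ × M)) (a b b' : Mᵒᵖ × M) {X : V}
    (l : X ⟶ (b ⟶[V] b')) :
    (l ≫ (insertRight (Mᵒᵖ × M) a).map b b') ▷ (P.obj a PUnit.unit ⊗ Q.obj b' PUnit.unit) ≫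
        (extTens P Q).pre (a, b) (a, b') PUnit.unit =
      (α_ _ _ _).inv ≫ (β_ _ _).hom ▷ _ ≫ (α_ _ _ _).hom ≫
        _ ◁ (l ▷ Q.obj b' PUnit.unit ≫ Q.pre b b' PUnit.unit) := by
  rw [extTens_pre]
  exact precomp_right_action l _ _ _ (tens_preSnd P Q a b b' (PUnit.unit, PUnit.unit))

variable (P Q : VProf V PUnit.{v + 1} (Mᵒᵖ × M))

/-- The maps from the convolution to the composite of the transposes. -/
def convLeg (m : Mᵒᵖ × M) (z : (Mᵒᵖ × M) × (Mᵒᵖ × M)) :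
    mulObj V m z.1 z.2 ⊗ (P.obj z.1 PUnit.unit ⊗ Q.obj z.2 PUnit.unit) ⟶
      (comp (unheart Q) (unheart P)).obj m.2 m.1.unop :=
  tensorμ _ _ _ _ ≫ (P.pre (m.1, z.2.1.unop) z.1 PUnit.unit ⊗ₘ
    Q.preSnd z.2.1 m.2 z.2.2 PUnit.unit) ≫ (β_ _ _).hom ≫
      j (unheart Q) (unheart P) m.2 z.2.1.unop m.1.unop

lemma preSnd_pre (p : Mᵒᵖ) (k k' : M) (a : Mᵒᵖ × M) :
    (k ⟶[V] k') ◁ P.pre (p, k') a PUnit.unit ≫ P.preSnd p k k' PUnit.unit =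
      (α_ _ _ _).inv ≫ ((α_ _ _ _).inv ≫ (β_ _ _).hom ▷ _ ≫ (α_ _ _ _).hom ≫
        (p ⟶[V] a.1) ◁ eComp V k k' a.2) ▷ _ ≫ P.pre (p, k) a PUnit.unit := by
  have h := action_comp_aux ((insertRight (V := V) M p).map k k') (𝟙 _) _ _ _ _
    (P.pre_comp (p, k) (p, k') a PUnit.unit)
  have h1 := insert_tensorμ_left (X := k ⟶[V] k') (T := k' ⟶[V] a.2) (eId V p)
    (eComp V p p a.1) (eComp V k k' a.2) (𝟙 _) (by rw [eId_whiskerRight_eComp, Category.comp_id])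
  rw [id_tensorHom] at h1
  rw [id_whiskerRight, Category.id_comp, tensorHom_id] at h
  refine h.trans ?_
  exact congrArg (fun t => _ ≫ t ▷ _ ≫ _) h1

lemma convLeg_dinat_fst (m a a' b : Mᵒᵖ × M) :
    Dinat (G := mulProf V M) (F := extTens P Q) (e := m) (c := PUnit.unit) (convLeg P Q m)
      ((insertLeft (Mᵒᵖ × M) b).map a a') := by
  have h := dinat_fst (eComp V (m.1, b.1.unop) a a') (P.pre a a' PUnit.unit)
    (P.pre (m.1, b.1.unop) a PUnit.unit) (P.pre (m.1, b.1.unop) a' PUnit.unit)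
    (P.pre_comp _ _ _ _) (Q.preSnd b.1 m.2 b.2 PUnit.unit)
  unfold Dinat
  refine (congrArg (fun t => t ▷ _ ≫ convLeg P Q m (a', b)) (mulProf_post_fst m a a' b)).trans ?_
  refine Eq.trans ?_ (congrArg (fun t => (α_ _ _ _).hom ≫ _ ◁ t ≫ convLeg P Q m (a, b))
    (extTens_pre_fst P Q a a' b)).symm
  have h' := congrArg (fun t => t ≫ (β_ _ _).hom ≫
      j (unheart Q) (unheart P) m.2 b.1.unop m.1.unop) h
  simp only [Category.assoc] at h'
  exact h'

lemma convLeg_dinat_mid (m a b : Mᵒᵖ × M) (q : Mᵒᵖ) :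
    Dinat (G := mulProf V M) (F := extTens P Q) (e := m) (c := PUnit.unit) (convLeg P Q m)
      ((insertLeft Mᵒᵖ b.2).map b.1 q ≫ (insertRight (Mᵒᵖ × M) a).map (b.1, b.2) (q, b.2)) := by
  have h := dinat_mid (P.pre (m.1, b.1.unop) a PUnit.unit) (P.preSnd m.1 q.unop b.1.unop PUnit.unit)
    (P.pre (m.1, q.unop) a PUnit.unit) (eComp V q.unop b.1.unop a.2)
    (preSnd_pre P m.1 q.unop b.1.unop a)
    (Q.preFst b.1 q b.2 PUnit.unit) (Q.preSnd b.1 m.2 b.2 PUnit.unit)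
    (Q.preSnd q m.2 b.2 PUnit.unit) (Q.preFst b.1 q m.2 PUnit.unit)
    (preFst_preSnd Q _ _ _ _ _) _ _ (j_dinat (unheart Q) (unheart P) m.2 q.unop b.1.unop m.1.unop)
  unfold Dinat
  refine (congrArg (fun t => t ▷ _ ≫ convLeg P Q m (a, (q,
      b.2))) (mulProf_post_mid m a b q)).trans ?_
  refine Eq.trans ?_ (congrArg (fun t => (α_ _ _ _).hom ≫ _ ◁ t ≫ convLeg P Q m (a, b))
    (extTens_pre_snd P Q a b (q, b.2) ((insertLeft Mᵒᵖ b.2).map b.1 q))).symm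
  exact h

lemma convLeg_dinat_snd (m a b : Mᵒᵖ × M) (n : M) :
    Dinat (G := mulProf V M) (F := extTens P Q) (e := m) (c := PUnit.unit) (convLeg P Q m)
      ((insertRight M b.1).map b.2 n ≫ (insertRight (Mᵒᵖ × M) a).map (b.1, b.2) (b.1, n)) := by
  have h := dinat_snd (eComp V m.2 b.2 n) (Q.preSnd b.1 b.2 n PUnit.unit)
    (Q.preSnd b.1 m.2 b.2 PUnit.unit) (Q.preSnd b.1 m.2 n PUnit.unit)
    ((unheart Q).pre_comp m.2 b.2 n b.1.unop) (P.pre (m.1, b.1.unop) a PUnit.unit)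
  unfold Dinat
  refine (congrArg (fun t => t ▷ _ ≫ convLeg P Q m (a, (b.1,
      n))) (mulProf_post_snd m a b n)).trans ?_
  refine Eq.trans ?_ (congrArg (fun t => (α_ _ _ _).hom ≫ _ ◁ t ≫ convLeg P Q m (a, b))
    (extTens_pre_snd P Q a b (b.1, n) ((insertRight M b.1).map b.2 n))).symm
  have h' := congrArg (fun t => t ≫ (β_ _ _).hom ≫
      j (unheart Q) (unheart P) m.2 b.1.unop m.1.unop) h
  simp only [Category.assoc] at h'
  exact h'

/-- The components of the map from the convolution to the composite of the transposes. -/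
def convHomApp (m : Mᵒᵖ × M) :
    (conv P Q).obj m PUnit.unit ⟶ (comp (unheart Q) (unheart P)).obj m.2 m.1.unop :=
  desc (G := mulProf V M) (F := extTens P Q) (convLeg P Q m)
    (dinat_prod_prod _ (fun a a' b => convLeg_dinat_fst P Q m a a' b)
      (fun a b₁ b₁' b₂ => convLeg_dinat_mid P Q m a (b₁, b₂) b₁')
      (fun a b₁ b₂ b₂' => convLeg_dinat_snd P Q m a (b₁, b₂) b₂'))

/-- The coprojections of the convolution. -/
def convJ (m : Mᵒᵖ × M) (z : (Mᵒᵖ × M) × (Mᵒᵖ × M)) :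
    mulObj V m z.1 z.2 ⊗ (P.obj z.1 PUnit.unit ⊗ Q.obj z.2 PUnit.unit) ⟶
      (conv P Q).obj m PUnit.unit :=
  j (mulProf V M) (extTens P Q) m z PUnit.unit

lemma convJ_convHomApp (m : Mᵒᵖ × M) (z : (Mᵒᵖ × M) × (Mᵒᵖ × M)) :
    convJ P Q m z ≫ convHomApp P Q m = convLeg P Q m z :=
  j_desc _ _ _

end VProf

end

end LaxModuleProf

namespace LaxModuleProf

noncomputable section

set_option linter.unusedSectionVars false

open VProf

section SymmetricCoherence

variable {V : Type u} [Category.{v} V] [MonoidalCategory V] [SymmetricCategory V]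
variable {A A' B C C' G G' P P' Q Q' X Y P₀ P₁ Q₀ Q₁ Z Z₀ Z₁ : V}

lemma conv_fst_equivariant (c : X ⊗ A ⟶ A') (p : (A ⊗ B) ⊗ P ⟶ P₁) (p' : (A' ⊗ B) ⊗ P ⟶ P₀)
    (w : X ⊗ P₁ ⟶ P₀)
    (hw : X ◁ p ≫ w = (α_ _ _ _).inv ≫ ((α_ _ _ _).inv ≫ c ▷ B) ▷ P ≫ p')
    (r : C ⊗ Q ⟶ Q₁) (i₁ : Q₁ ⊗ P₁ ⟶ Z₁) (i₀ : Q₁ ⊗ P₀ ⟶ Z₀) (a : Z₁ ⊗ X ⟶ Z₀)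
    (ha : i₁ ▷ X ≫ a = (α_ _ _ _).hom ≫ Q₁ ◁ ((β_ _ _).hom ≫ w) ≫ i₀) :
    (α_ _ _ _).inv ≫ ((α_ _ _ _).inv ≫ ((α_ _ _ _).inv ≫ c ▷ B) ▷ C) ▷ (P ⊗ Q) ≫
        tensorμ _ _ _ _ ≫ (p' ⊗ₘ r) ≫ (β_ _ _).hom ≫ i₀ =
      X ◁ (tensorμ _ _ _ _ ≫ (p ⊗ₘ r) ≫ (β_ _ _).hom ≫ i₁) ≫ (β_ _ _).hom ≫ a := by
  have c1 : X ◁ (β_ P₁ Q₁).hom ≫ (β_ X (Q₁ ⊗ P₁)).hom ≫ (α_ _ _ _).hom ≫ Q₁ ◁ (β_ P₁ X).hom =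
      (α_ _ _ _).inv ≫ (β_ (X ⊗ P₁) Q₁).hom := by
    rw [BraidedCategory.braiding_tensor_left_hom, BraidedCategory.braiding_tensor_right_hom]
    simp [← MonoidalCategory.whiskerLeft_comp]
  have n := tensorμ_natural_left ((α_ X A B).inv ≫ c ▷ B) (𝟙 C) P Q
  rw [tensorHom_id, id_whiskerRight, tensorHom_id] at n
  have c2 : X ◁ tensorμ (A ⊗ B) C P Q ≫ (α_ _ _ _).inv ≫ (α_ _ _ _).inv ▷ (C ⊗ Q) =
      (α_ _ _ _).inv ≫ (α_ _ _ _).inv ▷ (P ⊗ Q) ≫ tensorμ (X ⊗ (A ⊗ B)) C P Q := by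
    simp [tensorμ]
    monoidal
  have e : (α_ X P₁ Q₁).inv ≫ w ▷ Q₁ ≫ (β_ P₀ Q₁).hom = X ◁ (β_ P₁ Q₁).hom ≫
      (β_ X (Q₁ ⊗ P₁)).hom ≫ (α_ _ _ _).hom ≫ Q₁ ◁ (β_ P₁ X).hom ≫ Q₁ ◁ w := by
    rw [reassoc_of% c1, BraidedCategory.braiding_naturality_left]
  rw [MonoidalCategory.whiskerLeft_comp, MonoidalCategory.whiskerLeft_comp,
    MonoidalCategory.whiskerLeft_comp]
  simp only [Category.assoc]
  rw [BraidedCategory.braiding_naturality_right_assoc, ha, MonoidalCategory.whiskerLeft_comp Q₁]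
  simp only [Category.assoc]
  have e2 : X ◁ (p ⊗ₘ r) ≫ (α_ _ _ _).inv ≫ w ▷ Q₁ = (α_ _ _ _).inv ≫ (α_ _ _ _).inv ▷ (C ⊗ Q) ≫
      ((α_ _ _ _).inv ≫ c ▷ B) ▷ P ▷ (C ⊗ Q) ≫ (p' ⊗ₘ r) := by
    rw [whiskerRight_comp_tensorHom, whiskerRight_comp_tensorHom, ← hw, ← id_tensorHom,
      associator_inv_naturality_assoc, id_tensorHom, tensorHom_comp_whiskerRight]
  rw [← reassoc_of% e, reassoc_of% e2, reassoc_of% c2, ← reassoc_of% n,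
    comp_whiskerRight (α_ _ _ _).inv, Category.assoc]

lemma conv_snd_equivariant (c : Y ⊗ C ⟶ C') (r : C ⊗ Q ⟶ Q₁) (r' : C' ⊗ Q ⟶ Q₀) (w : Y ⊗ Q₁ ⟶ Q₀)
    (hw : Y ◁ r ≫ w = (α_ _ _ _).inv ≫ c ▷ Q ≫ r') (p : G ⊗ P ⟶ P₁)
    (i₁ : Q₁ ⊗ P₁ ⟶ Z₁) (i₀ : Q₀ ⊗ P₁ ⟶ Z₀) (a : Y ⊗ Z₁ ⟶ Z₀)
    (ha : Y ◁ i₁ ≫ a = (α_ _ _ _).inv ≫ w ▷ P₁ ≫ i₀) :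
    (α_ _ _ _).inv ≫ ((α_ _ _ _).inv ≫ (β_ _ _).hom ▷ C ≫ (α_ _ _ _).hom ≫ G ◁ c) ▷ (P ⊗ Q) ≫
        tensorμ _ _ _ _ ≫ (p ⊗ₘ r') ≫ (β_ _ _).hom ≫ i₀ =
      Y ◁ (tensorμ _ _ _ _ ≫ (p ⊗ₘ r) ≫ (β_ _ _).hom ≫ i₁) ≫ a := by
  have n := tensorμ_natural_left (𝟙 G) c P Q
  rw [id_tensorHom, id_whiskerRight, id_tensorHom] at n
  have c1 : Y ◁ (β_ P₁ Q₁).hom ≫ (α_ _ _ _).inv =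
      (α_ _ _ _).inv ≫ (β_ Y P₁).hom ▷ Q₁ ≫ (α_ _ _ _).hom ≫ (β_ P₁ (Y ⊗ Q₁)).hom := by
    rw [BraidedCategory.braiding_tensor_right_hom, Iso.hom_inv_id_assoc, ← comp_whiskerRight_assoc]
    simp
  have c2 : Y ◁ tensorμ G C P Q ≫ (α_ _ _ _).inv ≫ (β_ Y (G ⊗ P)).hom ▷ (C ⊗ Q) ≫
      (α_ _ _ _).hom ≫ (G ⊗ P) ◁ (α_ _ _ _).inv =
      (α_ _ _ _).inv ≫ ((α_ _ _ _).inv ≫ (β_ Y G).hom ▷ C ≫ (α_ _ _ _).hom) ▷ (P ⊗ Q) ≫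
        tensorμ G (Y ⊗ C) P Q := by
    have h := whisker_exchange (β_ Y G).hom ((α_ C P Q).inv ≫ (β_ C P).hom ▷ Q ≫ (α_ P C Q).hom)
    have h' := congrArg (fun t => Y ◁ (α_ G C (P ⊗ Q)).hom ≫ (α_ _ _ _).inv ≫ t ≫ (α_ _ _ _).hom ≫
      G ◁ ((α_ _ _ _).inv ≫ (β_ Y P).hom ▷ (C ⊗ Q) ≫ (α_ _ _ _).hom ≫ P ◁ (α_ _ _ _).inv) ≫
      (α_ _ _ _).inv) h
    refine Eq.trans ?_ (h'.trans ?_)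
    · rw [BraidedCategory.braiding_tensor_right_hom]
      simp [tensorμ]
      monoidal
    · rw [tensorμ, BraidedCategory.braiding_tensor_left_hom]
      simp
      monoidal
  simp only [MonoidalCategory.whiskerLeft_comp _ (tensorμ _ _ _ _),
    MonoidalCategory.whiskerLeft_comp _ (p ⊗ₘ r), MonoidalCategory.whiskerLeft_comp _ (β_ _ _).hom,
    Category.assoc]
  have e2 : Y ◁ (p ⊗ₘ r) ≫ (α_ _ _ _).inv ≫ (β_ Y P₁).hom ▷ Q₁ ≫ (α_ _ _ _).hom ≫ P₁ ◁ w =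
      (α_ _ _ _).inv ≫ (β_ Y (G ⊗ P)).hom ▷ (C ⊗ Q) ≫ (α_ _ _ _).hom ≫
        (G ⊗ P) ◁ (α_ _ _ _).inv ≫ (G ⊗ P) ◁ c ▷ Q ≫ (p ⊗ₘ r') := by
    rw [whiskerLeft_comp_tensorHom, whiskerLeft_comp_tensorHom, ← hw, ← tensorHom_comp_whiskerLeft,
      ← id_tensorHom Y, ← id_tensorHom Y, ← associator_naturality_assoc,
      associator_inv_naturality_assoc, tensorHom_comp_whiskerRight_assoc,
      BraidedCategory.braiding_naturality, whiskerRight_comp_tensorHom_assoc]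
  rw [ha, reassoc_of% c1, ← BraidedCategory.braiding_naturality_right_assoc, reassoc_of% e2,
    reassoc_of% c2, ← reassoc_of% n]
  simp only [comp_whiskerRight, Category.assoc]

lemma conv_reduce {κ₂ : (G' ⊗ C') ⊗ (P' ⊗ Q') ⟶ Z} {κ₁ : (G' ⊗ C) ⊗ (P' ⊗ Q) ⟶ Z}
    {κ₀ : (G ⊗ C) ⊗ (P ⊗ Q) ⟶ Z} (c : C ⊗ C' ⟶ C') (g : G ⊗ G' ⟶ G') (p : G' ⊗ P' ⟶ P)
    (q : C' ⊗ Q' ⟶ Q) (i : 𝟙_ V ⟶ G) (k : 𝟙_ V ⟶ C) (hi : i ▷ G' ≫ g = (λ_ G').hom)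
    (hk : k ▷ C' ≫ c = (λ_ C').hom)
    (h₂ : ((α_ G' C C').hom ≫ G' ◁ c) ▷ (P' ⊗ Q') ≫ κ₂ =
      (α_ _ _ _).hom ≫ _ ◁ ((α_ _ _ _).inv ≫ (β_ _ _).hom ▷ Q' ≫ (α_ _ _ _).hom ≫ P' ◁ q) ≫ κ₁)
    (h₁ : ((α_ G C G').hom ≫ G ◁ (β_ C G').hom ≫ (α_ _ _ _).inv ≫ g ▷ C) ▷ (P' ⊗ Q) ≫ κ₁ =
      (α_ _ _ _).hom ≫ _ ◁ ((α_ _ _ _).inv ≫ p ▷ Q) ≫ κ₀) :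
    κ₂ = tensorμ _ _ _ _ ≫ (p ⊗ₘ q) ≫ (λ_ (P ⊗ Q)).inv ≫
      ((λ_ (𝟙_ V)).inv ≫ (i ⊗ₘ k)) ▷ (P ⊗ Q) ≫ κ₀ := by
  have a₂ : κ₂ = (α_ _ _ _).hom ≫ G' ◁ ((α_ _ _ _).inv ≫ (β_ C' P').hom ▷ Q' ≫ (α_ _ _ _).hom ≫
      P' ◁ q) ≫ ((ρ_ G').inv ≫ G' ◁ k) ▷ (P' ⊗ Q) ≫ κ₁ := by
    have e : ((ρ_ G').inv ≫ G' ◁ k) ▷ C' ≫ (α_ G' C C').hom ≫ G' ◁ c = 𝟙 _ := by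
      rw [comp_whiskerRight, Category.assoc, associator_naturality_middle_assoc,
        ← MonoidalCategory.whiskerLeft_comp, hk]
      simp
    have h := congrArg (fun t => ((ρ_ G').inv ≫ G' ◁ k) ▷ C' ▷ (P' ⊗ Q') ≫ t) h₂
    rw [← comp_whiskerRight_assoc, e, id_whiskerRight, Category.id_comp,
      associator_naturality_left_assoc, ← whisker_exchange_assoc] at h
    exact h
  have a₁ : κ₁ = (β_ G' C).hom ▷ (P' ⊗ Q) ≫ (α_ _ _ _).hom ≫ C ◁ ((α_ _ _ _).inv ≫ p ▷ Q) ≫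
      ((λ_ C).inv ≫ i ▷ C) ▷ (P ⊗ Q) ≫ κ₀ := by
    have e : (β_ G' C).hom ≫ ((λ_ C).inv ≫ i ▷ C) ▷ G' ≫ (α_ G C G').hom ≫ G ◁ (β_ C G').hom ≫
        (α_ _ _ _).inv ≫ g ▷ C = 𝟙 _ := by
      rw [comp_whiskerRight, Category.assoc, associator_naturality_left_assoc,
        ← whisker_exchange_assoc, associator_inv_naturality_left_assoc, ← comp_whiskerRight, hi]
      simp
    have h := congrArg (fun t => ((β_ G' C).hom ≫ ((λ_ C).inv ≫ i ▷ C) ▷ G') ▷ (P' ⊗ Q) ≫ t) h₁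
    rw [← comp_whiskerRight_assoc, Category.assoc, e, id_whiskerRight, Category.id_comp,
      comp_whiskerRight, Category.assoc, associator_naturality_left_assoc,
      ← whisker_exchange_assoc] at h
    exact h
  have e1 : ((ρ_ G').inv ≫ G' ◁ k) ≫ (β_ G' C).hom = (λ_ G').inv ≫ k ▷ G' := by
    rw [Category.assoc, BraidedCategory.braiding_naturality_right]
    simp
  have e2 : k ≫ (λ_ C).inv ≫ i ▷ C = (λ_ (𝟙_ V)).inv ≫ (i ⊗ₘ k) := by
    rw [leftUnitor_inv_naturality_assoc, MonoidalCategory.tensorHom_def']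
  have e3 : tensorμ G' C' P' Q' ≫ (p ⊗ₘ q) = (α_ _ _ _).hom ≫ G' ◁ ((α_ _ _ _).inv ≫
      (β_ C' P').hom ▷ Q' ≫ (α_ _ _ _).hom ≫ P' ◁ q) ≫ (α_ _ _ _).inv ≫ p ▷ Q := by
    rw [MonoidalCategory.tensorHom_def', tensorμ]
    simp
  rw [a₂, a₁, ← comp_whiskerRight_assoc, e1, reassoc_of% e3, comp_whiskerRight, Category.assoc,
    associator_naturality_left_assoc, ← whisker_exchange_assoc, ← comp_whiskerRight_assoc, e2]
  simp
lemma conv_dinat_aux {U H' X K P Q Q' P₀ Z : V} (u : 𝟙_ V ⟶ U) (t : U ⊗ X ⟶ H')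
    (s : X ⊗ (P ⊗ Q') ⟶ P ⊗ Q) (κ' : H' ⊗ (P ⊗ Q') ⟶ Z) (κ : U ⊗ (P ⊗ Q) ⟶ Z)
    (m : H' ⊗ (P ⊗ Q') ⟶ P₀ ⊗ Q') (ι₀ : P₀ ⊗ Q' ⟶ Z) (l : X ⟶ K) (i : K ⟶ H') (p : K ⊗ P ⟶ P₀)
    (h : t ▷ (P ⊗ Q') ≫ κ' = (α_ _ _ _).hom ≫ U ◁ s ≫ κ) (h₁ : κ' = m ≫ ι₀)
    (h₂ : ((λ_ X).inv ≫ u ▷ X) ≫ t = l ≫ i)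
    (h₃ : i ▷ (P ⊗ Q') ≫ m = (α_ _ _ _).inv ≫ p ▷ Q') :
    (α_ _ _ _).inv ≫ (l ▷ P ≫ p) ▷ Q' ≫ ι₀ = s ≫ (λ_ _).inv ≫ u ▷ _ ≫ κ := by
  have h4 := congrArg (fun t => ((λ_ X).inv ≫ u ▷ X) ▷ (P ⊗ Q') ≫ t) h
  rw [← comp_whiskerRight_assoc, h₂, h₁, comp_whiskerRight, Category.assoc, reassoc_of% h₃,
    comp_whiskerRight, Category.assoc, associator_naturality_left_assoc,
    ← whisker_exchange_assoc] at h4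
  rw [comp_whiskerRight, Category.assoc, ← associator_inv_naturality_left_assoc, h4,
    leftUnitor_inv_naturality_assoc]
  simp

lemma insert_units_braiding {W C X : V} (w : 𝟙_ V ⟶ W) (c : 𝟙_ V ⟶ C) :
    ((λ_ X).inv ≫ ((λ_ (𝟙_ V)).inv ≫ (w ⊗ₘ c)) ▷ X) ≫ (α_ _ _ _).hom ≫ W ◁ (β_ C X).hom ≫
        (α_ _ _ _).inv =
      ((λ_ X).inv ≫ w ▷ X) ≫ (ρ_ _).inv ≫ (W ⊗ X) ◁ c := by
  rw [MonoidalCategory.tensorHom_def, comp_whiskerRight, comp_whiskerRight]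
  simp only [Category.assoc]
  rw [associator_naturality_middle_assoc, ← MonoidalCategory.whiskerLeft_comp_assoc,
    BraidedCategory.braiding_naturality_left, MonoidalCategory.whiskerLeft_comp_assoc,
    braiding_tensorUnit_left]
  simp only [MonoidalCategory.whiskerLeft_comp, Category.assoc]
  monoidal

lemma insert_units_mid {A B C X : V} (a : 𝟙_ V ⟶ A) (b : 𝟙_ V ⟶ B) (c : 𝟙_ V ⟶ C) (e : X ⊗ B ⟶ X)
    (he : X ◁ b ≫ e = (ρ_ X).hom) :
    ((λ_ X).inv ≫ ((λ_ (𝟙_ V)).inv ≫ (((λ_ (𝟙_ V)).inv ≫ (a ⊗ₘ b)) ⊗ₘ c)) ▷ X) ≫ (α_ _ _ _).hom ≫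
        (A ⊗ B) ◁ (β_ C X).hom ≫ (α_ _ _ _).inv ≫ ((α_ _ _ _).hom ≫ A ◁ ((β_ B X).hom ≫ e)) ▷ C =
      ((λ_ X).inv ≫ a ▷ X) ≫ (ρ_ _).inv ≫ (A ⊗ X) ◁ c := by
  have h1 := insert_units_braiding (X := X) ((λ_ (𝟙_ V)).inv ≫ (a ⊗ₘ b)) c
  have h2 := insert_units_braiding (X := X) a b
  have h3 : ((λ_ X).inv ≫ ((λ_ (𝟙_ V)).inv ≫ (a ⊗ₘ b)) ▷ X) ≫ (α_ _ _ _).hom ≫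
      A ◁ ((β_ B X).hom ≫ e) = (λ_ X).inv ≫ a ▷ X := by
    have h4 := congrArg (fun t => t ≫ (α_ _ _ _).hom ≫ A ◁ e) h2
    simp only [Category.assoc, Iso.inv_hom_id_assoc] at h4
    simp only [MonoidalCategory.whiskerLeft_comp, Category.assoc]
    rw [h4, associator_naturality_right_assoc, ← MonoidalCategory.whiskerLeft_comp, he]
    simp
  simp only [Category.assoc] at h1 h3 ⊢
  rw [reassoc_of% h1, whisker_exchange, ← rightUnitor_inv_naturality_assoc, Category.assoc,
    reassoc_of% h3]

end SymmetricCoherence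

namespace VProf

variable {V : Type u} [Category.{v} V] [MonoidalCategory V] [SymmetricCategory V]
  [MonoidalClosed V] [HasColimits V]
  {M : Type v} [Category.{v} M] [EnrichedOrdinaryCategory V M]
  (P Q : VProf V PUnit.{v + 1} (Mᵒᵖ × M))

/-- The three identities inserted in the coprojections of the convolution. -/
def mulUnit (V : Type u) [Category.{v} V] [MonoidalCategory V] [SymmetricCategory V]
    {M : Type v} [Category.{v} M] [EnrichedOrdinaryCategory V M] (m : Mᵒᵖ × M) (k : M) :
    𝟙_ V ⟶ mulObj V m (m.1, k) (Opposite.op k, m.2) :=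
  (λ_ (𝟙_ V)).inv ≫ (eId V (m.1, k) ⊗ₘ eId V m.2)

lemma convι_eq (m : Mᵒᵖ × M) (k : M) :
    convι P Q m k = (λ_ _).inv ≫ mulUnit V m k ▷ _ ≫ convJ P Q m ((m.1, k), (Opposite.op k, m.2)) :=
  rfl

lemma mulUnit_action (m : Mᵒᵖ × M) (k : M) :
    (λ_ _).inv ≫ mulUnit V m k ▷ _ ≫ tensorμ _ _ _ _ ≫ (P.pre (m.1, k) (m.1, k) PUnit.unit ⊗ₘ
      Q.preSnd (Opposite.op k) m.2 m.2 PUnit.unit) = 𝟙 _ := by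
  have h1 := P.pre_id (m.1, k) PUnit.unit
  have h2 := (unheart Q).pre_id m.2 k
  have h3 := tensor_left_unitality (C := V) (P.obj (m.1, k) PUnit.unit)
    (Q.obj (Opposite.op k, m.2) PUnit.unit)
  rw [mulUnit, comp_whiskerRight, Category.assoc, tensorμ_natural_left_assoc,
    tensorHom_comp_tensorHom, h1, h2, ← h3, Iso.inv_hom_id]

lemma convι_convHomApp (m : Mᵒᵖ × M) (k : M) :
    convι P Q m k ≫ convHomApp P Q m = (β_ _ _).hom ≫ j (unheart Q) (unheart P) m.2 k m.1.unop := by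
  have h := congrArg (fun t => t ≫ (β_ _ _).hom ≫ j (unheart Q) (unheart P) m.2 k m.1.unop)
    (mulUnit_action P Q m k)
  rw [convι_eq, Category.assoc, Category.assoc, convJ_convHomApp]
  simp only [Category.assoc, Category.id_comp] at h
  exact h

lemma dinat_j {C D E : Type v} [EnrichedCategory V C] [EnrichedCategory V D] [EnrichedCategory V E]
    (G : VProf V D E) (F : VProf V C D) (e : E) (c : C) {d d' : D} {X : V} (l : X ⟶ (d ⟶[V] d')) :
    Dinat (fun d => j G F e d c) l := by
  rw [Dinat, comp_whiskerRight, Category.assoc, j_dinat, associator_naturality_middle_assoc,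
    MonoidalCategory.whiskerLeft_comp, Category.assoc]

lemma convJ_dinat (m : Mᵒᵖ × M) (z z' : (Mᵒᵖ × M) × (Mᵒᵖ × M)) {X : V} (l : X ⟶ (z ⟶[V] z')) :
    (mulObj V m z.1 z.2 ◁ l ≫ (mulProf V M).post m z z') ▷ _ ≫ convJ P Q m z' =
      (α_ _ _ _).hom ≫ _ ◁ (l ▷ (P.obj z'.1 PUnit.unit ⊗ Q.obj z'.2 PUnit.unit) ≫
        (extTens P Q).pre z z' PUnit.unit) ≫ convJ P Q m z :=
  dinat_j (mulProf V M) (extTens P Q) m PUnit.unit l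

lemma convJ_dinat_fst (m a a' b : Mᵒᵖ × M) :
    ((α_ _ _ _).hom ≫ _ ◁ (β_ _ _).hom ≫ (α_ _ _ _).inv ≫
        eComp V (m.1, b.1.unop) a a' ▷ (m.2 ⟶[V] b.2)) ▷ _ ≫ convJ P Q m (a', b) =
      (α_ _ _ _).hom ≫ _ ◁ ((α_ _ _ _).inv ≫ P.pre a a' PUnit.unit ▷ _) ≫ convJ P Q m (a, b) := by
  have h := convJ_dinat P Q m (a, b) (a', b) ((insertLeft (Mᵒᵖ × M) b).map a a')
  refine ((congrArg (fun t => t ▷ _ ≫ convJ P Q m (a', b))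
    (mulProf_post_fst m a a' b)).symm.trans h).trans ?_
  exact congrArg (fun t => (α_ _ _ _).hom ≫ _ ◁ t ≫ convJ P Q m (a, b)) (extTens_pre_fst P Q a a' b)

lemma convJ_dinat_mid (m a b : Mᵒᵖ × M) (q : Mᵒᵖ) :
    ((α_ _ _ _).hom ≫ _ ◁ (β_ _ _).hom ≫ (α_ _ _ _).inv ≫
        ((α_ _ _ _).hom ≫ _ ◁ ((β_ _ _).hom ≫ eComp V q.unop b.1.unop a.2)) ▷
          (m.2 ⟶[V] b.2)) ▷ _ ≫ convJ P Q m (a, (q, b.2)) =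
      (α_ _ _ _).hom ≫ _ ◁ ((α_ _ _ _).inv ≫ (β_ _ _).hom ▷ _ ≫ (α_ _ _ _).hom ≫
        _ ◁ Q.preFst b.1 q b.2 PUnit.unit) ≫ convJ P Q m (a, b) := by
  have h := convJ_dinat P Q m (a, b) (a, (q, b.2)) ((insertLeft Mᵒᵖ b.2).map b.1 q ≫
    (insertRight (Mᵒᵖ × M) a).map (b.1, b.2) (q, b.2))
  refine ((congrArg (fun t => t ▷ _ ≫ convJ P Q m (a, (q, b.2)))
    (mulProf_post_mid m a b q)).symm.trans h).trans ?_
  exact congrArg (fun t => (α_ _ _ _).hom ≫ _ ◁ t ≫ convJ P Q m (a, b))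
    (extTens_pre_snd P Q a b (q, b.2) ((insertLeft Mᵒᵖ b.2).map b.1 q))

lemma convJ_dinat_snd (m a b : Mᵒᵖ × M) (n : M) :
    ((α_ _ _ _).hom ≫ _ ◁ eComp V m.2 b.2 n) ▷ _ ≫ convJ P Q m (a, (b.1, n)) =
      (α_ _ _ _).hom ≫ _ ◁ ((α_ _ _ _).inv ≫ (β_ _ _).hom ▷ _ ≫ (α_ _ _ _).hom ≫
        _ ◁ Q.preSnd b.1 b.2 n PUnit.unit) ≫ convJ P Q m (a, b) := by
  have h := convJ_dinat P Q m (a, b) (a, (b.1, n)) ((insertRight M b.1).map b.2 n ≫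
    (insertRight (Mᵒᵖ × M) a).map (b.1, b.2) (b.1, n))
  refine ((congrArg (fun t => t ▷ _ ≫ convJ P Q m (a, (b.1, n)))
    (mulProf_post_snd m a b n)).symm.trans h).trans ?_
  exact congrArg (fun t => (α_ _ _ _).hom ≫ _ ◁ t ≫ convJ P Q m (a, b))
    (extTens_pre_snd P Q a b (b.1, n) ((insertRight M b.1).map b.2 n))

lemma convJ_eq (m : Mᵒᵖ × M) (z : (Mᵒᵖ × M) × (Mᵒᵖ × M)) :
    convJ P Q m z = tensorμ _ _ _ _ ≫ (P.pre (m.1, z.2.1.unop) z.1 PUnit.unit ⊗ₘ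
      Q.preSnd z.2.1 m.2 z.2.2 PUnit.unit) ≫ convι P Q m z.2.1.unop :=
  conv_reduce (eComp V m.2 m.2 z.2.2) (eComp V (m.1, z.2.1.unop) (m.1, z.2.1.unop) z.1)
    (P.pre (m.1, z.2.1.unop) z.1 PUnit.unit) (Q.preSnd z.2.1 m.2 z.2.2 PUnit.unit)
    (eId V (m.1, z.2.1.unop)) (eId V m.2) (eId_whiskerRight_eComp V _ _)
    (eId_whiskerRight_eComp V _ _) (convJ_dinat_snd P Q m z.1 (z.2.1, m.2) z.2.2)
    (convJ_dinat_fst P Q m (m.1, z.2.1.unop) z.1 (z.2.1, m.2))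

lemma convι_ext {m : Mᵒᵖ × M} {Z : V} {f g : (conv P Q).obj m PUnit.unit ⟶ Z}
    (h : ∀ k, convι P Q m k ≫ f = convι P Q m k ≫ g) : f = g := by
  refine j_ext (G := mulProf V M) (F := extTens P Q) (fun z => ?_)
  have e := convJ_eq P Q m z
  refine (congrArg (fun t => t ≫ f) e).trans (Eq.trans ?_ (congrArg (fun t => t ≫ g) e).symm)
  simp only [Category.assoc, h]

lemma convι_dinat (m : Mᵒᵖ × M) (k k' : M) :
    (α_ _ _ _).inv ≫ P.preSnd m.1 k k' PUnit.unit ▷ _ ≫ convι P Q m k =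
      (α_ _ _ _).inv ≫ (β_ _ _).hom ▷ _ ≫ (α_ _ _ _).hom ≫
        _ ◁ Q.preFst (Opposite.op k') (Opposite.op k) m.2 PUnit.unit ≫ convι P Q m k' := by
  have h := convJ_dinat_mid P Q m (m.1, k') (Opposite.op k', m.2) (Opposite.op k)
  have h1 := convJ_eq P Q m ((m.1, k'), (Opposite.op k, m.2))
  have h2 := insert_units_mid (eId V m.1) (eId V k') (eId V m.2) (eComp V k k' k')
    (whiskerLeft_eId_eComp V k k')
  have h3 := insert_tensorμ_right (X := (m.1 ⟶[V] m.1) ⊗ (k ⟶[V] k'))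
    (G := P.obj (m.1, k') PUnit.unit) (T := Q.obj (Opposite.op k, m.2) PUnit.unit) (eId V m.2)
    (P.pre (m.1, k) (m.1, k') PUnit.unit) (Q.preSnd (Opposite.op k) m.2 m.2 PUnit.unit) (𝟙 _)
    (by rw [Category.comp_id]; exact (unheart Q).pre_id m.2 k)
  rw [tensorHom_id] at h3
  have h4 := conv_dinat_aux _ _ _ _ _ _ _ _ _ _ h (h1.trans (Category.assoc _ _ _).symm) h2 h3
  simp only [Category.assoc] at h4
  exact h4

end VProf

end

end LaxModuleProf

namespace LaxModuleProf

noncomputable section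

set_option linter.unusedSectionVars false

open VProf

namespace VProf

variable {V : Type u} [Category.{v} V] [MonoidalCategory V] [SymmetricCategory V]
  [MonoidalClosed V] [HasColimits V]

lemma j_pre_comp {C D E : Type v} [EnrichedCategory V C] [EnrichedCategory V D]
    [EnrichedCategory V E] (G : VProf V D E) (F : VProf V C D) {e e' : E} (d : D) (c : C) {X : V}
    (l : X ⟶ (e ⟶[V] e')) :
    X ◁ j G F e' d c ≫ l ▷ _ ≫ (comp G F).pre e e' c =
      (α_ _ _ _).inv ≫ (l ▷ _ ≫ G.pre e e' d) ▷ F.obj d c ≫ j G F e d c := by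
  rw [whisker_exchange_assoc, j_pre, comp_whiskerRight, Category.assoc,
    associator_inv_naturality_left_assoc]

lemma braiding_dinat {V : Type u} [Category.{v} V] [MonoidalCategory V] [SymmetricCategory V]
    {X P P' Q Q' Z : V} (s : X ⊗ P' ⟶ P) (f : X ⊗ Q ⟶ Q') (i : P ⊗ Q ⟶ Z) (i' : P' ⊗ Q' ⟶ Z)
    (h : (α_ _ _ _).inv ≫ s ▷ Q ≫ i =
      (α_ _ _ _).inv ≫ (β_ _ _).hom ▷ _ ≫ (α_ _ _ _).hom ≫ P' ◁ f ≫ i') :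
    ((β_ Q X).hom ≫ f) ▷ P' ≫ (β_ _ _).hom ≫ i' =
      (α_ _ _ _).hom ≫ Q ◁ s ≫ (β_ _ _).hom ≫ i := by
  have h' : s ▷ Q ≫ i = (β_ _ _).hom ▷ _ ≫ (α_ _ _ _).hom ≫ P' ◁ f ≫ i' := by
    rwa [cancel_epi] at h
  have c := braiding_braiding_assoc X Q P'
  rw [BraidedCategory.braiding_naturality_right_assoc, h', reassoc_of% c, Iso.hom_inv_id_assoc,
    comp_whiskerRight, Category.assoc, BraidedCategory.braiding_naturality_left_assoc]

variable {M : Type v} [Category.{v} M] [EnrichedOrdinaryCategory V M]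
  (P Q : VProf V PUnit.{v + 1} (Mᵒᵖ × M))

/-- The components of the map from the composite of the transposes to the convolution. -/
def convInvApp (m : Mᵒᵖ × M) :
    (comp (unheart Q) (unheart P)).obj m.2 m.1.unop ⟶ (conv P Q).obj m PUnit.unit :=
  desc (fun k => (β_ _ _).hom ≫ convι P Q m k)
    (fun k k' => braiding_dinat _ _ _ _ (convι_dinat P Q m k k'))

lemma j_convInvApp (m : Mᵒᵖ × M) (k : M) :
    j (unheart Q) (unheart P) m.2 k m.1.unop ≫ convInvApp P Q m =
      (β_ _ _).hom ≫ convι P Q m k :=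
  j_desc _ _ _

lemma preFst_pre (p q : Mᵒᵖ) (k : M) (a : Mᵒᵖ × M) :
    (p ⟶[V] q) ◁ P.pre (q, k) a PUnit.unit ≫ P.preFst p q k PUnit.unit =
      (α_ _ _ _).inv ≫ ((α_ _ _ _).inv ≫ eComp V p q a.1 ▷ (k ⟶[V] a.2)) ▷ _ ≫
        P.pre (p, k) a PUnit.unit := by
  have h := action_comp_aux ((insertLeft (V := V) Mᵒᵖ k).map p q) (𝟙 _) _ _ _ _
    (P.pre_comp (p, k) (q, k) a PUnit.unit)
  have h1 := insert_tensorμ_right (X := p ⟶[V] q) (T := k ⟶[V] a.2) (eId V k)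
    (eComp V p q a.1) (eComp V k k a.2) (𝟙 _) (by rw [eId_whiskerRight_eComp, Category.comp_id])
  rw [tensorHom_id] at h1
  rw [id_whiskerRight, Category.id_comp, tensorHom_id] at h
  refine h.trans ?_
  exact congrArg (fun t => _ ≫ t ▷ _ ≫ _) h1

lemma convJ_preFst (m : Mᵒᵖ × M) (p : Mᵒᵖ) (z : (Mᵒᵖ × M) × (Mᵒᵖ × M)) :
    (p ⟶[V] m.1) ◁ convJ P Q m z ≫ (conv P Q).preFst p m.1 m.2 PUnit.unit =
      (α_ _ _ _).inv ≫ ((α_ _ _ _).inv ≫ ((α_ _ _ _).inv ≫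
        eComp V p m.1 z.1.1 ▷ (z.2.1.unop ⟶[V] z.1.2)) ▷ (m.2 ⟶[V] z.2.2)) ▷ _ ≫
          convJ P Q (p, m.2) z := by
  have h := j_pre_comp (mulProf V M) (extTens P Q) (e := (p, m.2)) (e' := m) z PUnit.unit
    ((insertLeft Mᵒᵖ m.2).map p m.1)
  exact h.trans (congrArg (fun t => (α_ _ _ _).inv ≫ t ▷ _ ≫ convJ P Q (p, m.2) z)
    (mulProf_preFst m z.1 z.2 p))

lemma convJ_preSnd (m : Mᵒᵖ × M) (n : M) (z : (Mᵒᵖ × M) × (Mᵒᵖ × M)) :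
    (n ⟶[V] m.2) ◁ convJ P Q m z ≫ (conv P Q).preSnd m.1 n m.2 PUnit.unit =
      (α_ _ _ _).inv ≫ ((α_ _ _ _).inv ≫ (β_ _ _).hom ▷ _ ≫ (α_ _ _ _).hom ≫
        _ ◁ eComp V n m.2 z.2.2) ▷ _ ≫ convJ P Q (m.1, n) z := by
  have h := j_pre_comp (mulProf V M) (extTens P Q) (e := (m.1, n)) (e' := m) z PUnit.unit
    ((insertRight M m.1).map n m.2)
  exact h.trans (congrArg (fun t => (α_ _ _ _).inv ≫ t ▷ _ ≫ convJ P Q (m.1, n) z)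
    (mulProf_preSnd m z.1 z.2 n))

lemma convHomApp_preFst (m : Mᵒᵖ × M) (p : Mᵒᵖ) :
    (conv P Q).preFst p m.1 m.2 PUnit.unit ≫ convHomApp P Q (p, m.2) =
      _ ◁ convHomApp P Q m ≫
        (heart (comp (unheart Q) (unheart P))).preFst p m.1 m.2 PUnit.unit := by
  have h0 := heart_preFst (comp (unheart Q) (unheart P)) m.1.unop p.unop m.2
  refine whiskerLeft_j_ext (G := mulProf V M) (F := extTens P Q) (fun z => ?_)
  have h1 := congrArg (fun t => t ≫ convHomApp P Q (p, m.2)) (convJ_preFst P Q m p z)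
  simp only [Category.assoc, convJ_convHomApp] at h1
  have h2 := congrArg (fun t => (p ⟶[V] m.1) ◁ t) (convJ_convHomApp P Q m z)
  rw [MonoidalCategory.whiskerLeft_comp] at h2
  have h3 := congrArg (fun t => t ≫
      (heart (comp (unheart Q) (unheart P))).preFst p m.1 m.2 PUnit.unit) h2
  simp only [Category.assoc] at h3
  refine h1.trans (Eq.trans ?_ h3.symm)
  refine Eq.trans ?_ (congrArg (fun t => _ ◁ convLeg P Q m z ≫ t) h0).symm
  exact conv_fst_equivariant (eComp V p m.1 z.1.1) (P.pre (m.1, z.2.1.unop) z.1 PUnit.unit)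
    (P.pre (p, z.2.1.unop) z.1 PUnit.unit) (P.preFst p m.1 z.2.1.unop PUnit.unit)
    (preFst_pre P p m.1 z.2.1.unop z.1) (Q.preSnd z.2.1 m.2 z.2.2 PUnit.unit) _ _ _
    (j_post (unheart Q) (unheart P) m.2 z.2.1.unop m.1.unop p.unop)

lemma convHomApp_preSnd (m : Mᵒᵖ × M) (n : M) :
    (conv P Q).preSnd m.1 n m.2 PUnit.unit ≫ convHomApp P Q (m.1, n) =
      _ ◁ convHomApp P Q m ≫
        (heart (comp (unheart Q) (unheart P))).preSnd m.1 n m.2 PUnit.unit := by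
  have h0 := heart_preSnd (comp (unheart Q) (unheart P)) m.1.unop n m.2
  refine whiskerLeft_j_ext (G := mulProf V M) (F := extTens P Q) (fun z => ?_)
  have h1 := congrArg (fun t => t ≫ convHomApp P Q (m.1, n)) (convJ_preSnd P Q m n z)
  simp only [Category.assoc, convJ_convHomApp] at h1
  have h2 := congrArg (fun t => (n ⟶[V] m.2) ◁ t) (convJ_convHomApp P Q m z)
  rw [MonoidalCategory.whiskerLeft_comp] at h2
  have h3 := congrArg (fun t => t ≫
      (heart (comp (unheart Q) (unheart P))).preSnd m.1 n m.2 PUnit.unit) h2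
  simp only [Category.assoc] at h3
  refine h1.trans (Eq.trans ?_ h3.symm)
  refine Eq.trans ?_ (congrArg (fun t => _ ◁ convLeg P Q m z ≫ t) h0).symm
  exact conv_snd_equivariant (eComp V n m.2 z.2.2) (Q.preSnd z.2.1 m.2 z.2.2 PUnit.unit)
    (Q.preSnd z.2.1 n z.2.2 PUnit.unit) (Q.preSnd z.2.1 n m.2 PUnit.unit)
    (Iso.eq_inv_comp _ |>.2 ((unheart Q).pre_comp n m.2 z.2.2 z.2.1.unop).symm)
    (P.pre (m.1, z.2.1.unop) z.1 PUnit.unit) _ _ _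
    (j_pre (unheart Q) (unheart P) n m.2 z.2.1.unop m.1.unop)

/-- The map from the convolution to the transpose of the composite. -/
def convHom : conv P Q ⟶ heart (comp (unheart Q) (unheart P)) where
  app m _ := convHomApp P Q m
  pre_app p q _ := by
    have h := pre_app_comp (K := conv P Q) (L := heart (comp (unheart Q) (unheart P)))
      (c := PUnit.unit) (fun m => convHomApp P Q m)
      ((insertLeft (V := V) Mᵒᵖ p.2).map p.1 q.1)
      ((insertRight (V := V) M q.1).map p.2 q.2) (by
        have h := convHomApp_preFst P Q (q.1, p.2) p.1
        exact (Category.assoc _ _ _).symm.trans h) (by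
        have h := convHomApp_preSnd P Q q p.2
        exact (Category.assoc _ _ _).symm.trans h)
    have e := insertLeft_tensor_insertRight_eComp (V := V) p.1 q.1 p.2 q.2
    have e1 (t : (p ⟶[V] q) ⊗ (conv P Q).obj q PUnit.unit ⟶
        (heart (comp (unheart Q) (unheart P))).obj p PUnit.unit) :
        (((insertLeft (V := V) Mᵒᵖ p.2).map p.1 q.1 ⊗ₘ (insertRight (V := V) M q.1).map p.2 q.2) ≫
          eComp V (p.1, p.2) (q.1, p.2) (q.1, q.2)) ▷ (conv P Q).obj q PUnit.unit ≫ t = t :=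
      (congrArg (fun s => s ▷ (conv P Q).obj q PUnit.unit ≫ t) e).trans
        ((congrArg (fun s => s ≫ t) (id_whiskerRight _ _)).trans (Category.id_comp _))
    have e2 (t : (p ⟶[V] q) ⊗ (heart (comp (unheart Q) (unheart P))).obj q PUnit.unit ⟶
        (heart (comp (unheart Q) (unheart P))).obj p PUnit.unit) :
        (((insertLeft (V := V) Mᵒᵖ p.2).map p.1 q.1 ⊗ₘ (insertRight (V := V) M q.1).map p.2 q.2) ≫
          eComp V (p.1, p.2) (q.1, p.2) (q.1, q.2)) ▷
            (heart (comp (unheart Q) (unheart P))).obj q PUnit.unit ≫ t = t :=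
      (congrArg (fun s => s ▷ (heart (comp (unheart Q) (unheart P))).obj q PUnit.unit ≫ t) e).trans
        ((congrArg (fun s => s ≫ t) (id_whiskerRight _ _)).trans (Category.id_comp _))
    exact (e1 _).symm.trans (h.trans (congrArg (fun s => _ ◁ convHomApp P Q q ≫ s) (e2 _)))
  post_app m _ _ := by
    have h := post_punit (conv P Q) m
    exact (congrArg (fun t => t ≫ convHomApp P Q m) h).trans (rightUnitor_naturality _).symm

/-- The convolution is the transpose of the composite of the transposes. -/
def convIso : conv P Q ≅ heart (comp (unheart Q) (unheart P)) :=
  isoOfComponents (convHom P Q) (fun m _ => convInvApp P Q m)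
    (fun m _ => convι_ext P Q (fun k => by
      have h := congrArg (fun t => t ≫ convInvApp P Q m) (convι_convHomApp P Q m k)
      simp only [Category.assoc, j_convInvApp, SymmetricCategory.symmetry_assoc] at h
      exact h.trans (Category.comp_id _).symm))
    (fun m _ => j_ext (fun k => by
      have h := congrArg (fun t => t ≫ convHomApp P Q m) (j_convInvApp P Q m k)
      simp only [Category.assoc, convι_convHomApp, SymmetricCategory.symmetry_assoc] at h
      exact h.trans (Category.comp_id _).symm))

lemma convι_convIso_hom (m : Mᵒᵖ × M) (k : M) :
    convι P Q m k ≫ (convIso P Q).hom.app m PUnit.unit =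
      (β_ _ _).hom ≫ j (unheart Q) (unheart P) m.2 k m.1.unop :=
  convι_convHomApp P Q m k

end VProf

end

end LaxModuleProf

namespace LaxModuleProf

noncomputable section

set_option linter.unusedSectionVars false

open VProf

/-! ### The monoidal structure on modules over the probimonad -/

section RotateTensor

variable {V : Type u} [Category.{v} V] [MonoidalCategory V] [SymmetricCategory V]

lemma rotate_tensor (X₀ Y₀ G F : V) :
    rotate X₀ Y₀ (G ⊗ F) ≫ Y₀ ◁ ((β_ G F).hom ▷ X₀) ≫ Y₀ ◁ (α_ _ _ _).hom ≫ (α_ _ _ _).inv =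
      tensorμ X₀ Y₀ G F ≫ (β_ _ _).hom ≫ (Y₀ ⊗ F) ◁ (β_ X₀ G).hom := by
  have h1 : (β_ (X₀ ⊗ G) (Y₀ ⊗ F)).hom ≫ (Y₀ ⊗ F) ◁ (β_ X₀ G).hom =
      (α_ _ _ _).hom ≫ (β_ X₀ (G ⊗ (Y₀ ⊗ F))).hom ≫ (β_ G (Y₀ ⊗ F)).hom ▷ X₀ ≫ (α_ _ _ _).hom := by
    have h := braiding_braiding_assoc G X₀ (Y₀ ⊗ F)
    rw [← BraidedCategory.braiding_naturality_left, h, Iso.hom_inv_id_assoc]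
  have h2 : ((α_ Y₀ G F).inv ≫ (β_ Y₀ G).hom ▷ F ≫ (α_ _ _ _).hom) ≫ (β_ G (Y₀ ⊗ F)).hom =
      Y₀ ◁ (β_ G F).hom ≫ (α_ _ _ _).inv := by
    rw [BraidedCategory.braiding_tensor_right_hom]
    simp [← comp_whiskerRight_assoc]
  have h3 : X₀ ◁ ((α_ Y₀ G F).inv ≫ (β_ Y₀ G).hom ▷ F ≫ (α_ _ _ _).hom) ≫
      (β_ X₀ (G ⊗ (Y₀ ⊗ F))).hom ≫ (β_ G (Y₀ ⊗ F)).hom ▷ X₀ =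
      (β_ _ _).hom ≫ (Y₀ ◁ (β_ G F).hom ≫ (α_ _ _ _).inv) ▷ X₀ := by
    rw [BraidedCategory.braiding_naturality_right_assoc, ← comp_whiskerRight, h2]
  rw [h1, tensorμ]
  simp only [MonoidalCategory.whiskerLeft_comp, comp_whiskerRight, Category.assoc] at h3 ⊢
  simp only [Iso.inv_hom_id_assoc]
  rw [reassoc_of% h3, rotate]
  simp

lemma braiding_rotate_inverse (X Y F : V) :
    Y ◁ (β_ F X).hom ≫ (α_ _ _ _).inv ≫ (β_ Y X).hom ▷ F ≫ rotate X Y F = 𝟙 _ := by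
  rw [rotate, BraidedCategory.braiding_tensor_right_hom]
  simp [← comp_whiskerRight_assoc, ← MonoidalCategory.whiskerLeft_comp]

lemma idLeft_rotate {D : Type v} [EnrichedCategory V D] (d : D) (Y F : V) :
    idLeft V d Y ▷ F ≫ rotate _ _ _ = Y ◁ idRight V F d := by
  have h := rotate_naturality (eId V d) (𝟙 Y) (𝟙 F)
  rw [tensorHom_id, tensorHom_id, id_tensorHom, id_tensorHom] at h
  rw [idLeft, comp_whiskerRight, Category.assoc, h, idRight, MonoidalCategory.whiskerLeft_comp,
    rotate]
  simp

lemma idRight_rotate {D : Type v} [EnrichedCategory V D] (d : D) (X F : V) :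
    idRight V X d ▷ F ≫ rotate _ _ _ = (β_ X F).hom ≫ idLeft V d (F ⊗ X) := by
  have h := rotate_naturality (𝟙 X) (eId V d) (𝟙 F)
  have h1 : (ρ_ X).inv ▷ F ≫ rotate X (𝟙_ V) F = (β_ X F).hom ≫ (λ_ (F ⊗ X)).inv := by
    have h2 : (ρ_ X).inv ▷ F ≫ (α_ X (𝟙_ V) F).hom = X ◁ (λ_ F).inv := by monoidal
    rw [rotate, reassoc_of% h2, BraidedCategory.braiding_naturality_right_assoc]
    simp
  rw [tensorHom_id, id_tensorHom, id_tensorHom_id, tensorHom_id] at h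
  rw [idRight, comp_whiskerRight, Category.assoc, h, idLeft, reassoc_of% h1]

lemma braiding_natural {X Y X' Y' Z Z' : V} {f : X ⟶ X'} {g : Y ⟶ Y'} {t' : X' ⊗ Y' ⟶ Z'}
    {t : X ⊗ Y ⟶ Z} {w : Z ⟶ Z'} (h : (f ⊗ₘ g) ≫ t' = t ≫ w) :
    (g ⊗ₘ f) ≫ (β_ _ _).hom ≫ t' = ((β_ _ _).hom ≫ t) ≫ w := by
  rw [BraidedCategory.braiding_naturality_assoc, h, Category.assoc]

lemma braiding_associativity {X Y Z XY YZ XYZ W : V} {a : X ⊗ Y ⟶ XY} {b : XY ⊗ Z ⟶ XYZ}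
    {c : Y ⊗ Z ⟶ YZ} {d : X ⊗ YZ ⟶ W} {e : XYZ ⟶ W}
    (h : a ▷ Z ≫ b ≫ e = (α_ _ _ _).hom ≫ X ◁ c ≫ d) :
    Z ◁ ((β_ Y X).hom ≫ a) ≫ ((β_ _ _).hom ≫ b) ≫ e =
      (α_ _ _ _).inv ≫ ((β_ Z Y).hom ≫ c) ▷ X ≫ (β_ _ _).hom ≫ d := by
  have h1 := braiding_braiding_assoc Y Z X
  have h2 := BraidedCategory.braiding_naturality_left ((β_ Z Y).hom ≫ c) X
  rw [MonoidalCategory.whiskerLeft_comp, Category.assoc, Category.assoc,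
    BraidedCategory.braiding_naturality_right_assoc Z a, h,
    BraidedCategory.braiding_naturality_right_assoc, reassoc_of% h1, reassoc_of% h2,
    MonoidalCategory.whiskerLeft_comp_assoc, BraidedCategory.braiding_naturality_left_assoc]

lemma braiding_left_unit {X Z U T W : V} {i : U ⟶ X} {t : X ⊗ Z ⟶ T} {e : T ⟶ W} {p : U ⊗ Z ⟶ W}
    (h : i ▷ Z ≫ t ≫ e = p) : Z ◁ i ≫ ((β_ _ _).hom ≫ t) ≫ e = (β_ _ _).hom ≫ p := by
  rw [Category.assoc, BraidedCategory.braiding_naturality_right_assoc, h]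

lemma braiding_right_unit {X Z U T W : V} {i : U ⟶ Z} {t : X ⊗ Z ⟶ T} {e : T ⟶ W} {p : U ⊗ X ⟶ W}
    (h : X ◁ i ≫ t ≫ e = (β_ _ _).hom ≫ p) : i ▷ X ≫ ((β_ _ _).hom ≫ t) ≫ e = p := by
  rw [Category.assoc, BraidedCategory.braiding_naturality_left_assoc, h,
    SymmetricCategory.symmetry_assoc]

lemma whiskerLeft_rotate (X Y : V) {F G : V} (f : F ⟶ G) :
    (X ⊗ Y) ◁ f ≫ rotate X Y G = rotate X Y F ≫ Y ◁ (f ▷ X) := by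
  have h := rotate_naturality (𝟙 X) (𝟙 Y) f
  rwa [id_tensorHom_id, id_tensorHom, id_tensorHom, tensorHom_id] at h

lemma rotate_tensor_component {D : Type v} [EnrichedCategory V D] {d : D}
    {X₀ Y₀ F G F' G' T T' : V} {J : F ⊗ G ⟶ T} {J' : F' ⊗ G' ⟶ T'}
    {κ : Y₀ ⊗ (T ⊗ X₀) ⟶ T'} {κF : Y₀ ⊗ (F ⊗ (d ⟶[V] d)) ⟶ F'} {κG : (d ⟶[V] d) ⊗ (G ⊗ X₀) ⟶ G'}
    (h : Y₀ ◁ (J ▷ X₀) ≫ κ = Y₀ ◁ (α_ _ _ _).hom ≫ (α_ _ _ _).inv ≫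
      ((Y₀ ◁ idRight V F d ≫ κF) ⊗ₘ (idLeft V d (G ⊗ X₀) ≫ κG)) ≫ J') :
    (X₀ ⊗ Y₀) ◁ ((β_ G F).hom ≫ J) ≫ rotate _ _ _ ≫ κ =
      tensorμ _ _ _ _ ≫
        ((idRight V X₀ d ▷ G ≫ rotate _ _ _ ≫ κG) ⊗ₘ (idLeft V d Y₀ ▷ F ≫ rotate _ _ _ ≫ κF)) ≫
        (β_ _ _).hom ≫ J' := by
  have h1 := whiskerLeft_rotate X₀ Y₀ ((β_ G F).hom ≫ J)
  have h2 := idRight_rotate d X₀ G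
  have h3 := idLeft_rotate d Y₀ F
  have h4 := rotate_tensor X₀ Y₀ G F
  rw [reassoc_of% h1, comp_whiskerRight, MonoidalCategory.whiskerLeft_comp_assoc, h,
    reassoc_of% h4, reassoc_of% h2, reassoc_of% h3, BraidedCategory.braiding_naturality_assoc,
    whiskerLeft_comp_tensorHom_assoc]

lemma rotate_unit_component {X₀ Y₀ A B T T' K W Z : V} {i : A ⟶ T} {i' : Z ⟶ T'} {t : A ⟶ B}
    {κ : Y₀ ⊗ (T ⊗ X₀) ⟶ T'} {c₁ : B ⊗ X₀ ⟶ W} {c₂ : Y₀ ⊗ W ⟶ Z} {c₃ : Y₀ ⊗ B ⟶ K}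
    {c₄ : K ⊗ X₀ ⟶ Z} (hc : (α_ _ _ _).inv ≫ c₃ ▷ X₀ ≫ c₄ = Y₀ ◁ c₁ ≫ c₂)
    (h : Y₀ ◁ (i ▷ X₀) ≫ κ = Y₀ ◁ (t ▷ X₀ ≫ c₁) ≫ c₂ ≫ i') :
    (X₀ ⊗ Y₀) ◁ i ≫ rotate _ _ _ ≫ κ =
      (α_ _ _ _).hom ≫ X₀ ◁ (Y₀ ◁ t ≫ c₃) ≫ (β_ _ _).hom ≫ c₄ ≫ i' := by
  have h1 := whiskerLeft_rotate X₀ Y₀ i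
  rw [reassoc_of% h1, h, MonoidalCategory.whiskerLeft_comp_assoc, ← reassoc_of% hc,
    BraidedCategory.braiding_naturality_right_assoc, comp_whiskerRight_assoc, rotate]
  simp only [Category.assoc, associator_inv_naturality_middle_assoc, Iso.hom_inv_id_assoc]

lemma counit_action {X Y F G F' G' : V} {c c' : Y ⊗ (F ⊗ X) ⟶ F'} {t t₀ : F ⟶ G} {t' t₀' : F' ⟶ G'}
    {d : Y ⊗ (G ⊗ X) ⟶ G'} (ht : t = t₀) (ht' : t' = t₀') (hc : c = c')
    (h : c' ≫ t₀' = Y ◁ (t₀ ▷ X) ≫ d) :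
    c ≫ t' = Y ◁ (t ▷ X) ≫ Y ◁ (β_ G X).hom ≫ (α_ _ _ _).inv ≫ (β_ Y X).hom ▷ G ≫
      rotate X Y G ≫ d := by
  subst ht ht' hc
  have h1 := braiding_rotate_inverse X Y G
  rw [h, reassoc_of% h1]

lemma counit_tensor {F G F' G' T T' T'' : V} {t t₀ : F ⟶ F'} {s s₀ : G ⟶ G'} {j : F ⊗ G ⟶ T}
    {μ : T ⟶ T'} {c c₀ : T' ⟶ T''} {J : G' ⊗ F' ⟶ T''} {J' : F' ⊗ G' ⟶ T''} (ht : t = t₀)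
    (hs : s = s₀) (hc : c = c₀) (hJ : J = (β_ _ _).hom ≫ J')
    (h : j ≫ μ ≫ c₀ = (t₀ ⊗ₘ s₀) ≫ J') :
    j ≫ μ ≫ c = (t ⊗ₘ s) ≫ (β_ _ _).hom ≫ J := by
  subst ht hs hc hJ
  rw [h, SymmetricCategory.symmetry_assoc]

lemma counit_unit {A B T T' : V} {u : A ⟶ B} {ε : B ⟶ T} {c c₀ : T ⟶ T'} {U U' : A ⟶ T'}
    (hc : c = c₀) (hU : U = U') (h : u ≫ ε ≫ c₀ = U') : u ≫ ε ≫ c = U := by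
  rw [hc, hU, h]

end RotateTensor

variable {V : Type u} [Category.{v} V] [MonoidalCategory V] [SymmetricCategory V]
  [MonoidalClosed V] [HasColimits V]
  {C : Type v} [Category.{v} C] [MonoidalCategory C] [EnrichedOrdinaryCategory V C]
  [MonoidalEnriched V C]
  {M : Type v} [Category.{v} M] [EnrichedOrdinaryCategory V M] [MonoidalLeftAction C M]
  [ModuleEnriched V C M]

namespace HMod

variable (V C M) in
/-- The transposes of the underlying profunctors of modules over `H`. -/
abbrev toProf : HMod V C M M ⥤ VProf V M M :=
  (equivStr V C M).functor ⋙ StrMod.forget V C M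

/-- The tensor product of modules over `H` is carried by the convolution. -/
def tensorIso (X Y : HMod V C M M) : (X ⊗ Y).prof ≅ conv Y.prof X.prof :=
  (heartUnheartIso (X ⊗ Y).prof).symm ≪≫
    (heartFunctor V M M).mapIso (Functor.Monoidal.μIso (toProf V C M) X Y).symm ≪≫
    (convIso Y.prof X.prof).symm

variable (V C M) in
/-- The unit module over `H` is carried by the transpose of the identity profunctor. -/
def unitIso : (𝟙_ (HMod V C M M)).prof ≅ heart (idProf V M) :=
  (heartUnheartIso (𝟙_ (HMod V C M M)).prof).symm ≪≫
    (heartFunctor V M M).mapIso (Functor.Monoidal.εIso (toProf V C M)).symm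

lemma convolutionJ_tensorIso (X Y : HMod V C M M) (m : Mᵒᵖ × M) (k : M) :
    convolutionJ (tensorIso X Y) m k =
      (β_ _ _).hom ≫ tensorJ (toProf V C M) X Y m.2 k m.1.unop := by
  have h := convι_convIso_hom Y.prof X.prof m k
  have h1 : (tensorIso X Y).inv.app m PUnit.unit =
      (convIso Y.prof X.prof).hom.app m PUnit.unit ≫
        (Functor.LaxMonoidal.μ (toProf V C M) X Y).app m.2 m.1.unop := by
    exact Category.comp_id _
  rw [convolutionJ, h1]
  exact (Category.assoc _ _ _).symm.trans
    ((congrArg (fun t => t ≫ _) h).trans (Category.assoc _ _ _))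

lemma convolutionU_unitIso (m : Mᵒᵖ × M) :
    convolutionU (unitIso V C M) m = tensorU (toProf V C M) m.2 m.1.unop :=
  Category.comp_id _

end HMod

variable (V C M) in
/-- The monoidal structure on modules over `H`. -/
def hTensorSpec : HTensorSpec V C M where
  tensorIso := HMod.tensorIso
  unitIso := HMod.unitIso V C M
  natural {X X' Y Y'} f g m k := by
    have h := tensorJ_natural (HMod.toProf V C M) f g m.2 k m.1.unop
    rw [HMod.convolutionJ_tensorIso, HMod.convolutionJ_tensorIso]
    exact braiding_natural h
  associativity X Y Z m k l := by
    have h := tensorJ_associativity (HMod.toProf V C M) X Y Z m.2 k l m.1.unop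
    rw [HMod.convolutionJ_tensorIso, HMod.convolutionJ_tensorIso, HMod.convolutionJ_tensorIso,
      HMod.convolutionJ_tensorIso]
    exact braiding_associativity h
  left_unit X m k := by
    have h := tensorJ_left_unit (HMod.toProf V C M) X m.2 k m.1.unop
    rw [HMod.convolutionJ_tensorIso, HMod.convolutionU_unitIso]
    exact braiding_left_unit h
  right_unit X m k := by
    have h := tensorJ_right_unit (HMod.toProf V C M) X m.2 k m.1.unop
    rw [HMod.convolutionJ_tensorIso, HMod.convolutionU_unitIso]
    exact braiding_right_unit h
  tensor_component X Y x m' m k := by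
    have h := omegaOfS_tensor (tensorJ_s (HMod.equivStr V C M).functor X Y)
      (tensorJ_pre (HMod.toProf V C M) X Y) (tensorJ_post (HMod.toProf V C M) X Y) x m'.2 m.2 k
      m.1.unop m'.1.unop
    rw [HMod.component_eq, HMod.component_eq, HMod.component_eq, HMod.convolutionJ_tensorIso,
      HMod.convolutionJ_tensorIso]
    exact rotate_tensor_component h
  unit_component x m' m := by
    have h := omegaOfS_unit_map (tensorU_s (HMod.equivStr V C M).functor)
      (Functor.LaxMonoidal.ε (HMod.toProf V C M)).pre_app
      (Functor.LaxMonoidal.ε (HMod.toProf V C M)).post_app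
      x m'.2 m.2 m.1.unop m'.1.unop
    rw [HMod.component_eq, HMod.convolutionU_unitIso, HMod.convolutionU_unitIso]
    exact rotate_unit_component (e_assoc V _ _ _ _) h

variable (V C M) in
/-- Transposing twice. -/
def heartToProfIso : HMod.toProf V C M ⋙ heartFunctor V M M ≅ HMod.forget V C M M :=
  NatIso.ofComponents (fun P => heartUnheartIso P.prof) (fun f => by
    ext p u
    exact (Category.comp_id _).trans (Category.id_comp _).symm)

/-- The canonical monoidal equivalence between modules over `H` and `Ω`-modules. -/
def hOmegaEquiv : HOmegaEquiv (hTensorSpec V C M) (omegaTensorSpec V C M) where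
  equiv := (HMod.equivStr V C M).trans (OmegaMod.equivStr V C M).symm
  monoidal := inferInstanceAs
    ((HMod.equivStr V C M).functor ⋙ (OmegaMod.equivStr V C M).inverse).Monoidal
  underlying := Functor.isoWhiskerLeft (HMod.equivStr V C M).functor
    (Functor.isoWhiskerRight (OmegaMod.equivStr V C M).counitIso
      (StrMod.forget V C M ⋙ heartFunctor V M M)) ≪≫ heartToProfIso V C M
  action P x n n₁ m₁ m := by
    have h := omegaOfS_map _ (StrMod.s_hom ((OmegaMod.equivStr V C M).counitIso.hom.app
      ((HMod.equivStr V C M).functor.obj P))) x n n₁ m₁ m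
    have h1 := HMod.component_eq P x (Opposite.op m, n) (Opposite.op m₁, n₁)
    have h2 := OmegaMod.component_eq
      ((OmegaMod.equivStr V C M).inverse.obj ((HMod.equivStr V C M).functor.obj P)) x n n₁ m₁ m
    rw [h1]
    exact counit_action (Category.comp_id _) (Category.comp_id _) h2 h
  tensor_comparison X Y n k m := by
    have h := tensorJ_comparison (HMod.equivStr V C M) (OmegaMod.equivStr V C M) X Y n k m
    have h1 := HMod.convolutionJ_tensorIso X Y (Opposite.op m, n) k
    exact counit_tensor (Category.comp_id _) (Category.comp_id _) (Category.comp_id _) h1 h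
  unit_comparison n m := by
    have h := tensorU_comparison (HMod.equivStr V C M) (OmegaMod.equivStr V C M) n m
    have h1 := HMod.convolutionU_unitIso (V := V) (C := C) (M := M) (Opposite.op m, n)
    exact counit_unit (Category.comp_id _) h1 h

end

end LaxModuleProf

theorem mainTheorem3 (V : Type u) [Category.{v} V] [MonoidalCategory V]
    [SymmetricCategory V] [MonoidalClosed V] [HasLimits V] [HasColimits V]
    (C : Type v) [Category.{v} C] [MonoidalCategory C] [EnrichedOrdinaryCategory V C]
    [LaxModuleProf.MonoidalEnriched V C]
    (M : Type v) [Category.{v} M] [EnrichedOrdinaryCategory V M] [MonoidalLeftAction C M]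
    [LaxModuleProf.ModuleEnriched V C M] :
    ∃ (_ : MonoidalCategory (LaxModuleProf.LaxMod V C M M))
      (_ : MonoidalCategory (LaxModuleProf.OmegaMod V C M M))
      (_ : MonoidalCategory (LaxModuleProf.HMod V C M M))
      (S₁ : LaxModuleProf.LaxTensorSpec V C M)
      (S₂ : LaxModuleProf.OmegaTensorSpec V C M)
      (S₃ : LaxModuleProf.HTensorSpec V C M),
      Nonempty (LaxModuleProf.LaxOmegaEquiv S₁ S₂) ∧
        Nonempty (LaxModuleProf.HOmegaEquiv S₃ S₂) := by
  exact ⟨inferInstance, inferInstance, inferInstance, LaxModuleProf.laxTensorSpec V C M,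
    LaxModuleProf.omegaTensorSpec V C M, LaxModuleProf.hTensorSpec V C M,
    ⟨LaxModuleProf.laxOmegaEquiv⟩, ⟨LaxModuleProf.hOmegaEquiv⟩⟩
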